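/- A suspended monoidal category is an additive monoidal category $(\mathcal D,\otimes,e)$ with unit constraints $l,r$, an auto-equivalence $T$ of $\mathcal D$, and natural isomorphisms $\lambda: x\otimes Ty\to T(x\otimes y)$ and $\rho: Tx\otimes y\to T(x\otimes y)$ such that $T(l_x)\circ\lambda_{e,x}=l_{Tx}$, $T(r_x)\circ\rho_{x,e}=r_{Tx}$ and $T(\lambda_{x,y})\circ\rho_{x,Ty}=-\,T(\rho_{x,y})\circ\lambda_{Tx,y}$. **Algebras.** Let $k$ be a commutative ring, $A$ an associative unital $k$-algebra that is flat as a $k$-module (which is automatic if $k$ is a field), and $A^e=A\otimes_kA^{op}$. 1. The derived category $D^-(A^e\text{-}\mathrm{Mod})$ of bounded above complexes of $A$-bimodules is a suspended monoidal category: its tensor product is the left derived functor $\otimes_A^L$ of the tensor product $\otimes_A$ of complexes of bimodules, its unit is $A$, its suspension is the translation functor $[1]$, and its associativity and unit constraints and $\lambda,\rho$ are compatible, through the canonical maps $K\otimes_A^LL\to K\otimes_AL$, with those of the tensor product of complexes. 2. The Hochschild cohomology $HH^*(A)=\mathrm{Ext}^*_{A^e}(A,A)$ is graded-commutative for the Yoneda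 product: $fg=(-1)^{pq}gf$ for $f$ of degree $p$ and $g$ of degree $q$. 3. If moreover $A$ is projective over $k$, then the cohomology of the Hochschild cochain complex $C^n(A,A)=\mathrm{Hom}_k(A^{\otimes n},A)$, with Gerstenhaber's cup product $(f\cup g)(a_1,\dots,a_{p+q})=f(a_1,\dots,a_p)\,g(a_{p+1},\dots,a_{p+q})$, is isomorphic as a graded ring to $\mathrm{Ext}^*_{A^e}(A,A)$ with the Yoneda product. Consequently the cup product is graded-commutative: for cocycles $f\in C^p$ and $g\in C^q$, the cochain $f\cup g-(-1)^{pq}g\cup f$ is a coboundary. **Coalgebras.** Let $C$ be a coassociative counital coalgebra over a field $k$. 1. The derived category $D^+({}^C\mathrm{Mod}^C)$ of bounded below complexes of $C$-bicomodules is a suspended monoidal category: its tensor product is the right derived functor of the cotensor product $\square_C$ of complexes of bicomodules, its unit is $C$, its suspension is the translation functor $[1]$, and its constraints are compatible, through the canonical maps $K\square_CL\to K\square_C^RL$, with those of the cotensor product of complexes. 2. The algebra $\mathrm{Ext}^*(C,C)$ of self-extensions of $C$ in the category of $C$-bicomodules is graded-commutative for the Yoneda product. 3. The Cartier cohomology of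 $C$, i.e. the cohomology of the complex $\mathrm{Hom}_k(C,C^{\otimes n})$ with coboundary $$(\delta f)(c)=\sum c_{(1)}\otimes f(c_{(2)})+\sum_{i=1}^n(-1)^i\Delta_i(f(c))+(-1)^{n+1}\sum f(c_{(1)})\otimes c_{(2)},$$ where $\Delta_i$ applies the comultiplication to the $i$-th tensor factor, with the cup product $(f\cup g)(c)=\sum f(c_{(1)})\otimes g(c_{(2)})$, is isomorphic as a graded ring to $\mathrm{Ext}^*(C,C)$ with the Yoneda product. Consequently this cup product is graded-commutative. -/

import Mathlib

open CategoryTheory CategoryTheory.Limits CategoryTheory.MonoidalCategory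
open scoped TensorProduct

universe w v u

noncomputable section

/-! ### Suspended monoidal categories -/

/-- The data that turn an additive monoidal category `C` with an auto-equivalence `T` into a
suspended monoidal category. -/
class SuspendedMonoidal (C : Type*) [Category C] [Preadditive C] [HasFiniteProducts C]
    [MonoidalCategory C] [MonoidalPreadditive C] (T : C ⥤ C) [T.Additive] [T.IsEquivalence] where
  lam (X Y : C) : X ⊗ T.obj Y ≅ T.obj (X ⊗ Y)
  rho (X Y : C) : T.obj X ⊗ Y ≅ T.obj (X ⊗ Y)
  lam_naturality {X X' Y Y' : C} (f : X ⟶ X') (g : Y ⟶ Y') :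
    (f ⊗ₘ T.map g) ≫ (lam X' Y').hom = (lam X Y).hom ≫ T.map (f ⊗ₘ g)
  rho_naturality {X X' Y Y' : C} (f : X ⟶ X') (g : Y ⟶ Y') :
    (T.map f ⊗ₘ g) ≫ (rho X' Y').hom = (rho X Y).hom ≫ T.map (f ⊗ₘ g)
  lam_unit (X : C) : (lam (𝟙_ C) X).hom ≫ T.map (λ_ X).hom = (λ_ (T.obj X)).hom
  rho_unit (X : C) : (rho X (𝟙_ C)).hom ≫ T.map (ρ_ X).hom = (ρ_ (T.obj X)).hom
  anticomm (X Y : C) :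
    (rho X (T.obj Y)).hom ≫ T.map (lam X Y).hom = -((lam (T.obj X) Y).hom ≫ T.map (rho X Y).hom)

/-! ### Tensor products of complexes -/

/-- A monoidal category has good coproducts if it has small coproducts, and the tensor product
commutes with them in each variable.  This makes total tensor products of unbounded
complexes available. -/
class HasGoodCoproducts (B : Type*) [Category B] [MonoidalCategory B] : Prop where
  hasCoproducts : HasCoproducts.{0} B
  left (X : B) (J : Type) (Y : J → B) :
    PreservesColimit (Discrete.functor Y) ((curriedTensor B).obj X)
  right (X : B) (J : Type) (Y : J → B) :
    PreservesColimit (Discrete.functor Y) ((curriedTensor B).flip.obj X)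

section Complexes

variable (B : Type u) [Category.{v} B] [Abelian B] [MonoidalCategory B] [MonoidalPreadditive B]
  [HasGoodCoproducts B]

instance HasGoodCoproducts.hasCoproducts' : HasCoproducts.{0} B := HasGoodCoproducts.hasCoproducts

instance HasGoodCoproducts.left' (X : B) (J : Type) (Y : J → B) :
    PreservesColimit (Discrete.functor Y) ((curriedTensor B).obj X) :=
  HasGoodCoproducts.left X J Y

instance HasGoodCoproducts.right' (X : B) (J : Type) (Y : J → B) :
    PreservesColimit (Discrete.functor Y) ((curriedTensor B).flip.obj X) :=
  HasGoodCoproducts.right X J Y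

instance gradedHasTensor : ∀ (X₁ X₂ : GradedObject ℤ B), GradedObject.HasTensor X₁ X₂ := by
  intro X₁ X₂ j
  infer_instance
instance gradedHasTensor₄ObjExt :  ∀ (X₁ X₂ X₃ X₄ : GradedObject ℤ B), GradedObject.HasTensor₄ObjExt X₁ X₂ X₃ X₄ := by
  intro X₁ X₂ X₃ X₄ i j
  infer_instance
instance gradedHasGoodTensor₁₂ :  ∀ (X₁ X₂ X₃ : GradedObject ℤ B), GradedObject.HasGoodTensor₁₂Tensor X₁ X₂ X₃ := by
  intro X₁ X₂ X₃ i j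
  infer_instance
instance gradedHasGoodTensor₂₃ :  ∀ (X₁ X₂ X₃ : GradedObject ℤ B), GradedObject.HasGoodTensorTensor₂₃ X₁ X₂ X₃ := by
  intro X₁ X₂ X₃ i j
  infer_instance

namespace CochainComplex

/-- The cochain complexes that are bounded above. -/
def minus : ObjectProperty (CochainComplex B ℤ) := fun K ↦ ∃ n : ℤ, K.IsStrictlyLE n

/-- The category of bounded above cochain complexes. -/
abbrev Minus := (CochainComplex.minus B).FullSubcategory

variable {B} in
lemma isZero_tensor_X (K L : CochainComplex B ℤ) (n : ℤ)
    (h : ∀ i j : ℤ, i + j = n → IsZero (K.X i) ∨ IsZero (L.X j)) : IsZero ((K ⊗ L).X n) := by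
  rw [IsZero.iff_id_eq_zero]
  apply HomologicalComplex.mapBifunctor.hom_ext
  intro i j hij
  apply IsZero.eq_of_src
  rcases h i j hij with h | h
  · exact Functor.map_isZero ((curriedTensor B).flip.obj (L.X j)) h
  · exact Functor.map_isZero ((curriedTensor B).obj (K.X i)) h

instance : (minus B).IsMonoidal where
  prop_unit := ⟨0, inferInstanceAs (CochainComplex.IsStrictlyLE
    ((HomologicalComplex.single B (ComplexShape.up ℤ) 0).obj (𝟙_ B)) 0)⟩
  prop_tensor K L := by
    rintro ⟨a, ha⟩ ⟨b, hb⟩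
    refine ⟨a + b, (isStrictlyLE_iff _ _).2 fun n hn ↦ isZero_tensor_X K L n fun i j hij ↦ ?_⟩
    by_cases hi : a < i
    · exact .inl (isZero_of_isStrictlyLE K a i hi)
    · exact .inr (isZero_of_isStrictlyLE L b j (by lia))

instance : (CochainComplex.plus B).IsMonoidal where
  prop_unit := ⟨0, inferInstanceAs (CochainComplex.IsStrictlyGE
    ((HomologicalComplex.single B (ComplexShape.up ℤ) 0).obj (𝟙_ B)) 0)⟩
  prop_tensor K L := by
    rintro ⟨a, ha⟩ ⟨b, hb⟩
    refine ⟨a + b, (isStrictlyGE_iff _ _).2 fun n hn ↦ isZero_tensor_X K L n fun i j hij ↦ ?_⟩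
    by_cases hi : i < a
    · exact .inl (isZero_of_isStrictlyGE K a i hi)
    · exact .inr (isZero_of_isStrictlyGE L b j (by lia))

instance : (minus B).IsStableUnderShift ℤ where
  isStableUnderShiftBy n :=
    ⟨fun K ⟨k, hk⟩ ↦ ⟨k - n, K.isStrictlyLE_shift k n _ (by lia)⟩⟩

variable {B}

/-- The isomorphism `K ⊗ L[1] ≅ (K ⊗ L)[1]`, which is `(-1)^p` on `K^p ⊗ L^q`. -/
def tensorShiftIso (K L : CochainComplex B ℤ) : K ⊗ L⟦(1 : ℤ)⟧ ≅ (K ⊗ L)⟦(1 : ℤ)⟧ :=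
  mapBifunctorShift₂Iso K L (curriedTensor B) 1

/-- The isomorphism `K[1] ⊗ L ≅ (K ⊗ L)[1]`, which does not involve signs. -/
def shiftTensorIso (K L : CochainComplex B ℤ) : K⟦(1 : ℤ)⟧ ⊗ L ≅ (K ⊗ L)⟦(1 : ℤ)⟧ :=
  mapBifunctorShift₁Iso K L (curriedTensor B) 1

end CochainComplex

open DerivedCategory

variable [HasDerivedCategory.{w} B]

/-- The localization functor from bounded above complexes to the bounded above
derived category. -/
def QMinus : CochainComplex.Minus B ⥤ DerivedCategory.Minus B :=
  TStructure.t.minus.lift ((CochainComplex.minus B).ι ⋙ DerivedCategory.Q) (by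
    rintro ⟨K, n, hK⟩
    exact ⟨n, inferInstanceAs ((DerivedCategory.Q.obj K).IsLE n)⟩)

/-- The localization functor from bounded below complexes to the bounded below
derived category. -/
def QPlus : CochainComplex.Plus B ⥤ DerivedCategory.Plus B :=
  TStructure.t.plus.lift ((CochainComplex.plus B).ι ⋙ DerivedCategory.Q) (by
    rintro ⟨K, n, hK⟩
    exact ⟨n, inferInstanceAs ((DerivedCategory.Q.obj K).IsGE n)⟩)

instance : (QMinus B).CommShift ℤ := by
  dsimp only [QMinus]
  infer_instance

instance : (QPlus B).CommShift ℤ := by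
  dsimp only [QPlus]
  infer_instance

variable {B} in
/-- The isomorphism `K ⊗ L[1] ≅ (K ⊗ L)[1]` in a full monoidal subcategory of complexes that is
stable under shifts. -/
def subTensorShiftIso (P : ObjectProperty (CochainComplex B ℤ)) [P.IsMonoidal]
    [P.IsStableUnderShift ℤ] (K L : P.FullSubcategory) : K ⊗ L⟦(1 : ℤ)⟧ ≅ (K ⊗ L)⟦(1 : ℤ)⟧ :=
  P.isoMk (whiskerLeftIso K.obj ((P.ι.commShiftIso (1 : ℤ)).app L) ≪≫
    CochainComplex.tensorShiftIso K.obj L.obj ≪≫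
    ((P.ι.commShiftIso (1 : ℤ)).app (K ⊗ L)).symm)

variable {B} in
/-- The isomorphism `K[1] ⊗ L ≅ (K ⊗ L)[1]` in a full monoidal subcategory of complexes that is
stable under shifts. -/
def subShiftTensorIso (P : ObjectProperty (CochainComplex B ℤ)) [P.IsMonoidal]
    [P.IsStableUnderShift ℤ] (K L : P.FullSubcategory) : K⟦(1 : ℤ)⟧ ⊗ L ≅ (K ⊗ L)⟦(1 : ℤ)⟧ :=
  P.isoMk (whiskerRightIso ((P.ι.commShiftIso (1 : ℤ)).app K) L.obj ≪≫
    CochainComplex.shiftTensorIso K.obj L.obj ≪≫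
    ((P.ι.commShiftIso (1 : ℤ)).app (K ⊗ L)).symm)

/-- The natural transformation `Q K ⊗ Q L ⟶ Q (K ⊗ L)` given by a lax monoidal functor. -/
@[simps]
def laxTensor {C D : Type*} [Category C] [Category D] [MonoidalCategory C] [MonoidalCategory D]
    (Q : C ⥤ D) [Q.LaxMonoidal] : Q.prod Q ⋙ tensor D ⟶ tensor C ⋙ Q where
  app X := Functor.LaxMonoidal.μ Q X.1 X.2
  naturality X Y f := by
    simp [Functor.LaxMonoidal.μ_natural]

/-- The natural transformation `Q (K ⊗ L) ⟶ Q K ⊗ Q L` given by an oplax monoidal functor. -/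
@[simps]
def oplaxTensor {C D : Type*} [Category C] [Category D] [MonoidalCategory C] [MonoidalCategory D]
    (Q : C ⥤ D) [Q.OplaxMonoidal] : tensor C ⋙ Q ⟶ Q.prod Q ⋙ tensor D where
  app X := Functor.OplaxMonoidal.δ Q X.1 X.2
  naturality X Y f := by
    simp [Functor.OplaxMonoidal.δ_natural]

open Functor.LaxMonoidal Functor.OplaxMonoidal

/-- The structure of a suspended monoidal category on the bounded above derived category whose
tensor product is the left derived functor of the tensor product of complexes, whose unit is the
unit of `B`, whose suspension is the translation, and whose constraints are the ones induced by
those of the tensor product of complexes. -/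
structure LeftDerivedSuspendedMonoidal where
  monoidal : MonoidalCategory (DerivedCategory.Minus B)
  preadditive : MonoidalPreadditive (DerivedCategory.Minus B)
  suspended : SuspendedMonoidal (DerivedCategory.Minus B)
    (shiftFunctor (DerivedCategory.Minus B) (1 : ℤ))
  /-- compatible maps `Q K ⊗ᴸ Q L ⟶ Q (K ⊗ L)` and `𝟙 ⟶ Q 𝟙`; compatibility with the associators
  and unitors is part of the notion of a lax monoidal functor -/
  lax : (QMinus B).LaxMonoidal
  isIso_unit : IsIso (ε (QMinus B))
  /-- `⊗ᴸ` is the left derived functor of `⊗`, i.e. the right Kan extension of `Q (- ⊗ -)` along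
  the localization functor -/
  isLeftDerived : (tensor (DerivedCategory.Minus B)).IsRightKanExtension (laxTensor (QMinus B))
  lam_compat (K L : CochainComplex.Minus B) :
    ((QMinus B).obj K ◁ ((QMinus B).commShiftIso (1 : ℤ)).hom.app L) ≫
        (SuspendedMonoidal.lam (T := shiftFunctor _ (1 : ℤ)) ((QMinus B).obj K)
          ((QMinus B).obj L)).hom ≫ (μ (QMinus B) K L)⟦(1 : ℤ)⟧' =
      μ (QMinus B) K (L⟦(1 : ℤ)⟧) ≫ (QMinus B).map (subTensorShiftIso _ K L).hom ≫
        ((QMinus B).commShiftIso (1 : ℤ)).hom.app (K ⊗ L)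
  rho_compat (K L : CochainComplex.Minus B) :
    (((QMinus B).commShiftIso (1 : ℤ)).hom.app K ▷ (QMinus B).obj L) ≫
        (SuspendedMonoidal.rho (T := shiftFunctor _ (1 : ℤ)) ((QMinus B).obj K)
          ((QMinus B).obj L)).hom ≫ (μ (QMinus B) K L)⟦(1 : ℤ)⟧' =
      μ (QMinus B) (K⟦(1 : ℤ)⟧) L ≫ (QMinus B).map (subShiftTensorIso _ K L).hom ≫
        ((QMinus B).commShiftIso (1 : ℤ)).hom.app (K ⊗ L)

/-- The structure of a suspended monoidal category on the bounded below derived category whose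
tensor product is the right derived functor of the tensor product of complexes, whose unit is the
unit of `B`, whose suspension is the translation, and whose constraints are the ones induced by
those of the tensor product of complexes. -/
structure RightDerivedSuspendedMonoidal where
  monoidal : MonoidalCategory (DerivedCategory.Plus B)
  preadditive : MonoidalPreadditive (DerivedCategory.Plus B)
  suspended : SuspendedMonoidal (DerivedCategory.Plus B)
    (shiftFunctor (DerivedCategory.Plus B) (1 : ℤ))
  /-- compatible maps `Q (K ⊗ L) ⟶ Q K ⊗ᴿ Q L` and `Q 𝟙 ⟶ 𝟙`; compatibility with the associators
  and unitors is part of the notion of an oplax monoidal functor -/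
  oplax : (QPlus B).OplaxMonoidal
  isIso_unit : IsIso (η (QPlus B))
  /-- `⊗ᴿ` is the right derived functor of `⊗`, i.e. the left Kan extension of `Q (- ⊗ -)` along
  the localization functor -/
  isRightDerived : (tensor (DerivedCategory.Plus B)).IsLeftKanExtension (oplaxTensor (QPlus B))
  lam_compat (K L : CochainComplex.Plus B) :
    δ (QPlus B) K (L⟦(1 : ℤ)⟧) ≫ ((QPlus B).obj K ◁ ((QPlus B).commShiftIso (1 : ℤ)).hom.app L) ≫
        (SuspendedMonoidal.lam (T := shiftFunctor _ (1 : ℤ)) ((QPlus B).obj K)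
          ((QPlus B).obj L)).hom =
      (QPlus B).map (subTensorShiftIso _ K L).hom ≫
        ((QPlus B).commShiftIso (1 : ℤ)).hom.app (K ⊗ L) ≫ (δ (QPlus B) K L)⟦(1 : ℤ)⟧'
  rho_compat (K L : CochainComplex.Plus B) :
    δ (QPlus B) (K⟦(1 : ℤ)⟧) L ≫ (((QPlus B).commShiftIso (1 : ℤ)).hom.app K ▷ (QPlus B).obj L) ≫
        (SuspendedMonoidal.rho (T := shiftFunctor _ (1 : ℤ)) ((QPlus B).obj K)
          ((QPlus B).obj L)).hom =
      (QPlus B).map (subShiftTensorIso _ K L).hom ≫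
        ((QPlus B).commShiftIso (1 : ℤ)).hom.app (K ⊗ L) ≫ (δ (QPlus B) K L)⟦(1 : ℤ)⟧'

end Complexes

/-! ### Bimodules over an algebra and their tensor product -/

/-- The category of `A`-bimodules over `k`, i.e. of left modules over the enveloping
algebra `A ⊗ₖ Aᵒᵖ`. -/
abbrev BimoduleCat (k A : Type u) [CommRing k] [Ring A] [Algebra k A] :=
  ModuleCat.{u} (A ⊗[k] Aᵐᵒᵖ)

namespace BimoduleCat

variable {k A : Type u} [CommRing k] [Ring A] [Algebra k A]

/-- A bimodule is a `k`-module. -/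
abbrev kModule (M : BimoduleCat k A) : Module k M := Module.restrictScalars k (A ⊗[k] Aᵐᵒᵖ) M

attribute [local instance] kModule

instance (M : BimoduleCat k A) : IsScalarTower k (A ⊗[k] Aᵐᵒᵖ) M :=
  IsScalarTower.restrictScalars k (A ⊗[k] Aᵐᵒᵖ) M

/-- The left action `a m`. -/
def lact {M : BimoduleCat k A} (a : A) (m : M) : M := (a ⊗ₜ[k] (1 : Aᵐᵒᵖ)) • m

/-- The right action `m a`. -/
def ract {M : BimoduleCat k A} (m : M) (a : A) : M := ((1 : A) ⊗ₜ[k] MulOpposite.op a) • m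

section
variable {M N : BimoduleCat k A}

lemma lact_add (a : A) (m m' : M) : lact a (m + m') = lact a m + lact a m' := smul_add _ _ _
lemma ract_add (m m' : M) (a : A) : ract (m + m') a = ract m a + ract m' a := smul_add _ _ _
lemma lact_ract (a b : A) (m : M) : lact a (ract m b) = ract (lact a m) b := by
  simp [lact, ract, ← mul_smul]
lemma lact_lact (a b : A) (m : M) : lact a (lact b m) = lact (a * b) m := by
  simp [lact, ← mul_smul]
lemma ract_ract (m : M) (a b : A) : ract (ract m a) b = ract m (a * b) := by
  simp [ract, ← mul_smul]
lemma add_lact (a b : A) (m : M) : lact (a + b) m = lact a m + lact b m := by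
  simp [lact, TensorProduct.add_tmul, add_smul]
lemma ract_add' (m : M) (a b : A) : ract m (a + b) = ract m a + ract m b := by
  simp [ract, TensorProduct.tmul_add, add_smul]
lemma smul_eq (a : A) (b : Aᵐᵒᵖ) (m : M) : (a ⊗ₜ[k] b) • m = lact a (ract m b.unop) := by
  simp [lact, ract, ← mul_smul]
lemma map_lact (f : M ⟶ N) (a : A) (m : M) : f (lact a m) = lact a (f m) :=
  f.hom.map_smul _ _
lemma map_ract (f : M ⟶ N) (m : M) (a : A) : f (ract m a) = ract (f m) a :=
  f.hom.map_smul _ _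
lemma lact_algebraMap (r : k) (m : M) : lact (algebraMap k A r) m = r • m := by
  rw [lact, Algebra.algebraMap_eq_smul_one, ← TensorProduct.smul_tmul',
    ← Algebra.TensorProduct.one_def, smul_assoc, one_smul]
lemma ract_algebraMap (r : k) (m : M) : ract m (algebraMap k A r) = r • m := by
  rw [ract, Algebra.algebraMap_eq_smul_one, MulOpposite.op_smul, TensorProduct.tmul_smul,
    MulOpposite.op_one, ← Algebra.TensorProduct.one_def, smul_assoc, one_smul]

/-- An additive map that is compatible with both actions is a morphism of bimodules. -/
def homMk (f : M →+ N) (hl : ∀ a m, f (lact a m) = lact a (f m))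
    (hr : ∀ m a, f (ract m a) = ract (f m) a) : M ⟶ N :=
  ModuleCat.ofHom
    { f with
      map_smul' := fun e m ↦ by
        induction e with
        | zero =>
          exact (congr_arg f (zero_smul (A ⊗[k] Aᵐᵒᵖ) m)).trans
            (f.map_zero.trans (zero_smul (A ⊗[k] Aᵐᵒᵖ) (f m)).symm)
        | add x y hx hy => simpa [add_smul] using congr_arg₂ (· + ·) hx hy
        | tmul a b => simp [smul_eq, hl, hr] }

@[simp] lemma homMk_apply (f : M →+ N) (hl hr) (m : M) : homMk f hl hr m = f m := rfl

end

variable (k A) in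
/-- The bimodule `A`. -/
def unit : BimoduleCat k A :=
  letI := instModuleTensorProductMop k A
  ModuleCat.of (A ⊗[k] Aᵐᵒᵖ) A

/-- `M ⊗ₖ N`, to be equipped with the outer bimodule structure. -/
def Outer (M N : BimoduleCat k A) : Type u := M ⊗[k] N

instance (M N : BimoduleCat k A) : AddCommGroup (Outer M N) :=
  inferInstanceAs (AddCommGroup (M ⊗[k] N))

/-- The action of the enveloping algebra on `M ⊗ₖ N`, where `a ⊗ b` acts through the
left action of `a` on `M` and the right action of `b` on `N`. -/
def outerAction (M N : BimoduleCat k A) : A ⊗[k] Aᵐᵒᵖ →ₐ[k] Module.End k (M ⊗[k] N) :=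
  (Module.endTensorEndAlgHom (A := k)).comp (Algebra.TensorProduct.map
    ((Algebra.lsmul (A := A ⊗[k] Aᵐᵒᵖ) k k M).comp Algebra.TensorProduct.includeLeft)
    ((Algebra.lsmul (A := A ⊗[k] Aᵐᵒᵖ) k k N).comp Algebra.TensorProduct.includeRight))

instance (M N : BimoduleCat k A) : Module (A ⊗[k] Aᵐᵒᵖ) (Outer M N) :=
  Module.compHom (M ⊗[k] N) (outerAction M N).toRingHom

/-- The element `m ⊗ n` of `M ⊗ₖ N`. -/
def Outer.tmul {M N : BimoduleCat k A} (m : M) (n : N) : Outer M N := m ⊗ₜ[k] n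

lemma Outer.smul_tmul {M N : BimoduleCat k A} (a : A) (b : Aᵐᵒᵖ) (m : M) (n : N) :
    (a ⊗ₜ[k] b) • Outer.tmul m n = Outer.tmul (lact a m) (ract n b.unop) := rfl

/-- The subbimodule of `M ⊗ₖ N` generated by all `m a ⊗ n - m ⊗ a n`. -/
def balanced (M N : BimoduleCat k A) : Submodule (A ⊗[k] Aᵐᵒᵖ) (Outer M N) :=
  Submodule.span _ {x | ∃ (m : M) (a : A) (n : N),
    x = Outer.tmul (ract m a) n - Outer.tmul m (lact a n)}

/-- The tensor product `M ⊗_A N` of bimodules. -/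
def tens (M N : BimoduleCat k A) : BimoduleCat k A :=
  ModuleCat.of (A ⊗[k] Aᵐᵒᵖ) (Outer M N ⧸ balanced M N)

/-- The element `m ⊗ n` of `M ⊗_A N`. -/
def tmul {M N : BimoduleCat k A} (m : M) (n : N) : tens M N :=
  Submodule.Quotient.mk (Outer.tmul m n)

section
variable {M N P : BimoduleCat k A}

lemma add_tmul (m m' : M) (n : N) : tmul (m + m') n = tmul m n + tmul m' n :=
  congr_arg Submodule.Quotient.mk (TensorProduct.add_tmul m m' n)
lemma tmul_add (m : M) (n n' : N) : tmul m (n + n') = tmul m n + tmul m n' :=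
  congr_arg Submodule.Quotient.mk (TensorProduct.tmul_add m n n')
lemma ract_tmul (m : M) (a : A) (n : N) : tmul (ract m a) n = tmul m (lact a n) :=
  (Submodule.Quotient.eq _).2 (Submodule.subset_span ⟨m, a, n, rfl⟩)
lemma lact_tmul (a : A) (m : M) (n : N) : lact a (tmul m n) = tmul (lact a m) n := by
  refine congr_arg Submodule.Quotient.mk ((Outer.smul_tmul a 1 m n).trans ?_)
  congr 1
  simpa using ract_algebraMap (k := k) (A := A) 1 n
lemma tmul_ract (m : M) (n : N) (a : A) : ract (tmul m n) a = tmul m (ract n a) := by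
  refine congr_arg Submodule.Quotient.mk ((Outer.smul_tmul 1 (.op a) m n).trans ?_)
  congr 1
  simpa using lact_algebraMap (k := k) (A := A) 1 m

variable (M N) in
/-- `(m, n) ↦ m ⊗ n` as a biadditive map. -/
def tmulHom : M →+ N →+ tens M N :=
  AddMonoidHom.mk' (fun m ↦ AddMonoidHom.mk' (tmul m) (tmul_add m))
    (fun m m' ↦ AddMonoidHom.ext (add_tmul m m'))

@[simp] lemma tmulHom_apply (m : M) (n : N) : tmulHom M N m n = tmul m n := rfl

lemma zero_tmul (n : N) : tmul (0 : M) n = 0 := DFunLike.congr_fun (tmulHom M N).map_zero n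
lemma tmul_zero (m : M) : tmul m (0 : N) = 0 := (tmulHom M N m).map_zero

lemma tens_induction {p : tens M N → Prop} (x : tens M N) (h₀ : p 0)
    (h : ∀ m n, p (tmul m n)) (hadd : ∀ x y, p x → p y → p (x + y)) : p x := by
  obtain ⟨x, rfl⟩ := Submodule.Quotient.mk_surjective _ x
  induction x using TensorProduct.induction_on with
  | zero => exact h₀
  | tmul m n => exact h m n
  | add x y hx hy => exact hadd _ _ hx hy

section lift
variable {Z : Type*} [AddCommGroup Z] (g : M →+ N →+ Z)
  (hg : ∀ m a n, g (ract m a) n = g m (lact a n))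

/-- Auxiliary definition for `lift`. -/
def liftAux : Outer M N →+ Z :=
  TensorProduct.liftAddHom g (fun r m n ↦ by
    rw [← ract_algebraMap (A := A), hg, lact_algebraMap])

lemma liftAux_balanced (x : Outer M N) (hx : x ∈ balanced M N) : liftAux g hg x = 0 := by
  suffices ∀ e : A ⊗[k] Aᵐᵒᵖ, liftAux g hg (e • x) = 0 by
    have h := this 1
    rwa [one_smul] at h
  induction hx using Submodule.span_induction with
  | mem x hx =>
    obtain ⟨m, a, n, rfl⟩ := hx
    intro e
    induction e with
    | zero => exact (congr_arg (liftAux g hg) (zero_smul (A ⊗[k] Aᵐᵒᵖ) _)).trans (map_zero _)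
    | add x y hx hy => rw [add_smul, map_add, hx, hy, add_zero]
    | tmul b c =>
      rw [smul_sub, map_sub, Outer.smul_tmul, Outer.smul_tmul, sub_eq_zero]
      change g _ _ = g _ _
      rw [lact_ract, hg, lact_ract]
  | zero => simp
  | add x y _ _ hx hy => intro e; rw [smul_add, map_add, hx, hy, add_zero]
  | smul a x _ hx => intro e; rw [← mul_smul]; exact hx _

/-- The universal property of `M ⊗_A N`. -/
def lift : tens M N →+ Z :=
  QuotientAddGroup.lift (balanced M N).toAddSubgroup (liftAux g hg) (liftAux_balanced g hg)

@[simp] lemma lift_tmul (m : M) (n : N) : lift g hg (tmul m n) = g m n := rfl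

end lift

/-- Morphisms of bimodules out of `M ⊗_A N`. -/
def tensHom (g : M →+ N →+ P) (hg : ∀ m a n, g (ract m a) n = g m (lact a n))
    (hl : ∀ a m n, g (lact a m) n = lact a (g m n))
    (hr : ∀ m n a, g m (ract n a) = ract (g m n) a) : tens M N ⟶ P :=
  homMk (lift g hg)
    (fun a x ↦ by
      induction x using tens_induction with
      | h₀ => simp [lact]
      | h m n => simp [lact_tmul, hl]
      | hadd x y hx hy => rw [lact_add, map_add, hx, hy, map_add, lact_add])
    (fun x a ↦ by
      induction x using tens_induction with
      | h₀ => simp [ract]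
      | h m n => simp [tmul_ract, hr]
      | hadd x y hx hy => rw [ract_add, map_add, hx, hy, map_add, ract_add])

@[simp] lemma tensHom_tmul (g : M →+ N →+ P) (hg hl hr) (m : M) (n : N) :
    tensHom g hg hl hr (tmul m n) = g m n := rfl

lemma tens_hom_ext {f g : tens M N ⟶ P} (h : ∀ m n, f (tmul m n) = g (tmul m n)) : f = g := by
  ext x
  induction x using tens_induction with
  | h₀ => simp
  | h m n => exact h m n
  | hadd x y hx hy => rw [map_add, hx, hy, map_add]

end

section monoidal
variable (M N P Q : BimoduleCat k A)
variable {M' N' : BimoduleCat k A}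

/-- Functoriality of `M ⊗_A N`. -/
def tensMap {M N : BimoduleCat k A} (f : M ⟶ M') (g : N ⟶ N') : tens M N ⟶ tens M' N' :=
  tensHom ((AddMonoidHom.compHom' g.hom.toAddMonoidHom).comp
      ((tmulHom M' N').comp f.hom.toAddMonoidHom))
    (fun m a n ↦ by
      change tmul (f (ract m a)) (g n) = tmul (f m) (g (lact a n))
      rw [map_ract, map_lact, ract_tmul])
    (fun a m n ↦ by
      change tmul (f (lact a m)) (g n) = lact a (tmul (f m) (g n))
      rw [map_lact, lact_tmul])
    (fun m n a ↦ by
      change tmul (f m) (g (ract n a)) = ract (tmul (f m) (g n)) a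
      rw [map_ract, tmul_ract])

@[simp] lemma tensMap_tmul {M N : BimoduleCat k A} (f : M ⟶ M') (g : N ⟶ N') (m : M) (n : N) :
    tensMap f g (tmul m n) = tmul (f m) (g n) := rfl

/-- Auxiliary definition for `assocHom`. -/
def assocHomAux : tens M N →+ P →+ tens M (tens N P) :=
  lift (AddMonoidHom.mk' (fun m ↦ (AddMonoidHom.compHom (tmulHom M (tens N P) m)).comp
      (tmulHom N P)) (fun m m' ↦ by ext n p; simp))
    (fun m a n ↦ by
      ext p
      change tmul (ract m a) (tmul n p) = tmul m (tmul (lact a n) p)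
      rw [ract_tmul, lact_tmul])

lemma assocHomAux_tmul (m : M) (n : N) (p : P) :
    assocHomAux M N P (tmul m n) p = tmul m (tmul n p) := rfl

/-- The map `(M ⊗_A N) ⊗_A P ⟶ M ⊗_A (N ⊗_A P)`. -/
def assocHom : tens (tens M N) P ⟶ tens M (tens N P) :=
  tensHom (assocHomAux M N P)
    (fun x a p ↦ by
      induction x using tens_induction with
      | h₀ => simp [ract]
      | h m n =>
        rw [tmul_ract m n a]
        exact congr_arg (tmul m) (ract_tmul n a p)
      | hadd x y hx hy =>
        rw [ract_add x y a, map_add, map_add, AddMonoidHom.add_apply, AddMonoidHom.add_apply,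
          hx, hy])
    (fun a x p ↦ by
      induction x using tens_induction with
      | h₀ => simp [lact]
      | h m n =>
        rw [lact_tmul a m n]
        exact (lact_tmul a m (tmul n p)).symm
      | hadd x y hx hy =>
        rw [lact_add a x y, map_add, map_add, AddMonoidHom.add_apply, AddMonoidHom.add_apply,
          hx, hy]
        exact (lact_add a _ _).symm)
    (fun x p a ↦ by
      induction x using tens_induction with
      | h₀ => simp [ract]
      | h m n =>
        rw [assocHomAux_tmul, assocHomAux_tmul, tmul_ract m (tmul n p) a, tmul_ract n p a]
      | hadd x y hx hy =>
        rw [map_add, AddMonoidHom.add_apply, AddMonoidHom.add_apply, hx, hy]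
        exact (ract_add _ _ a).symm)

@[simp] lemma assocHom_tmul (m : M) (n : N) (p : P) :
    assocHom M N P (tmul (tmul m n) p) = tmul m (tmul n p) := rfl

/-- Auxiliary definition for `assocInv`. -/
def assocInvAux : M →+ tens N P →+ tens (tens M N) P :=
  AddMonoidHom.mk' (fun m ↦ lift ((tmulHom (tens M N) P).comp (tmulHom M N m))
      (fun n a p ↦ by
        change tmul (tmul m (ract n a)) p = tmul (tmul m n) (lact a p)
        rw [← tmul_ract, ract_tmul]))
    (fun m m' ↦ by
      ext x
      induction x using tens_induction with
      | h₀ => simp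
      | h n p => simp
      | hadd x y hx hy => rw [map_add, hx, hy, map_add])

lemma assocInvAux_tmul (m : M) (n : N) (p : P) :
    assocInvAux M N P m (tmul n p) = tmul (tmul m n) p := rfl

/-- The map `M ⊗_A (N ⊗_A P) ⟶ (M ⊗_A N) ⊗_A P`. -/
def assocInv : tens M (tens N P) ⟶ tens (tens M N) P :=
  tensHom (assocInvAux M N P)
    (fun m a x ↦ by
      induction x using tens_induction with
      | h₀ => simp [lact]
      | h n p =>
        rw [lact_tmul a n p]
        exact congr_arg (fun x ↦ tmul x p) (ract_tmul m a n)
      | hadd x y hx hy => rw [lact_add a x y, map_add, map_add, hx, hy])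
    (fun a m x ↦ by
      induction x using tens_induction with
      | h₀ => simp [lact]
      | h n p =>
        rw [assocInvAux_tmul, assocInvAux_tmul, lact_tmul a (tmul m n) p, lact_tmul a m n]
      | hadd x y hx hy =>
        rw [map_add, map_add, hx, hy]
        exact (lact_add a _ _).symm)
    (fun m x a ↦ by
      induction x using tens_induction with
      | h₀ => simp [ract]
      | h n p =>
        rw [tmul_ract n p a]
        exact (tmul_ract (tmul m n) p a).symm
      | hadd x y hx hy =>
        rw [ract_add x y a, map_add, map_add, hx, hy]
        exact (ract_add _ _ a).symm)

@[simp] lemma assocInv_tmul (m : M) (n : N) (p : P) :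
    assocInv M N P (tmul m (tmul n p)) = tmul (tmul m n) p := rfl

variable {M N P} in
lemma tens_hom_ext₃ {X : BimoduleCat k A} {f g : tens (tens M N) P ⟶ X}
    (h : ∀ m n p, f (tmul (tmul m n) p) = g (tmul (tmul m n) p)) : f = g :=
  tens_hom_ext fun x p ↦ by
    induction x using tens_induction with
    | h₀ =>
      simp [zero_tmul]
    | h m n => exact h m n p
    | hadd x y hx hy => rw [add_tmul, map_add, hx, hy, map_add]

variable {M N P} in
lemma tens_hom_ext₃' {X : BimoduleCat k A} {f g : tens M (tens N P) ⟶ X}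
    (h : ∀ m n p, f (tmul m (tmul n p)) = g (tmul m (tmul n p))) : f = g :=
  tens_hom_ext fun m x ↦ by
    induction x using tens_induction with
    | h₀ =>
      simp [tmul_zero]
    | h n p => exact h m n p
    | hadd x y hx hy => rw [tmul_add, map_add, hx, hy, map_add]

variable {M N P Q} in
lemma tens_hom_ext₄ {X : BimoduleCat k A} {f g : tens (tens (tens M N) P) Q ⟶ X}
    (h : ∀ m n p q, f (tmul (tmul (tmul m n) p) q) = g (tmul (tmul (tmul m n) p) q)) : f = g :=
  tens_hom_ext₃ fun x p q ↦ by
    induction x using tens_induction with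
    | h₀ =>
      simp [zero_tmul]
    | h m n => exact h m n p q
    | hadd x y hx hy => rw [add_tmul, add_tmul, map_add, hx, hy, map_add]

/-- The associativity isomorphism. -/
def assocIso : tens (tens M N) P ≅ tens M (tens N P) where
  hom := assocHom M N P
  inv := assocInv M N P
  hom_inv_id := tens_hom_ext₃ fun _ _ _ ↦ rfl
  inv_hom_id := tens_hom_ext₃' fun _ _ _ ↦ rfl

/-- The element of the bimodule `A` given by an element of `A`. -/
def toUnit (a : A) : unit k A := a

lemma lact_toUnit (a b : A) : lact a (toUnit (k := k) b) = toUnit (a * b) :=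
  (TensorProduct.Algebra.smul_def (R := k) a (1 : Aᵐᵒᵖ) b).trans (by simp [toUnit])

lemma ract_toUnit (a b : A) : ract (toUnit (k := k) b) a = toUnit (b * a) :=
  (TensorProduct.Algebra.smul_def (R := k) (1 : A) (MulOpposite.op a) b).trans (by simp [toUnit])

/-- The element of `A` given by an element of the bimodule `A`. -/
def ofUnit (a : unit k A) : A := a

lemma lact_one (m : M) : lact 1 m = m := one_smul (A ⊗[k] Aᵐᵒᵖ) m
lemma ract_one (m : M) : ract m 1 = m := one_smul (A ⊗[k] Aᵐᵒᵖ) m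

/-- The isomorphism `A ⊗_A M ≅ M`. -/
def leftUnitIso : tens (unit k A) M ≅ M where
  hom := tensHom (AddMonoidHom.mk' (fun a ↦ AddMonoidHom.mk' (lact (ofUnit a)) (lact_add _))
      (fun a b ↦ by
        ext m
        exact add_lact (ofUnit a) (ofUnit b) m))
    (fun a b m ↦ by
      change lact (ofUnit (ract (toUnit (ofUnit a)) b)) m = lact (ofUnit a) (lact b m)
      rw [ract_toUnit, lact_lact]; rfl)
    (fun b a m ↦ by
      change lact (ofUnit (lact b (toUnit (ofUnit a)))) m = lact b (lact (ofUnit a) m)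
      rw [lact_toUnit, lact_lact]; rfl)
    (fun _ _ _ ↦ lact_ract _ _ _)
  inv := homMk (tmulHom (unit k A) M (toUnit 1))
    (fun a m ↦ by
      change tmul _ _ = lact a (tmul _ _)
      rw [← ract_tmul, lact_tmul, lact_toUnit, ract_toUnit, mul_one, one_mul])
    (fun _ _ ↦ (tmul_ract _ _ _).symm)
  hom_inv_id := tens_hom_ext fun a m ↦ by
    change tmul (toUnit 1) (lact (ofUnit a) m) = tmul a m
    rw [← ract_tmul, ract_toUnit, one_mul]; rfl
  inv_hom_id := by
    ext m
    exact lact_one M m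

/-- The isomorphism `M ⊗_A A ≅ M`. -/
def rightUnitIso : tens M (unit k A) ≅ M where
  hom := tensHom (AddMonoidHom.mk' (fun m ↦ AddMonoidHom.mk' (fun a ↦ ract m (ofUnit a))
        (fun a b ↦ by
          exact ract_add' m (ofUnit a) (ofUnit b)))
      (fun m m' ↦ by ext a; exact ract_add _ _ _))
    (fun m b a ↦ by
      change ract (ract m b) (ofUnit a) = ract m (ofUnit (lact b (toUnit (ofUnit a))))
      rw [lact_toUnit, ract_ract]; rfl)
    (fun _ _ _ ↦ (lact_ract _ _ _).symm)
    (fun m a b ↦ by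
      change ract m (ofUnit (ract (toUnit (ofUnit a)) b)) = ract (ract m (ofUnit a)) b
      rw [ract_toUnit, ract_ract]; rfl)
  inv := homMk ((tmulHom M (unit k A)).flip (toUnit 1))
    (fun _ _ ↦ (lact_tmul _ _ _).symm)
    (fun m a ↦ by
      change tmul _ _ = ract (tmul _ _) a
      rw [ract_tmul, tmul_ract, lact_toUnit, ract_toUnit, mul_one, one_mul])
  hom_inv_id := tens_hom_ext fun m a ↦ by
    change tmul (ract m (ofUnit a)) (toUnit 1) = tmul m a
    rw [ract_tmul, lact_toUnit, mul_one]; rfl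
  inv_hom_id := by
    ext m
    exact ract_one M m

instance : MonoidalCategoryStruct (BimoduleCat k A) where
  tensorObj := tens
  tensorHom := tensMap
  whiskerLeft M _ _ g := tensMap (𝟙 M) g
  whiskerRight f N := tensMap f (𝟙 N)
  tensorUnit := unit k A
  associator := assocIso
  leftUnitor := leftUnitIso
  rightUnitor := rightUnitIso

/-- The monoidal category of `A`-bimodules, with the tensor product `⊗_A`. -/
instance : MonoidalCategory (BimoduleCat k A) where
  tensorHom_def _ _ := tens_hom_ext fun _ _ ↦ rfl
  id_tensorHom_id _ _ := tens_hom_ext fun _ _ ↦ rfl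
  tensorHom_comp_tensorHom _ _ _ _ := tens_hom_ext fun _ _ ↦ rfl
  whiskerLeft_id _ _ := tens_hom_ext fun _ _ ↦ rfl
  id_whiskerRight _ _ := tens_hom_ext fun _ _ ↦ rfl
  associator_naturality _ _ _ := tens_hom_ext₃ fun _ _ _ ↦ rfl
  leftUnitor_naturality f := tens_hom_ext fun _ m ↦ (map_lact f _ m).symm
  rightUnitor_naturality f := tens_hom_ext fun m _ ↦ (map_ract f m _).symm
  pentagon _ _ _ _ := tens_hom_ext₄ fun _ _ _ _ ↦ rfl
  triangle _ _ := tens_hom_ext₃ fun m a n ↦ (ract_tmul m (ofUnit a) n).symm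

end monoidal
lemma tensorHom_eq {M N M' N' : BimoduleCat k A} (f : M ⟶ M') (g : N ⟶ N') :
    f ⊗ₘ g = tensMap f g := rfl

instance : MonoidalPreadditive (BimoduleCat k A) where
  whiskerLeft_zero := tens_hom_ext fun m _ ↦ tmul_zero m
  zero_whiskerRight := tens_hom_ext fun _ n ↦ zero_tmul n
  whiskerLeft_add _ _ := tens_hom_ext fun m _ ↦ tmul_add m _ _
  add_whiskerRight _ _ := tens_hom_ext fun _ n ↦ add_tmul _ _ n

section coproducts

open DirectSum

variable (M X : BimoduleCat k A) {J : Type} [DecidableEq J] (Y : J → BimoduleCat k A)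

/-- The direct sum of a family of bimodules. -/
abbrev dsum : BimoduleCat k A := ModuleCat.of (A ⊗[k] Aᵐᵒᵖ) (⨁ i, Y i)

/-- The inclusion of a summand. -/
abbrev dsumι (i : J) : Y i ⟶ dsum Y :=
  ModuleCat.ofHom (DirectSum.lof (A ⊗[k] Aᵐᵒᵖ) J (fun i ↦ Y i) i)

variable {Y} in
lemma dsum_induction {p : dsum Y → Prop} (x : dsum Y) (h₀ : p 0)
    (h : ∀ i y, p (dsumι Y i y)) (hadd : ∀ x y, p x → p y → p (x + y)) : p x :=
  DirectSum.induction_on x h₀ h hadd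

variable {M X Y} in
/-- Auxiliary definition for `tensDsumDesc`. -/
def tensDsumAux (f : ∀ i, tens M (Y i) ⟶ X) : M →+ dsum Y →+ X :=
  AddMonoidHom.mk' (fun m ↦ DirectSum.toAddMonoid fun i ↦
    (f i).hom.toAddMonoidHom.comp (tmulHom M (Y i) m)) (fun m m' ↦ by
      refine DirectSum.addHom_ext fun i y ↦ ?_
      simp)

variable {M X Y} in
lemma tensDsumAux_apply (f : ∀ i, tens M (Y i) ⟶ X) (m : M) (i : J) (y : Y i) :
    tensDsumAux f m (dsumι Y i y) = f i (tmul m y) :=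
  DirectSum.toAddMonoid_of (fun i ↦ (f i).hom.toAddMonoidHom.comp (tmulHom M (Y i) m)) i y

variable {M X Y} in
/-- The map out of `M ⊗_A ⨁ Yᵢ` given by maps out of `M ⊗_A Yᵢ`. -/
def tensDsumDesc (f : ∀ i, tens M (Y i) ⟶ X) : tens M (dsum Y) ⟶ X :=
  have hg := tensDsumAux_apply f
  tensHom (tensDsumAux f)
    (fun m a y ↦ by
      induction y using dsum_induction with
      | h₀ => simp [lact]
      | h i y => rw [← map_lact, hg, hg, ract_tmul]
      | hadd x y hx hy => rw [lact_add a x y, map_add, map_add, hx, hy])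
    (fun a m y ↦ by
      induction y using dsum_induction with
      | h₀ => simp [lact]
      | h i y => rw [hg, hg, ← lact_tmul, map_lact]
      | hadd x y hx hy =>
        rw [map_add, map_add, hx, hy]
        exact (lact_add a _ _).symm)
    (fun m y a ↦ by
      induction y using dsum_induction with
      | h₀ => simp [ract]
      | h i y => rw [← map_ract, hg, hg, ← tmul_ract, map_ract]
      | hadd x y hx hy =>
        rw [ract_add x y a, map_add, map_add, hx, hy]
        exact (ract_add _ _ a).symm)

variable {M X Y} in
lemma tensDsumDesc_tmul (f : ∀ i, tens M (Y i) ⟶ X) (m : M) (i : J) (y : Y i) :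
    tensDsumDesc f (tmul m (dsumι Y i y)) = f i (tmul m y) :=
  tensDsumAux_apply f m i y

variable {M X Y} in
lemma tensDsum_hom_ext {f g : tens M (dsum Y) ⟶ X}
    (h : ∀ i, tensMap (𝟙 M) (dsumι Y i) ≫ f = tensMap (𝟙 M) (dsumι Y i) ≫ g) : f = g :=
  tens_hom_ext fun m y ↦ by
    induction y using dsum_induction with
    | h₀ => simp [tmul_zero]
    | h i y => exact congr($(h i) (tmul m y))
    | hadd x y hx hy => rw [tmul_add, map_add, hx, hy, map_add]

variable {M X Y} in
/-- Auxiliary definition for `dsumTensDesc`. -/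
def dsumTensAux (f : ∀ i, tens (Y i) M ⟶ X) : dsum Y →+ M →+ X :=
  DirectSum.toAddMonoid fun i ↦
    (AddMonoidHom.compHom (f i).hom.toAddMonoidHom).comp (tmulHom (Y i) M)

variable {M X Y} in
lemma dsumTensAux_apply (f : ∀ i, tens (Y i) M ⟶ X) (m : M) (i : J) (y : Y i) :
    dsumTensAux f (dsumι Y i y) m = f i (tmul y m) :=
  DFunLike.congr_fun (DirectSum.toAddMonoid_of (fun i ↦
    (AddMonoidHom.compHom (f i).hom.toAddMonoidHom).comp (tmulHom (Y i) M)) i y) m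

variable {M X Y} in
/-- The map out of `(⨁ Yᵢ) ⊗_A M` given by maps out of `Yᵢ ⊗_A M`. -/
def dsumTensDesc (f : ∀ i, tens (Y i) M ⟶ X) : tens (dsum Y) M ⟶ X :=
  have hg := dsumTensAux_apply f
  tensHom (dsumTensAux f)
    (fun y a m ↦ by
      induction y using dsum_induction with
      | h₀ => simp [ract]
      | h i y => rw [← map_ract, hg, hg, ract_tmul]
      | hadd x y hx hy =>
        rw [ract_add x y a, map_add, map_add, AddMonoidHom.add_apply, AddMonoidHom.add_apply,
          hx, hy])
    (fun a y m ↦ by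
      induction y using dsum_induction with
      | h₀ => simp [lact]
      | h i y => rw [← map_lact, hg, hg, ← lact_tmul, map_lact]
      | hadd x y hx hy =>
        rw [lact_add a x y, map_add, map_add, AddMonoidHom.add_apply, AddMonoidHom.add_apply,
          hx, hy]
        exact (lact_add a _ _).symm)
    (fun y m a ↦ by
      induction y using dsum_induction with
      | h₀ => simp [ract]
      | h i y => rw [hg, hg, ← tmul_ract, map_ract]
      | hadd x y hx hy =>
        rw [map_add, AddMonoidHom.add_apply, AddMonoidHom.add_apply, hx, hy]
        exact (ract_add _ _ a).symm)

variable {M X Y} in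
lemma dsumTensDesc_tmul (f : ∀ i, tens (Y i) M ⟶ X) (m : M) (i : J) (y : Y i) :
    dsumTensDesc f (tmul (dsumι Y i y) m) = f i (tmul y m) :=
  dsumTensAux_apply f m i y

variable {M X Y} in
lemma dsumTens_hom_ext {f g : tens (dsum Y) M ⟶ X}
    (h : ∀ i, tensMap (dsumι Y i) (𝟙 M) ≫ f = tensMap (dsumι Y i) (𝟙 M) ≫ g) : f = g :=
  tens_hom_ext fun y m ↦ by
    induction y using dsum_induction with
    | h₀ => simp [zero_tmul]
    | h i y => exact congr($(h i) (tmul y m))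
    | hadd x y hx hy => rw [add_tmul, map_add, hx, hy, map_add]

end coproducts

instance : HasGoodCoproducts (BimoduleCat k A) where
  hasCoproducts _ := inferInstance
  left M J Y := by
    classical
    refine preservesColimit_of_preserves_colimit_cocone
      (ModuleCat.coproductCoconeIsColimit.{u, 0, u} Y) ?_
    exact
      { desc s := tensDsumDesc fun i ↦ s.ι.app ⟨i⟩
        fac s i := tens_hom_ext fun m y ↦ tensDsumDesc_tmul (fun i ↦ s.ι.app ⟨i⟩) m i.as y
        uniq s f hf := tensDsum_hom_ext fun i ↦ (hf ⟨i⟩).trans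
          (tens_hom_ext fun m y ↦ (tensDsumDesc_tmul (fun i ↦ s.ι.app ⟨i⟩) m i y).symm) }
  right M J Y := by
    classical
    refine preservesColimit_of_preserves_colimit_cocone
      (ModuleCat.coproductCoconeIsColimit.{u, 0, u} Y) ?_
    exact
      { desc s := dsumTensDesc fun i ↦ s.ι.app ⟨i⟩
        fac s i := tens_hom_ext fun y m ↦ dsumTensDesc_tmul (fun i ↦ s.ι.app ⟨i⟩) m i.as y
        uniq s f hf := dsumTens_hom_ext fun i ↦ (hf ⟨i⟩).trans
          (tens_hom_ext fun y m ↦ (dsumTensDesc_tmul (fun i ↦ s.ι.app ⟨i⟩) m i y).symm) }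
end BimoduleCat

/-! ### Bicomodules over a coalgebra -/

open ComonObj in
/-- A bicomodule over a coalgebra object `C` in a monoidal category `V`. -/
structure Bicomod {V : Type u} [Category.{v} V] [MonoidalCategory V] (C : V) [ComonObj C] where
  X : V
  left : X ⟶ C ⊗ X
  right : X ⟶ X ⊗ C
  left_counit : left ≫ ε ▷ X = (λ_ X).inv
  left_coassoc : left ≫ C ◁ left = left ≫ Δ ▷ X ≫ (α_ C C X).hom
  right_counit : right ≫ X ◁ ε = (ρ_ X).inv
  right_coassoc : right ≫ right ▷ C = right ≫ X ◁ Δ ≫ (α_ X C C).inv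
  left_right : left ≫ C ◁ right = right ≫ left ▷ C ≫ (α_ C X C).hom

namespace Bicomod

open ComonObj

section basic

variable {V : Type u} [Category.{v} V] [MonoidalCategory V] {C : V} [ComonObj C]

/-- Morphisms of bicomodules. -/
@[ext]
structure Hom (M N : Bicomod C) where
  hom : M.X ⟶ N.X
  left_comm : M.left ≫ C ◁ hom = hom ≫ N.left
  right_comm : M.right ≫ hom ▷ C = hom ≫ N.right

attribute [simp] left_counit left_coassoc right_counit right_coassoc left_right

@[simp] lemma left_counit_assoc (M : Bicomod C) {Z : V} (f : 𝟙_ V ⊗ M.X ⟶ Z) :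
    M.left ≫ ε ▷ M.X ≫ f = (λ_ M.X).inv ≫ f := by
  rw [← M.left_counit, Category.assoc]

@[simp] lemma left_coassoc_assoc (M : Bicomod C) {Z : V} (f : C ⊗ C ⊗ M.X ⟶ Z) :
    M.left ≫ C ◁ M.left ≫ f = M.left ≫ Δ ▷ M.X ≫ (α_ C C M.X).hom ≫ f := by
  simp only [← Category.assoc, M.left_coassoc]

@[simp] lemma right_counit_assoc (M : Bicomod C) {Z : V} (f : M.X ⊗ 𝟙_ V ⟶ Z) :
    M.right ≫ M.X ◁ ε ≫ f = (ρ_ M.X).inv ≫ f := by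
  rw [← M.right_counit, Category.assoc]

@[simp] lemma right_coassoc_assoc (M : Bicomod C) {Z : V} (f : (M.X ⊗ C) ⊗ C ⟶ Z) :
    M.right ≫ M.right ▷ C ≫ f = M.right ≫ M.X ◁ Δ ≫ (α_ M.X C C).inv ≫ f := by
  simp only [← Category.assoc, M.right_coassoc]

@[simp] lemma left_right_assoc (M : Bicomod C) {Z : V} (f : C ⊗ M.X ⊗ C ⟶ Z) :
    M.left ≫ C ◁ M.right ≫ f = M.right ≫ M.left ▷ C ≫ (α_ C M.X C).hom ≫ f := by
  simp only [← Category.assoc, M.left_right]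

lemma Hom.left_comm_assoc {M N : Bicomod C} (g : Hom M N) {Z : V} (f : C ⊗ N.X ⟶ Z) :
    M.left ≫ C ◁ g.hom ≫ f = g.hom ≫ N.left ≫ f := by
  simp only [← Category.assoc, g.left_comm]

lemma Hom.right_comm_assoc {M N : Bicomod C} (g : Hom M N) {Z : V} (f : N.X ⊗ C ⟶ Z) :
    M.right ≫ g.hom ▷ C ≫ f = g.hom ≫ N.right ≫ f := by
  simp only [← Category.assoc, g.right_comm]

instance : Category (Bicomod C) where
  Hom := Hom
  id M := { hom := 𝟙 M.X, left_comm := by simp, right_comm := by simp }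
  comp f g :=
    { hom := f.hom ≫ g.hom
      left_comm := by simp [f.left_comm_assoc, g.left_comm]
      right_comm := by simp [f.right_comm_assoc, g.right_comm] }

@[ext] lemma hom_ext {M N : Bicomod C} {f g : M ⟶ N} (h : f.hom = g.hom) : f = g := Hom.ext h
@[simp] lemma id_hom (M : Bicomod C) : Hom.hom (𝟙 M) = 𝟙 M.X := rfl
@[simp] lemma comp_hom {M N P : Bicomod C} (f : M ⟶ N) (g : N ⟶ P) :
    (f ≫ g).hom = f.hom ≫ g.hom := rfl

variable (C) in
/-- The forgetful functor. -/
@[simps] def forget : Bicomod C ⥤ V where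
  obj M := M.X
  map f := f.hom

instance : (forget C).Faithful where
  map_injective h := hom_ext h

/-- An isomorphism of underlying objects that is a morphism of bicomodules. -/
@[simps] def isoMk {M N : Bicomod C} (e : M.X ≅ N.X)
    (h₁ : M.left ≫ C ◁ e.hom = e.hom ≫ N.left) (h₂ : M.right ≫ e.hom ▷ C = e.hom ≫ N.right) :
    M ≅ N where
  hom := ⟨e.hom, h₁, h₂⟩
  inv :=
    { hom := e.inv
      left_comm := by
        rw [← cancel_epi e.hom, e.hom_inv_id_assoc, ← reassoc_of% h₁, ← whiskerLeft_comp]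
        simp
      right_comm := by
        rw [← cancel_epi e.hom, e.hom_inv_id_assoc, ← reassoc_of% h₂, ← comp_whiskerRight]
        simp }

instance : (forget C).ReflectsIsomorphisms where
  reflects {M N} f hf := by
    have : IsIso f.hom := hf
    exact (isoMk (asIso f.hom) f.left_comm f.right_comm).isIso_hom

variable (C) in
/-- The bicomodule `C`. -/
@[simps] abbrev unit : Bicomod C where
  X := C
  left := Δ
  right := Δ
  left_counit := by simp
  left_coassoc := by simp
  right_counit := by simp
  right_coassoc := by
    rw [comul_assoc_flip]
  left_right := by simp

/-- `M ⊗ N` with the left coaction of `M` and the right coaction of `N`. -/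
@[simps] abbrev outer (M N : Bicomod C) : Bicomod C where
  X := M.X ⊗ N.X
  left := M.left ▷ N.X ≫ (α_ _ _ _).hom
  right := M.X ◁ N.right ≫ (α_ _ _ _).inv
  left_counit := by
    have := congr($(M.left_counit) ▷ N.X)
    rw [comp_whiskerRight] at this
    simp [reassoc_of% this]
  left_coassoc := by
    have := congr($(M.left_coassoc) ▷ N.X)
    simp only [comp_whiskerRight] at this
    simp only [Category.assoc, whiskerLeft_comp, ← associator_naturality_middle_assoc,
      reassoc_of% this]
    simp
  right_counit := by
    have := congr(M.X ◁ $(N.right_counit))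
    rw [whiskerLeft_comp] at this
    simp [reassoc_of% this]
  right_coassoc := by
    have := congr(M.X ◁ $(N.right_coassoc))
    simp only [whiskerLeft_comp] at this
    simp only [Category.assoc, comp_whiskerRight, ← associator_inv_naturality_middle_assoc,
      reassoc_of% this]
    simp
  left_right := by
    simp only [Category.assoc, whiskerLeft_comp, comp_whiskerRight,
      ← associator_naturality_right_assoc, ← whisker_exchange_assoc]
    simp

/-- The subobject of a bicomodule given by a monomorphism to which both coactions restrict. -/
@[simps] abbrev ofMono (M : Bicomod C) {X : V} (i : X ⟶ M.X) (l : X ⟶ C ⊗ X) (r : X ⟶ X ⊗ C)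
    (hl : l ≫ C ◁ i = i ≫ M.left) (hr : r ≫ i ▷ C = i ≫ M.right) [Mono i]
    (h : ∀ {Y Z : V} (f : Y ⟶ Z) (W : V) [Mono f], Mono (W ◁ f))
    (h' : ∀ {Y Z : V} (f : Y ⟶ Z) (W : V) [Mono f], Mono (f ▷ W)) : Bicomod C where
  X := X
  left := l
  right := r
  left_counit := by
    have := h i (𝟙_ V)
    rw [← cancel_mono (𝟙_ V ◁ i), Category.assoc, ← whisker_exchange, reassoc_of% hl]
    simp
  left_coassoc := by
    have := h i C
    have := h (C ◁ i) C
    rw [← cancel_mono (C ◁ C ◁ i)]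
    simp only [Category.assoc, ← whiskerLeft_comp, hl]
    simp only [whiskerLeft_comp, reassoc_of% hl, left_coassoc]
    rw [← associator_naturality_right, ← whisker_exchange_assoc, reassoc_of% hl]
  right_counit := by
    have := h' i (𝟙_ V)
    rw [← cancel_mono (i ▷ 𝟙_ V), Category.assoc, whisker_exchange, reassoc_of% hr]
    simp
  right_coassoc := by
    have := h' i C
    have := h' (i ▷ C) C
    rw [← cancel_mono (i ▷ C ▷ C)]
    simp only [Category.assoc, ← comp_whiskerRight, hr]
    simp only [comp_whiskerRight, reassoc_of% hr, right_coassoc]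
    rw [← associator_inv_naturality_left, whisker_exchange_assoc, reassoc_of% hr]
  left_right := by
    have := h' i C
    have := h (i ▷ C) C
    rw [← cancel_mono (C ◁ i ▷ C)]
    simp only [Category.assoc, ← whiskerLeft_comp, hr]
    simp only [whiskerLeft_comp, reassoc_of% hl, left_right]
    rw [← associator_naturality_middle, ← comp_whiskerRight_assoc, hl, comp_whiskerRight_assoc,
      reassoc_of% hr]

/-- The quotient of a bicomodule given by an epimorphism to which both coactions descend. -/
@[simps] abbrev ofEpi (M : Bicomod C) {X : V} (p : M.X ⟶ X) (l : X ⟶ C ⊗ X) (r : X ⟶ X ⊗ C)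
    (hl : p ≫ l = M.left ≫ C ◁ p) (hr : p ≫ r = M.right ≫ p ▷ C) [Epi p] : Bicomod C where
  X := X
  left := l
  right := r
  left_counit := by
    rw [← cancel_epi p, reassoc_of% hl, whisker_exchange]
    simp
  left_coassoc := by
    rw [← cancel_epi p, reassoc_of% hl, reassoc_of% hl, ← whiskerLeft_comp, hl,
      whiskerLeft_comp, left_coassoc_assoc, whisker_exchange_assoc]
    simp
  right_counit := by
    rw [← cancel_epi p, reassoc_of% hr, ← whisker_exchange]
    simp
  right_coassoc := by
    rw [← cancel_epi p, reassoc_of% hr, reassoc_of% hr, ← comp_whiskerRight, hr,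
      comp_whiskerRight, right_coassoc_assoc, ← whisker_exchange_assoc]
    simp
  left_right := by
    rw [← cancel_epi p, reassoc_of% hl, reassoc_of% hr, ← whiskerLeft_comp, hr,
      whiskerLeft_comp, left_right_assoc, ← comp_whiskerRight_assoc, hl]
    simp

end basic

section abelian

variable {V : Type u} [Category.{v} V] [Abelian V] [MonoidalCategory V] [MonoidalPreadditive V]
  {C : V} [ComonObj C]

instance (M N : Bicomod C) : Zero (M ⟶ N) := ⟨⟨0, by simp, by simp⟩⟩
instance (M N : Bicomod C) : Add (M ⟶ N) :=
  ⟨fun f g ↦ ⟨f.hom + g.hom, by simp [f.left_comm, g.left_comm],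
    by simp [f.right_comm, g.right_comm]⟩⟩
instance (M N : Bicomod C) : Neg (M ⟶ N) :=
  ⟨fun f ↦ ⟨-f.hom, by
      have := (tensorLeft C).map_neg (f := f.hom)
      dsimp at this
      simp [this, f.left_comm], by
      have := (tensorRight C).map_neg (f := f.hom)
      dsimp at this
      simp [this, f.right_comm]⟩⟩

@[simp] lemma zero_hom (M N : Bicomod C) : Hom.hom (0 : M ⟶ N) = 0 := rfl
@[simp] lemma add_hom {M N : Bicomod C} (f g : M ⟶ N) : (f + g).hom = f.hom + g.hom := rfl
@[simp] lemma neg_hom {M N : Bicomod C} (f : M ⟶ N) : (-f).hom = -f.hom := rfl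

instance : Preadditive (Bicomod C) where
  homGroup M N :=
    { AddGroup.ofLeftAxioms (G := (M ⟶ N)) (fun f g h ↦ hom_ext (add_assoc _ _ _))
        (fun f ↦ hom_ext (zero_add _)) (fun f ↦ hom_ext (neg_add_cancel _)) with
      add_comm := fun f g ↦ hom_ext (add_comm _ _) }
  add_comp _ _ _ f f' g := hom_ext (Preadditive.add_comp _ _ _ _ _ _)
  comp_add _ _ _ f g g' := hom_ext (Preadditive.comp_add _ _ _ _ _ _)

lemma sub_hom {M N : Bicomod C} (f g : M ⟶ N) : (f - g).hom = f.hom - g.hom := by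
  rw [sub_eq_add_neg, sub_eq_add_neg]; rfl

section cokernels

/-- The cokernel of a morphism of bicomodules. -/
abbrev coker {M N : Bicomod C} (f : M ⟶ N) : Bicomod C :=
  N.ofEpi (cokernel.π f.hom)
    (cokernel.desc f.hom (N.left ≫ C ◁ cokernel.π f.hom) (by
      rw [← f.left_comm_assoc, ← whiskerLeft_comp]; simp))
    (cokernel.desc f.hom (N.right ≫ cokernel.π f.hom ▷ C) (by
      rw [← f.right_comm_assoc, ← comp_whiskerRight]; simp))
    (by simp) (by simp)

/-- The projection to the cokernel. -/
abbrev cokerπ {M N : Bicomod C} (f : M ⟶ N) : N ⟶ coker f where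
  hom := cokernel.π f.hom
  left_comm := by simp [coker]
  right_comm := by simp [coker]

@[simp] lemma cokerπ_hom {M N : Bicomod C} (f : M ⟶ N) : (cokerπ f).hom = cokernel.π f.hom := rfl

/-- A morphism of underlying objects through which a morphism of bicomodules factors after an
epimorphism is a morphism of bicomodules. -/
abbrev descHom {M N P : Bicomod C} (p : M ⟶ N) [Epi p.hom] (g : M ⟶ P) (l : N.X ⟶ P.X)
    (h : p.hom ≫ l = g.hom) : N ⟶ P where
  hom := l
  left_comm := by
    rw [← cancel_epi p.hom, ← p.left_comm_assoc, ← whiskerLeft_comp, h, g.left_comm,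
      reassoc_of% h]
  right_comm := by
    rw [← cancel_epi p.hom, ← p.right_comm_assoc, ← comp_whiskerRight, h, g.right_comm,
      reassoc_of% h]

instance {M N : Bicomod C} (f : M ⟶ N) : Epi (cokerπ f).hom :=
  inferInstanceAs (Epi (cokernel.π f.hom))

/-- `coker f` is the cokernel. -/
def isColimitCoker {M N : Bicomod C} (f : M ⟶ N) :
    IsColimit (CokernelCofork.ofπ (f := f) (cokerπ f) (hom_ext (by simp))) :=
  CokernelCofork.IsColimit.ofπ _ _
    (fun g hg ↦ descHom (cokerπ f) g (cokernel.desc f.hom g.hom (congr_arg Hom.hom hg)) (by simp))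
    (fun g hg ↦ hom_ext (by simp [descHom]))
    (fun g hg m hm ↦ hom_ext (by
      rw [← cancel_epi (cokernel.π f.hom)]
      simpa [descHom] using congr_arg Hom.hom hm))

instance : HasCokernels (Bicomod C) where
  has_colimit f := ⟨⟨_, isColimitCoker f⟩⟩

end cokernels

section coproducts

variable {J : Type*} (F : J → Bicomod C) [HasCoproduct (fun j ↦ (F j).X)]

/-- The coproduct of a family of bicomodules. -/
abbrev coprod : Bicomod C where
  X := ∐ (fun j ↦ (F j).X)
  left := Sigma.desc fun j ↦ (F j).left ≫ C ◁ Sigma.ι (fun j ↦ (F j).X) j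
  right := Sigma.desc fun j ↦ (F j).right ≫ Sigma.ι (fun j ↦ (F j).X) j ▷ C
  left_counit := Sigma.hom_ext _ _ fun j ↦ by simp [whisker_exchange]
  left_coassoc := Sigma.hom_ext _ _ fun j ↦ by
    simp [whisker_exchange_assoc, ← whiskerLeft_comp]
    simp
  right_counit := Sigma.hom_ext _ _ fun j ↦ by simp [← whisker_exchange]
  right_coassoc := Sigma.hom_ext _ _ fun j ↦ by
    simp [← whisker_exchange_assoc, ← comp_whiskerRight]
    simp
  left_right := Sigma.hom_ext _ _ fun j ↦ by
    simp [← whiskerLeft_comp, ← comp_whiskerRight_assoc]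
    simp

/-- The inclusion of a summand. -/
abbrev coprodι (j : J) : F j ⟶ coprod F where
  hom := Sigma.ι (fun j ↦ (F j).X) j
  left_comm := by simp [coprod]
  right_comm := by simp [coprod]

/-- The morphism from a coproduct that is given by a family of morphisms. -/
abbrev coprodDesc {M : Bicomod C} (f : ∀ j, F j ⟶ M) : coprod F ⟶ M where
  hom := Sigma.desc fun j ↦ (f j).hom
  left_comm := Sigma.hom_ext _ _ fun j ↦ by
    simp [coprod, ← whiskerLeft_comp, (f j).left_comm]
  right_comm := Sigma.hom_ext _ _ fun j ↦ by
    simp [coprod, ← comp_whiskerRight, (f j).right_comm]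

/-- `coprod F` is the coproduct. -/
def isColimitCoprod : IsColimit (Cofan.mk (coprod F) (coprodι F)) :=
  Cofan.IsColimit.mk _ (fun s ↦ coprodDesc F s.inj)
    (fun s j ↦ hom_ext (by simp [coprodι, coprodDesc]))
    (fun s m hm ↦ hom_ext (Sigma.hom_ext _ _ fun j ↦ by
      simpa [coprodι, coprodDesc] using congr_arg Hom.hom (hm j)))

end coproducts

lemma hasCoproducts (J : Type*) [HasCoproductsOfShape J V] :
    HasCoproductsOfShape J (Bicomod C) := by
  have (F : J → Bicomod C) : HasCoproduct F := ⟨⟨_, isColimitCoprod F⟩⟩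
  exact ⟨fun K ↦ hasColimit_of_iso Discrete.natIsoFunctor⟩

instance : HasFiniteCoproducts (Bicomod C) := ⟨fun n ↦ hasCoproducts (Fin n)⟩

instance : HasFiniteProducts (Bicomod C) :=
  have := HasFiniteBiproducts.of_hasFiniteCoproducts (C := Bicomod C)
  inferInstance

lemma epi_hom {M N : Bicomod C} (f : M ⟶ N) [Epi f] : Epi f.hom := by
  have : cokerπ f = 0 := by
    rw [← cancel_epi f]
    exact hom_ext (by simp)
  exact Preadditive.epi_of_cokernel_zero (congr_arg Hom.hom this)

section kernels

variable [∀ X : V, PreservesFiniteLimits (tensorLeft X)]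
  [∀ X : V, PreservesFiniteLimits (tensorRight X)]

instance mono_whiskerLeft {X Y : V} (f : X ⟶ Y) [Mono f] (W : V) : Mono (W ◁ f) :=
  inferInstanceAs (Mono ((tensorLeft W).map f))

instance mono_whiskerRight {X Y : V} (f : X ⟶ Y) [Mono f] (W : V) : Mono (f ▷ W) :=
  inferInstanceAs (Mono ((tensorRight W).map f))

/-- A lift to `W ⊗ ker f`. -/
def liftL {X Y Z W : V} (f : X ⟶ Y) (g : Z ⟶ W ⊗ X) (h : g ≫ W ◁ f = 0) : Z ⟶ W ⊗ kernel f :=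
  (KernelFork.mapIsLimit _ (kernelIsKernel f) (tensorLeft W)).lift (KernelFork.ofι g h)

/-- A lift to `ker f ⊗ W`. -/
def liftR {X Y Z W : V} (f : X ⟶ Y) (g : Z ⟶ X ⊗ W) (h : g ≫ f ▷ W = 0) : Z ⟶ kernel f ⊗ W :=
  (KernelFork.mapIsLimit _ (kernelIsKernel f) (tensorRight W)).lift (KernelFork.ofι g h)

@[simp] lemma liftL_comp {X Y Z W : V} (f : X ⟶ Y) (g : Z ⟶ W ⊗ X) (h : g ≫ W ◁ f = 0) :
    liftL f g h ≫ W ◁ kernel.ι f = g :=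
  (KernelFork.mapIsLimit _ (kernelIsKernel f) (tensorLeft W)).fac (KernelFork.ofι g h) .zero

@[simp] lemma liftR_comp {X Y Z W : V} (f : X ⟶ Y) (g : Z ⟶ X ⊗ W) (h : g ≫ f ▷ W = 0) :
    liftR f g h ≫ kernel.ι f ▷ W = g :=
  (KernelFork.mapIsLimit _ (kernelIsKernel f) (tensorRight W)).fac (KernelFork.ofι g h) .zero

/-- The kernel of a morphism of bicomodules. -/
abbrev ker {M N : Bicomod C} (f : M ⟶ N) : Bicomod C :=
  M.ofMono (kernel.ι f.hom)
    (liftL f.hom (kernel.ι f.hom ≫ M.left) (by simp [f.left_comm]))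
    (liftR f.hom (kernel.ι f.hom ≫ M.right) (by simp [f.right_comm]))
    (by simp) (by simp) (fun f W ↦ inferInstance) (fun f W ↦ inferInstance)

/-- The inclusion of the kernel. -/
abbrev kerι {M N : Bicomod C} (f : M ⟶ N) : ker f ⟶ M where
  hom := kernel.ι f.hom
  left_comm := by simp [ker]
  right_comm := by simp [ker]

@[simp] lemma kerι_hom {M N : Bicomod C} (f : M ⟶ N) : (kerι f).hom = kernel.ι f.hom := rfl

instance {M N : Bicomod C} (f : M ⟶ N) : Mono (kerι f).hom :=
  inferInstanceAs (Mono (kernel.ι f.hom))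

/-- A morphism of underlying objects through which a morphism of bicomodules factors before a
monomorphism is a morphism of bicomodules. -/
abbrev liftHom {M N P : Bicomod C} (i : M ⟶ N) [Mono i.hom] (g : P ⟶ N) (l : P.X ⟶ M.X)
    (h : l ≫ i.hom = g.hom) : P ⟶ M where
  hom := l
  left_comm := by
    rw [← cancel_mono (C ◁ i.hom), Category.assoc, ← whiskerLeft_comp, h, g.left_comm,
      Category.assoc, i.left_comm, reassoc_of% h]
  right_comm := by
    rw [← cancel_mono (i.hom ▷ C), Category.assoc, ← comp_whiskerRight, h, g.right_comm,
      Category.assoc, i.right_comm, reassoc_of% h]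

/-- `ker f` is the kernel. -/
def isLimitKer {M N : Bicomod C} (f : M ⟶ N) :
    IsLimit (KernelFork.ofι (f := f) (kerι f) (hom_ext (by simp))) :=
  KernelFork.IsLimit.ofι _ _
    (fun g hg ↦ liftHom (kerι f) g (kernel.lift f.hom g.hom (congr_arg Hom.hom hg)) (by simp))
    (fun g hg ↦ hom_ext (by simp))
    (fun g hg m hm ↦ hom_ext (by
      rw [← cancel_mono (kernel.ι f.hom)]
      simpa using congr_arg Hom.hom hm))

instance : HasKernels (Bicomod C) where
  has_limit f := ⟨⟨_, isLimitKer f⟩⟩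

lemma mono_hom {M N : Bicomod C} (f : M ⟶ N) [Mono f] : Mono f.hom := by
  have : kerι f = 0 := by
    rw [← cancel_mono f]
    exact hom_ext (by simp)
  exact Preadditive.mono_of_kernel_zero (congr_arg Hom.hom this)

instance : Abelian (Bicomod C) where
  normalMonoOfMono {M N} f hf := by
    have := mono_hom f
    refine ⟨⟨coker f, cokerπ f, hom_ext (by simp), KernelFork.IsLimit.ofι _ _
      (fun g hg ↦ liftHom f g (Abelian.monoLift f.hom g.hom (congr_arg Hom.hom hg)) (by simp))
      (fun g hg ↦ hom_ext (by simp)) (fun g hg m hm ↦ ?_)⟩⟩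
    rw [← cancel_mono f, hm]
    exact hom_ext (by simp)
  normalEpiOfEpi {M N} f hf := by
    have := epi_hom f
    refine ⟨⟨ker f, kerι f, hom_ext (by simp), CokernelCofork.IsColimit.ofπ _ _
      (fun g hg ↦ descHom f g (Abelian.epiDesc f.hom g.hom (congr_arg Hom.hom hg)) (by simp))
      (fun g hg ↦ hom_ext (by simp [descHom])) (fun g hg m hm ↦ ?_)⟩⟩
    rw [← cancel_epi f, hm]
    exact hom_ext (by simp [descHom])

end kernels

end abelian

section cotensor

variable {V : Type u} [Category.{v} V] [Abelian V] [MonoidalCategory V] [MonoidalPreadditive V]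
  {C : V} [ComonObj C] [∀ X : V, PreservesFiniteLimits (tensorLeft X)]
  [∀ X : V, PreservesFiniteLimits (tensorRight X)]

lemma whiskerLeft_sub (W : V) {X Y : V} (f g : X ⟶ Y) : W ◁ (f - g) = W ◁ f - W ◁ g :=
  (tensorLeft W).map_sub

lemma sub_whiskerRight (W : V) {X Y : V} (f g : X ⟶ Y) : (f - g) ▷ W = f ▷ W - g ▷ W :=
  (tensorRight W).map_sub

/-- `M ⊗ N ⟶ M ⊗ C ⊗ N` induced by the right coaction of `M`. -/
abbrev cotD₁ (M N : Bicomod C) : outer M N ⟶ outer M (outer (unit C) N) where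
  hom := M.right ▷ N.X ≫ (α_ _ _ _).hom
  left_comm := by
    have := congr($(M.left_right) ▷ N.X)
    simp only [comp_whiskerRight] at this
    simp only [outer, Category.assoc, whiskerLeft_comp, ← associator_naturality_middle_assoc,
      reassoc_of% this]
    simp
  right_comm := by
    simp only [outer, unit, Category.assoc, whiskerLeft_comp, comp_whiskerRight,
      ← associator_inv_naturality_left_assoc, whisker_exchange_assoc]
    simp

/-- `M ⊗ N ⟶ M ⊗ C ⊗ N` induced by the left coaction of `N`. -/
abbrev cotD₂ (M N : Bicomod C) : outer M N ⟶ outer M (outer (unit C) N) where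
  hom := M.X ◁ N.left
  left_comm := by
    simp only [outer, unit, Category.assoc,
      ← associator_naturality_right, ← whisker_exchange_assoc]
  right_comm := by
    have := congr(M.X ◁ $(N.left_right))
    simp only [whiskerLeft_comp] at this
    simp only [outer, Category.assoc, whiskerLeft_comp, ← associator_inv_naturality_middle,
      reassoc_of% this]
    simp

/-- The cotensor product of two bicomodules. -/
def cot (M N : Bicomod C) : Bicomod C := ker (cotD₁ M N - cotD₂ M N)

/-- The inclusion of the cotensor product into the tensor product. -/
def cotι (M N : Bicomod C) : cot M N ⟶ outer M N := kerι (cotD₁ M N - cotD₂ M N)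

/-- The underlying morphism of the inclusion of the cotensor product into the tensor product. -/
def cι (M N : Bicomod C) : (cot M N).X ⟶ M.X ⊗ N.X := (cotι M N).hom

lemma cotι_hom (M N : Bicomod C) : (cotι M N).hom = cι M N := rfl

instance (M N : Bicomod C) : Mono (cotι M N).hom :=
  inferInstanceAs (Mono (kernel.ι (cotD₁ M N - cotD₂ M N).hom))

instance (M N : Bicomod C) : Mono (cι M N) := inferInstanceAs (Mono (cotι M N).hom)

lemma cι_eq (M N : Bicomod C) :
    cι M N ≫ M.right ▷ N.X ≫ (α_ _ _ _).hom = cι M N ≫ M.X ◁ N.left := by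
  have h : cι M N ≫ (cotD₁ M N - cotD₂ M N).hom = 0 :=
    kernel.condition (cotD₁ M N - cotD₂ M N).hom
  rw [sub_hom, Preadditive.comp_sub, sub_eq_zero] at h
  exact h

lemma cι_eq_assoc (M N : Bicomod C) {Z : V} (h : M.X ⊗ C ⊗ N.X ⟶ Z) :
    cι M N ≫ M.right ▷ N.X ≫ (α_ _ _ _).hom ≫ h = cι M N ≫ M.X ◁ N.left ≫ h := by
  simpa using cι_eq M N =≫ h

lemma cι_left (M N : Bicomod C) :
    (cot M N).left ≫ C ◁ cι M N = cι M N ≫ M.left ▷ N.X ≫ (α_ _ _ _).hom :=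
  (cotι M N).left_comm

lemma cι_right (M N : Bicomod C) :
    (cot M N).right ≫ cι M N ▷ C = cι M N ≫ M.X ◁ N.right ≫ (α_ _ _ _).inv :=
  (cotι M N).right_comm

lemma exists_lift (M N : Bicomod C) {Z : V} (g : Z ⟶ M.X ⊗ N.X)
    (h : g ≫ M.right ▷ N.X ≫ (α_ _ _ _).hom = g ≫ M.X ◁ N.left) :
    ∃ l : Z ⟶ (cot M N).X, l ≫ cι M N = g :=
  ⟨kernel.lift (cotD₁ M N - cotD₂ M N).hom g (by
    rw [sub_hom, Preadditive.comp_sub, sub_eq_zero]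
    exact h), kernel.lift_ι _ _ _⟩

lemma exists_liftL (M N : Bicomod C) {Z W : V} (g : Z ⟶ W ⊗ M.X ⊗ N.X)
    (h : g ≫ W ◁ M.right ▷ N.X ≫ W ◁ (α_ _ _ _).hom = g ≫ W ◁ M.X ◁ N.left) :
    ∃ l : Z ⟶ W ⊗ (cot M N).X, l ≫ W ◁ cι M N = g :=
  ⟨liftL (cotD₁ M N - cotD₂ M N).hom g (by
    rw [sub_hom, whiskerLeft_sub, Preadditive.comp_sub, sub_eq_zero, whiskerLeft_comp]
    exact h), liftL_comp _ _ _⟩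

lemma exists_liftR (M N : Bicomod C) {Z W : V} (g : Z ⟶ (M.X ⊗ N.X) ⊗ W)
    (h : g ≫ M.right ▷ N.X ▷ W ≫ (α_ _ _ _).hom ▷ W = g ≫ (M.X ◁ N.left) ▷ W) :
    ∃ l : Z ⟶ (cot M N).X ⊗ W, l ≫ cι M N ▷ W = g :=
  ⟨liftR (cotD₁ M N - cotD₂ M N).hom g (by
    rw [sub_hom, sub_whiskerRight, Preadditive.comp_sub, sub_eq_zero, comp_whiskerRight]
    exact h), liftR_comp _ _ _⟩

lemma cι_tensorHom_eq {M M' N N' : Bicomod C} (f : M ⟶ M') (g : N ⟶ N') :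
    (cι M N ≫ (f.hom ⊗ₘ g.hom)) ≫ M'.right ▷ N'.X ≫ (α_ _ _ _).hom =
      (cι M N ≫ (f.hom ⊗ₘ g.hom)) ≫ M'.X ◁ N'.left := by
  have h₁ : (f.hom ⊗ₘ g.hom) ≫ M'.right ▷ N'.X =
      M.right ▷ N.X ≫ ((f.hom ▷ C) ⊗ₘ g.hom) := by
    rw [tensorHom_def', Category.assoc, ← comp_whiskerRight, ← f.right_comm, comp_whiskerRight,
      whisker_exchange_assoc, tensorHom_def']
  have h₂ : (f.hom ⊗ₘ g.hom) ≫ M'.X ◁ N'.left = M.X ◁ N.left ≫ (f.hom ⊗ₘ C ◁ g.hom) := by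
    rw [MonoidalCategory.tensorHom_def, Category.assoc, ← whiskerLeft_comp, ← g.left_comm, whiskerLeft_comp,
      ← whisker_exchange_assoc, MonoidalCategory.tensorHom_def]
  have h₃ : (f.hom ▷ C ⊗ₘ g.hom) ≫ (α_ M'.X C N'.X).hom =
      (α_ _ _ _).hom ≫ (f.hom ⊗ₘ C ◁ g.hom) := by
    rw [← tensorHom_id, associator_naturality, id_tensorHom]
  rw [Category.assoc, Category.assoc, reassoc_of% h₁, h₂, ← cι_eq_assoc, h₃]

/-- Functoriality of `outer`. -/
abbrev outerMap {M M' N N' : Bicomod C} (f : M ⟶ M') (g : N ⟶ N') : outer M N ⟶ outer M' N' where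
  hom := f.hom ⊗ₘ g.hom
  left_comm := by
    have h : M.left ▷ N.X ≫ ((C ◁ f.hom) ⊗ₘ g.hom) = (f.hom ⊗ₘ g.hom) ≫ M'.left ▷ N'.X := by
      rw [tensorHom_def', ← whisker_exchange_assoc, ← comp_whiskerRight, f.left_comm,
        tensorHom_def', Category.assoc, comp_whiskerRight]
    rw [← id_tensorHom] at h
    rw [← id_tensorHom, Category.assoc, ← associator_naturality, reassoc_of% h]
  right_comm := by
    have h : M.X ◁ N.right ≫ (f.hom ⊗ₘ (g.hom ▷ C)) = (f.hom ⊗ₘ g.hom) ≫ M'.X ◁ N'.right := by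
      rw [MonoidalCategory.tensorHom_def, whisker_exchange_assoc, ← whiskerLeft_comp, g.right_comm,
        MonoidalCategory.tensorHom_def, Category.assoc, whiskerLeft_comp]
    rw [← tensorHom_id] at h
    rw [← tensorHom_id, Category.assoc, ← associator_inv_naturality, reassoc_of% h]

/-- Functoriality of the cotensor product. -/
def cotMap {M M' N N' : Bicomod C} (f : M ⟶ M') (g : N ⟶ N') : cot M N ⟶ cot M' N' :=
  liftHom (cotι M' N') (cotι M N ≫ outerMap f g)
    (exists_lift M' N' _ (cι_tensorHom_eq f g)).choose
    (exists_lift M' N' _ (cι_tensorHom_eq f g)).choose_spec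

@[simp] lemma cotMap_hom_comp {M M' N N' : Bicomod C} (f : M ⟶ M') (g : N ⟶ N') :
    (cotMap f g).hom ≫ cι M' N' = cι M N ≫ (f.hom ⊗ₘ g.hom) :=
  (exists_lift M' N' _ (cι_tensorHom_eq f g)).choose_spec

/-- The inclusion of `(M □ N) □ P` into `M ⊗ (N ⊗ P)`. -/
def e₁ (M N P : Bicomod C) : (cot (cot M N) P).X ⟶ M.X ⊗ N.X ⊗ P.X :=
  cι (cot M N) P ≫ cι M N ▷ P.X ≫ (α_ _ _ _).hom

/-- The inclusion of `M □ (N □ P)` into `M ⊗ (N ⊗ P)`. -/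
def e₂ (M N P : Bicomod C) : (cot M (cot N P)).X ⟶ M.X ⊗ N.X ⊗ P.X :=
  cι M (cot N P) ≫ M.X ◁ cι N P

instance (M N P : Bicomod C) : Mono (e₁ M N P) := by
  dsimp [e₁]; infer_instance

instance (M N P : Bicomod C) : Mono (e₂ M N P) := by
  dsimp [e₂]; infer_instance

/-- The equations that define `M □ N □ P` in `M ⊗ (N ⊗ P)`. -/
structure Good (M N P : Bicomod C) {Z : V} (f : Z ⟶ M.X ⊗ N.X ⊗ P.X) : Prop where
  fst : f ≫ M.right ▷ (N.X ⊗ P.X) ≫ (α_ _ _ _).hom =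
    f ≫ M.X ◁ N.left ▷ P.X ≫ M.X ◁ (α_ _ _ _).hom
  snd : f ≫ M.X ◁ N.right ▷ P.X ≫ M.X ◁ (α_ _ _ _).hom = f ≫ M.X ◁ N.X ◁ P.left

lemma good_e₁ (M N P : Bicomod C) : Good M N P (e₁ M N P) where
  fst := by
    have := congr($(cι_eq M N) ▷ P.X)
    simp only [comp_whiskerRight] at this
    simp only [e₁, Category.assoc, ← associator_naturality_left_assoc,
      ← associator_naturality_middle_assoc, ← reassoc_of% this]
    simp
  snd := by
    have := congr($(cι_right M N) ▷ P.X)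
    simp only [comp_whiskerRight] at this
    have h : cι M N ▷ P.X ≫ (M.X ◁ N.right) ▷ P.X =
        (cot M N).right ▷ P.X ≫ cι M N ▷ C ▷ P.X ≫ (α_ _ _ _).hom ▷ P.X := by
      rw [reassoc_of% this]; simp
    simp only [e₁, Category.assoc, ← associator_naturality_middle_assoc, reassoc_of% h]
    have h2 : cι M N ▷ C ▷ P.X ≫ (α_ M.X N.X C).hom ▷ P.X ≫ (α_ M.X (N.X ⊗ C) P.X).hom ≫
        M.X ◁ (α_ N.X C P.X).hom = (α_ _ _ _).hom ≫ cι M N ▷ (C ⊗ P.X) ≫ (α_ _ _ _).hom := by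
      simp
    rw [h2, cι_eq_assoc (cot M N) P, whisker_exchange_assoc]
    simp

lemma good_e₂ (M N P : Bicomod C) : Good M N P (e₂ M N P) where
  fst := by
    have := congr(M.X ◁ $(cι_left N P))
    simp only [whiskerLeft_comp] at this
    simp only [e₂, Category.assoc, ← this]
    rw [whisker_exchange_assoc, ← cι_eq_assoc]
    simp
  snd := by
    have := congr(M.X ◁ $(cι_eq N P))
    simp only [whiskerLeft_comp] at this
    simp only [e₂, Category.assoc, this]

lemma exists_lift_e₁ (M N P : Bicomod C) {Z : V} (f : Z ⟶ M.X ⊗ N.X ⊗ P.X) (hf : Good M N P f) :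
    ∃ l, l ≫ e₁ M N P = f := by
  obtain ⟨g, hg⟩ := exists_liftR M N (f ≫ (α_ _ _ _).inv) (by
    have h := hf.fst =≫ (M.X ◁ (α_ _ _ _).inv ≫ (α_ _ _ _).inv)
    simp at h
    simp [← h])
  have hg' : g ≫ cι M N ▷ P.X ≫ (α_ _ _ _).hom = f := by rw [reassoc_of% hg]; simp
  obtain ⟨l, hl⟩ := exists_lift (cot M N) P g (by
    have := congr($(cι_right M N) ▷ P.X)
    simp only [comp_whiskerRight] at this
    rw [← cancel_mono (cι M N ▷ (C ⊗ P.X) ≫ (α_ _ _ _).hom)]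
    have h1 : (g ≫ (cot M N).X ◁ P.left) ≫ cι M N ▷ (C ⊗ P.X) ≫ (α_ _ _ _).hom =
        f ≫ M.X ◁ N.X ◁ P.left := by
      rw [Category.assoc, whisker_exchange_assoc, reassoc_of% hg]; simp
    rw [h1, ← hf.snd, Category.assoc, Category.assoc, ← associator_naturality_left_assoc,
      reassoc_of% this, reassoc_of% hg]
    simp)
  exact ⟨l, by rw [e₁, reassoc_of% hl, hg']⟩

lemma exists_lift_e₂ (M N P : Bicomod C) {Z : V} (f : Z ⟶ M.X ⊗ N.X ⊗ P.X) (hf : Good M N P f) :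
    ∃ l, l ≫ e₂ M N P = f := by
  obtain ⟨g, hg⟩ := exists_liftL N P f hf.snd
  obtain ⟨l, hl⟩ := exists_lift M (cot N P) g (by
    have := congr(M.X ◁ $(cι_left N P))
    simp only [whiskerLeft_comp] at this
    rw [← cancel_mono (M.X ◁ C ◁ cι N P), Category.assoc, Category.assoc, Category.assoc, this,
      reassoc_of% hg, ← hf.fst, ← associator_naturality_right, ← whisker_exchange_assoc,
      reassoc_of% hg])
  exact ⟨l, by rw [e₂, reassoc_of% hl, hg]⟩

/-- The inclusion of `(M □ N) □ P` into `M ⊗ (N ⊗ P)` is a morphism of bicomodules. -/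
abbrev e₁' (M N P : Bicomod C) : cot (cot M N) P ⟶ outer M (outer N P) where
  hom := e₁ M N P
  left_comm := by
    have h1 := cι_left (cot M N) P
    have h2 := congr($(cι_left M N) ▷ P.X)
    simp only [comp_whiskerRight] at h2
    simp only [e₁, whiskerLeft_comp, reassoc_of% h1, ← associator_naturality_middle_assoc,
      reassoc_of% h2]
    simp
  right_comm := by
    have h1 := cι_right (cot M N) P
    simp only [e₁, comp_whiskerRight, reassoc_of% h1, ← associator_inv_naturality_left_assoc,
      whisker_exchange_assoc]
    simp

/-- The inclusion of `M □ (N □ P)` into `M ⊗ (N ⊗ P)` is a morphism of bicomodules. -/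
abbrev e₂' (M N P : Bicomod C) : cot M (cot N P) ⟶ outer M (outer N P) where
  hom := e₂ M N P
  left_comm := by
    have h1 := cι_left M (cot N P)
    simp only [e₂, whiskerLeft_comp, reassoc_of% h1]
    rw [← associator_naturality_right, ← whisker_exchange_assoc]
    simp
  right_comm := by
    have h1 := cι_right M (cot N P)
    have h2 := congr(M.X ◁ $(cι_right N P))
    simp only [whiskerLeft_comp] at h2
    simp only [e₂, comp_whiskerRight, reassoc_of% h1, ← associator_inv_naturality_middle,
      reassoc_of% h2]
    simp

/-- The associativity isomorphism of the cotensor product. -/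
def cotAssoc (M N P : Bicomod C) : cot (cot M N) P ≅ cot M (cot N P) where
  hom := liftHom (e₂' M N P) (e₁' M N P) _
    (exists_lift_e₂ M N P _ (good_e₁ M N P)).choose_spec
  inv := liftHom (e₁' M N P) (e₂' M N P) _
    (exists_lift_e₁ M N P _ (good_e₂ M N P)).choose_spec
  hom_inv_id := by
    ext
    rw [← cancel_mono (e₁ M N P)]
    simp [(exists_lift_e₂ M N P _ (good_e₁ M N P)).choose_spec,
      (exists_lift_e₁ M N P _ (good_e₂ M N P)).choose_spec]
  inv_hom_id := by
    ext
    rw [← cancel_mono (e₂ M N P)]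
    simp [(exists_lift_e₂ M N P _ (good_e₁ M N P)).choose_spec,
      (exists_lift_e₁ M N P _ (good_e₂ M N P)).choose_spec]

lemma cotAssoc_hom_comp (M N P : Bicomod C) :
    (cotAssoc M N P).hom.hom ≫ cι M (cot N P) ≫ M.X ◁ cι N P =
      cι (cot M N) P ≫ cι M N ▷ P.X ≫ (α_ _ _ _).hom :=
  (exists_lift_e₂ M N P _ (good_e₁ M N P)).choose_spec

/-- The isomorphism `C □ M ≅ M`. -/
def cotLeftUnit (M : Bicomod C) : cot (unit C) M ≅ M :=
  have h := (exists_lift (unit C) M M.left (by simp)).choose_spec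
  let φ := liftHom (cotι (unit C) M)
      { hom := M.left, left_comm := by simp, right_comm := by simp } _ h
  Iso.symm (isoMk
    { hom := φ.hom
      inv := cι (unit C) M ≫ ε ▷ M.X ≫ (λ_ M.X).hom
      hom_inv_id := by simp [φ, reassoc_of% h]
      inv_hom_id := by
        rw [← cancel_mono (cι (unit C) M)]
        have h' : φ.hom ≫ cι (unit C) M = M.left := h
        rw [Category.assoc, Category.assoc, Category.assoc, h', ← leftUnitor_naturality,
          ← whisker_exchange_assoc, Category.id_comp]
        have := cι_eq_assoc (unit C) M (ε ▷ (C ⊗ M.X) ≫ (λ_ _).hom)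
        dsimp only [unit] at this
        rw [← this]
        simp [← comp_whiskerRight_assoc] } φ.left_comm φ.right_comm)

/-- The isomorphism `M □ C ≅ M`. -/
def cotRightUnit (M : Bicomod C) : cot M (unit C) ≅ M :=
  have h := (exists_lift M (unit C) M.right (by simp)).choose_spec
  let φ := liftHom (cotι M (unit C))
      { hom := M.right, left_comm := by simp, right_comm := by simp } _ h
  Iso.symm (isoMk
    { hom := φ.hom
      inv := cι M (unit C) ≫ M.X ◁ ε ≫ (ρ_ M.X).hom
      hom_inv_id := by simp [φ, reassoc_of% h]
      inv_hom_id := by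
        rw [← cancel_mono (cι M (unit C))]
        have h' : φ.hom ≫ cι M (unit C) = M.right := h
        rw [Category.assoc, Category.assoc, Category.assoc, h', ← rightUnitor_naturality,
          whisker_exchange_assoc, Category.id_comp]
        have := cι_eq M (unit C) =≫ ((α_ _ _ _).inv ≫ _ ◁ ε ≫ (ρ_ _).hom)
        simp at this
        simp [this, ← whiskerLeft_comp_assoc] } φ.left_comm φ.right_comm)

lemma cotLeftUnit_hom (M : Bicomod C) :
    (cotLeftUnit M).hom.hom = cι (unit C) M ≫ ε ▷ M.X ≫ (λ_ M.X).hom := rfl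

lemma cotRightUnit_hom (M : Bicomod C) :
    (cotRightUnit M).hom.hom = cι M (unit C) ≫ M.X ◁ ε ≫ (ρ_ M.X).hom := rfl

lemma cotMap_id (M N : Bicomod C) : cotMap (𝟙 M) (𝟙 N) = 𝟙 (cot M N) := by
  ext
  rw [← cancel_mono (cι M N)]
  simp

lemma cotMap_comp {M M' M'' N N' N'' : Bicomod C} (f : M ⟶ M') (g : N ⟶ N') (f' : M' ⟶ M'')
    (g' : N' ⟶ N'') : cotMap f g ≫ cotMap f' g' = cotMap (f ≫ f') (g ≫ g') := by
  ext
  rw [← cancel_mono (cι M'' N'')]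
  simp [reassoc_of% cotMap_hom_comp f g]

lemma cotAssoc_naturality {M M' N N' P P' : Bicomod C} (f : M ⟶ M') (g : N ⟶ N') (h : P ⟶ P') :
    cotMap (cotMap f g) h ≫ (cotAssoc M' N' P').hom =
      (cotAssoc M N P).hom ≫ cotMap f (cotMap g h) := by
  ext
  rw [← cancel_mono (cι M' (cot N' P')), ← cancel_mono (M'.X ◁ cι N' P')]
  simp only [comp_hom, Category.assoc, cotAssoc_hom_comp, cotMap_hom_comp,
    tensorHom_comp_whiskerLeft, reassoc_of% cotMap_hom_comp (cotMap f g) h,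
    tensorHom_comp_whiskerRight_assoc, ← whiskerRight_comp_tensorHom_assoc,
    ← whiskerLeft_comp_tensorHom]
  rw [associator_naturality, reassoc_of% cotAssoc_hom_comp]

lemma cotLeftUnit_naturality {M N : Bicomod C} (f : M ⟶ N) :
    cotMap (𝟙 (unit C)) f ≫ (cotLeftUnit N).hom = (cotLeftUnit M).hom ≫ f := by
  ext
  simp only [comp_hom, cotLeftUnit_hom, reassoc_of% cotMap_hom_comp, id_hom, id_tensorHom,
    whisker_exchange_assoc, leftUnitor_naturality, Category.assoc]

lemma cotRightUnit_naturality {M N : Bicomod C} (f : M ⟶ N) :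
    cotMap f (𝟙 (unit C)) ≫ (cotRightUnit N).hom = (cotRightUnit M).hom ≫ f := by
  ext
  simp only [comp_hom, cotRightUnit_hom, reassoc_of% cotMap_hom_comp, id_hom, tensorHom_id,
    ← whisker_exchange_assoc, rightUnitor_naturality, Category.assoc]

lemma cot_triangle (M N : Bicomod C) :
    (cotAssoc M (unit C) N).hom ≫ cotMap (𝟙 M) (cotLeftUnit N).hom =
      cotMap (cotRightUnit M).hom (𝟙 N) := by
  ext
  rw [← cancel_mono (cι M N)]
  simp only [comp_hom, Category.assoc, cotMap_hom_comp, id_hom, id_tensorHom, tensorHom_id,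
    cotLeftUnit_hom, cotRightUnit_hom, whiskerLeft_comp, comp_whiskerRight,
    reassoc_of% cotAssoc_hom_comp]
  simp

lemma cot_pentagon (M N P R : Bicomod C) :
    cotMap (cotAssoc M N P).hom (𝟙 R) ≫ (cotAssoc M (cot N P) R).hom ≫
        cotMap (𝟙 M) (cotAssoc N P R).hom =
      (cotAssoc (cot M N) P R).hom ≫ (cotAssoc M N (cot P R)).hom := by
  ext
  rw [← cancel_mono (cι M (cot N (cot P R))), ← cancel_mono (M.X ◁ cι N (cot P R)),
    ← cancel_mono (M.X ◁ N.X ◁ cι P R)]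
  have h1 := congr(M.X ◁ $(cotAssoc_hom_comp N P R))
  have h2 := congr($(cotAssoc_hom_comp M N P) ▷ R.X)
  simp only [whiskerLeft_comp, comp_whiskerRight] at h1 h2
  simp only [comp_hom, Category.assoc, cotMap_hom_comp, id_hom, id_tensorHom, tensorHom_id,
    cotAssoc_hom_comp, reassoc_of% cotAssoc_hom_comp, reassoc_of% cotMap_hom_comp, h1]
  rw [← associator_naturality_middle_assoc, reassoc_of% h2, ← associator_naturality_right,
    ← whisker_exchange_assoc, reassoc_of% cotAssoc_hom_comp (cot M N) P R]
  simp

instance : MonoidalCategoryStruct (Bicomod C) where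
  tensorObj := cot
  tensorHom := cotMap
  tensorUnit := unit C
  whiskerLeft M _ _ f := cotMap (𝟙 M) f
  whiskerRight f N := cotMap f (𝟙 N)
  associator := cotAssoc
  leftUnitor := cotLeftUnit
  rightUnitor := cotRightUnit

/-- Bicomodules form a monoidal category with respect to the cotensor product. -/
instance : MonoidalCategory (Bicomod C) :=
  .ofTensorHom cotMap_id (fun _ _ _ _ ↦ rfl) (fun _ _ ↦ rfl) cotMap_comp cotAssoc_naturality
    cotLeftUnit_naturality cotRightUnit_naturality cot_pentagon cot_triangle

instance : MonoidalPreadditive (Bicomod C) where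
  whiskerLeft_zero {M N P} := by
    refine hom_ext ?_
    rw [← cancel_mono (cι M P)]
    exact (cotMap_hom_comp _ _).trans (by simp)
  zero_whiskerRight {M N P} := by
    refine hom_ext ?_
    rw [← cancel_mono (cι P M)]
    exact (cotMap_hom_comp _ _).trans (by simp)
  whiskerLeft_add {M N P} f g := by
    refine hom_ext ?_
    rw [← cancel_mono (cι M P), add_hom, Preadditive.add_comp]
    refine (cotMap_hom_comp _ _).trans (.trans ?_
      (congr_arg₂ _ (cotMap_hom_comp _ _).symm (cotMap_hom_comp _ _).symm))
    simp
  add_whiskerRight {M N P} f g := by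
    refine hom_ext ?_
    rw [← cancel_mono (cι P M), add_hom, Preadditive.add_comp]
    refine (cotMap_hom_comp _ _).trans (.trans ?_
      (congr_arg₂ _ (cotMap_hom_comp _ _).symm (cotMap_hom_comp _ _).symm))
    simp

end cotensor

section coproducts

/-- If colimits of shape `J` are exact, then a kernel of functors that preserve them preserves
them. -/
lemma preservesColimitsOfShape_of_kernel {A V : Type*} [Category A] [Category V]
    [HasZeroMorphisms V] [HasZeroObject V] (J : Type*) [Category J] [HasColimitsOfShape J A]
    [HasColimitsOfShape J V] [HasExactColimitsOfShape J V] {K G₁ G₂ : A ⥤ V}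
    (i : K ⟶ G₁) (d : G₁ ⟶ G₂) (hid : ∀ N, i.app N ≫ d.app N = 0)
    (hi : ∀ N, Mono (i.app N)) (hl : ∀ (N : A) (Z : V) (g : Z ⟶ G₁.obj N), g ≫ d.app N = 0 →
      ∃ l, l ≫ i.app N = g)
    [PreservesColimitsOfShape J G₁] [PreservesColimitsOfShape J G₂] :
    PreservesColimitsOfShape J K where
  preservesColimit {F} := by
    have h0 : Functor.whiskerLeft F i ≫ Functor.whiskerLeft F d = 0 := by
      ext j
      exact hid _
    have hker : IsLimit (KernelFork.ofι (f := Functor.whiskerLeft F d)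
        (Functor.whiskerLeft F i) h0) :=
      KernelFork.IsLimit.ofι _ _
        (fun {Z} g hg ↦
          { app j := (hl (F.obj j) _ (g.app j) (congr_app hg j)).choose
            naturality {j j'} f := by
              have := hi (F.obj j')
              have h1 := (hl (F.obj j) _ (g.app j) (congr_app hg j)).choose_spec
              have h2 := (hl (F.obj j') _ (g.app j') (congr_app hg j')).choose_spec
              rw [← cancel_mono (i.app (F.obj j'))]
              simp [h2, reassoc_of% h1] })
        (fun {Z} g hg ↦ by
          ext j
          exact (hl (F.obj j) _ (g.app j) (congr_app hg j)).choose_spec)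
        (fun {Z} g hg m hm ↦ by
          ext j
          have := hi (F.obj j)
          rw [← cancel_mono (i.app (F.obj j))]
          exact (congr_app hm j).trans
            (hl (F.obj j) _ (g.app j) (congr_app hg j)).choose_spec.symm)
    have hker' := KernelFork.mapIsLimit _ hker (colim (J := J) (C := V))
    have : Mono (colim.map (Functor.whiskerLeft F i)) :=
      Fork.IsLimit.mono hker'
    have n₁ : colim.map (Functor.whiskerLeft F i) ≫ colimit.post F G₁ =
        colimit.post F K ≫ i.app (colimit F) := colimit.hom_ext fun j ↦ by simp
    have n₂ : colim.map (Functor.whiskerLeft F d) ≫ colimit.post F G₂ =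
        colimit.post F G₁ ≫ d.app (colimit F) := colimit.hom_ext fun j ↦ by simp
    have hm : Mono (colimit.post F K) := by
      have : Mono (colimit.post F K ≫ i.app (colimit F)) := by
        rw [← n₁]; infer_instance
      exact mono_of_mono _ (i.app (colimit F))
    have hs : (i.app (colimit F) ≫ inv (colimit.post F G₁)) ≫
        colim.map (Functor.whiskerLeft F d) = 0 := by
      rw [← cancel_mono (colimit.post F G₂), Category.assoc, Category.assoc, n₂]
      simp [hid]
    obtain ⟨s, h⟩ : ∃ s : K.obj (colimit F) ⟶ colimit (F ⋙ K),
        s ≫ colim.map (Functor.whiskerLeft F i) = i.app (colimit F) ≫ inv (colimit.post F G₁) :=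
      ⟨hker'.lift (KernelFork.ofι _ hs), hker'.fac (KernelFork.ofι _ hs) .zero⟩
    have h' : s ≫ colimit.post F K = 𝟙 _ := by
      have := hi (colimit F)
      rw [← cancel_mono (i.app (colimit F)), Category.assoc, ← n₁, reassoc_of% h]
      simp
    have : IsIso (colimit.post F K) :=
      ⟨s, by rw [← cancel_mono (colimit.post F K), Category.assoc, h']; simp, h'⟩
    exact preservesColimit_of_isIso_post K F

variable {V : Type u} [Category.{v} V] [Abelian V] [MonoidalCategory V] [MonoidalPreadditive V]
  {C : V} [ComonObj C] [∀ X : V, PreservesFiniteLimits (tensorLeft X)]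
  [∀ X : V, PreservesFiniteLimits (tensorRight X)] [HasGoodCoproducts V]

lemma preservesCoproducts_tensorLeft (J : Type) (X : V) :
    PreservesColimitsOfShape (Discrete J) (tensorLeft X) where
  preservesColimit {K} :=
    have : PreservesColimit (Discrete.functor (K.obj ∘ Discrete.mk)) (tensorLeft X) :=
      HasGoodCoproducts.left X J _
    preservesColimit_of_iso_diagram _ Discrete.natIsoFunctor.symm

lemma preservesCoproducts_tensorRight (J : Type) (X : V) :
    PreservesColimitsOfShape (Discrete J) (tensorRight X) where
  preservesColimit {K} :=
    have : PreservesColimit (Discrete.functor (K.obj ∘ Discrete.mk)) (tensorRight X) :=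
      HasGoodCoproducts.right X J _
    preservesColimit_of_iso_diagram _ Discrete.natIsoFunctor.symm

lemma preservesCoproducts_forget (J : Type) [HasCoproductsOfShape J V] :
    PreservesColimitsOfShape (Discrete J) (forget C) where
  preservesColimit {K} := by
    have : PreservesColimit (Discrete.functor (K.obj ∘ Discrete.mk)) (forget C) := by
      let F := K.obj ∘ Discrete.mk
      refine preservesColimit_of_preserves_colimit_cocone (isColimitCoprod F) ?_
      refine (isColimitMapCoconeCofanMkEquiv (forget C) F (coprodι F)).symm ?_
      exact coproductIsCoproduct (fun j ↦ (F j).X)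
    exact preservesColimit_of_iso_diagram _ Discrete.natIsoFunctor.symm

variable [hJ : HasCoproducts.{0} V] [∀ J : Type, HasExactColimitsOfShape (Discrete J) V]

/-- The natural transformation whose kernel is the cotensor product `M □ -`. -/
abbrev cotDL (M : Bicomod C) :
    forget C ⋙ tensorLeft M.X ⟶ (forget C ⋙ tensorLeft C) ⋙ tensorLeft M.X where
  app N := (cotD₁ M N - cotD₂ M N).hom
  naturality N N' f := by
    simp only [sub_hom]
    change M.X ◁ f.hom ≫ (M.right ▷ N'.X ≫ (α_ _ _ _).hom - M.X ◁ N'.left) =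
      (M.right ▷ N.X ≫ (α_ _ _ _).hom - M.X ◁ N.left) ≫ M.X ◁ C ◁ f.hom
    simp only [Preadditive.comp_sub, Preadditive.sub_comp, ← whiskerLeft_comp, f.left_comm,
      whisker_exchange_assoc, Category.assoc]
    simp

/-- The natural transformation whose kernel is the cotensor product `- □ N`. -/
abbrev cotDR (N : Bicomod C) :
    forget C ⋙ tensorRight N.X ⟶ forget C ⋙ tensorRight (C ⊗ N.X) where
  app M := (cotD₁ M N - cotD₂ M N).hom
  naturality M M' f := by
    simp only [sub_hom]
    change f.hom ▷ N.X ≫ (M'.right ▷ N.X ≫ (α_ _ _ _).hom - M'.X ◁ N.left) =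
      (M.right ▷ N.X ≫ (α_ _ _ _).hom - M.X ◁ N.left) ≫ f.hom ▷ (C ⊗ N.X)
    have := congr($(f.right_comm) ▷ N.X)
    simp only [comp_whiskerRight] at this
    simp only [Preadditive.comp_sub, Preadditive.sub_comp, ← reassoc_of% this,
      whisker_exchange, Category.assoc]
    simp

/-- The inclusion of `M □ -`. -/
abbrev cιL (M : Bicomod C) : tensorLeft M ⋙ forget C ⟶ forget C ⋙ tensorLeft M.X where
  app N := cι M N
  naturality N N' f := by
    refine (cotMap_hom_comp _ _).trans ?_
    simp
    rfl

/-- The inclusion of `- □ N`. -/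
abbrev cιR (N : Bicomod C) : tensorRight N ⋙ forget C ⟶ forget C ⋙ tensorRight N.X where
  app M := cι M N
  naturality M M' f := by
    refine (cotMap_hom_comp _ _).trans ?_
    simp
    rfl

instance : HasGoodCoproducts (Bicomod C) where
  hasCoproducts J := hasCoproducts J
  left M J Y := by
    have := preservesCoproducts_forget (C := C) J
    have := preservesCoproducts_tensorLeft J M.X
    have := preservesCoproducts_tensorLeft J C
    have := hasCoproducts (C := C) J
    have : PreservesColimitsOfShape (Discrete J) (tensorLeft M ⋙ forget C) :=
      preservesColimitsOfShape_of_kernel (Discrete J)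
        (cιL M)
        (cotDL M) (fun N ↦ kernel.condition (cotD₁ M N - cotD₂ M N).hom)
        (fun N ↦ (inferInstance : Mono (cι M N)))
        (fun N Z g hg ↦ ⟨kernel.lift _ g hg, kernel.lift_ι _ g hg⟩)
    have : ReflectsColimitsOfShape (Discrete J) (forget C) :=
      reflectsColimitsOfShape_of_reflectsIsomorphisms
    have : PreservesColimitsOfShape (Discrete J) (tensorLeft M) :=
      preservesColimitsOfShape_of_reflects_of_preserves _ (forget C)
    exact inferInstanceAs (PreservesColimit (Discrete.functor Y) (tensorLeft M))
  right M J Y := by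
    have := preservesCoproducts_forget (C := C) J
    have := preservesCoproducts_tensorRight J M.X
    have := preservesCoproducts_tensorRight J (C ⊗ M.X)
    have := hasCoproducts (C := C) J
    have : PreservesColimitsOfShape (Discrete J) (tensorRight M ⋙ forget C) :=
      preservesColimitsOfShape_of_kernel (Discrete J)
        (cιR M)
        (cotDR M) (fun N ↦ kernel.condition (cotD₁ N M - cotD₂ N M).hom)
        (fun N ↦ inferInstanceAs (Mono (cι N M)))
        (fun N Z g hg ↦ ⟨kernel.lift _ g hg, kernel.lift_ι _ g hg⟩)
    have : ReflectsColimitsOfShape (Discrete J) (forget C) :=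
      reflectsColimitsOfShape_of_reflectsIsomorphisms
    have : PreservesColimitsOfShape (Discrete J) (tensorRight M) :=
      preservesColimitsOfShape_of_reflects_of_preserves _ (forget C)
    exact inferInstanceAs (PreservesColimit (Discrete.functor Y) (tensorRight M))

end coproducts
end Bicomod
/-! ### Bicomodules over a coalgebra over a field -/

section BicomoduleCat

instance moduleCat_hasGoodCoproducts (k : Type u) [CommRing k] :
    HasGoodCoproducts (ModuleCat.{u} k) where
  hasCoproducts J := inferInstance
  left X J Y := inferInstanceAs (PreservesColimit _ (tensorLeft X))
  right X J Y := inferInstanceAs (PreservesColimit _ (tensorRight X))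

instance moduleCat_hasCoproducts (k : Type u) [CommRing k] : HasCoproducts.{0} (ModuleCat.{u} k) :=
  fun J ↦ inferInstance

instance moduleCat_exactCoproducts (k : Type u) [CommRing k] (J : Type) :
    HasExactColimitsOfShape (Discrete J) (ModuleCat.{u} k) :=
  inferInstance

/-- A coalgebra is a comonoid object in the monoidal category of modules. -/
instance comonObjOfCoalgebra (k C : Type u) [CommRing k] [AddCommGroup C] [Module k C]
    [Coalgebra k C] : ComonObj (ModuleCat.of k C) where
  counit := ModuleCat.ofHom Coalgebra.counit
  comul := ModuleCat.ofHom Coalgebra.comul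
  counit_comul := ModuleCat.hom_ext <| by simpa using! Coalgebra.rTensor_counit_comp_comul
  comul_counit := ModuleCat.hom_ext <| by simpa using! Coalgebra.lTensor_counit_comp_comul
  comul_assoc := ModuleCat.hom_ext Coalgebra.coassoc.symm

/-- The category of `C`-bicomodules over a field. -/
abbrev BicomoduleCat (k C : Type u) [Field k] [AddCommGroup C] [Module k C] [Coalgebra k C] :=
  Bicomod (ModuleCat.of k C)

end BicomoduleCat

/-- The quotient of a submodule `Z` by a submodule `B`, where `B` is contained in `Z`. -/
def Subquotient {k M : Type*} [CommRing k] [AddCommGroup M] [Module k M] (Z B : Submodule k M) :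
    Type _ :=
  Z ⧸ B.submoduleOf Z

namespace Subquotient

variable {k M : Type*} [CommRing k] [AddCommGroup M] [Module k M]

instance (Z B : Submodule k M) : AddCommGroup (Subquotient Z B) :=
  inferInstanceAs (AddCommGroup (Z ⧸ B.submoduleOf Z))

/-- The class of an element of `Z`. -/
def mk {Z : Submodule k M} (B : Submodule k M) (x : M) (hx : x ∈ Z) : Subquotient Z B :=
  Submodule.Quotient.mk ⟨x, hx⟩

end Subquotient

/-! ### The Hochschild complex and the cup product -/

namespace Hochschild

variable (k A : Type u) [CommRing k] [Ring A] [Algebra k A]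

/-- The `k`-multilinear cochains in `n` variables. -/
def cochains (n : ℕ) : Submodule k ((Fin n → A) → A) where
  carrier := {f | ∃ g : MultilinearMap k (fun _ : Fin n ↦ A) A, ⇑g = f}
  add_mem' := by
    rintro _ _ ⟨f, rfl⟩ ⟨g, rfl⟩
    exact ⟨f + g, rfl⟩
  zero_mem' := ⟨0, rfl⟩
  smul_mem' := by
    rintro c _ ⟨f, rfl⟩
    exact ⟨c • f, rfl⟩

/-- The Hochschild coboundary
`(δ f)(a₀, …, aₙ) = a₀ f(a₁, …, aₙ) + ∑ (-1)ⁱ⁺¹ f(…, aᵢ aᵢ₊₁, …) + (-1)ⁿ⁺¹ f(a₀, …, aₙ₋₁) aₙ`. -/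
def d (n : ℕ) : ((Fin n → A) → A) →ₗ[k] ((Fin (n + 1) → A) → A) where
  toFun f a := a 0 * f (fun i ↦ a i.succ) +
    ∑ j : Fin n, (-1 : ℤ) ^ (j.val + 1) • f (Fin.contractNth j.castSucc (· * ·) a) +
    (-1 : ℤ) ^ (n + 1) • (f (fun i ↦ a i.castSucc) * a (Fin.last n))
  map_add' f g := by
    funext a
    simp only [Pi.add_apply, mul_add, add_mul, smul_add, Finset.sum_add_distrib]
    abel
  map_smul' c f := by
    funext a
    simp only [Pi.smul_apply, RingHom.id_apply, smul_add, Finset.smul_sum,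
      smul_comm c, Algebra.mul_smul_comm, Algebra.smul_mul_assoc]

/-- The Hochschild cocycles. -/
def cocycles (n : ℕ) : Submodule k ((Fin n → A) → A) :=
  cochains k A n ⊓ LinearMap.ker (d k A n)

/-- The Hochschild coboundaries. -/
def coboundaries : (n : ℕ) → Submodule k ((Fin n → A) → A)
  | 0 => ⊥
  | n + 1 => (cochains k A n).map (d k A n)

/-- The cohomology of the Hochschild complex. -/
abbrev cohomology (n : ℕ) : Type u :=
  Subquotient (cocycles k A n) (coboundaries k A n)

variable {k A}

/-- The cup product `(f ∪ g)(a₁, …, a_{p+q}) = f(a₁, …, a_p) g(a_{p+1}, …, a_{p+q})`. -/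
def cup {p q : ℕ} (f : (Fin p → A) → A) (g : (Fin q → A) → A) : (Fin (p + q) → A) → A :=
  fun a ↦ f (fun i ↦ a (i.castAdd q)) * g (fun j ↦ a (j.natAdd p))

/-- A function of `m` variables as a function of `n = m` variables. -/
def reindex {m n : ℕ} (h : m = n) (f : (Fin m → A) → A) : (Fin n → A) → A :=
  fun a ↦ f (fun i ↦ a (i.cast h))

end Hochschild

/-! ### The Cartier complex and the cup product -/

namespace Cartier

open TensorAlgebra

variable (k C : Type u) [Field k] [AddCommGroup C] [Module k C] [Coalgebra k C]

/-- The cochains of degree `n`, i.e. the linear maps from `C` to `C^{⊗ n}`, where `C^{⊗ n}` is the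
homogeneous component of degree `n` of the tensor algebra. -/
def cochains (n : ℕ) : Submodule k (C →ₗ[k] TensorAlgebra k C) where
  carrier := {f | ∀ c, f c ∈ LinearMap.range (ι k (M := C)) ^ n}
  add_mem' hf hg c := add_mem (hf c) (hg c)
  zero_mem' _ := zero_mem _
  smul_mem' a _ hf c := Submodule.smul_mem _ a (hf c)

variable {k C}

/-- The cup product `c ↦ ∑ f(c₁) ⊗ g(c₂)`, where `Δ c = ∑ c₁ ⊗ c₂`. -/
def cup (f g : C →ₗ[k] TensorAlgebra k C) : C →ₗ[k] TensorAlgebra k C :=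
  LinearMap.mul' k (TensorAlgebra k C) ∘ₗ TensorProduct.map f g ∘ₗ Coalgebra.comul

lemma cup_add (f g h : C →ₗ[k] TensorAlgebra k C) : cup f (g + h) = cup f g + cup f h := by
  simp only [cup, TensorProduct.map_add_right, LinearMap.add_comp, LinearMap.comp_add]

lemma add_cup (f g h : C →ₗ[k] TensorAlgebra k C) : cup (f + g) h = cup f h + cup g h := by
  simp only [cup, TensorProduct.map_add_left, LinearMap.add_comp, LinearMap.comp_add]

lemma cup_smul (a : k) (f g : C →ₗ[k] TensorAlgebra k C) : cup f (a • g) = a • cup f g := by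
  simp only [cup, TensorProduct.map_smul_right, LinearMap.smul_comp, LinearMap.comp_smul]

lemma smul_cup (a : k) (f g : C →ₗ[k] TensorAlgebra k C) : cup (a • f) g = a • cup f g := by
  simp only [cup, TensorProduct.map_smul_left, LinearMap.smul_comp, LinearMap.comp_smul]

variable (k C)

/-- The comultiplication with values in the tensor algebra. -/
def comul : C →ₗ[k] TensorAlgebra k C := cup (ι k) (ι k)

/-- The algebra homomorphism from the tensor algebra to matrices that sends `x` to the matrix with
rows `((-1)^{|x|} x, D x)` and `(0, x)`, where `D` is the derivation below. -/
def matrixHom : TensorAlgebra k C →ₐ[k] Matrix (Fin 2) (Fin 2) (TensorAlgebra k C) :=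
  TensorAlgebra.lift k
    { toFun c := !![-ι k c, comul k C c; 0, ι k c]
      map_add' c c' := by
        ext i j
        fin_cases i <;> fin_cases j <;> simp [add_comm]
      map_smul' a c := by
        ext i j
        fin_cases i <;> fin_cases j <;> simp }

/-- The linear map with `D(xy) = D(x) y + (-1)^{|x|} x D(y)` and `D(c) = Δ(c)` for `c` in `C`.  On
`C^{⊗ n}` it is the alternating sum `∑ (-1)^{i-1} Δᵢ`, where `Δᵢ` is the comultiplication of the
`i`-th factor. -/
def der : TensorAlgebra k C →ₗ[k] TensorAlgebra k C :=
  Matrix.entryLinearMap k (TensorAlgebra k C) 0 1 ∘ₗ (matrixHom k C).toLinearMap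

lemma der_ι (c : C) : der k C (ι k c) = comul k C c := by
  simp [der, matrixHom]

lemma der_one : der k C 1 = 0 := by
  simp [der]

lemma matrixHom_apply (x : TensorAlgebra k C) : matrixHom k C x 1 0 = 0 ∧
    matrixHom k C x 1 1 = x := by
  induction x using TensorAlgebra.induction with
  | algebraMap r => simp [Matrix.algebraMap_matrix_apply]
  | ι c => simp [matrixHom]
  | mul x y hx hy => simp [Matrix.mul_apply, hx, hy]
  | add x y hx hy => simp [hx, hy]

lemma der_ι_mul (c : C) (x : TensorAlgebra k C) :
    der k C (ι k c * x) = comul k C c * x - ι k c * der k C x := by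
  have h : matrixHom k C (ι k c) = !![-ι k c, comul k C c; 0, ι k c] := by simp [matrixHom]
  simp only [der, LinearMap.comp_apply, AlgHom.toLinearMap_apply, map_mul, h,
    Matrix.entryLinearMap_apply, Matrix.mul_apply, Fin.sum_univ_two, (matrixHom_apply k C x).2]
  simp
  abel

/-- The coboundary of the Cartier complex, which sends `f` of degree `n` to
`c ↦ ∑ c₁ ⊗ f(c₂) + ∑ (-1)ⁱ Δᵢ(f(c)) + (-1)ⁿ⁺¹ ∑ f(c₁) ⊗ c₂`. -/
def d (n : ℕ) : (C →ₗ[k] TensorAlgebra k C) →ₗ[k] (C →ₗ[k] TensorAlgebra k C) where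
  toFun f := cup (ι k) f - der k C ∘ₗ f + (-1 : ℤ) ^ (n + 1) • cup f (ι k)
  map_add' f g := by
    simp only [cup_add, add_cup, LinearMap.comp_add, smul_add]
    abel
  map_smul' a f := by
    simp only [cup_smul, smul_cup, LinearMap.comp_smul, smul_add, smul_sub, RingHom.id_apply,
      smul_comm a]

/-- The cocycles of the Cartier complex. -/
def cocycles (n : ℕ) : Submodule k (C →ₗ[k] TensorAlgebra k C) :=
  cochains k C n ⊓ LinearMap.ker (d k C n)

/-- The coboundaries of the Cartier complex. -/
def coboundaries : ℕ → Submodule k (C →ₗ[k] TensorAlgebra k C)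
  | 0 => ⊥
  | n + 1 => (cochains k C n).map (d k C n)

/-- The Cartier cohomology. -/
abbrev cohomology (n : ℕ) : Type u :=
  Subquotient (cocycles k C n) (coboundaries k C n)

end Cartier

end

/-!
Both suspended monoidal structures come from the same construction. An object of an abelian
monoidal category is called tensor exact if tensoring with it on either side is exact. Over a flat
algebra every bimodule is functorially a quotient of a tensor exact one, a summand of the free
bimodule on its elements (`BimoduleCat.functorialResolution`); over a field every bicomodule embeds
functorially into a cofree one, which is tensor exact for the cotensor product
(`Bicomod.functorialCoresolution`). Resolving the terms of a bounded complex and taking the total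
complex resolves the complex by tensor exact objects, and tensoring with a complex of tensor exact
objects preserves quasi-isomorphisms between bounded complexes; both facts follow from
`HomologicalComplex₂.quasiIso_total_map`, for bicomplexes with finitely many nonzero terms in each
total degree. The bounded derived category is therefore the localization of the category of
bounded complexes of tensor exact objects (`FunctorialResolution.isLocalization`,
`FunctorialCoresolution.isLocalization`), and a localization at a class of morphisms that is stable
under tensor products inherits the tensor product, its constraints and the isomorphisms
`X ⊗ Y[n] ≅ (X ⊗ Y)[n]` and `X[n] ⊗ Y ≅ (X ⊗ Y)[n]` (`TensorShift.localization`). The comparison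
with the tensor product of arbitrary complexes is defined by resolving both factors, and its
universal property as a derived functor is formal (`MonoidalOn.isRightKanExtension_lax`,
`MonoidalOn.isLeftKanExtension_oplax`).

Graded commutativity of the self-extensions of the unit is an Eckmann-Hilton argument: for
`f : 𝟙 ⟶ 𝟙[p]` and `g : 𝟙 ⟶ 𝟙[q]`, both products are obtained from `f ⊗ g` by moving the two
shifts out of the tensor product, and the two orders of doing so differ by the sign `(-1)^{pq}`
(`TensorShift.comp_shift_eq`).

The comparison with Hochschild cohomology uses the bar resolution, whose terms are projective
bimodules if the algebra is projective: morphisms from `A^{⊗ (n + 2)}` to `A` are multilinear maps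
in `n` variables, and composition with the bar differential is the Hochschild differential. A
cocycle `f` lifts to an endomorphism of the bar resolution by applying it to the last factors
(`barShift`), which exhibits the Yoneda product of `f` and `g` as `(-1)^{pq}` times the cup product
of `g` and `f`. By graded commutativity this is the product of the classes of the cocycles in the
other order, so that the Yoneda product is the cup product (`hochschildExt_cup`).

Dually, the cobar resolution consists of injective bicomodules, and morphisms from `C` to
`C^{⊗ (n + 2)}` are linear maps from `C` to `C^{⊗ n}`, the tensor power being regarded as
a submodule of the tensor algebra. Lifting the second factor (`cobarShift`) exhibits the Yoneda
product as `(-1)^{pq}` times the cup product in the same order. The sign is removed by rescaling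
the isomorphism in degree `n` by `(-1)^{n (n - 1) / 2}` (`cartierExt_cup`).
-/

/-! ### Localization of full subcategories -/

namespace CategoryTheory.Localization

section

variable {C₀ C D₀ D : Type*} [Category C₀] [Category C] [Category D₀] [Category D]
  {j : C₀ ⥤ C} [j.Full] [j.Faithful] {L : C ⥤ D} {W : MorphismProperty C} [L.IsLocalization W]
  {κ : D₀ ⥤ D} [κ.Full] [κ.Faithful] {L₀ : C₀ ⥤ D₀} [L₀.EssSurj]

/-- Let `C₀` be a full subcategory of `C` with functorial approximations `θ : j (τ X) ⟶ X` that
preserve `W`.  If for any two objects of `C₀` one of the approximations `θ n` is in `W` for both,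
then the restriction of a localization functor of `C` to `C₀` is a localization functor onto the
full subcategory `D₀`.  A family of approximations is needed for bounded complexes, as the
truncation that is a quasi-isomorphism depends on the complex. -/
lemma isLocalization_of_approximations (e : L₀ ⋙ κ ≅ j ⋙ L)
    {ι : Type*} (τ : ι → C ⥤ C₀) (θ : ∀ n, τ n ⋙ j ⟶ 𝟭 C)
    (hτ : ∀ n ⦃X Y : C⦄ (f : X ⟶ Y), W f → W (j.map ((τ n).map f)))
    (hθ : ∀ X Y : C₀, ∃ n, W ((θ n).app (j.obj X)) ∧ W ((θ n).app (j.obj Y))) :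
    L₀.IsLocalization (W.inverseImage j) := by
  set W₀ := W.inverseImage j with hW₀
  have hL : W.IsInvertedBy L := Localization.inverts L W
  have h₀ : W₀.IsInvertedBy L₀ := by
    intro X Y f hf
    have : IsIso (κ.map (L₀.map f)) := by
      have := hL _ hf
      have h := e.hom.naturality f
      dsimp at h
      have h' : κ.map (L₀.map f) = e.hom.app X ≫ L.map (j.map f) ≫ e.inv.app Y := by
        rw [← Category.assoc, ← h]; simp
      rw [h']
      infer_instance
    exact isIso_of_reflects_iso _ κ
  let ℓ : C₀ ⥤ W₀.Localization := W₀.Q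
  let G : W₀.Localization ⥤ D₀ := Localization.lift L₀ h₀ ℓ
  let eG : ℓ ⋙ G ≅ L₀ := Localization.fac L₀ h₀ ℓ
  have hT : ∀ n, W.IsInvertedBy (τ n ⋙ ℓ) := fun n X Y f hf ↦
    Localization.inverts ℓ W₀ _ (hτ n f hf)
  let T : ι → D ⥤ W₀.Localization := fun n ↦ Localization.lift (τ n ⋙ ℓ) (hT n) L
  let eT : ∀ n, L ⋙ T n ≅ τ n ⋙ ℓ := fun n ↦ Localization.fac _ (hT n) L
  -- the comparison `G ⋙ κ ⋙ T n ⟶ 𝟭` induced by `θ n`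
  let a : ∀ n (X : C₀), (τ n).obj (j.obj X) ⟶ X := fun n X ↦ j.preimage ((θ n).app (j.obj X))
  have a_nat : ∀ n {X Y : C₀} (f : X ⟶ Y), (τ n).map (j.map f) ≫ a n Y = a n X ≫ f := by
    intro n X Y f
    apply j.map_injective
    simpa [a] using (θ n).naturality (j.map f)
  let u : ∀ n (X : C₀), (T n).obj (κ.obj (G.obj (ℓ.obj X))) ≅ ℓ.obj ((τ n).obj (j.obj X)) :=
    fun n X ↦ (T n).mapIso (κ.mapIso (eG.app X) ≪≫ e.app X) ≪≫ (eT n).app (j.obj X)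
  let v : ∀ n (X : C), κ.obj (G.obj ((T n).obj (L.obj X))) ≅ L.obj (j.obj ((τ n).obj X)) :=
    fun n X ↦ κ.mapIso (G.mapIso ((eT n).app X) ≪≫ eG.app _) ≪≫ e.app _
  let α : ∀ n, ℓ ⋙ (G ⋙ κ ⋙ T n) ⟶ ℓ ⋙ 𝟭 _ := fun n ↦
    { app X := (u n X).hom ≫ ℓ.map (a n X)
      naturality X Y f := by
        have h1 := eG.hom.naturality f
        have h2 := e.hom.naturality f
        have h3 := (eT n).hom.naturality (j.map f)
        dsimp at h1 h2 h3
        have h4 := congr_arg ℓ.map (a_nat n f)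
        rw [ℓ.map_comp, ℓ.map_comp] at h4
        simp only [u, Functor.comp_map, Functor.id_map, Iso.trans_hom, Functor.mapIso_hom,
          Iso.app_hom, Category.assoc]
        rw [← h4, ← reassoc_of% h3]
        simp only [← Functor.map_comp_assoc, Category.assoc, ← h2]
        rw [h1] }
  let β : ∀ n, L ⋙ (T n ⋙ G ⋙ κ) ⟶ L ⋙ 𝟭 _ := fun n ↦
    { app X := (v n X).hom ≫ L.map ((θ n).app X)
      naturality X Y f := by
        have h1 := (eT n).hom.naturality f
        have h2 := eG.hom.naturality ((τ n).map f)
        have h3 := e.hom.naturality ((τ n).map f)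
        have h4 := (θ n).naturality f
        dsimp at h1 h2 h3 h4
        simp only [v, Functor.comp_map, Functor.id_map, Iso.trans_hom, Functor.mapIso_hom,
          Iso.app_hom, Category.assoc, ← L.map_comp, ← h4]
        rw [L.map_comp, ← reassoc_of% h3]
        simp only [← Functor.map_comp_assoc, Category.assoc, ← h2]
        rw [h1] }
  let α' : ∀ n, G ⋙ κ ⋙ T n ⟶ 𝟭 _ := fun n ↦
    (fullyFaithfulWhiskeringLeft ℓ W₀ _).preimage (α n)
  have hα' : ∀ n X, (α' n).app (ℓ.obj X) = (u n X).hom ≫ ℓ.map (a n X) := fun n X ↦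
    NatTrans.congr_app ((fullyFaithfulWhiskeringLeft ℓ W₀ _).map_preimage (α n)) X
  let β' : ∀ n, T n ⋙ G ⋙ κ ⟶ 𝟭 _ := fun n ↦
    (fullyFaithfulWhiskeringLeft L W _).preimage (β n)
  have hβ' : ∀ n X, (β' n).app (L.obj X) = (v n X).hom ≫ L.map ((θ n).app X) := fun n X ↦
    NatTrans.congr_app ((fullyFaithfulWhiskeringLeft L W _).map_preimage (β n)) X
  have hiso : ∀ n X, W ((θ n).app (j.obj X)) → IsIso ((α' n).app (ℓ.obj X)) := by
    intro n X h
    have : IsIso (ℓ.map (a n X)) := Localization.inverts ℓ W₀ _ (by simpa [W₀, a] using h)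
    rw [hα']
    infer_instance
  have hαβ : ∀ n X, κ.map (G.map ((α' n).app (ℓ.obj X))) =
      (β' n).app (κ.obj (G.obj (ℓ.obj X))) := by
    intro n X
    have h1 := (β' n).naturality (κ.map (eG.hom.app X) ≫ e.hom.app X)
    have h2 := eG.hom.naturality (a n X)
    have h3 := e.hom.naturality (a n X)
    dsimp at h1 h2 h3
    rw [hβ'] at h1
    rw [← cancel_mono (κ.map (eG.hom.app X) ≫ e.hom.app X), ← h1, hα', G.map_comp, κ.map_comp,
      Category.assoc, ← κ.map_comp_assoc (G.map (ℓ.map (a n X))), h2, κ.map_comp,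
      Category.assoc, h3]
    simp [u, v, a]
  have hℓ : ∀ Z : W₀.Localization, ∃ X, ℓ.obj X = Z :=
    (Construction.objEquiv W₀).surjective
  have : G.Faithful := ⟨by
    intro X Y f g h
    obtain ⟨X, rfl⟩ := hℓ X
    obtain ⟨Y, rfl⟩ := hℓ Y
    obtain ⟨n, hn, -⟩ := hθ X Y
    have := hiso n X hn
    rw [← cancel_epi ((α' n).app (ℓ.obj X))]
    have h1 := (α' n).naturality f
    have h2 := (α' n).naturality g
    dsimp at h1 h2
    rw [← h1, ← h2, h]⟩
  have : G.Full := ⟨by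
    intro X Y c
    obtain ⟨X, rfl⟩ := hℓ X
    obtain ⟨Y, rfl⟩ := hℓ Y
    obtain ⟨n, hn, hn'⟩ := hθ X Y
    have := hiso n X hn
    have := hiso n Y hn'
    refine ⟨inv ((α' n).app (ℓ.obj X)) ≫ (T n).map (κ.map c) ≫ (α' n).app (ℓ.obj Y),
      κ.map_injective ?_⟩
    have h := (β' n).naturality (κ.map c)
    dsimp at h
    rw [G.map_comp, G.map_comp, κ.map_comp, κ.map_comp, hαβ, h, ← hαβ, ← κ.map_comp_assoc,
      ← G.map_comp, IsIso.inv_hom_id]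
    simp⟩
  have : G.EssSurj := ⟨fun Y ↦ ⟨ℓ.obj (L₀.objPreimage Y),
    ⟨eG.app _ ≪≫ L₀.objObjPreimageIso Y⟩⟩⟩
  have : G.IsEquivalence := { }
  exact Functor.IsLocalization.of_iso W₀ eG

/-- The dual of `isLocalization_of_approximations`. -/
lemma isLocalization_of_coapproximations (e : L₀ ⋙ κ ≅ j ⋙ L)
    {ι : Type*} (τ : ι → C ⥤ C₀) (θ : ∀ n, 𝟭 C ⟶ τ n ⋙ j)
    (hτ : ∀ n ⦃X Y : C⦄ (f : X ⟶ Y), W f → W (j.map ((τ n).map f)))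
    (hθ : ∀ X Y : C₀, ∃ n, W ((θ n).app (j.obj X)) ∧ W ((θ n).app (j.obj Y))) :
    L₀.IsLocalization (W.inverseImage j) := by
  rw [← Functor.IsLocalization.op_iff]
  exact isLocalization_of_approximations (j := j.op) (L := L.op) (W := W.op) (κ := κ.op)
    (L₀ := L₀.op) (NatIso.op e).symm (fun n ↦ (τ n).op) (fun n ↦ NatTrans.op (θ n))
    (fun n X Y f hf ↦ hτ n f.unop hf) (fun X Y ↦ hθ X.unop Y.unop)
end

end CategoryTheory.Localization

/-! ### Quasi-isomorphisms of bicomplexes -/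

namespace CochainComplex

variable {B : Type*} [Category B] [Abelian B]

/-- A morphism of complexes is a quasi-isomorphism if and only if every (generalized) cocycle of
its mapping cone is, after an epimorphic base change, a coboundary. -/
lemma quasiIso_iff_refinements {K L : CochainComplex B ℤ} (f : K ⟶ L) :
    QuasiIso f ↔ ∀ (m n p : ℤ) (_ : m + 1 = n) (_ : n + 1 = p) ⦃A : B⦄ (x : A ⟶ K.X p)
      (y : A ⟶ L.X n), x ≫ K.d p (p + 1) = 0 → x ≫ f.f p = y ≫ L.d n p →
        ∃ (A' : B) (π : A' ⟶ A) (_ : Epi π) (z : A' ⟶ K.X n) (t : A' ⟶ L.X m),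
          π ≫ x = z ≫ K.d n p ∧ π ≫ y = z ≫ f.f n + t ≫ L.d m n := by
  constructor
  · intro hf m n p hmn hnp A x y hx hxy
    have h1 := (HomologicalComplex.mono_homologyMap_iff_up_to_refinements f n p (p + 1)
      (by simp; lia) (by simp)).1 inferInstance
    have h2 := (HomologicalComplex.epi_homologyMap_iff_up_to_refinements f m n p
      (by simp; lia) (by simp; lia)).1 inferInstance
    obtain ⟨A₁, π₁, _, z₀, hz₀⟩ := h1 x hx y hxy
    obtain ⟨A₂, π₂, _, z₁, hz₁, t, ht⟩ := h2 (π₁ ≫ y - z₀ ≫ f.f n) (by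
      simp [Preadditive.sub_comp, ← hxy, reassoc_of% hz₀])
    refine ⟨A₂, π₂ ≫ π₁, epi_comp _ _, π₂ ≫ z₀ + z₁, t, ?_, ?_⟩
    · simp [hz₀, hz₁]
    · rw [Preadditive.comp_sub, sub_eq_iff_eq_add] at ht
      rw [Category.assoc, ht]
      simp only [Preadditive.add_comp, Category.assoc]
      abel
  · intro h
    rw [quasiIso_iff]
    intro n
    rw [quasiIsoAt_iff_isIso_homologyMap]
    have : Mono (HomologicalComplex.homologyMap f n) := by
      rw [HomologicalComplex.mono_homologyMap_iff_up_to_refinements f (n - 1) n (n + 1)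
        (by simp) (by simp)]
      intro A x hx y hxy
      obtain ⟨A', π, hπ, z, t, h1, -⟩ := h (n - 2) (n - 1) n (by lia) (by lia) x y hx hxy
      exact ⟨A', π, hπ, z, h1⟩
    have : Epi (HomologicalComplex.homologyMap f n) := by
      rw [HomologicalComplex.epi_homologyMap_iff_up_to_refinements f (n - 1) n (n + 1)
        (by simp) (by simp)]
      intro A y hy
      obtain ⟨A', π, hπ, z, t, h1, h2⟩ := h (n - 1) n (n + 1) (by lia) (by lia)
        (0 : A ⟶ _) y (by simp) (by simp [hy])
      exact ⟨A', π, hπ, z, by simp [← h1], t, h2⟩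
    exact isIso_of_mono_of_epi _

end CochainComplex

namespace HomologicalComplex₂

open ComplexShape

variable {B : Type*} [Category B] [Abelian B] [HasCoproducts.{0} B]

instance (M : HomologicalComplex₂ B (up ℤ) (up ℤ)) : M.HasTotal (up ℤ) := by
  intro n
  infer_instance

/-- The projection of the total complex onto a summand. -/
noncomputable def totalProj (M : HomologicalComplex₂ B (up ℤ) (up ℤ)) (i j n : ℤ)
    (h : i + j = n) : (M.total (up ℤ)).X n ⟶ (M.X i).X j :=
  M.totalDesc fun i' j' h' ↦
    if hi : i' = i then eqToHom (by
      have hj : j' = j := by dsimp at h'; lia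
      rw [hi, hj]) else 0

variable (M M' : HomologicalComplex₂ B (up ℤ) (up ℤ))

@[simp]
lemma ιTotal_totalProj (i j n : ℤ) (h : i + j = n) :
    M.ιTotal (up ℤ) i j n h ≫ M.totalProj i j n h = 𝟙 _ := by
  simp [totalProj]

@[simp]
lemma ιTotal_totalProj_assoc (i j n : ℤ) (h : i + j = n) {Z : B} (f : (M.X i).X j ⟶ Z) :
    M.ιTotal (up ℤ) i j n h ≫ M.totalProj i j n h ≫ f = f := by
  rw [← Category.assoc, ιTotal_totalProj, Category.id_comp]

lemma ιTotal_totalProj_of_ne (i j i' j' n : ℤ) (h : i + j = n) (h' : i' + j' = n) (hi : i ≠ i') :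
    M.ιTotal (up ℤ) i j n h ≫ M.totalProj i' j' n h' = 0 := by
  simp [totalProj, hi]

/-- The total complex is in each degree a finite direct sum if all but finitely many of its summands
vanish. -/
lemma id_total_eq_sum {n lo hi : ℤ}
    (hM : ∀ i j, i + j = n → i < lo ∨ hi < i → IsZero ((M.X i).X j)) :
    ∑ i ∈ Finset.Icc lo hi, M.totalProj i (n - i) n (by lia) ≫
      M.ιTotal (up ℤ) i (n - i) n (by simp) = 𝟙 ((M.total (up ℤ)).X n) := by
  refine total.hom_ext (up ℤ) fun i j hij ↦ ?_
  obtain rfl : j = n - i := by dsimp at hij; lia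
  by_cases hi' : i ∈ Finset.Icc lo hi
  · rw [Preadditive.comp_sum, Finset.sum_eq_single_of_mem i hi']
    · simp
    · intro b _ hb
      rw [← Category.assoc, ιTotal_totalProj_of_ne _ _ _ _ _ _ _ _ hb.symm, zero_comp]
  · exact (hM i _ (by lia) (by simp at hi'; lia)).eq_of_src _ _

lemma hom_total_ext {A : B} {n lo hi : ℤ}
    (hM : ∀ i j, i + j = n → i < lo ∨ hi < i → IsZero ((M.X i).X j))
    {x : A ⟶ (M.total (up ℤ)).X n}
    (hx : ∀ i j (h : i + j = n), lo ≤ i → i ≤ hi → x ≫ M.totalProj i j n h = 0) : x = 0 := by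
  rw [← Category.comp_id x, ← M.id_total_eq_sum hM, Preadditive.comp_sum]
  refine Finset.sum_eq_zero fun i hi' ↦ ?_
  rw [← Category.assoc, hx i _ _ (Finset.mem_Icc.1 hi').1 (Finset.mem_Icc.1 hi').2, zero_comp]

/-- The differential of the total complex, in terms of components. -/
lemma total_d_totalProj (i₀ i j j' n n' : ℤ) (h : i + j = n) (h' : i + j' = n') (h₀ : i₀ + j' = n)
    (hn : n + 1 = n') :
    (M.total (up ℤ)).d n n' ≫ M.totalProj i j' n' h' =
      M.totalProj i₀ j' n h₀ ≫ (M.d i₀ i).f j' +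
      i.negOnePow • M.totalProj i j n h ≫ (M.X i).d j j' := by
  refine total.hom_ext (up ℤ) fun a b hab ↦ ?_
  change a + b = n at hab
  have h1 : M.ιTotal (up ℤ) a b n hab ≫ (M.total (up ℤ)).d n n' =
      M.d₁ (up ℤ) a b n' + M.d₂ (up ℤ) a b n' := by
    simp [total]
  rw [reassoc_of% h1, M.d₁_eq (up ℤ) (i₁' := a + 1) (by simp) b n' (by dsimp; lia),
    M.d₂_eq (up ℤ) a (i₂' := b + 1) (by simp) n' (by dsimp; lia)]
  have e1 : ε₁ (up ℤ) (up ℤ) (up ℤ) (a, b) = 1 := rfl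
  have e2 : ε₂ (up ℤ) (up ℤ) (up ℤ) (a, b) = a.negOnePow := rfl
  rw [e1, e2, one_smul]
  simp only [Preadditive.add_comp, Preadditive.comp_add, Category.assoc, Linear.units_smul_comp,
    Linear.comp_units_smul]
  congr 1
  · by_cases ha : a = i₀
    · obtain rfl : i₀ + 1 = i := by lia
      obtain rfl : b = j' := by lia
      subst ha
      simp
    · rw [ιTotal_totalProj_of_ne _ _ _ _ _ _ _ _ (by lia), comp_zero, ← Category.assoc,
        ιTotal_totalProj_of_ne _ _ _ _ _ _ _ _ (by lia), zero_comp]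
  · by_cases ha : a = i
    · obtain rfl : j + 1 = j' := by lia
      subst ha
      obtain rfl : b = j := by lia
      simp
    · rw [ιTotal_totalProj_of_ne _ _ _ _ _ _ _ _ (by lia), comp_zero, ← Category.assoc,
        ιTotal_totalProj_of_ne _ _ _ _ _ _ _ _ (by lia), zero_comp, smul_zero, smul_zero]

lemma total_map_totalProj {M M' : HomologicalComplex₂ B (up ℤ) (up ℤ)} (φ : M ⟶ M') (i j n : ℤ)
    (h : i + j = n) : (total.map φ (up ℤ)).f n ≫ M'.totalProj i j n h =
      M.totalProj i j n h ≫ (φ.f i).f j := by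
  refine total.hom_ext (up ℤ) fun a b hab ↦ ?_
  change a + b = n at hab
  rw [ιTotal_map_assoc]
  by_cases ha : a = i
  · subst ha
    obtain rfl : b = j := by lia
    simp
  · rw [ιTotal_totalProj_of_ne _ _ _ _ _ _ _ _ ha, comp_zero, ← Category.assoc,
        ιTotal_totalProj_of_ne _ _ _ _ _ _ _ _ ha, zero_comp]

/-- The support of `M` meets every antidiagonal in a finite set. -/
def IsLocallyFinite : Prop :=
  ∀ n : ℤ, ∃ lo hi : ℤ, ∀ i j, i + j = n → i < lo ∨ hi < i → IsZero ((M.X i).X j)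

variable {M M'}

/-- The induction is on the number `hi + 1 - a` of columns in which the cocycle `(x, y)` of the
mapping cone of the total complexes may be nonzero: the component in the lowest column `a` is a
cocycle of the mapping cone of that column, and is removed by subtracting a coboundary. -/
lemma quasiIso_total_aux (φ : M ⟶ M') (hφ : ∀ i, QuasiIso (φ.f i)) {m n p lo hi : ℤ}
    (hmn : m + 1 = n) (hnp : n + 1 = p)
    (hM : ∀ i j, i + j = p → i < lo ∨ hi < i → IsZero ((M.X i).X j))
    (hM' : ∀ i j, i + j = n → i < lo ∨ hi < i → IsZero ((M'.X i).X j)) (r : ℕ) :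
    ∀ (a : ℤ) (_ : hi < a + r) ⦃A : B⦄ (x : A ⟶ (M.total (up ℤ)).X p)
      (y : A ⟶ (M'.total (up ℤ)).X n) (_ : x ≫ (M.total (up ℤ)).d p (p + 1) = 0)
      (_ : x ≫ (total.map φ (up ℤ)).f p = y ≫ (M'.total (up ℤ)).d n p)
      (_ : ∀ i j (h : i + j = p), i < a → x ≫ M.totalProj i j p h = 0)
      (_ : ∀ i j (h : i + j = n), i < a → y ≫ M'.totalProj i j n h = 0),
      ∃ (A' : B) (π : A' ⟶ A) (_ : Epi π) (z : A' ⟶ (M.total (up ℤ)).X n)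
        (t : A' ⟶ (M'.total (up ℤ)).X m), π ≫ x = z ≫ (M.total (up ℤ)).d n p ∧
          π ≫ y = z ≫ (total.map φ (up ℤ)).f n + t ≫ (M'.total (up ℤ)).d m n := by
  induction r with
  | zero =>
    intro a ha A x y _ _ hxa hya
    refine ⟨A, 𝟙 A, inferInstance, 0, 0, ?_, ?_⟩
    · rw [hom_total_ext M hM (x := x) fun i j h _ hi ↦ hxa i j h (by simp at ha; lia)]
      simp
    · rw [hom_total_ext M' hM' (x := y) fun i j h _ hi ↦ hya i j h (by simp at ha; lia)]
      simp
  | succ r ih =>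
    intro a ha A x y hx hxy hxa hya
    have hcol := (CochainComplex.quasiIso_iff_refinements (φ.f a)).1 (hφ a) (m - a) (n - a) (p - a)
      (by lia) (by lia) (x ≫ M.totalProj a (p - a) p (by lia))
      (a.negOnePow • (y ≫ M'.totalProj a (n - a) n (by lia)))
      (by
        have h := congr_arg (· ≫ M.totalProj a (p - a + 1) (p + 1) (by lia)) hx
        rw [Category.assoc, M.total_d_totalProj (a - 1) a (p - a) (p - a + 1) p (p + 1) (by lia)
          (by lia) (by lia) rfl, Preadditive.comp_add, ← Category.assoc, hxa _ _ _ (by lia),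
          zero_comp, zero_add, zero_comp, Linear.comp_units_smul, smul_eq_zero_iff_eq] at h
        rw [Category.assoc, h])
      (by
        have h := congr_arg (· ≫ M'.totalProj a (p - a) p (by lia)) hxy
        rw [Category.assoc, Category.assoc, total_map_totalProj,
          M'.total_d_totalProj (a - 1) a (n - a) (p - a) n p (by lia)
          (by lia) (by lia) hnp, Preadditive.comp_add, ← Category.assoc y, hya _ _ _ (by lia),
          zero_comp, zero_add, Linear.comp_units_smul] at h
        rw [Category.assoc, h, Linear.units_smul_comp, Category.assoc])
    obtain ⟨A₁, π₁, _, z, t, h1, h2⟩ := hcol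
    -- `(z', t')` is a cochain in column `a` whose coboundary agrees with `(x, y)` in that column
    set z' := a.negOnePow • (z ≫ M.ιTotal (up ℤ) a (n - a) n (by simp)) with hz'
    set t' := t ≫ M'.ιTotal (up ℤ) a (m - a) m (by simp) with ht'
    have hz0 : ∀ i j (h : i + j = n), i ≠ a → z' ≫ M.totalProj i j n h = 0 := by
      intro i j h hi
      rw [hz', Linear.units_smul_comp, Category.assoc,
        ιTotal_totalProj_of_ne _ _ _ _ _ _ _ _ hi.symm, comp_zero, smul_zero]
    have hza : z' ≫ M.totalProj a (n - a) n (by lia) = a.negOnePow • z := by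
      rw [hz', Linear.units_smul_comp, Category.assoc, ιTotal_totalProj, Category.comp_id]
    have ht0 : ∀ i j (h : i + j = m), i ≠ a → t' ≫ M'.totalProj i j m h = 0 := by
      intro i j h hi
      rw [ht', Category.assoc, ιTotal_totalProj_of_ne _ _ _ _ _ _ _ _ hi.symm, comp_zero]
    have hta : t' ≫ M'.totalProj a (m - a) m (by lia) = t := by
      rw [ht', Category.assoc, ιTotal_totalProj, Category.comp_id]
    obtain ⟨A₂, π₂, _, z₂, t₂, h3, h4⟩ := ih (a + 1) (by push_cast at ha; lia)
      (π₁ ≫ x - z' ≫ (M.total (up ℤ)).d n p)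
      (π₁ ≫ y - z' ≫ (total.map φ (up ℤ)).f n - t' ≫ (M'.total (up ℤ)).d m n)
      (by simp [Preadditive.sub_comp, hx])
      (by simp [Preadditive.sub_comp, hxy])
      (by
        intro i j h hi
        rw [Preadditive.sub_comp, Category.assoc, Category.assoc,
          M.total_d_totalProj (i - 1) i (n - i) j n p (by lia) h (by lia) hnp,
          Preadditive.comp_add, ← Category.assoc z', hz0 (i - 1) _ _ (by lia), zero_comp, zero_add,
          Linear.comp_units_smul, ← Category.assoc z']
        obtain hi | rfl : i < a ∨ i = a := by lia
        · rw [hz0 i _ _ (by lia), hxa i _ _ hi]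
          simp
        · obtain rfl : j = p - i := by lia
          rw [hza, h1, Linear.units_smul_comp, smul_smul]
          simp)
      (by
        intro i j h hi
        rw [Preadditive.sub_comp, Preadditive.sub_comp, Category.assoc, Category.assoc,
          Category.assoc, total_map_totalProj,
          M'.total_d_totalProj (i - 1) i (m - i) j m n (by lia) h (by lia) hmn,
          Preadditive.comp_add, ← Category.assoc t', ht0 (i - 1) _ _ (by lia), zero_comp, zero_add,
          Linear.comp_units_smul, ← Category.assoc t', ← Category.assoc z']
        obtain hi | rfl : i < a ∨ i = a := by lia
        · rw [hz0 i _ _ (by lia), ht0 i _ _ (by lia), hya i _ _ hi]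
          simp
        · obtain rfl : j = n - i := by lia
          rw [Linear.comp_units_smul] at h2
          rw [hza, hta, Linear.units_smul_comp, sub_sub, ← smul_add, ← h2, smul_smul]
          simp)
    refine ⟨A₂, π₂ ≫ π₁, epi_comp _ _, π₂ ≫ z' + z₂, π₂ ≫ t' + t₂, ?_, ?_⟩
    · simp only [Preadditive.comp_sub, sub_eq_iff_eq_add] at h3
      simp only [Category.assoc, h3, Preadditive.add_comp]
      abel
    · simp only [Preadditive.comp_sub, sub_eq_iff_eq_add] at h4
      simp only [Category.assoc, h4, Preadditive.add_comp]
      abel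

/-- A morphism of locally finite bicomplexes which is a quasi-isomorphism on columns induces a
quasi-isomorphism on total complexes. -/
lemma quasiIso_total_map (φ : M ⟶ M') (hM : M.IsLocallyFinite) (hM' : M'.IsLocallyFinite)
    (hφ : ∀ i, QuasiIso (φ.f i)) : QuasiIso (total.map φ (up ℤ)) := by
  rw [CochainComplex.quasiIso_iff_refinements]
  intro m n p hmn hnp A x y hx hxy
  obtain ⟨lo, hi, h⟩ := hM p
  obtain ⟨lo', hi', h'⟩ := hM' n
  refine quasiIso_total_aux φ hφ hmn hnp (lo := min lo lo') (hi := max hi hi')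
    (fun i j hij H ↦ h i j hij (by simp at H; lia)) (fun i j hij H ↦ h' i j hij (by simp at H; lia))
    (max hi hi' + 1 - min lo lo').toNat (min lo lo') (by simp; lia) x y hx hxy ?_ ?_
  · exact fun i j hij hi ↦ (h i j hij (by simp at hi; lia)).eq_of_tgt _ _
  · exact fun i j hij hi ↦ (h' i j hij (by simp at hi; lia)).eq_of_tgt _ _

end HomologicalComplex₂

/-! ### Tensor exact objects exact for the tensor product -/

namespace CategoryTheory

variable {B : Type*} [Category B] [Abelian B]

/-- If the identity of `X` is a finite sum of morphisms `X ⟶ X s ⟶ X`, and the functors `F' s`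
are exact, then `F` is exact if there are natural transformations `F ⟶ F' s ⟶ F` whose composites
sum up to the identity. -/
lemma exact_map_of_sum_eq_id (F : B ⥤ B) [F.PreservesZeroMorphisms] {ι : Type*} (J : Finset ι)
    (F' : ι → (B ⥤ B)) [∀ s, (F' s).PreservesZeroMorphisms] (p : ∀ s, F ⟶ F' s) (q : ∀ s, F' s ⟶ F)
    (h : ∀ X, ∑ s ∈ J, (p s).app X ≫ (q s).app X = 𝟙 (F.obj X)) (S : ShortComplex B)
    (hS : ∀ s ∈ J, (S.map (F' s)).Exact) : (S.map F).Exact := by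
  rw [ShortComplex.exact_iff_isZero_homology, IsZero.iff_id_eq_zero]
  have h1 : 𝟙 (S.map F) = ∑ s ∈ J, S.mapNatTrans (p s) ≫ S.mapNatTrans (q s) := by
    have hs : ∀ (T : Finset ι) (f : ι → (S.map F ⟶ S.map F)),
        (∑ s ∈ T, f s).τ₁ = ∑ s ∈ T, (f s).τ₁ ∧ (∑ s ∈ T, f s).τ₂ = ∑ s ∈ T, (f s).τ₂ ∧
          (∑ s ∈ T, f s).τ₃ = ∑ s ∈ T, (f s).τ₃ := by
      intro T f
      classical
      induction T using Finset.induction_on with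
      | empty => simp
      | insert a T ha ih => simp [Finset.sum_insert ha, ih]
    ext
    · rw [(hs _ _).1]; exact (h _).symm
    · rw [(hs _ _).2.1]; exact (h _).symm
    · rw [(hs _ _).2.2]; exact (h _).symm
  have h2 : ∀ (T : Finset ι) (f : ι → (S.map F ⟶ S.map F)),
      ShortComplex.homologyMap (∑ s ∈ T, f s) = ∑ s ∈ T, ShortComplex.homologyMap (f s) := by
    intro T f
    classical
    induction T using Finset.induction_on with
    | empty => simp
    | insert a T ha ih => simp [Finset.sum_insert ha, ih, ShortComplex.homologyMap_add]
  rw [← ShortComplex.homologyMap_id, h1, h2]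
  refine Finset.sum_eq_zero fun s hs ↦ ?_
  rw [ShortComplex.homologyMap_comp,
    ((ShortComplex.exact_iff_isZero_homology _).1 (hS s hs)).eq_of_tgt
      (ShortComplex.homologyMap (S.mapNatTrans (p s))) 0, zero_comp]

variable [MonoidalCategory B] [MonoidalPreadditive B]

/-- The objects `X` such that the functors `X ⊗ -` and `- ⊗ X` are exact. -/
def TensorExact : ObjectProperty B := fun X ↦ ∀ S : ShortComplex B, S.Exact →
  (S.map (tensorLeft X)).Exact ∧ (S.map (tensorRight X)).Exact

namespace TensorExact

lemma unit : TensorExact (𝟙_ B) := fun S hS ↦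
  ⟨(ShortComplex.exact_iff_of_iso (S.mapNatIso (leftUnitorNatIso B))).2 hS,
    (ShortComplex.exact_iff_of_iso (S.mapNatIso (rightUnitorNatIso B))).2 hS⟩

lemma tensor {X Y : B} (hX : TensorExact X) (hY : TensorExact Y) : TensorExact (X ⊗ Y) := by
  intro S hS
  constructor
  · exact (ShortComplex.exact_iff_of_iso (S.mapNatIso (tensorLeftTensor X Y))).2
      (hX _ (hY _ hS).1).1
  · exact (ShortComplex.exact_iff_of_iso (S.mapNatIso (tensorRightTensor X Y))).2
      (hY _ (hX _ hS).2).2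

/-- A retract of a finite direct sum of tensor exact objects is tensor exact. -/
lemma of_sum_eq_id {X : B} {ι : Type*} (J : Finset ι) (Y : ι → B) (p : ∀ s, X ⟶ Y s)
    (q : ∀ s, Y s ⟶ X) (h : ∑ s ∈ J, p s ≫ q s = 𝟙 X) (hY : ∀ s ∈ J, TensorExact (Y s)) :
    TensorExact X := by
  intro S hS
  refine ⟨exact_map_of_sum_eq_id _ J (fun s ↦ tensorLeft (Y s))
    (fun s ↦ (curriedTensor B).map (p s)) (fun s ↦ (curriedTensor B).map (q s)) ?_ S
    (fun s hs ↦ (hY s hs S hS).1), exact_map_of_sum_eq_id _ J (fun s ↦ tensorRight (Y s))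
    (fun s ↦ (curriedTensor B).flip.map (p s)) (fun s ↦ (curriedTensor B).flip.map (q s)) ?_ S
    (fun s hs ↦ (hY s hs S hS).2)⟩
  · intro Z
    dsimp
    simp only [← comp_whiskerRight]
    rw [← sum_whiskerRight, h, id_whiskerRight]
  · intro Z
    dsimp
    simp only [← whiskerLeft_comp]
    rw [← whiskerLeft_sum, h, whiskerLeft_id]

lemma of_iso {X Y : B} (e : X ≅ Y) (hX : TensorExact X) : TensorExact Y :=
  of_sum_eq_id (Finset.univ (α := Unit)) (fun _ ↦ X) (fun _ ↦ e.inv) (fun _ ↦ e.hom) (by simp)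
    (fun _ _ ↦ hX)

lemma of_isZero {X : B} (h : IsZero X) : TensorExact X :=
  of_sum_eq_id (∅ : Finset Unit) (fun _ ↦ X) (fun _ ↦ 𝟙 _) (fun _ ↦ 𝟙 _)
    (h.eq_of_src _ _) (by simp)

lemma preservesHomology_tensorLeft {X : B} (h : TensorExact X) :
    (tensorLeft X).PreservesHomology :=
  ((Functor.exact_tfae (tensorLeft X)).out 1 2).1 fun S hS ↦ (h S hS).1

lemma preservesHomology_tensorRight {X : B} (h : TensorExact X) :
    (tensorRight X).PreservesHomology :=
  ((Functor.exact_tfae (tensorRight X)).out 1 2).1 fun S hS ↦ (h S hS).2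

end TensorExact

end CategoryTheory

namespace HomologicalComplex₂

open ComplexShape

variable {B : Type*} [Category B] [Abelian B] [HasCoproducts.{0} B]

lemma tensorExact_total_X [MonoidalCategory B] [MonoidalPreadditive B]
    (M : HomologicalComplex₂ B (up ℤ) (up ℤ)) (hM : M.IsLocallyFinite)
    (h : ∀ i j, TensorExact ((M.X i).X j)) (n : ℤ) : TensorExact ((M.total (up ℤ)).X n) := by
  obtain ⟨lo, hi, hM⟩ := hM n
  exact TensorExact.of_sum_eq_id _ _ _ _ (M.id_total_eq_sum hM) fun i _ ↦ h _ _

end HomologicalComplex₂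

section

variable {B : Type u} [Category.{v} B] [Abelian B] [MonoidalCategory B] [MonoidalPreadditive B]

namespace CochainComplex

/-- The class of complexes `𝓑` is such that in each degree, the tensor product of two
complexes in `𝓑` involves finitely many nonzero summands. -/
class LocallyFinite (𝓑 : ObjectProperty (CochainComplex B ℤ)) : Prop where
  bounds {K L : CochainComplex B ℤ} (hK : 𝓑 K) (hL : 𝓑 L) (n : ℤ) : ∃ lo hi : ℤ,
    ∀ i j, i + j = n → i < lo ∨ hi < i → IsZero (K.X i) ∨ IsZero (L.X j)

instance : LocallyFinite (minus B) where
  bounds {K L} := by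
    rintro ⟨a, ha⟩ ⟨b, hb⟩ n
    refine ⟨n - b, a, fun i j hij h ↦ ?_⟩
    rcases h with h | h
    · exact .inr (isZero_of_isStrictlyLE L b j (by lia))
    · exact .inl (isZero_of_isStrictlyLE K a i (by lia))

instance : LocallyFinite (CochainComplex.plus B) where
  bounds {K L} := by
    rintro ⟨a, ha⟩ ⟨b, hb⟩ n
    refine ⟨a, n - b, fun i j hij h ↦ ?_⟩
    rcases h with h | h
    · exact .inl (isZero_of_isStrictlyGE K a i (by lia))
    · exact .inr (isZero_of_isStrictlyGE L b j (by lia))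

/-- The bicomplex with terms `K^i ⊗ L^j`. -/
noncomputable abbrev tensorBicomplex (K L : CochainComplex B ℤ) :
    HomologicalComplex₂ B (ComplexShape.up ℤ) (ComplexShape.up ℤ) :=
  (((curriedTensor B).mapBifunctorHomologicalComplex _ _).obj K).obj L

lemma isLocallyFinite_tensorBicomplex {𝓑 : ObjectProperty (CochainComplex B ℤ)}
    [h𝓑 : LocallyFinite 𝓑] {K L : CochainComplex B ℤ} (hK : 𝓑 K) (hL : 𝓑 L) :
    (tensorBicomplex K L).IsLocallyFinite := by
  intro n
  obtain ⟨lo, hi, h⟩ := h𝓑.bounds hK hL n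
  refine ⟨lo, hi, fun i j hij h' ↦ ?_⟩
  rcases h i j hij h' with h | h
  · exact Functor.map_isZero ((curriedTensor B).flip.obj (L.X j)) h
  · exact Functor.map_isZero ((curriedTensor B).obj (K.X i)) h

variable [HasGoodCoproducts B] {𝓑 : ObjectProperty (CochainComplex B ℤ)} [LocallyFinite 𝓑]

/-- Tensoring with a complex of tensor exact objects preserves quasi-isomorphisms: the induced
morphism of bicomplexes is a quasi-isomorphism on columns. -/
lemma quasiIso_whiskerLeft {K L L' : CochainComplex B ℤ} (hK : 𝓑 K) (hL : 𝓑 L) (hL' : 𝓑 L')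
    (hK' : ∀ n, TensorExact (K.X n)) (f : L ⟶ L') [QuasiIso f] : QuasiIso (K ◁ f) := by
  let φ := ((((curriedTensor B).mapBifunctorHomologicalComplex _ _).map (𝟙 K)).app L ≫
    (((curriedTensor B).mapBifunctorHomologicalComplex _ _).obj K).map f :
      tensorBicomplex K L ⟶ tensorBicomplex K L')
  change QuasiIso (HomologicalComplex₂.total.map φ _)
  apply HomologicalComplex₂.quasiIso_total_map _ (isLocallyFinite_tensorBicomplex hK hL)
    (isLocallyFinite_tensorBicomplex hK hL')
  intro i
  have := (hK' i).preservesHomology_tensorLeft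
  have h : QuasiIso (((tensorLeft (K.X i)).mapHomologicalComplex (ComplexShape.up ℤ)).map f) :=
    inferInstance
  have e : φ.f i = ((tensorLeft (K.X i)).mapHomologicalComplex (ComplexShape.up ℤ)).map f := by
      refine HomologicalComplex.hom_ext _ _ fun j ↦ ?_
      change (𝟙 K : K ⟶ K).f i ▷ L.X j ≫ K.X i ◁ f.f j = K.X i ◁ f.f j
      simp
  rw [e]
  exact h

lemma quasiIso_whiskerRight {K L L' : CochainComplex B ℤ} (hK : 𝓑 K) (hL : 𝓑 L) (hL' : 𝓑 L')
    (hK' : ∀ n, TensorExact (K.X n)) (f : L ⟶ L') [QuasiIso f] : QuasiIso (f ▷ K) := by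
  -- flipping the bicomplex turns its rows into columns
  have e := HomologicalComplex.mapBifunctorFlipIso_hom_naturality f (𝟙 K)
    (curriedTensor B) (ComplexShape.up ℤ)
  have hfin : ∀ {M : CochainComplex B ℤ}, 𝓑 M →
      ((((curriedTensor B).flip.mapBifunctorHomologicalComplex _ _).obj K).obj M :
        HomologicalComplex₂ B (ComplexShape.up ℤ) (ComplexShape.up ℤ)).IsLocallyFinite := by
    intro M hM n
    obtain ⟨lo, hi, h⟩ := LocallyFinite.bounds hK hM n
    refine ⟨lo, hi, fun i j hij h' ↦ ?_⟩
    rcases h i j hij h' with h | h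
    · exact Functor.map_isZero ((curriedTensor B).obj (M.X j)) h
    · exact Functor.map_isZero ((curriedTensor B).flip.obj (K.X i)) h
  have hq : QuasiIso (HomologicalComplex.mapBifunctorMap (𝟙 K) f (curriedTensor B).flip
      (ComplexShape.up ℤ)) := by
    let φ := ((((curriedTensor B).flip.mapBifunctorHomologicalComplex
      (ComplexShape.up ℤ) (ComplexShape.up ℤ)).map (𝟙 K)).app L ≫
        (((curriedTensor B).flip.mapBifunctorHomologicalComplex _ _).obj K).map f)
    change QuasiIso (HomologicalComplex₂.total.map φ _)
    apply HomologicalComplex₂.quasiIso_total_map _ (hfin hL) (hfin hL')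
    intro i
    have := (hK' i).preservesHomology_tensorRight
    have h : QuasiIso (((tensorRight (K.X i)).mapHomologicalComplex (ComplexShape.up ℤ)).map f) :=
      inferInstance
    have e' : φ.f i = ((tensorRight (K.X i)).mapHomologicalComplex (ComplexShape.up ℤ)).map f := by
      refine HomologicalComplex.hom_ext _ _ fun j ↦ ?_
      change L.X j ◁ (𝟙 K : K ⟶ K).f i ≫ f.f j ▷ K.X i = f.f j ▷ K.X i
      simp
    rw [e']
    exact h
  have : QuasiIso ((HomologicalComplex.mapBifunctorFlipIso L K (curriedTensor B)
      (ComplexShape.up ℤ)).hom ≫ HomologicalComplex.mapBifunctorMap f (𝟙 K) (curriedTensor B)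
      (ComplexShape.up ℤ)) := by
    rw [← e]
    infer_instance
  exact quasiIso_of_comp_left (HomologicalComplex.mapBifunctorFlipIso L K (curriedTensor B)
    (ComplexShape.up ℤ)).hom _

/-- The quasi-isomorphisms between complexes in a given class. -/
abbrev subQuasiIso (𝓑 : ObjectProperty (CochainComplex B ℤ)) :
    MorphismProperty 𝓑.FullSubcategory :=
  (HomologicalComplex.quasiIso B (ComplexShape.up ℤ)).inverseImage 𝓑.ι

/-- The complexes in a given class with terms that are exact for the tensor product. -/
def termwiseTensorExact (𝓑 : ObjectProperty (CochainComplex B ℤ)) :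
    ObjectProperty 𝓑.FullSubcategory :=
  fun K ↦ ∀ n, TensorExact (K.obj.X n)

/-- The quasi-isomorphisms between complexes with terms that are exact for the tensor product. -/
abbrev flatQuasiIso (𝓑 : ObjectProperty (CochainComplex B ℤ)) :
    MorphismProperty (termwiseTensorExact 𝓑).FullSubcategory :=
  (subQuasiIso 𝓑).inverseImage (termwiseTensorExact 𝓑).ι

variable (𝓑) [𝓑.IsMonoidal]

instance : (termwiseTensorExact 𝓑).IsMonoidal where
  prop_unit n := by
    change TensorExact (((HomologicalComplex.single B (ComplexShape.up ℤ) 0).obj (𝟙_ B)).X n)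
    by_cases h : n = 0
    · subst h
      exact TensorExact.of_iso (HomologicalComplex.singleObjXSelf _ _ _).symm TensorExact.unit
    · exact TensorExact.of_isZero (HomologicalComplex.isZero_single_obj_X _ _ _ _ h)
  prop_tensor K L hK hL n :=
    HomologicalComplex₂.tensorExact_total_X _
      (isLocallyFinite_tensorBicomplex K.property L.property)
      (fun i j ↦ TensorExact.tensor (hK i) (hL j)) n

instance : (flatQuasiIso 𝓑).IsMonoidal where
  whiskerLeft K L L' f hf :=
    have : QuasiIso f.hom.hom := hf
    quasiIso_whiskerLeft K.obj.property L.obj.property L'.obj.property K.property f.hom.hom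
  whiskerRight f hf K :=
    have : QuasiIso f.hom.hom := hf
    quasiIso_whiskerRight K.obj.property (ObjectProperty.FullSubcategory.property _)
      (ObjectProperty.FullSubcategory.property _) K.property f.hom.hom

end CochainComplex
end

/-! ### Functorial resolutions of complexes -/

section

open ComplexShape HomologicalComplex₂

variable {B : Type*} [Category B] [Abelian B]

/-- Functorial resolutions of objects by complexes in nonpositive degrees with terms
satisfying `P`. -/
structure FunctorialResolution (P : ObjectProperty B) where
  /-- The resolution. -/
  res : B ⥤ CochainComplex B ℤ
  preservesZero : res.PreservesZeroMorphisms := by infer_instance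
  /-- The quasi-isomorphism to the resolved object. -/
  augmentation : res ⟶ HomologicalComplex.single B (up ℤ) 0
  quasiIso X : QuasiIso (augmentation.app X)
  prop X n : P ((res.obj X).X n)
  isZero X n : 0 < n → IsZero ((res.obj X).X n)

/-- Functorial resolutions of objects by complexes in nonnegative degrees with terms
satisfying `P`. -/
structure FunctorialCoresolution (P : ObjectProperty B) where
  /-- The resolution. -/
  res : B ⥤ CochainComplex B ℤ
  preservesZero : res.PreservesZeroMorphisms := by infer_instance
  /-- The quasi-isomorphism from the resolved object. -/
  coaugmentation : HomologicalComplex.single B (up ℤ) 0 ⟶ res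
  quasiIso X : QuasiIso (coaugmentation.app X)
  prop X n : P ((res.obj X).X n)
  isZero X n : n < 0 → IsZero ((res.obj X).X n)

attribute [instance] FunctorialResolution.preservesZero FunctorialResolution.quasiIso
  FunctorialCoresolution.preservesZero FunctorialCoresolution.quasiIso

/-- A complex, considered as a bicomplex concentrated in the zeroth row. -/
noncomputable abbrev singleRow (K : CochainComplex B ℤ) : HomologicalComplex₂ B (up ℤ) (up ℤ) :=
  ((HomologicalComplex.single B (up ℤ) 0).mapHomologicalComplex (up ℤ)).obj K

lemma isLocallyFinite_singleRow (K : CochainComplex B ℤ) : (singleRow K).IsLocallyFinite :=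
  fun n ↦ ⟨n, n, fun _ _ _ _ ↦ HomologicalComplex.isZero_single_obj_X _ _ _ _ (by lia)⟩

/-- The nonzero terms of `singleRow K`. -/
noncomputable def singleRowXIso (K : CochainComplex B ℤ) (n : ℤ) :
    ((singleRow K).X n).X 0 ≅ K.X n :=
  HomologicalComplex.singleObjXSelf (up ℤ) 0 (K.X n)

lemma singleRow_d_f (K : CochainComplex B ℤ) (n n' : ℤ) : ((singleRow K).d n n').f 0 =
    (singleRowXIso K n).hom ≫ K.d n n' ≫ (singleRowXIso K n').inv :=
  HomologicalComplex.single_map_f_self _ _ _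

lemma singleRow_map_f_f {K L : CochainComplex B ℤ} (f : K ⟶ L) (n : ℤ) :
    ((((HomologicalComplex.single B (up ℤ) 0).mapHomologicalComplex (up ℤ)).map f).f n).f 0 =
    (singleRowXIso K n).hom ≫ f.f n ≫ (singleRowXIso L n).inv :=
  HomologicalComplex.single_map_f_self _ _ _

lemma isZero_singleRow (K : CochainComplex B ℤ) (i j : ℤ) (hj : j ≠ 0) :
    IsZero (((singleRow K).X i).X j) :=
  HomologicalComplex.isZero_single_obj_X _ _ _ _ hj

namespace FunctorialResolution

variable {P : ObjectProperty B} (Φ : FunctorialResolution P)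

/-- The bicomplex obtained by resolving the terms of a complex. -/
noncomputable abbrev bicomplex : CochainComplex B ℤ ⥤ HomologicalComplex₂ B (up ℤ) (up ℤ) :=
  Φ.res.mapHomologicalComplex (up ℤ)

lemma isZero_bicomplex {K : CochainComplex B ℤ} {a : ℤ} (h : K.IsStrictlyLE a) {i j : ℤ}
    (hij : a < i ∨ 0 < j) : IsZero (((Φ.bicomplex.obj K).X i).X j) := by
  rcases hij with hi | hj
  · exact Functor.map_isZero (Φ.res ⋙ HomologicalComplex.eval _ _ j)
      (K.isZero_of_isStrictlyLE a i hi)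
  · exact Φ.isZero _ _ hj

lemma isLocallyFinite_bicomplex {K : CochainComplex B ℤ} (hK : CochainComplex.minus B K) :
    (Φ.bicomplex.obj K).IsLocallyFinite := by
  obtain ⟨a, ha⟩ := hK
  exact fun n ↦ ⟨n, a, fun i j hij h ↦ Φ.isZero_bicomplex ha (by lia)⟩

end FunctorialResolution

namespace FunctorialCoresolution

variable {P : ObjectProperty B} (Φ : FunctorialCoresolution P)

/-- The bicomplex obtained by resolving the terms of a complex. -/
noncomputable abbrev bicomplex : CochainComplex B ℤ ⥤ HomologicalComplex₂ B (up ℤ) (up ℤ) :=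
  Φ.res.mapHomologicalComplex (up ℤ)

lemma isZero_bicomplex {K : CochainComplex B ℤ} {a : ℤ} (h : K.IsStrictlyGE a) {i j : ℤ}
    (hij : i < a ∨ j < 0) : IsZero (((Φ.bicomplex.obj K).X i).X j) := by
  rcases hij with hi | hj
  · exact Functor.map_isZero (Φ.res ⋙ HomologicalComplex.eval _ _ j)
      (K.isZero_of_isStrictlyGE a i hi)
  · exact Φ.isZero _ _ hj

lemma isLocallyFinite_bicomplex {K : CochainComplex B ℤ} (hK : CochainComplex.plus B K) :
    (Φ.bicomplex.obj K).IsLocallyFinite := by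
  obtain ⟨a, ha⟩ := hK
  exact fun n ↦ ⟨a, n, fun i j hij h ↦ Φ.isZero_bicomplex ha (by lia)⟩

end FunctorialCoresolution

variable [HasCoproducts.{0} B]

/-- The total complex of a bicomplex that is concentrated in the zeroth row. -/
noncomputable def totalSingleRowIso (K : CochainComplex B ℤ) : (singleRow K).total (up ℤ) ≅ K :=
  (HomologicalComplex.Hom.isoOfComponents (fun n ↦
    { hom := (singleRowXIso K n).inv ≫ (singleRow K).ιTotal (up ℤ) n 0 n (by simp)
      inv := (singleRow K).totalProj n 0 n (by simp) ≫ (singleRowXIso K n).hom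
      hom_inv_id := by simp
      inv_hom_id := by
        refine total.hom_ext (up ℤ) fun i j hij ↦ ?_
        change i + j = n at hij
        by_cases hj : j = 0
        · obtain rfl : i = n := by lia
          subst hj
          simp
        · exact (isZero_singleRow K _ _ hj).eq_of_src _ _ })
    (fun n n' hn ↦ by
      have h1 : (singleRow K).ιTotal (up ℤ) n 0 n (by simp) ≫
          ((singleRow K).total (up ℤ)).d n n' =
            (singleRow K).d₁ (up ℤ) n 0 n' + (singleRow K).d₂ (up ℤ) n 0 n' := by
        simp [total]
      have h2 : ((singleRow K).X n).d 0 1 = 0 := rfl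
      dsimp only
      rw [Category.assoc, h1, (singleRow K).d₁_eq (up ℤ) hn 0 n' (by simp),
        (singleRow K).d₂_eq (up ℤ) n (i₂' := 1) (by simp) n' (by simpa using hn)]
      have e1 : ε₁ (up ℤ) (up ℤ) (up ℤ) (n, 0) = 1 := rfl
      rw [e1, one_smul, h2, zero_comp, smul_zero, add_zero, singleRow_d_f]
      simp)).symm

lemma ιTotal_totalSingleRowIso_hom_f (K : CochainComplex B ℤ) (n : ℤ) :
    (singleRow K).ιTotal (up ℤ) n 0 n (by simp) ≫ (totalSingleRowIso K).hom.f n =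
      (singleRowXIso K n).hom := by
  simp [totalSingleRowIso]

lemma totalSingleRowIso_hom_naturality {K L : CochainComplex B ℤ} (f : K ⟶ L) :
    (total.map (((HomologicalComplex.single B (up ℤ) 0).mapHomologicalComplex (up ℤ)).map f)
      (up ℤ) : (singleRow K).total (up ℤ) ⟶ (singleRow L).total (up ℤ)) ≫
        (totalSingleRowIso L).hom = (totalSingleRowIso K).hom ≫ f := by
  ext n i j hij
  change i + j = n at hij
  by_cases hj : j = 0
  · obtain rfl : i = n := by lia
    subst hj
    rw [HomologicalComplex.comp_f, HomologicalComplex.comp_f, ιTotal_map_assoc,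
      ιTotal_totalSingleRowIso_hom_f, reassoc_of% (ιTotal_totalSingleRowIso_hom_f K),
      singleRow_map_f_f]
    simp
  · exact (isZero_singleRow K _ _ hj).eq_of_src _ _

lemma totalSingleRowIso_inv_naturality {K L : CochainComplex B ℤ} (f : K ⟶ L) :
    (totalSingleRowIso K).inv ≫
      (total.map (((HomologicalComplex.single B (up ℤ) 0).mapHomologicalComplex (up ℤ)).map f)
        (up ℤ) : (singleRow K).total (up ℤ) ⟶ (singleRow L).total (up ℤ)) =
          f ≫ (totalSingleRowIso L).inv := by
  rw [Iso.inv_comp_eq, ← Category.assoc, Iso.eq_comp_inv, totalSingleRowIso_hom_naturality]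

lemma isZero_total_X (M : HomologicalComplex₂ B (up ℤ) (up ℤ)) (n : ℤ)
    (h : ∀ i j, i + j = n → IsZero ((M.X i).X j)) : IsZero ((M.total (up ℤ)).X n) := by
  rw [IsZero.iff_id_eq_zero]
  exact total.hom_ext (up ℤ) fun i j hij ↦ (h i j hij).eq_of_src _ _

namespace FunctorialResolution

variable {P : ObjectProperty B} (Φ : FunctorialResolution P)

/-- The natural morphism from the total complex of the resolutions of the terms of `K` to `K`. -/
noncomputable def totalAugmentation : Φ.bicomplex ⋙ totalFunctor B (up ℤ) (up ℤ) (up ℤ) ⟶ 𝟭 _ where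
  app K := total.map ((NatTrans.mapHomologicalComplex Φ.augmentation (up ℤ)).app K) (up ℤ) ≫
    (totalSingleRowIso K).hom
  naturality K L f := by
    change total.map (Φ.bicomplex.map f) (up ℤ) ≫ _ ≫ _ = (_ ≫ _) ≫ f
    rw [Category.assoc, ← totalSingleRowIso_hom_naturality, ← total.map_comp_assoc,
      NatTrans.mapHomologicalComplex_naturality, total.map_comp_assoc]

lemma quasiIso_totalAugmentation {K : CochainComplex B ℤ}
    (h : (Φ.bicomplex.obj K).IsLocallyFinite) :
    QuasiIso (Φ.totalAugmentation.app K) := by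
  have : QuasiIso (total.map ((NatTrans.mapHomologicalComplex Φ.augmentation (up ℤ)).app K)
      (up ℤ)) :=
    quasiIso_total_map _ h (isLocallyFinite_singleRow K) fun i ↦ Φ.quasiIso (K.X i)
  change QuasiIso (total.map ((NatTrans.mapHomologicalComplex Φ.augmentation (up ℤ)).app K)
    (up ℤ) ≫ (totalSingleRowIso K).hom)
  infer_instance

end FunctorialResolution

namespace FunctorialCoresolution

variable {P : ObjectProperty B} (Φ : FunctorialCoresolution P)

/-- The natural morphism from `K` to the total complex of the resolutions of the terms of `K`. -/
noncomputable def totalCoaugmentation :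
    𝟭 _ ⟶ Φ.bicomplex ⋙ totalFunctor B (up ℤ) (up ℤ) (up ℤ) where
  app K := (totalSingleRowIso K).inv ≫
    total.map ((NatTrans.mapHomologicalComplex Φ.coaugmentation (up ℤ)).app K) (up ℤ)
  naturality K L f := by
    change f ≫ _ ≫ _ = (_ ≫ _) ≫ total.map (Φ.bicomplex.map f) (up ℤ)
    rw [Category.assoc, ← Category.assoc f, ← totalSingleRowIso_inv_naturality, Category.assoc,
      ← total.map_comp, ← total.map_comp, NatTrans.mapHomologicalComplex_naturality]

lemma quasiIso_totalCoaugmentation {K : CochainComplex B ℤ}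
    (h : (Φ.bicomplex.obj K).IsLocallyFinite) : QuasiIso (Φ.totalCoaugmentation.app K) := by
  have : QuasiIso (total.map ((NatTrans.mapHomologicalComplex Φ.coaugmentation (up ℤ)).app K)
      (up ℤ)) :=
    quasiIso_total_map _ (isLocallyFinite_singleRow K) h fun i ↦ Φ.quasiIso (K.X i)
  change QuasiIso ((totalSingleRowIso K).inv ≫
    total.map ((NatTrans.mapHomologicalComplex Φ.coaugmentation (up ℤ)).app K) (up ℤ))
  infer_instance

end FunctorialCoresolution

end

section

variable {B : Type u} [Category.{v} B] [Abelian B] [MonoidalCategory B] [MonoidalPreadditive B]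
  [HasGoodCoproducts B]

open ComplexShape HomologicalComplex₂ CochainComplex

namespace FunctorialResolution

variable (Φ : FunctorialResolution (TensorExact (B := B)))

lemma minus_total_bicomplex {K : CochainComplex B ℤ} (hK : minus B K) :
    minus B ((Φ.bicomplex.obj K).total (up ℤ)) := by
  obtain ⟨a, ha⟩ := hK
  exact ⟨a, (isStrictlyLE_iff _ _).2 fun n hn ↦ isZero_total_X _ _ fun i j hij ↦
    Φ.isZero_bicomplex ha (by lia)⟩

/-- The resolution functor for bounded above complexes. -/
noncomputable def resolutionFunctor :
    Minus B ⥤ (termwiseTensorExact (minus B)).FullSubcategory :=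
  ObjectProperty.lift _ (ObjectProperty.lift _
    ((minus B).ι ⋙ Φ.bicomplex ⋙ totalFunctor B (up ℤ) (up ℤ) (up ℤ))
    fun K ↦ Φ.minus_total_bicomplex K.property)
    fun K n ↦ tensorExact_total_X _ (Φ.isLocallyFinite_bicomplex K.property)
      (fun _ _ ↦ Φ.prop _ _) n

/-- The natural morphism from the resolution of a bounded above complex. -/
noncomputable def resolutionπ :
    Φ.resolutionFunctor ⋙ (termwiseTensorExact (minus B)).ι ⟶ 𝟭 (Minus B) where
  app K := ObjectProperty.homMk (Φ.totalAugmentation.app K.obj)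
  naturality K L f := by
    ext : 1
    exact Φ.totalAugmentation.naturality f.hom

lemma subQuasiIso_resolutionπ (K : Minus B) : subQuasiIso (minus B) (Φ.resolutionπ.app K) :=
  Φ.quasiIso_totalAugmentation (Φ.isLocallyFinite_bicomplex K.property)

end FunctorialResolution

namespace FunctorialCoresolution

variable (Φ : FunctorialCoresolution (TensorExact (B := B)))

lemma plus_total_bicomplex {K : CochainComplex B ℤ} (hK : CochainComplex.plus B K) :
    CochainComplex.plus B ((Φ.bicomplex.obj K).total (up ℤ)) := by
  obtain ⟨a, ha⟩ := hK
  exact ⟨a, (isStrictlyGE_iff _ _).2 fun n hn ↦ isZero_total_X _ _ fun i j hij ↦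
    Φ.isZero_bicomplex ha (by lia)⟩

/-- The resolution functor for bounded below complexes. -/
noncomputable def coresolutionFunctor :
    CochainComplex.Plus B ⥤ (termwiseTensorExact (CochainComplex.plus B)).FullSubcategory :=
  ObjectProperty.lift _ (ObjectProperty.lift _
    ((CochainComplex.plus B).ι ⋙ Φ.bicomplex ⋙ totalFunctor B (up ℤ) (up ℤ) (up ℤ))
    fun K ↦ Φ.plus_total_bicomplex K.property)
    fun K n ↦ tensorExact_total_X _ (Φ.isLocallyFinite_bicomplex K.property)
      (fun _ _ ↦ Φ.prop _ _) n

/-- The natural morphism to the resolution of a bounded below complex. -/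
noncomputable def coresolutionι :
    𝟭 (CochainComplex.Plus B) ⟶
      Φ.coresolutionFunctor ⋙ (termwiseTensorExact (CochainComplex.plus B)).ι where
  app K := ObjectProperty.homMk (Φ.totalCoaugmentation.app K.obj)
  naturality K L f := by
    ext : 1
    exact Φ.totalCoaugmentation.naturality f.hom

lemma subQuasiIso_coresolutionι (K : CochainComplex.Plus B) :
    subQuasiIso (CochainComplex.plus B) (Φ.coresolutionι.app K) :=
  Φ.quasiIso_totalCoaugmentation (Φ.isLocallyFinite_bicomplex K.property)

end FunctorialCoresolution

end

/-! ### Functorial resolutions from functorial epimorphisms and monomorphisms -/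

section

open ComplexShape

namespace HomologicalComplex

variable {C : Type*} [Category C] [Preadditive C] [HasZeroObject C] {ι ι' : Type*}
  [DecidableEq ι] [DecidableEq ι'] {c : ComplexShape ι} {c' : ComplexShape ι'} (e : c.Embedding c')

lemma extendSingleIso_hom_naturality {X Y : C} (f : X ⟶ Y) (i : ι) (i' : ι') (h : e.f i = i') :
    extendMap ((single C c i).map f) e ≫ (extendSingleIso e Y i i' h).hom =
      (extendSingleIso e X i i' h).hom ≫ (single C c' i').map f := by
  apply to_single_hom_ext
  rw [comp_f, comp_f, extendSingleIso_hom_f, extendSingleIso_hom_f, extendMap_f _ e h,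
    single_map_f_self, single_map_f_self]
  simp

end HomologicalComplex

namespace CategoryTheory.Abelian.LeftResolution

variable {B : Type*} [Category B] [Abelian B] (Λ : LeftResolution (𝟭 B))

lemma exact_chainComplex (X : B) : ∃ h, (ShortComplex.mk ((Λ.chainComplex X).d 1 0)
    ((Λ.chainComplexXZeroIso X).hom ≫ Λ.π.app X) h).Exact ∧
      Epi ((Λ.chainComplexXZeroIso X).hom ≫ Λ.π.app X) := by
  let S := ShortComplex.mk (Λ.π.app (kernel (Λ.π.app X)) ≫ kernel.ι (Λ.π.app X))
    (Λ.π.app X) (by simp)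
  have hS : S.Exact := by
    rw [ShortComplex.exact_iff_epi_kernel_lift]
    have : kernel.lift S.g S.f S.zero = Λ.π.app (kernel (Λ.π.app X)) := by
      rw [← cancel_mono (kernel.ι S.g), kernel.lift_ι]
    rw [this]
    infer_instance
  have h := Λ.map_chainComplex_d_1_0 X
  dsimp only [Functor.id_map, Functor.id_obj] at h
  refine ⟨by simp [h], ?_⟩
  refine (ShortComplex.exact_and_epi_g_iff_of_iso (ShortComplex.isoMk (S₂ := S)
    (Λ.chainComplexXOneIso X) (Λ.chainComplexXZeroIso X) (Iso.refl X) ?_ ?_)).2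
    ⟨hS, Λ.epi_π_app X⟩
  · dsimp only [S]
    rw [h]
    simp
  · simp [S]

/-- The augmentation of the resolution of an object. -/
noncomputable def chainComplexε (X : B) :
    Λ.chainComplex X ⟶ (HomologicalComplex.single B (down ℕ) 0).obj X :=
  HomologicalComplex.mkHomToSingle ((Λ.chainComplexXZeroIso X).hom ≫ Λ.π.app X) (by
    rintro i (hi : 0 + 1 = i)
    subst hi
    exact (Λ.exact_chainComplex X).choose)

instance (X : B) : QuasiIso (Λ.chainComplexε X) where
  quasiIsoAt n := by
    obtain _ | n := n
    · rw [ChainComplex.quasiIsoAt₀_iff, ShortComplex.quasiIso_iff_of_zeros' _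
        (HomologicalComplex.shape _ _ _ (by simp)) rfl rfl]
      obtain ⟨h, h', h''⟩ := Λ.exact_chainComplex X
      refine (ShortComplex.exact_and_epi_g_iff_of_iso (ShortComplex.isoMk
        (S₂ := ShortComplex.mk _ _ h) (Iso.refl ((Λ.chainComplex X).X 1))
        (Iso.refl ((Λ.chainComplex X).X 0)) (HomologicalComplex.singleObjXSelf (down ℕ) 0 X)
        ?_ ?_)).2 ⟨h', h''⟩
      · change 𝟙 _ ≫ (Λ.chainComplex X).d 1 0 = (Λ.chainComplex X).d 1 0 ≫ 𝟙 _
        simp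
      · change 𝟙 _ ≫ (Λ.chainComplexXZeroIso X).hom ≫ Λ.π.app X =
          (Λ.chainComplexε X).f 0 ≫ (HomologicalComplex.singleObjXSelf (down ℕ) 0 X).hom
        simp [chainComplexε]
    · rw [quasiIsoAt_iff_exactAt]
      · exact HomologicalComplex.exactAt_single_obj _ _ _ _ (by simp)
      · exact Λ.exactAt_map_chainComplex_succ X n

lemma chainComplexε_naturality {X Y : B} (f : X ⟶ Y) :
    Λ.chainComplexMap f ≫ Λ.chainComplexε Y =
      Λ.chainComplexε X ≫ (HomologicalComplex.single B (down ℕ) 0).map f := by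
  apply HomologicalComplex.to_single_hom_ext
  simp [chainComplexε, HomologicalComplex.single_map_f_self]

lemma chainComplex_X (P : ObjectProperty B) (h : ∀ X, P (Λ.F.obj X)) [P.IsClosedUnderIsomorphisms]
    (X : B) (n : ℕ) : P ((Λ.chainComplex X).X n) := by
  obtain _ | _ | n := n
  · exact P.prop_of_iso (Λ.chainComplexXZeroIso X).symm (h _)
  · exact P.prop_of_iso (Λ.chainComplexXOneIso X).symm (h _)
  · exact P.prop_of_iso (Λ.chainComplexXIso X n).symm (h _)

/-- A functorial epimorphism onto each object induces functorial resolutions. -/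
noncomputable def functorialResolution [Λ.F.PreservesZeroMorphisms] (P : ObjectProperty B)
    (h : ∀ X, P (Λ.F.obj X)) (h₀ : ∀ X, IsZero X → P X) [P.IsClosedUnderIsomorphisms] :
    FunctorialResolution P where
  res := Λ.chainComplexFunctor ⋙ embeddingDownNat.extendFunctor B
  preservesZero := ⟨fun X Y ↦ by
    change HomologicalComplex.extendMap (Λ.chainComplexMap (0 : X ⟶ Y)) embeddingDownNat = 0
    rw [chainComplexMap_zero, HomologicalComplex.extendMap_zero]⟩
  augmentation :=
    { app X := HomologicalComplex.extendMap (Λ.chainComplexε X) embeddingDownNat ≫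
        (HomologicalComplex.extendSingleIso embeddingDownNat X 0 0 (by simp)).hom
      naturality X Y f := by
        change HomologicalComplex.extendMap (Λ.chainComplexMap f) embeddingDownNat ≫ _ ≫ _ =
          (_ ≫ _) ≫ _
        rw [← HomologicalComplex.extendMap_comp_assoc, chainComplexε_naturality,
          HomologicalComplex.extendMap_comp, Category.assoc, Category.assoc]
        rw [HomologicalComplex.extendSingleIso_hom_naturality] }
  quasiIso X := by
    change QuasiIso (HomologicalComplex.extendMap (Λ.chainComplexε X) embeddingDownNat ≫
      (HomologicalComplex.extendSingleIso embeddingDownNat X 0 0 (by simp)).hom)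
    infer_instance
  prop X n := by
    by_cases hn : ∃ m, embeddingDownNat.f m = n
    · obtain ⟨m, hm⟩ := hn
      exact P.prop_of_iso ((Λ.chainComplex X).extendXIso embeddingDownNat hm).symm
        (Λ.chainComplex_X P h X m)
    · exact h₀ _ ((Λ.chainComplex X).isZero_extend_X embeddingDownNat n (by simpa using hn))
  isZero X n hn := (Λ.chainComplex X).isZero_extend_X embeddingDownNat n (by
    intro i
    change -(i : ℤ) ≠ n
    lia)

end CategoryTheory.Abelian.LeftResolution

namespace CategoryTheory.Abelian.LeftResolution

variable {B : Type*} [Category B] [Abelian B] (Λ : LeftResolution (𝟭 Bᵒᵖ))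

open Opposite

/-- The resolution of an object by the opposite of a left resolution in the opposite category. -/
noncomputable def cochainComplex (X : B) : CochainComplex B ℕ := (Λ.chainComplex (op X)).unop

/-- The functoriality of the resolution by the opposite of a left resolution. -/
noncomputable def cochainComplexMap {X Y : B} (f : X ⟶ Y) :
    Λ.cochainComplex X ⟶ Λ.cochainComplex Y :=
  (HomologicalComplex.unopFunctor B (down ℕ)).map (Λ.chainComplexMap f.op).op

lemma cochainComplexMap_id (X : B) : Λ.cochainComplexMap (𝟙 X) = 𝟙 _ := by
  change (HomologicalComplex.unopFunctor B (down ℕ)).map (Λ.chainComplexMap (𝟙 (op X))).op = 𝟙 _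
  rw [chainComplexMap_id]
  rfl

lemma cochainComplexMap_comp {X Y Z : B} (f : X ⟶ Y) (g : Y ⟶ Z) :
    Λ.cochainComplexMap (f ≫ g) = Λ.cochainComplexMap f ≫ Λ.cochainComplexMap g := by
  change (HomologicalComplex.unopFunctor B (down ℕ)).map (Λ.chainComplexMap (g.op ≫ f.op)).op = _
  rw [chainComplexMap_comp]
  rfl

lemma cochainComplexMap_zero [Λ.F.PreservesZeroMorphisms] (X Y : B) :
    Λ.cochainComplexMap (0 : X ⟶ Y) = 0 := by
  change (HomologicalComplex.unopFunctor B (down ℕ)).map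
    (Λ.chainComplexMap (0 : op Y ⟶ op X)).op = _
  rw [chainComplexMap_zero]
  rfl

/-- The morphism from an object to its resolution, in degree zero. -/
noncomputable def coaugmentation₀ (X : B) : X ⟶ (Λ.cochainComplex X).X 0 :=
  ((Λ.chainComplexXZeroIso (op X)).hom ≫ Λ.π.app (op X)).unop

lemma exact_cochainComplex (X : B) : ∃ h, (ShortComplex.mk (Λ.coaugmentation₀ X)
    ((Λ.cochainComplex X).d 0 1) h).Exact ∧ Mono (Λ.coaugmentation₀ X) := by
  obtain ⟨h, h', h''⟩ := Λ.exact_chainComplex (op X)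
  refine ⟨Quiver.Hom.op_inj h, h'.unop, ?_⟩
  exact unop_mono_of_epi _

/-- The morphism from an object to its resolution. -/
noncomputable def cochainComplexη (X : B) :
    (HomologicalComplex.single B (up ℕ) 0).obj X ⟶ Λ.cochainComplex X :=
  HomologicalComplex.mkHomFromSingle (Λ.coaugmentation₀ X) (by
    rintro i (hi : 0 + 1 = i)
    subst hi
    exact (Λ.exact_cochainComplex X).choose)

instance (X : B) : QuasiIso (Λ.cochainComplexη X) where
  quasiIsoAt n := by
    obtain _ | n := n
    · rw [CochainComplex.quasiIsoAt₀_iff, ShortComplex.quasiIso_iff_of_zeros _ rfl rfl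
        ((Λ.cochainComplex X).shape 0 0 (by simp))]
      obtain ⟨h, h', h''⟩ := Λ.exact_cochainComplex X
      refine (ShortComplex.exact_and_mono_f_iff_of_iso (ShortComplex.isoMk
        (S₂ := ShortComplex.mk _ _ h) (HomologicalComplex.singleObjXSelf (up ℕ) 0 X)
        (Iso.refl ((Λ.cochainComplex X).X 0)) (Iso.refl ((Λ.cochainComplex X).X 1))
        ?_ ?_)).2 ⟨h', h''⟩
      · change (HomologicalComplex.singleObjXSelf (up ℕ) 0 X).hom ≫ Λ.coaugmentation₀ X =
          (Λ.cochainComplexη X).f 0 ≫ 𝟙 _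
        simp [cochainComplexη]
      · change 𝟙 ((Λ.cochainComplex X).X 0) ≫ (Λ.cochainComplex X).d 0 1 =
          (Λ.cochainComplex X).d 0 1 ≫ 𝟙 _
        simp
    · rw [quasiIsoAt_iff_exactAt']
      · exact HomologicalComplex.exactAt_single_obj _ _ _ _ (by simp)
      · exact (Λ.exactAt_map_chainComplex_succ (op X) n).unop

lemma cochainComplexη_naturality {X Y : B} (f : X ⟶ Y) :
    Λ.cochainComplexη X ≫ Λ.cochainComplexMap f =
      (HomologicalComplex.single B (up ℕ) 0).map f ≫ Λ.cochainComplexη Y := by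
  apply HomologicalComplex.from_single_hom_ext
  have h : Λ.coaugmentation₀ X ≫ (Λ.cochainComplexMap f).f 0 = f ≫ Λ.coaugmentation₀ Y := by
    apply Quiver.Hom.op_inj
    change (Λ.chainComplexMap f.op).f 0 ≫ (Λ.chainComplexXZeroIso (op X)).hom ≫ Λ.π.app (op X) =
      ((Λ.chainComplexXZeroIso (op Y)).hom ≫ Λ.π.app (op Y)) ≫ f.op
    have := Λ.π.naturality f.op
    dsimp at this
    rw [chainComplexMap_f_0, Category.assoc, Category.assoc, Category.assoc,
      Iso.inv_hom_id_assoc, this]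
  simp [cochainComplexη, HomologicalComplex.single_map_f_self, h]

/-- A functorial monomorphism from each object induces functorial resolutions. -/
noncomputable def functorialCoresolution [Λ.F.PreservesZeroMorphisms] (P : ObjectProperty B)
    (h : ∀ X, P.op (Λ.F.obj X)) (h₀ : ∀ X, IsZero X → P X) [P.IsClosedUnderIsomorphisms] :
    FunctorialCoresolution P where
  res :=
    { obj X := (Λ.cochainComplex X).extend embeddingUpNat
      map f := HomologicalComplex.extendMap (Λ.cochainComplexMap f) embeddingUpNat
      map_id X := by rw [cochainComplexMap_id, HomologicalComplex.extendMap_id]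
      map_comp f g := by rw [cochainComplexMap_comp, HomologicalComplex.extendMap_comp] }
  preservesZero := ⟨fun X Y ↦ by
    dsimp only
    rw [cochainComplexMap_zero, HomologicalComplex.extendMap_zero]⟩
  coaugmentation :=
    { app X := (HomologicalComplex.extendSingleIso embeddingUpNat X 0 0 (by simp)).inv ≫
        HomologicalComplex.extendMap (Λ.cochainComplexη X) embeddingUpNat
      naturality X Y f := by
        rw [← cancel_epi (HomologicalComplex.extendSingleIso embeddingUpNat X 0 0 (by simp)).hom,
          ← Category.assoc, ← HomologicalComplex.extendSingleIso_hom_naturality]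
        simp only [Category.assoc, Iso.hom_inv_id_assoc]
        rw [← HomologicalComplex.extendMap_comp, ← HomologicalComplex.extendMap_comp,
          cochainComplexη_naturality] }
  quasiIso X := by
    change QuasiIso ((HomologicalComplex.extendSingleIso embeddingUpNat X 0 0 (by simp)).inv ≫
      HomologicalComplex.extendMap (Λ.cochainComplexη X) embeddingUpNat)
    infer_instance
  prop X n := by
    by_cases hn : ∃ m, embeddingUpNat.f m = n
    · obtain ⟨m, hm⟩ := hn
      exact P.prop_of_iso ((Λ.cochainComplex X).extendXIso embeddingUpNat hm).symm
        (Λ.chainComplex_X P.op h (op X) m)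
    · exact h₀ _ ((Λ.cochainComplex X).isZero_extend_X embeddingUpNat n (by simpa using hn))
  isZero X n hn := (Λ.cochainComplex X).isZero_extend_X embeddingUpNat n (by
    intro i
    change (i : ℤ) ≠ n
    lia)

end CategoryTheory.Abelian.LeftResolution

end

/-! ### Derived tensor products -/

namespace CategoryTheory

section

open CategoryTheory.Functor

variable {C D : Type*} [Category C] [Category D] [MonoidalCategory C] [MonoidalCategory D]

/-- The structure of a monoidal functor on the restriction of a functor `Q` to the objects
satisfying `P`. -/
structure MonoidalOn (P : ObjectProperty C) [P.IsMonoidal] (Q : C ⥤ D) where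
  /-- The unit isomorphism. -/
  ε : 𝟙_ D ≅ Q.obj (𝟙_ C)
  /-- The tensorator for objects satisfying `P`. -/
  μ {x y : C} (hx : P x) (hy : P y) : Q.obj x ⊗ Q.obj y ≅ Q.obj (x ⊗ y)
  natural {x x' y y' : C} (hx : P x) (hx' : P x') (hy : P y) (hy' : P y') (f : x ⟶ x')
    (g : y ⟶ y') : (Q.map f ⊗ₘ Q.map g) ≫ (μ hx' hy').hom = (μ hx hy).hom ≫ Q.map (f ⊗ₘ g)
  associativity {x y z : C} (hx : P x) (hy : P y) (hz : P z) :
    (μ hx hy).hom ▷ Q.obj z ≫ (μ (P.prop_tensor hx hy) hz).hom ≫ Q.map (α_ x y z).hom =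
      (α_ (Q.obj x) (Q.obj y) (Q.obj z)).hom ≫ Q.obj x ◁ (μ hy hz).hom ≫
        (μ hx (P.prop_tensor hy hz)).hom
  left_unitality {x : C} (hx : P x) : (λ_ (Q.obj x)).hom =
    ε.hom ▷ Q.obj x ≫ (μ P.prop_unit hx).hom ≫ Q.map (λ_ x).hom
  right_unitality {x : C} (hx : P x) : (ρ_ (Q.obj x)).hom =
    Q.obj x ◁ ε.hom ≫ (μ hx P.prop_unit).hom ≫ Q.map (ρ_ x).hom

/-- A monoidal structure on the restriction of `Q` to a full monoidal subcategory. -/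
def MonoidalOn.ofMonoidal (P : ObjectProperty C) [P.IsMonoidal] (Q : C ⥤ D)
    (M : (P.ι ⋙ Q).Monoidal) : MonoidalOn P Q where
  ε := Monoidal.εIso (P.ι ⋙ Q)
  μ {x y} hx hy := Monoidal.μIso (P.ι ⋙ Q) ⟨x, hx⟩ ⟨y, hy⟩
  natural {x x' y y'} hx hx' hy hy' f g :=
    LaxMonoidal.μ_natural (P.ι ⋙ Q) (X := ⟨x, hx⟩) (Y := ⟨x', hx'⟩) (X' := ⟨y, hy⟩)
      (Y' := ⟨y', hy'⟩) (ObjectProperty.homMk f) (ObjectProperty.homMk g)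
  associativity {x y z} hx hy hz :=
    LaxMonoidal.associativity (P.ι ⋙ Q) ⟨x, hx⟩ ⟨y, hy⟩ ⟨z, hz⟩
  left_unitality {x} hx := LaxMonoidal.left_unitality (P.ι ⋙ Q) ⟨x, hx⟩
  right_unitality {x} hx := LaxMonoidal.right_unitality (P.ι ⋙ Q) ⟨x, hx⟩

/-- Functorial morphisms `R X ⟶ X` such that `R X` satisfies `P` and `Q R X ⟶ Q X` is an
isomorphism. -/
structure LeftApproximation (P : ObjectProperty C) (Q : C ⥤ D) where
  /-- The approximation functor. -/
  R : C ⥤ C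
  /-- The morphism from the approximation. -/
  π X : R.obj X ⟶ X
  naturality {X Y : C} (f : X ⟶ Y) : R.map f ≫ π Y = π X ≫ f
  prop X : P (R.obj X)
  isIso X : IsIso (Q.map (π X))

/-- Functorial morphisms `X ⟶ R X` such that `R X` satisfies `P` and `Q X ⟶ Q R X` is an
isomorphism. -/
structure RightApproximation (P : ObjectProperty C) (Q : C ⥤ D) where
  /-- The approximation functor. -/
  R : C ⥤ C
  /-- The morphism to the approximation. -/
  π X : X ⟶ R.obj X
  naturality {X Y : C} (f : X ⟶ Y) : f ≫ π Y = π X ≫ R.map f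
  prop X : P (R.obj X)
  isIso X : IsIso (Q.map (π X))

attribute [instance] LeftApproximation.isIso RightApproximation.isIso

namespace MonoidalOn

variable {P : ObjectProperty C} [P.IsMonoidal] {Q : C ⥤ D} (M : MonoidalOn P Q)

section Left

variable (A : LeftApproximation P Q)

/-- The morphism `Q X ⊗ Q Y ⟶ Q (X ⊗ Y)` obtained by resolving `X` and `Y`. -/
noncomputable def lμ (X Y : C) : Q.obj X ⊗ Q.obj Y ⟶ Q.obj (X ⊗ Y) :=
  (inv (Q.map (A.π X)) ⊗ₘ inv (Q.map (A.π Y))) ≫ (M.μ (A.prop X) (A.prop Y)).hom ≫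
    Q.map (A.π X ⊗ₘ A.π Y)

/-- The morphism `lμ` can be computed using any morphisms from objects satisfying `P`. -/
lemma map_tensor_lμ {x y X Y : C} (hx : P x) (hy : P y) (p : x ⟶ X) (q : y ⟶ Y) :
    (Q.map p ⊗ₘ Q.map q) ≫ M.lμ A X Y = (M.μ hx hy).hom ≫ Q.map (p ⊗ₘ q) := by
  rw [← cancel_epi (Q.map (A.π x) ⊗ₘ Q.map (A.π y)),
    reassoc_of% (M.natural (A.prop x) hx (A.prop y) hy (A.π x) (A.π y)),
    ← Q.map_comp, tensorHom_comp_tensorHom_assoc, ← Q.map_comp, ← Q.map_comp,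
    tensorHom_comp_tensorHom, ← A.naturality p, ← A.naturality q, ← tensorHom_comp_tensorHom,
    Q.map_comp, Q.map_comp, Q.map_comp, lμ, tensorHom_comp_tensorHom_assoc, Category.assoc,
    IsIso.hom_inv_id, Category.assoc, IsIso.hom_inv_id, Category.comp_id, Category.comp_id,
    reassoc_of% (M.natural (A.prop x) (A.prop X) (A.prop y) (A.prop Y))]

lemma map_tensor_lμ_assoc {x y X Y : C} (hx : P x) (hy : P y) (p : x ⟶ X) (q : y ⟶ Y) {Z : D}
    (f : Q.obj (X ⊗ Y) ⟶ Z) :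
    (Q.map p ⊗ₘ Q.map q) ≫ M.lμ A X Y ≫ f = (M.μ hx hy).hom ≫ Q.map (p ⊗ₘ q) ≫ f := by
  rw [← Category.assoc, map_tensor_lμ, Category.assoc]

/-- The lax monoidal structure on `Q`. -/
@[reducible]
noncomputable def lax : Q.LaxMonoidal where
  ε := M.ε.hom
  μ := M.lμ A
  μ_natural_left {X X'} f Y := by
    rw [← cancel_epi (Q.map (A.π _) ⊗ₘ Q.map (A.π _))]
    rw [← tensorHom_id, tensorHom_comp_tensorHom_assoc,
      M.map_tensor_lμ_assoc A (A.prop _) (A.prop _), ← Q.map_comp, Category.comp_id,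
      ← Q.map_comp, M.map_tensor_lμ A (A.prop _) (A.prop _),
      ← tensorHom_id, tensorHom_comp_tensorHom, Category.comp_id]
  μ_natural_right {Y Y'} X f := by
    rw [← cancel_epi (Q.map (A.π _) ⊗ₘ Q.map (A.π _))]
    rw [← id_tensorHom, tensorHom_comp_tensorHom_assoc,
      M.map_tensor_lμ_assoc A (A.prop _) (A.prop _), ← Q.map_comp, Category.comp_id,
      ← Q.map_comp, M.map_tensor_lμ A (A.prop _) (A.prop _),
      ← id_tensorHom, tensorHom_comp_tensorHom, Category.comp_id]
  associativity X Y Z := by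
    rw [← cancel_epi ((Q.map (A.π X) ⊗ₘ Q.map (A.π Y)) ⊗ₘ Q.map (A.π Z)),
      ← tensorHom_id, ← id_tensorHom, tensorHom_comp_tensorHom_assoc, associator_naturality_assoc,
      tensorHom_comp_tensorHom_assoc, Category.comp_id, Category.comp_id,
      M.map_tensor_lμ A (A.prop _) (A.prop _), M.map_tensor_lμ A (A.prop _) (A.prop _)]
    have h1 := M.map_tensor_lμ A (P.prop_tensor (A.prop X) (A.prop Y)) (A.prop Z)
      (A.π X ⊗ₘ A.π Y) (A.π Z)
    have h2 := M.map_tensor_lμ A (A.prop X) (P.prop_tensor (A.prop Y) (A.prop Z))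
      (A.π X) (A.π Y ⊗ₘ A.π Z)
    have e1 : ((M.μ (A.prop X) (A.prop Y)).hom ≫ Q.map (A.π X ⊗ₘ A.π Y)) ⊗ₘ Q.map (A.π Z) =
        ((M.μ (A.prop X) (A.prop Y)).hom ▷ Q.obj (A.R.obj Z)) ≫
          (Q.map (A.π X ⊗ₘ A.π Y) ⊗ₘ Q.map (A.π Z)) := by
      rw [← tensorHom_id, tensorHom_comp_tensorHom, Category.id_comp]
    have e2 : Q.map (A.π X) ⊗ₘ ((M.μ (A.prop Y) (A.prop Z)).hom ≫ Q.map (A.π Y ⊗ₘ A.π Z)) =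
        (Q.obj (A.R.obj X) ◁ (M.μ (A.prop Y) (A.prop Z)).hom) ≫
          (Q.map (A.π X) ⊗ₘ Q.map (A.π Y ⊗ₘ A.π Z)) := by
      rw [← id_tensorHom, tensorHom_comp_tensorHom, Category.id_comp]
    rw [e1, e2, Category.assoc, Category.assoc, reassoc_of% h1, h2,
      ← reassoc_of% (M.associativity (A.prop X) (A.prop Y) (A.prop Z)), ← Q.map_comp, ← Q.map_comp]
    congr 3
    exact associator_naturality _ _ _
  left_unitality X := by
    rw [← cancel_epi (𝟙_ D ◁ Q.map (A.π X))]
    have h := M.map_tensor_lμ A P.prop_unit (A.prop X) (𝟙 _) (A.π X)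
    rw [Q.map_id, id_tensorHom] at h
    rw [leftUnitor_naturality, M.left_unitality (A.prop X), whisker_exchange_assoc,
      reassoc_of% h, Category.assoc, Category.assoc, ← Q.map_comp, ← Q.map_comp, id_tensorHom,
      leftUnitor_naturality]
  right_unitality X := by
    rw [← cancel_epi (Q.map (A.π X) ▷ 𝟙_ D)]
    have h := M.map_tensor_lμ A (A.prop X) P.prop_unit (A.π X) (𝟙 _)
    rw [Q.map_id, tensorHom_id] at h
    rw [rightUnitor_naturality, M.right_unitality (A.prop X), ← whisker_exchange_assoc,
      reassoc_of% h, Category.assoc, Category.assoc, ← Q.map_comp, ← Q.map_comp, tensorHom_id,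
      rightUnitor_naturality]

lemma lμ_eq {x y : C} (hx : P x) (hy : P y) : M.lμ A x y = (M.μ hx hy).hom := by
  simpa using M.map_tensor_lμ A hx hy (𝟙 x) (𝟙 y)

/-- The universal property of the tensor product of `D` as a left derived functor.  On objects
satisfying `P`, the transformation `σ` is `γ` followed by the inverse of the tensorator, and natural
transformations out of a functor on `D × D` are determined by such objects. -/
lemma existsUnique_comp_laxTensor (W₀ : MorphismProperty P.FullSubcategory)
    [W₀.ContainsIdentities] [(P.ι ⋙ Q).IsLocalization W₀] (G : D × D ⥤ D)
    (γ : Q.prod Q ⋙ G ⟶ tensor C ⋙ Q) :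
    ∃ σ : G ⟶ tensor D, (∀ X Y : C, σ.app (Q.obj X, Q.obj Y) ≫ M.lμ A X Y = γ.app (X, Y)) ∧
      ∀ σ' : G ⟶ tensor D,
        (∀ X Y : C, σ'.app (Q.obj X, Q.obj Y) ≫ M.lμ A X Y = γ.app (X, Y)) → σ' = σ := by
  let LL := (P.ι ⋙ Q).prod (P.ι ⋙ Q)
  have : LL.IsLocalization (W₀.prod W₀) := inferInstance
  have hγ {X X' Y Y' : C} (f : X ⟶ X') (g : Y ⟶ Y') :
      G.map (Prod.mkHom (Q.map f) (Q.map g)) ≫ γ.app (X', Y') = γ.app (X, Y) ≫ Q.map (f ⊗ₘ g) :=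
    γ.naturality (X := (X, Y)) (Y := (X', Y')) (Prod.mkHom f g)
  let τ : LL ⋙ G ⟶ LL ⋙ tensor D :=
    { app x := γ.app (x.1.obj, x.2.obj) ≫ (M.μ x.1.property x.2.property).inv
      naturality x y f := by
        have h := M.natural x.1.property y.1.property x.2.property y.2.property f.1.hom f.2.hom
        change G.map (Prod.mkHom (Q.map f.1.hom) (Q.map f.2.hom)) ≫ _ =
          _ ≫ (Q.map f.1.hom ⊗ₘ Q.map f.2.hom)
        rw [reassoc_of% (hγ f.1.hom f.2.hom), ← cancel_mono (M.μ y.1.property y.2.property).hom]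
        simp only [Category.assoc, Iso.inv_hom_id, Category.comp_id, h, Iso.inv_hom_id_assoc] }
  let σ := Localization.liftNatTrans LL (W₀.prod W₀) (LL ⋙ G) (LL ⋙ tensor D) G (tensor D) τ
  have hσ {x y : C} (hx : P x) (hy : P y) :
      σ.app (Q.obj x, Q.obj y) = γ.app (x, y) ≫ (M.μ hx hy).inv := by
    have := Localization.liftNatTrans_app LL (W₀.prod W₀) (LL ⋙ G) (LL ⋙ tensor D) G
      (tensor D) τ (⟨x, hx⟩, ⟨y, hy⟩)
    refine this.trans ?_
    change 𝟙 _ ≫ _ ≫ 𝟙 _ = _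
    rw [Category.id_comp, Category.comp_id]
  refine ⟨σ, fun X Y ↦ ?_, fun σ' hσ' ↦ Localization.natTrans_ext LL (W₀.prod W₀) fun x ↦ ?_⟩
  · let a : (Q.obj (A.R.obj X), Q.obj (A.R.obj Y)) ⟶ (Q.obj X, Q.obj Y) :=
      (Prod.mkHom (Q.map (A.π X)) (Q.map (A.π Y)))
    have : IsIso a := by
      rw [isIso_prod_iff]
      exact ⟨A.isIso X, A.isIso Y⟩
    have h := σ.naturality a
    change _ = _ ≫ (Q.map (A.π X) ⊗ₘ Q.map (A.π Y)) at h
    rw [← cancel_epi (G.map a), hγ, reassoc_of% h, M.map_tensor_lμ A (A.prop X) (A.prop Y),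
      hσ (A.prop X) (A.prop Y), Category.assoc, Iso.inv_hom_id_assoc]
  · change σ'.app (Q.obj x.1.obj, Q.obj x.2.obj) = σ.app (Q.obj x.1.obj, Q.obj x.2.obj)
    rw [hσ x.1.property x.2.property, ← hσ' , M.lμ_eq A x.1.property x.2.property,
      Category.assoc, Iso.hom_inv_id, Category.comp_id]

/-- If the objects satisfying `P` suffice to compute the localization `Q`, then the tensor
product of `D` is a left derived functor of the tensor product of `C`. -/
theorem isRightKanExtension_lax (W₀ : MorphismProperty P.FullSubcategory)
    [W₀.ContainsIdentities] [(P.ι ⋙ Q).IsLocalization W₀] :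
    letI := M.lax A
    (tensor D).IsRightKanExtension (laxTensor Q) := by
  let := M.lax A
  choose σ hσ hσ' using M.existsUnique_comp_laxTensor A W₀
  refine ⟨⟨IsTerminal.ofUniqueHom (fun E ↦ CostructuredArrow.homMk (σ E.left E.hom) ?_)
    fun E f ↦ CostructuredArrow.hom_ext _ _ (hσ' _ _ _ fun X Y ↦ ?_)⟩⟩
  · ext ⟨X, Y⟩
    exact hσ _ _ X Y
  · exact NatTrans.congr_app (CostructuredArrow.w f) (X, Y)

end Left

section Right

variable (A : RightApproximation P Q)

/-- The morphism `Q (X ⊗ Y) ⟶ Q X ⊗ Q Y` obtained by resolving `X` and `Y`. -/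
noncomputable def rδ (X Y : C) : Q.obj (X ⊗ Y) ⟶ Q.obj X ⊗ Q.obj Y :=
  Q.map (A.π X ⊗ₘ A.π Y) ≫ (M.μ (A.prop X) (A.prop Y)).inv ≫
    (inv (Q.map (A.π X)) ⊗ₘ inv (Q.map (A.π Y)))

lemma natural_inv {x x' y y' : C} (hx : P x) (hx' : P x') (hy : P y) (hy' : P y') (f : x ⟶ x')
    (g : y ⟶ y') : (M.μ hx hy).inv ≫ (Q.map f ⊗ₘ Q.map g) = Q.map (f ⊗ₘ g) ≫ (M.μ hx' hy').inv := by
  rw [Iso.inv_comp_eq, ← reassoc_of% (M.natural hx hx' hy hy' f g), Iso.hom_inv_id,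
    Category.comp_id]

/-- The morphism `rδ` can be computed using any morphisms to objects satisfying `P`. -/
lemma rδ_map_tensor {x y X Y : C} (hx : P x) (hy : P y) (p : X ⟶ x) (q : Y ⟶ y) :
    M.rδ A X Y ≫ (Q.map p ⊗ₘ Q.map q) = Q.map (p ⊗ₘ q) ≫ (M.μ hx hy).inv := by
  rw [← cancel_mono (Q.map (A.π x) ⊗ₘ Q.map (A.π y)), Category.assoc, Category.assoc,
    M.natural_inv hx (A.prop x) hy (A.prop y),
    ← Q.map_comp_assoc, tensorHom_comp_tensorHom, ← Q.map_comp, ← Q.map_comp,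
    tensorHom_comp_tensorHom, A.naturality p, A.naturality q, ← tensorHom_comp_tensorHom,
    Q.map_comp, Q.map_comp, Q.map_comp, rδ, Category.assoc, Category.assoc,
    tensorHom_comp_tensorHom,
    IsIso.inv_hom_id_assoc, IsIso.inv_hom_id_assoc, Category.assoc,
    M.natural_inv (A.prop X) (A.prop x) (A.prop Y) (A.prop y)]

lemma rδ_map_tensor_assoc {x y X Y : C} (hx : P x) (hy : P y) (p : X ⟶ x) (q : Y ⟶ y) {Z : D}
    (f : Q.obj x ⊗ Q.obj y ⟶ Z) :
    M.rδ A X Y ≫ (Q.map p ⊗ₘ Q.map q) ≫ f = Q.map (p ⊗ₘ q) ≫ (M.μ hx hy).inv ≫ f := by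
  rw [← Category.assoc, rδ_map_tensor, Category.assoc]

/-- The oplax monoidal structure on `Q`. -/
@[reducible]
noncomputable def oplax : Q.OplaxMonoidal where
  η := M.ε.inv
  δ := M.rδ A
  δ_natural_left {X X'} f Y := by
    rw [← cancel_mono (Q.map (A.π _) ⊗ₘ Q.map (A.π _)), Category.assoc, Category.assoc,
      ← tensorHom_id, tensorHom_comp_tensorHom, M.rδ_map_tensor A (A.prop _) (A.prop _),
      ← Q.map_comp, Category.id_comp, M.rδ_map_tensor A (A.prop _) (A.prop _),
      ← tensorHom_id, ← Q.map_comp_assoc, tensorHom_comp_tensorHom, Category.id_comp]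
  δ_natural_right {Y Y'} X f := by
    rw [← cancel_mono (Q.map (A.π _) ⊗ₘ Q.map (A.π _)), Category.assoc, Category.assoc,
      ← id_tensorHom, tensorHom_comp_tensorHom, M.rδ_map_tensor A (A.prop _) (A.prop _),
      ← Q.map_comp, Category.id_comp, M.rδ_map_tensor A (A.prop _) (A.prop _),
      ← id_tensorHom, ← Q.map_comp_assoc, tensorHom_comp_tensorHom, Category.id_comp]
  oplax_associativity X Y Z := by
    have h1 := M.rδ_map_tensor A (P.prop_tensor (A.prop X) (A.prop Y)) (A.prop Z)
      (A.π X ⊗ₘ A.π Y) (A.π Z)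
    have h2 := M.rδ_map_tensor A (A.prop X) (P.prop_tensor (A.prop Y) (A.prop Z))
      (A.π X) (A.π Y ⊗ₘ A.π Z)
    have e1 : (Q.map (A.π X ⊗ₘ A.π Y) ≫ (M.μ (A.prop X) (A.prop Y)).inv) ⊗ₘ Q.map (A.π Z) =
        (Q.map (A.π X ⊗ₘ A.π Y) ⊗ₘ Q.map (A.π Z)) ≫
          ((M.μ (A.prop X) (A.prop Y)).inv ▷ Q.obj (A.R.obj Z)) := by
      rw [← tensorHom_id, tensorHom_comp_tensorHom, Category.comp_id]
    have e2 : Q.map (A.π X) ⊗ₘ (Q.map (A.π Y ⊗ₘ A.π Z) ≫ (M.μ (A.prop Y) (A.prop Z)).inv) =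
        (Q.map (A.π X) ⊗ₘ Q.map (A.π Y ⊗ₘ A.π Z)) ≫
          (Q.obj (A.R.obj X) ◁ (M.μ (A.prop Y) (A.prop Z)).inv) := by
      rw [← id_tensorHom, tensorHom_comp_tensorHom, Category.comp_id]
    have h3 : (M.μ (P.prop_tensor (A.prop X) (A.prop Y)) (A.prop Z)).inv ≫
        (M.μ (A.prop X) (A.prop Y)).inv ▷ Q.obj (A.R.obj Z) ≫ (α_ _ _ _).hom =
        Q.map (α_ _ _ _).hom ≫ (M.μ (A.prop X) (P.prop_tensor (A.prop Y) (A.prop Z))).inv ≫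
          Q.obj (A.R.obj X) ◁ (M.μ (A.prop Y) (A.prop Z)).inv := by
      rw [Iso.inv_comp_eq, ← cancel_epi ((M.μ (A.prop X) (A.prop Y)).hom ▷ Q.obj (A.R.obj Z)),
        reassoc_of% (M.associativity (A.prop X) (A.prop Y) (A.prop Z)),
        ← comp_whiskerRight_assoc, Iso.hom_inv_id, id_whiskerRight, Category.id_comp,
        Iso.hom_inv_id_assoc, ← MonoidalCategory.whiskerLeft_comp, Iso.hom_inv_id,
        MonoidalCategory.whiskerLeft_id, Category.comp_id]
    rw [← cancel_mono (Q.map (A.π X) ⊗ₘ (Q.map (A.π Y) ⊗ₘ Q.map (A.π Z)))]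
    simp only [Category.assoc]
    rw [← associator_naturality, ← id_tensorHom (Q.obj X) (M.rδ A Y Z),
      ← tensorHom_id (M.rδ A X Y) (Q.obj Z), tensorHom_comp_tensorHom,
      tensorHom_comp_tensorHom_assoc, Category.id_comp, Category.id_comp,
      M.rδ_map_tensor A (A.prop _) (A.prop _), M.rδ_map_tensor A (A.prop _) (A.prop _),
      e1, e2, reassoc_of% h2, Category.assoc, reassoc_of% h1, h3, ← Q.map_comp_assoc,
      associator_naturality, Q.map_comp_assoc]
  oplax_left_unitality X := by
    have h := M.rδ_map_tensor A P.prop_unit (A.prop X) (𝟙 _) (A.π X)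
    rw [Q.map_id, id_tensorHom] at h
    have h' : Q.map (λ_ (A.R.obj X)).inv ≫ (M.μ P.prop_unit (A.prop X)).inv ≫
        M.ε.inv ▷ Q.obj (A.R.obj X) = (λ_ (Q.obj (A.R.obj X))).inv := by
      rw [← cancel_mono (λ_ (Q.obj (A.R.obj X))).hom, Category.assoc, Category.assoc,
        M.left_unitality (A.prop X), ← comp_whiskerRight_assoc, Iso.inv_hom_id, id_whiskerRight,
        Category.id_comp, Iso.inv_hom_id_assoc, ← Q.map_comp, Iso.inv_hom_id, Q.map_id,
        ← M.left_unitality (A.prop X), Iso.inv_hom_id]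
    rw [← cancel_mono (𝟙_ D ◁ Q.map (A.π X))]
    simp only [Category.assoc]
    rw [← leftUnitor_inv_naturality, ← whisker_exchange, reassoc_of% h, id_tensorHom,
      ← Q.map_comp_assoc, ← leftUnitor_inv_naturality, Q.map_comp_assoc, h']
  oplax_right_unitality X := by
    have h := M.rδ_map_tensor A (A.prop X) P.prop_unit (A.π X) (𝟙 _)
    rw [Q.map_id, tensorHom_id] at h
    have h' : Q.map (ρ_ (A.R.obj X)).inv ≫ (M.μ (A.prop X) P.prop_unit).inv ≫
        Q.obj (A.R.obj X) ◁ M.ε.inv = (ρ_ (Q.obj (A.R.obj X))).inv := by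
      rw [← cancel_mono (ρ_ (Q.obj (A.R.obj X))).hom, Category.assoc, Category.assoc,
        M.right_unitality (A.prop X), ← MonoidalCategory.whiskerLeft_comp_assoc, Iso.inv_hom_id,
        MonoidalCategory.whiskerLeft_id, Category.id_comp, Iso.inv_hom_id_assoc, ← Q.map_comp,
        Iso.inv_hom_id, Q.map_id, ← M.right_unitality (A.prop X), Iso.inv_hom_id]
    rw [← cancel_mono (Q.map (A.π X) ▷ 𝟙_ D)]
    simp only [Category.assoc]
    rw [← rightUnitor_inv_naturality, whisker_exchange, reassoc_of% h, tensorHom_id,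
      ← Q.map_comp_assoc, ← rightUnitor_inv_naturality, Q.map_comp_assoc, h']

lemma rδ_eq {x y : C} (hx : P x) (hy : P y) : M.rδ A x y = (M.μ hx hy).inv := by
  simpa using M.rδ_map_tensor A hx hy (𝟙 x) (𝟙 y)

/-- The universal property of the tensor product of `D` as a right derived functor. -/
lemma existsUnique_oplaxTensor_comp (W₀ : MorphismProperty P.FullSubcategory)
    [W₀.ContainsIdentities] [(P.ι ⋙ Q).IsLocalization W₀] (G : D × D ⥤ D)
    (γ : tensor C ⋙ Q ⟶ Q.prod Q ⋙ G) :
    ∃ σ : tensor D ⟶ G, (∀ X Y : C, M.rδ A X Y ≫ σ.app (Q.obj X, Q.obj Y) = γ.app (X, Y)) ∧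
      ∀ σ' : tensor D ⟶ G,
        (∀ X Y : C, M.rδ A X Y ≫ σ'.app (Q.obj X, Q.obj Y) = γ.app (X, Y)) → σ' = σ := by
  let LL := (P.ι ⋙ Q).prod (P.ι ⋙ Q)
  have : LL.IsLocalization (W₀.prod W₀) := inferInstance
  have hγ {X X' Y Y' : C} (f : X ⟶ X') (g : Y ⟶ Y') :
      Q.map (f ⊗ₘ g) ≫ γ.app (X', Y') = γ.app (X, Y) ≫ G.map (Prod.mkHom (Q.map f) (Q.map g)) :=
    γ.naturality (X := (X, Y)) (Y := (X', Y')) (Prod.mkHom f g)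
  let τ : LL ⋙ tensor D ⟶ LL ⋙ G :=
    { app x := (M.μ x.1.property x.2.property).hom ≫ γ.app (x.1.obj, x.2.obj)
      naturality x y f := by
        have h := M.natural x.1.property y.1.property x.2.property y.2.property f.1.hom f.2.hom
        change (Q.map f.1.hom ⊗ₘ Q.map f.2.hom) ≫ _ =
          _ ≫ G.map (Prod.mkHom (Q.map f.1.hom) (Q.map f.2.hom))
        rw [reassoc_of% h, hγ f.1.hom f.2.hom, Category.assoc] }
  let σ := Localization.liftNatTrans LL (W₀.prod W₀) (LL ⋙ tensor D) (LL ⋙ G) (tensor D) G τ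
  have hσ {x y : C} (hx : P x) (hy : P y) :
      σ.app (Q.obj x, Q.obj y) = (M.μ hx hy).hom ≫ γ.app (x, y) := by
    have := Localization.liftNatTrans_app LL (W₀.prod W₀) (LL ⋙ tensor D) (LL ⋙ G) (tensor D)
      G τ (⟨x, hx⟩, ⟨y, hy⟩)
    refine this.trans ?_
    change 𝟙 _ ≫ _ ≫ 𝟙 _ = _
    rw [Category.id_comp, Category.comp_id]
  refine ⟨σ, fun X Y ↦ ?_, fun σ' hσ' ↦ Localization.natTrans_ext LL (W₀.prod W₀) fun x ↦ ?_⟩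
  · let a : (Q.obj X, Q.obj Y) ⟶ (Q.obj (A.R.obj X), Q.obj (A.R.obj Y)) :=
      Prod.mkHom (Q.map (A.π X)) (Q.map (A.π Y))
    have : IsIso a := by
      rw [isIso_prod_iff]
      exact ⟨A.isIso X, A.isIso Y⟩
    have h := σ.naturality a
    change (Q.map (A.π X) ⊗ₘ Q.map (A.π Y)) ≫ _ = _ at h
    rw [← cancel_mono (G.map a), ← hγ, Category.assoc, ← h,
      M.rδ_map_tensor_assoc A (A.prop X) (A.prop Y),
      hσ (A.prop X) (A.prop Y), Iso.inv_hom_id_assoc]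
  · change σ'.app (Q.obj x.1.obj, Q.obj x.2.obj) = σ.app (Q.obj x.1.obj, Q.obj x.2.obj)
    rw [hσ x.1.property x.2.property, ← hσ', M.rδ_eq A x.1.property x.2.property,
      Iso.hom_inv_id_assoc]

/-- If the objects satisfying `P` suffice to compute the localization `Q`, then the tensor
product of `D` is a right derived functor of the tensor product of `C`. -/
theorem isLeftKanExtension_oplax (W₀ : MorphismProperty P.FullSubcategory)
    [W₀.ContainsIdentities] [(P.ι ⋙ Q).IsLocalization W₀] :
    letI := M.oplax A
    (tensor D).IsLeftKanExtension (oplaxTensor Q) := by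
  let := M.oplax A
  choose σ hσ hσ' using M.existsUnique_oplaxTensor_comp A W₀
  refine ⟨⟨IsInitial.ofUniqueHom (fun E ↦ StructuredArrow.homMk (σ E.right E.hom) ?_)
    fun E f ↦ StructuredArrow.hom_ext _ _ (hσ' _ _ _ fun X Y ↦ ?_)⟩⟩
  · ext ⟨X, Y⟩
    exact hσ _ _ X Y
  · exact NatTrans.congr_app (StructuredArrow.w f) (X, Y)

end Right

end MonoidalOn

end

end CategoryTheory

/-! ### Tensor products and shifts -/

namespace CategoryTheory

/-- Natural isomorphisms `X ⊗ Y[n] ≅ (X ⊗ Y)[n]` and `X[n] ⊗ Y ≅ (X ⊗ Y)[n]` for all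
integers `n`. -/
structure TensorShiftData (C : Type*) [Category C] [MonoidalCategory C] [HasShift C ℤ] where
  /-- the isomorphism `X ⊗ Y[n] ≅ (X ⊗ Y)[n]` -/
  lam (n : ℤ) (X Y : C) : X ⊗ Y⟦n⟧ ≅ (X ⊗ Y)⟦n⟧
  /-- the isomorphism `X[n] ⊗ Y ≅ (X ⊗ Y)[n]` -/
  rho (n : ℤ) (X Y : C) : X⟦n⟧ ⊗ Y ≅ (X ⊗ Y)⟦n⟧
  lam_naturality (n : ℤ) {X X' Y Y' : C} (f : X ⟶ X') (g : Y ⟶ Y') :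
    (f ⊗ₘ g⟦n⟧') ≫ (lam n X' Y').hom = (lam n X Y).hom ≫ (f ⊗ₘ g)⟦n⟧'
  rho_naturality (n : ℤ) {X X' Y Y' : C} (f : X ⟶ X') (g : Y ⟶ Y') :
    (f⟦n⟧' ⊗ₘ g) ≫ (rho n X' Y').hom = (rho n X Y).hom ≫ (f ⊗ₘ g)⟦n⟧'

/-- The compatibility of a monoidal structure with all shifts by integers: the isomorphisms
`X ⊗ Y[n] ≅ (X ⊗ Y)[n]` and `X[m] ⊗ Y ≅ (X ⊗ Y)[m]` are compatible with the unitors, and they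
commute up to the sign `(-1)^{mn}`. -/
structure TensorShift (C : Type*) [Category C] [Preadditive C] [MonoidalCategory C]
    [HasShift C ℤ] extends TensorShiftData C where
  lam_unit (n : ℤ) (X : C) : (lam n (𝟙_ C) X).hom ≫ (λ_ X).hom⟦n⟧' = (λ_ (X⟦n⟧)).hom
  rho_unit (n : ℤ) (X : C) : (rho n X (𝟙_ C)).hom ≫ (ρ_ X).hom⟦n⟧' = (ρ_ (X⟦n⟧)).hom
  anticomm (m n : ℤ) (X Y : C) :
    (rho m X (Y⟦n⟧)).hom ≫ (lam n X Y).hom⟦m⟧' = (m * n).negOnePow •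
      ((lam n (X⟦m⟧) Y).hom ≫ (rho m X Y).hom⟦n⟧' ≫ (shiftFunctorComm C m n).hom.app (X ⊗ Y))

end CategoryTheory

namespace CochainComplex

variable {B : Type u} [Category.{v} B] [Abelian B] [MonoidalCategory B] [MonoidalPreadditive B]
  [HasGoodCoproducts B]

lemma whiskerLeft_shift_comp (n : ℤ) (X : CochainComplex B ℤ) {Y Y' : CochainComplex B ℤ}
    (g : Y ⟶ Y') :
    (X ◁ g⟦n⟧') ≫ (mapBifunctorShift₂Iso X Y' (curriedTensor B) n).hom =
      (mapBifunctorShift₂Iso X Y (curriedTensor B) n).hom ≫ (X ◁ g)⟦n⟧' :=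
  mapBifunctorShift₂Iso_hom_naturality₂ X g (curriedTensor B) n

lemma whiskerRight_comp_shift (n : ℤ) {X X' : CochainComplex B ℤ} (Y : CochainComplex B ℤ)
    (f : X ⟶ X') :
    (f ▷ (Y⟦n⟧)) ≫ (mapBifunctorShift₂Iso X' Y (curriedTensor B) n).hom =
      (mapBifunctorShift₂Iso X Y (curriedTensor B) n).hom ≫ (f ▷ Y)⟦n⟧' :=
  (NatTrans.shift_app_comm ((curriedTensor B).map₂CochainComplex.map f) n Y).symm

lemma shift_whiskerRight_comp (n : ℤ) {X X' : CochainComplex B ℤ} (Y : CochainComplex B ℤ)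
    (f : X ⟶ X') :
    (f⟦n⟧' ▷ Y) ≫ (mapBifunctorShift₁Iso X' Y (curriedTensor B) n).hom =
      (mapBifunctorShift₁Iso X Y (curriedTensor B) n).hom ≫ (f ▷ Y)⟦n⟧' :=
  mapBifunctorShift₁Iso_hom_naturality₁ f Y (curriedTensor B) n

lemma whiskerLeft_comp_shift (n : ℤ) (X : CochainComplex B ℤ) {Y Y' : CochainComplex B ℤ}
    (g : Y ⟶ Y') :
    ((X⟦n⟧) ◁ g) ≫ (mapBifunctorShift₁Iso X Y' (curriedTensor B) n).hom =
      (mapBifunctorShift₁Iso X Y (curriedTensor B) n).hom ≫ (X ◁ g)⟦n⟧' :=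
  (NatTrans.shift_app_comm ((curriedTensor B).map₂CochainComplex.flip.map g) n X).symm

lemma leftUnitor_inv_f (X : CochainComplex B ℤ) (i : ℤ) :
    (λ_ X).inv.f i = (λ_ (X.X i)).inv ≫
      ((HomologicalComplex.singleObjXSelf (ComplexShape.up ℤ) 0 (𝟙_ B)).inv ▷ (X.X i)) ≫
      ιMapBifunctor (𝟙_ (CochainComplex B ℤ)) X (curriedTensor B) 0 i i (zero_add i) :=
  HomologicalComplex.leftUnitor'_inv X i

lemma rightUnitor_inv_f (X : CochainComplex B ℤ) (i : ℤ) :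
    (ρ_ X).inv.f i = (ρ_ (X.X i)).inv ≫
      ((X.X i) ◁ (HomologicalComplex.singleObjXSelf (ComplexShape.up ℤ) 0 (𝟙_ B)).inv) ≫
      ιMapBifunctor X (𝟙_ (CochainComplex B ℤ)) (curriedTensor B) i 0 i (add_zero i) :=
  HomologicalComplex.rightUnitor'_inv X i

lemma leftUnitor_inv_shift (n : ℤ) (X : CochainComplex B ℤ) :
    (λ_ (X⟦n⟧)).inv ≫ (mapBifunctorShift₂Iso (𝟙_ _) X (curriedTensor B) n).hom =
      (λ_ X).inv⟦n⟧' := by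
  apply HomologicalComplex.hom_ext
  intro m
  rw [HomologicalComplex.comp_f, leftUnitor_inv_f, Category.assoc, Category.assoc,
    ι_mapBifunctorShift₂Iso_hom_f _ _ _ _ _ _ _ _ (m + n) (m + n) rfl rfl, shiftFunctor_map_f',
    leftUnitor_inv_f, zero_mul, Int.negOnePow_zero, one_smul]
  refine congrArg (_ ≫ _ ≫ ·) ?_
  exact (((curriedTensor B).obj _).map_id (X.X (m + n)) =≫ _).trans
    ((Category.id_comp _).trans (Category.comp_id _))

lemma rightUnitor_inv_shift (n : ℤ) (X : CochainComplex B ℤ) :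
    (ρ_ (X⟦n⟧)).inv ≫ (mapBifunctorShift₁Iso X (𝟙_ _) (curriedTensor B) n).hom =
      (ρ_ X).inv⟦n⟧' := by
  apply HomologicalComplex.hom_ext
  intro m
  rw [HomologicalComplex.comp_f, rightUnitor_inv_f, Category.assoc, Category.assoc,
    ι_mapBifunctorShift₁Iso_hom_f _ _ _ _ _ _ _ _ (m + n) (m + n) rfl rfl, shiftFunctor_map_f',
    rightUnitor_inv_f]
  refine congrArg (_ ≫ _ ≫ ·) ?_
  exact (((curriedTensor B).flip.obj _).map_id (X.X (m + n)) =≫ _).trans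
    ((Category.id_comp _).trans (Category.comp_id _))

variable (B)

/-- The shift isomorphisms of the tensor product of complexes. -/
noncomputable def tensorShift : TensorShift (CochainComplex B ℤ) where
  lam n K L := mapBifunctorShift₂Iso K L (curriedTensor B) n
  rho n K L := mapBifunctorShift₁Iso K L (curriedTensor B) n
  lam_naturality n {X X' Y Y'} f g := by
    rw [MonoidalCategory.tensorHom_def, Category.assoc, whiskerLeft_shift_comp,
      reassoc_of% (whiskerRight_comp_shift n Y f), ← Functor.map_comp,
      ← MonoidalCategory.tensorHom_def]
  rho_naturality n {X X' Y Y'} f g := by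
    rw [MonoidalCategory.tensorHom_def, Category.assoc, whiskerLeft_comp_shift,
      reassoc_of% (shift_whiskerRight_comp n Y f), ← Functor.map_comp,
      ← MonoidalCategory.tensorHom_def]
  lam_unit n X := by
    rw [← cancel_epi (λ_ (X⟦n⟧)).inv, reassoc_of% (leftUnitor_inv_shift n X), ← Functor.map_comp,
      Iso.inv_hom_id, Iso.inv_hom_id, CategoryTheory.Functor.map_id]
  rho_unit n X := by
    rw [← cancel_epi (ρ_ (X⟦n⟧)).inv, reassoc_of% (rightUnitor_inv_shift n X), ← Functor.map_comp,
      Iso.inv_hom_id, Iso.inv_hom_id, CategoryTheory.Functor.map_id]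
  anticomm m n X Y := congr_arg Iso.hom
    (mapBifunctorShift₁Iso_trans_mapBifunctorShift₂Iso X Y (curriedTensor B) m n)

end CochainComplex

/-! ### Monoidal functors that commute with shifts -/

namespace CategoryTheory.TensorShiftData

open Functor.LaxMonoidal

section

variable {C D : Type*} [Category C] [Category D] [MonoidalCategory C] [MonoidalCategory D]
  [HasShift C ℤ] [HasShift D ℤ] (T : TensorShiftData C) (T' : TensorShiftData D)
  (F : C ⥤ D) [F.Monoidal] [F.CommShift ℤ]

/-- A monoidal functor that commutes with shifts is compatible with given shift isomorphisms of
the tensor products. -/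
structure Compatible : Prop where
  lam (n : ℤ) (X Y : C) : F.obj X ◁ (F.commShiftIso n).hom.app Y ≫
    (T'.lam n (F.obj X) (F.obj Y)).hom ≫ (μ F X Y)⟦n⟧' =
      μ F X (Y⟦n⟧) ≫ F.map (T.lam n X Y).hom ≫ (F.commShiftIso n).hom.app (X ⊗ Y)
  rho (n : ℤ) (X Y : C) : (F.commShiftIso n).hom.app X ▷ F.obj Y ≫
    (T'.rho n (F.obj X) (F.obj Y)).hom ≫ (μ F X Y)⟦n⟧' =
      μ F (X⟦n⟧) Y ≫ F.map (T.rho n X Y).hom ≫ (F.commShiftIso n).hom.app (X ⊗ Y)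

variable {T T' F}

namespace Compatible

lemma lam_unit_iff (h : Compatible T T' F) (n : ℤ) (X : C) :
    (T'.lam n (𝟙_ D) (F.obj X)).hom ≫ (λ_ (F.obj X)).hom⟦n⟧' = (λ_ ((F.obj X)⟦n⟧)).hom ↔
      F.map ((T.lam n (𝟙_ C) X).hom ≫ (λ_ X).hom⟦n⟧') = F.map (λ_ (X⟦n⟧)).hom := by
  have h1 : 𝟙_ D ◁ (F.commShiftIso n).hom.app X ≫
      (T'.lam n (𝟙_ D) (F.obj X)).hom ≫ (λ_ (F.obj X)).hom⟦n⟧' =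
      ε F ▷ F.obj (X⟦n⟧) ≫ μ F (𝟙_ C) (X⟦n⟧) ≫ F.map ((T.lam n (𝟙_ C) X).hom ≫ (λ_ X).hom⟦n⟧') ≫
        (F.commShiftIso n).hom.app X := by
    have e1 := T'.lam_naturality n (ε F) (𝟙 (F.obj X))
    rw [CategoryTheory.Functor.map_id, tensorHom_id, tensorHom_id] at e1
    have e2 := (F.commShiftIso n).hom.naturality (λ_ X).hom
    have e3 := whisker_exchange (ε F) ((F.commShiftIso n).hom.app X)
    dsimp at e2 e3
    rw [F.map_comp, Category.assoc, e2, ← reassoc_of% (h.lam n (𝟙_ C) X), left_unitality F X,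
      Functor.map_comp, Functor.map_comp, ← reassoc_of% e1, reassoc_of% e3]
  have h2 : 𝟙_ D ◁ (F.commShiftIso n).hom.app X ≫ (λ_ ((F.obj X)⟦n⟧)).hom =
      ε F ▷ F.obj (X⟦n⟧) ≫ μ F (𝟙_ C) (X⟦n⟧) ≫ F.map (λ_ (X⟦n⟧)).hom ≫
        (F.commShiftIso n).hom.app X := by
    have e2 := leftUnitor_naturality ((F.commShiftIso n).hom.app X)
    dsimp at e2
    rw [e2, left_unitality]
    simp only [Category.assoc]
  rw [← cancel_epi (𝟙_ D ◁ (F.commShiftIso n).hom.app X), h1, h2, cancel_epi, cancel_epi,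
    cancel_mono]

lemma rho_unit_iff (h : Compatible T T' F) (n : ℤ) (X : C) :
    (T'.rho n (F.obj X) (𝟙_ D)).hom ≫ (ρ_ (F.obj X)).hom⟦n⟧' = (ρ_ ((F.obj X)⟦n⟧)).hom ↔
      F.map ((T.rho n X (𝟙_ C)).hom ≫ (ρ_ X).hom⟦n⟧') = F.map (ρ_ (X⟦n⟧)).hom := by
  have h1 : (F.commShiftIso n).hom.app X ▷ 𝟙_ D ≫
      (T'.rho n (F.obj X) (𝟙_ D)).hom ≫ (ρ_ (F.obj X)).hom⟦n⟧' =
      F.obj (X⟦n⟧) ◁ ε F ≫ μ F (X⟦n⟧) (𝟙_ C) ≫ F.map ((T.rho n X (𝟙_ C)).hom ≫ (ρ_ X).hom⟦n⟧') ≫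
        (F.commShiftIso n).hom.app X := by
    have e1 := T'.rho_naturality n (𝟙 (F.obj X)) (ε F)
    rw [CategoryTheory.Functor.map_id, id_tensorHom, id_tensorHom] at e1
    have e2 := (F.commShiftIso n).hom.naturality (ρ_ X).hom
    have e3 := whisker_exchange ((F.commShiftIso n).hom.app X) (ε F)
    dsimp at e2 e3
    rw [F.map_comp, Category.assoc, e2, ← reassoc_of% (h.rho n X (𝟙_ C)), right_unitality F X,
      Functor.map_comp, Functor.map_comp, ← reassoc_of% e1, ← reassoc_of% e3]
  have h2 : (F.commShiftIso n).hom.app X ▷ 𝟙_ D ≫ (ρ_ ((F.obj X)⟦n⟧)).hom =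
      F.obj (X⟦n⟧) ◁ ε F ≫ μ F (X⟦n⟧) (𝟙_ C) ≫ F.map (ρ_ (X⟦n⟧)).hom ≫
        (F.commShiftIso n).hom.app X := by
    have e2 := rightUnitor_naturality ((F.commShiftIso n).hom.app X)
    dsimp at e2
    rw [e2, right_unitality]
    simp only [Category.assoc]
  rw [← cancel_epi ((F.commShiftIso n).hom.app X ▷ 𝟙_ D), h1, h2, cancel_epi, cancel_epi,
    cancel_mono]

/-- One side of the anticommutation law for `F X` and `F Y`, in terms of that for `X` and `Y`. -/
lemma rho_lam (h : Compatible T T' F) (m n : ℤ) (X Y : C) :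
    ((F.commShiftIso m).hom.app X ⊗ₘ (F.commShiftIso n).hom.app Y) ≫
      (T'.rho m (F.obj X) ((F.obj Y)⟦n⟧)).hom ≫ (T'.lam n (F.obj X) (F.obj Y)).hom⟦m⟧' ≫
        ((μ F X Y)⟦n⟧')⟦m⟧' =
      μ F (X⟦m⟧) (Y⟦n⟧) ≫ F.map ((T.rho m X (Y⟦n⟧)).hom ≫ (T.lam n X Y).hom⟦m⟧') ≫
        (F.commShiftIso m).hom.app ((X ⊗ Y)⟦n⟧) ≫ ((F.commShiftIso n).hom.app (X ⊗ Y))⟦m⟧' := by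
  have e1 := T'.rho_naturality m (𝟙 (F.obj X)) ((F.commShiftIso n).hom.app Y)
  rw [CategoryTheory.Functor.map_id, id_tensorHom, id_tensorHom] at e1
  have e2 := (F.commShiftIso m).hom.naturality (T.lam n X Y).hom
  have e3 := congr_arg (fun f ↦ f⟦m⟧') (h.lam n X Y)
  dsimp at e1 e2 e3
  simp only [Functor.map_comp] at e3
  rw [MonoidalCategory.tensorHom_def, F.map_comp]
  simp only [Category.assoc]
  dsimp
  rw [reassoc_of% e1, e3, reassoc_of% (h.rho m X (Y⟦n⟧)), reassoc_of% e2]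

/-- The other side of the anticommutation law for `F X` and `F Y`, in terms of that for `X`
and `Y`. -/
lemma lam_rho (h : Compatible T T' F) (m n : ℤ) (X Y : C) :
    ((F.commShiftIso m).hom.app X ⊗ₘ (F.commShiftIso n).hom.app Y) ≫
      (T'.lam n ((F.obj X)⟦m⟧) (F.obj Y)).hom ≫ (T'.rho m (F.obj X) (F.obj Y)).hom⟦n⟧' ≫
        ((μ F X Y)⟦m⟧')⟦n⟧' =
      μ F (X⟦m⟧) (Y⟦n⟧) ≫ F.map ((T.lam n (X⟦m⟧) Y).hom ≫ (T.rho m X Y).hom⟦n⟧') ≫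
        (F.commShiftIso n).hom.app ((X ⊗ Y)⟦m⟧) ≫ ((F.commShiftIso m).hom.app (X ⊗ Y))⟦n⟧' := by
  have e1 := T'.lam_naturality n ((F.commShiftIso m).hom.app X) (𝟙 (F.obj Y))
  rw [CategoryTheory.Functor.map_id, tensorHom_id, tensorHom_id] at e1
  have e2 := (F.commShiftIso n).hom.naturality (T.rho m X Y).hom
  have e3 := congr_arg (fun f ↦ f⟦n⟧') (h.rho m X Y)
  dsimp at e1 e2 e3
  simp only [Functor.map_comp] at e3
  rw [MonoidalCategory.tensorHom_def', F.map_comp]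
  simp only [Category.assoc]
  dsimp
  rw [reassoc_of% e1, e3, reassoc_of% (h.lam n (X⟦m⟧) Y), reassoc_of% e2]

lemma anticomm_iff (h : Compatible T T' F) [Preadditive C] [Preadditive D] [F.Additive]
    (m n : ℤ) (X Y : C) :
    (T'.rho m (F.obj X) ((F.obj Y)⟦n⟧)).hom ≫ (T'.lam n (F.obj X) (F.obj Y)).hom⟦m⟧' =
      (m * n).negOnePow • ((T'.lam n ((F.obj X)⟦m⟧) (F.obj Y)).hom ≫
        (T'.rho m (F.obj X) (F.obj Y)).hom⟦n⟧' ≫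
          (shiftFunctorComm D m n).hom.app (F.obj X ⊗ F.obj Y)) ↔
    F.map ((T.rho m X (Y⟦n⟧)).hom ≫ (T.lam n X Y).hom⟦m⟧') = F.map ((m * n).negOnePow •
      ((T.lam n (X⟦m⟧) Y).hom ≫ (T.rho m X Y).hom⟦n⟧' ≫
        (shiftFunctorComm C m n).hom.app (X ⊗ Y))) := by
  have e1 := (shiftFunctorComm D m n).hom.naturality (μ F X Y)
  dsimp at e1
  have e2 : F.map ((shiftFunctorComm C m n).hom.app (X ⊗ Y)) ≫
      (F.commShiftIso m).hom.app ((X ⊗ Y)⟦n⟧) ≫ ((F.commShiftIso n).hom.app (X ⊗ Y))⟦m⟧' =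
      (F.commShiftIso n).hom.app ((X ⊗ Y)⟦m⟧) ≫ ((F.commShiftIso m).hom.app (X ⊗ Y))⟦n⟧' ≫
        (shiftFunctorComm D m n).hom.app (F.obj (X ⊗ Y)) := by
    rw [F.map_shiftFunctorComm]
    simp only [Category.assoc, Iso.inv_hom_id_app_assoc]
    dsimp
    rw [← Functor.map_comp, Iso.inv_hom_id_app]
    dsimp
    rw [CategoryTheory.Functor.map_id, Category.comp_id]
  rw [← cancel_epi ((F.commShiftIso m).hom.app X ⊗ₘ (F.commShiftIso n).hom.app Y),
    ← cancel_mono (((μ F X Y)⟦n⟧')⟦m⟧'), Category.assoc, Category.assoc, h.rho_lam,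
    Linear.comp_units_smul, Linear.units_smul_comp, Functor.map_units_smul, Category.assoc,
    Category.assoc, Category.assoc, ← e1, reassoc_of% (h.lam_rho m n X Y), ← e2,
    ← Linear.comp_units_smul, cancel_epi, ← F.map_comp_assoc, ← Linear.units_smul_comp, cancel_mono,
    Category.assoc]

end Compatible

end

end CategoryTheory.TensorShiftData

namespace CategoryTheory.TensorShift

section

variable {C : Type*} [Category C] [HasShift C ℤ] (P : ObjectProperty C)
  [P.IsStableUnderShift ℤ]

/-- The isomorphism between the shift in a full subcategory and the shift in the ambient
category. -/
noncomputable def shiftObjIso (n : ℤ) (X : P.FullSubcategory) : (X⟦n⟧).obj ≅ X.obj⟦n⟧ :=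
  (P.ι.commShiftIso n).app X

lemma shiftObjIso_naturality (n : ℤ) {X Y : P.FullSubcategory} (f : X ⟶ Y) :
    (f⟦n⟧').hom ≫ (shiftObjIso P n Y).hom = (shiftObjIso P n X).hom ≫ f.hom⟦n⟧' :=
  (P.ι.commShiftIso n).hom.naturality f

end

variable {C : Type*} [Category C] [Preadditive C] [MonoidalCategory C] [HasShift C ℤ]
  (T : TensorShift C) (P : ObjectProperty C) [P.IsMonoidal] [P.IsStableUnderShift ℤ]

/-- The isomorphism `X ⊗ Y[n] ≅ (X ⊗ Y)[n]` in a full subcategory, as an isomorphism in the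
ambient category. -/
noncomputable def subLam (n : ℤ) (X Y : P.FullSubcategory) : (X ⊗ Y⟦n⟧).obj ≅ ((X ⊗ Y)⟦n⟧).obj :=
  whiskerLeftIso X.obj (shiftObjIso P n Y) ≪≫ T.lam n X.obj Y.obj ≪≫
    (shiftObjIso P n (X ⊗ Y)).symm

/-- The isomorphism `X[n] ⊗ Y ≅ (X ⊗ Y)[n]` in a full subcategory, as an isomorphism in the
ambient category. -/
noncomputable def subRho (n : ℤ) (X Y : P.FullSubcategory) : (X⟦n⟧ ⊗ Y).obj ≅ ((X ⊗ Y)⟦n⟧).obj :=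
  whiskerRightIso (shiftObjIso P n X) Y.obj ≪≫ T.rho n X.obj Y.obj ≪≫
    (shiftObjIso P n (X ⊗ Y)).symm

lemma subLam_comp (n : ℤ) (X Y : P.FullSubcategory) :
    (T.subLam P n X Y).hom ≫ (shiftObjIso P n (X ⊗ Y)).hom =
      X.obj ◁ (shiftObjIso P n Y).hom ≫ (T.lam n X.obj Y.obj).hom := by
  simp [subLam]

lemma subRho_comp (n : ℤ) (X Y : P.FullSubcategory) :
    (T.subRho P n X Y).hom ≫ (shiftObjIso P n (X ⊗ Y)).hom =
      (shiftObjIso P n X).hom ▷ Y.obj ≫ (T.rho n X.obj Y.obj).hom := by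
  simp [subRho]

/-- The isomorphisms `X ⊗ Y[n] ≅ (X ⊗ Y)[n]` and `X[n] ⊗ Y ≅ (X ⊗ Y)[n]` in a full
subcategory. -/
noncomputable def subData : TensorShiftData P.FullSubcategory where
  lam n X Y := P.isoMk (T.subLam P n X Y)
  rho n X Y := P.isoMk (T.subRho P n X Y)
  lam_naturality n {X X' Y Y'} f g := by
    apply P.hom_ext
    change (f.hom ⊗ₘ (g⟦n⟧').hom) ≫ (T.subLam P n X' Y').hom =
      (T.subLam P n X Y).hom ≫ ((f ⊗ₘ g)⟦n⟧').hom
    rw [← cancel_mono (shiftObjIso P n (X' ⊗ Y')).hom, Category.assoc, Category.assoc,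
      shiftObjIso_naturality, subLam_comp, reassoc_of% (T.subLam_comp P n X Y),
      ← id_tensorHom, tensorHom_comp_tensorHom_assoc, shiftObjIso_naturality, Category.comp_id]
    change _ = _ ≫ _ ≫ (f.hom ⊗ₘ g.hom)⟦n⟧'
    rw [← T.lam_naturality, ← id_tensorHom, tensorHom_comp_tensorHom_assoc, Category.id_comp]
  rho_naturality n {X X' Y Y'} f g := by
    apply P.hom_ext
    change ((f⟦n⟧').hom ⊗ₘ g.hom) ≫ (T.subRho P n X' Y').hom =
      (T.subRho P n X Y).hom ≫ ((f ⊗ₘ g)⟦n⟧').hom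
    rw [← cancel_mono (shiftObjIso P n (X' ⊗ Y')).hom, Category.assoc, Category.assoc,
      shiftObjIso_naturality, subRho_comp, reassoc_of% (T.subRho_comp P n X Y),
      ← tensorHom_id, tensorHom_comp_tensorHom_assoc, shiftObjIso_naturality, Category.comp_id]
    change _ = _ ≫ _ ≫ (f.hom ⊗ₘ g.hom)⟦n⟧'
    rw [← T.rho_naturality, ← tensorHom_id, tensorHom_comp_tensorHom_assoc, Category.id_comp]

lemma subData_compatible : (T.subData P).Compatible T.toTensorShiftData P.ι where
  lam n X Y := by
    change X.obj ◁ (shiftObjIso P n Y).hom ≫ (T.lam n X.obj Y.obj).hom ≫ (𝟙 (X.obj ⊗ Y.obj))⟦n⟧' =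
      𝟙 (X.obj ⊗ (Y⟦n⟧).obj) ≫ (T.subLam P n X Y).hom ≫ (shiftObjIso P n (X ⊗ Y)).hom
    rw [subLam_comp, CategoryTheory.Functor.map_id, Category.comp_id, Category.id_comp]
  rho n X Y := by
    change (shiftObjIso P n X).hom ▷ Y.obj ≫ (T.rho n X.obj Y.obj).hom ≫ (𝟙 (X.obj ⊗ Y.obj))⟦n⟧' =
      𝟙 ((X⟦n⟧).obj ⊗ Y.obj) ≫ (T.subRho P n X Y).hom ≫ (shiftObjIso P n (X ⊗ Y)).hom
    rw [subRho_comp, CategoryTheory.Functor.map_id, Category.comp_id, Category.id_comp]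

/-- The restriction of shift isomorphisms to a full subcategory. -/
noncomputable def fullSubcategory : TensorShift P.FullSubcategory where
  toTensorShiftData := T.subData P
  lam_unit n X := P.ι.map_injective
    (((T.subData_compatible P).lam_unit_iff n X).1 (T.lam_unit n _))
  rho_unit n X := P.ι.map_injective
    (((T.subData_compatible P).rho_unit_iff n X).1 (T.rho_unit n _))
  anticomm m n X Y := P.ι.map_injective
    (((T.subData_compatible P).anticomm_iff m n X Y).1 (T.anticomm m n _ _))

end CategoryTheory.TensorShift

/-! ### Shift isomorphisms on monoidal localizations -/

namespace CategoryTheory.TensorShiftData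

open Functor.LaxMonoidal

section

variable {D : Type*} [Category D] [MonoidalCategory D] [HasShift D ℤ] (T : TensorShiftData D)

lemma lam_unit_of_iso (n : ℤ) {X X' : D} (e : X ≅ X')
    (h : (T.lam n (𝟙_ D) X).hom ≫ (λ_ X).hom⟦n⟧' = (λ_ (X⟦n⟧)).hom) :
    (T.lam n (𝟙_ D) X').hom ≫ (λ_ X').hom⟦n⟧' = (λ_ (X'⟦n⟧)).hom := by
  have h1 := T.lam_naturality n (𝟙 (𝟙_ D)) e.hom
  rw [← cancel_epi (𝟙_ D ◁ e.hom⟦n⟧'), leftUnitor_naturality, ← h, Category.assoc,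
    ← Functor.map_comp, ← leftUnitor_naturality, Functor.map_comp, ← id_tensorHom, ← id_tensorHom,
    reassoc_of% h1]

lemma rho_unit_of_iso (n : ℤ) {X X' : D} (e : X ≅ X')
    (h : (T.rho n X (𝟙_ D)).hom ≫ (ρ_ X).hom⟦n⟧' = (ρ_ (X⟦n⟧)).hom) :
    (T.rho n X' (𝟙_ D)).hom ≫ (ρ_ X').hom⟦n⟧' = (ρ_ (X'⟦n⟧)).hom := by
  have h1 := T.rho_naturality n e.hom (𝟙 (𝟙_ D))
  rw [← cancel_epi (e.hom⟦n⟧' ▷ 𝟙_ D), rightUnitor_naturality, ← h, Category.assoc,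
    ← Functor.map_comp, ← rightUnitor_naturality, Functor.map_comp, ← tensorHom_id, ← tensorHom_id,
    reassoc_of% h1]

lemma anticomm_of_iso [Preadditive D] (m n : ℤ) {X X' Y Y' : D} (e : X ≅ X') (f : Y ≅ Y')
    (h : (T.rho m X (Y⟦n⟧)).hom ≫ (T.lam n X Y).hom⟦m⟧' = (m * n).negOnePow •
      ((T.lam n (X⟦m⟧) Y).hom ≫ (T.rho m X Y).hom⟦n⟧' ≫
        (shiftFunctorComm D m n).hom.app (X ⊗ Y))) :
    (T.rho m X' (Y'⟦n⟧)).hom ≫ (T.lam n X' Y').hom⟦m⟧' = (m * n).negOnePow •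
      ((T.lam n (X'⟦m⟧) Y').hom ≫ (T.rho m X' Y').hom⟦n⟧' ≫
        (shiftFunctorComm D m n).hom.app (X' ⊗ Y')) := by
  have h1 := T.lam_naturality n e.hom f.hom
  have h2 := T.rho_naturality m e.hom f.hom
  have h3 := T.rho_naturality m e.hom (f.hom⟦n⟧')
  have h4 := T.lam_naturality n (e.hom⟦m⟧') f.hom
  have h5 := (shiftFunctorComm D m n).hom.naturality (e.hom ⊗ₘ f.hom)
  dsimp at h5
  rw [← cancel_epi (e.hom⟦m⟧' ⊗ₘ f.hom⟦n⟧'), reassoc_of% h3, ← Functor.map_comp, h1,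
    Linear.comp_units_smul, reassoc_of% h4, ← Functor.map_comp_assoc, h2, Functor.map_comp,
    Functor.map_comp, reassoc_of% h, Category.assoc, h5, Linear.units_smul_comp, Category.assoc,
    Category.assoc]

end

section

variable {C D : Type*} [Category C] [Category D] [MonoidalCategory C] [MonoidalCategory D]
  [HasShift C ℤ] [HasShift D ℤ] (T : TensorShiftData C)
  (F : C ⥤ D) [F.Monoidal] [F.CommShift ℤ]

/-- The isomorphism `F X ⊗ (F Y)[n] ≅ (F X ⊗ F Y)[n]` that is compatible with a given isomorphism
`X ⊗ Y[n] ≅ (X ⊗ Y)[n]`. -/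
noncomputable def mapLam (n : ℤ) (X Y : C) : F.obj X ⊗ (F.obj Y)⟦n⟧ ≅ (F.obj X ⊗ F.obj Y)⟦n⟧ :=
  (whiskerLeftIso (F.obj X) ((F.commShiftIso n).app Y)).symm ≪≫
    Functor.Monoidal.μIso F X (Y⟦n⟧) ≪≫ F.mapIso (T.lam n X Y) ≪≫ (F.commShiftIso n).app (X ⊗ Y) ≪≫
      (shiftFunctor D n).mapIso (Functor.Monoidal.μIso F X Y).symm

/-- The isomorphism `(F X)[n] ⊗ F Y ≅ (F X ⊗ F Y)[n]` that is compatible with a given isomorphism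
`X[n] ⊗ Y ≅ (X ⊗ Y)[n]`. -/
noncomputable def mapRho (n : ℤ) (X Y : C) : (F.obj X)⟦n⟧ ⊗ F.obj Y ≅ (F.obj X ⊗ F.obj Y)⟦n⟧ :=
  (whiskerRightIso ((F.commShiftIso n).app X) (F.obj Y)).symm ≪≫
    Functor.Monoidal.μIso F (X⟦n⟧) Y ≪≫ F.mapIso (T.rho n X Y) ≪≫ (F.commShiftIso n).app (X ⊗ Y) ≪≫
      (shiftFunctor D n).mapIso (Functor.Monoidal.μIso F X Y).symm

lemma mapLam_comp (n : ℤ) (X Y : C) : F.obj X ◁ (F.commShiftIso n).hom.app Y ≫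
    (T.mapLam F n X Y).hom ≫ (μ F X Y)⟦n⟧' =
      μ F X (Y⟦n⟧) ≫ F.map (T.lam n X Y).hom ≫ (F.commShiftIso n).hom.app (X ⊗ Y) := by
  have := (whiskerLeftIso (F.obj X) ((F.commShiftIso n).app Y)).hom_inv_id_assoc
    (μ F X (Y⟦n⟧) ≫ F.map (T.lam n X Y).hom ≫ (F.commShiftIso n).hom.app (X ⊗ Y))
  refine Eq.trans ?_ this
  have h : (Functor.Monoidal.μIso F X Y).inv⟦n⟧' ≫ (μ F X Y)⟦n⟧' = 𝟙 _ :=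
    ((shiftFunctor D n).mapIso (Functor.Monoidal.μIso F X Y)).inv_hom_id
  simp only [mapLam, Iso.trans_hom, Category.assoc]
  dsimp
  rw [h, Category.comp_id]
  rfl

lemma mapRho_comp (n : ℤ) (X Y : C) : (F.commShiftIso n).hom.app X ▷ F.obj Y ≫
    (T.mapRho F n X Y).hom ≫ (μ F X Y)⟦n⟧' =
      μ F (X⟦n⟧) Y ≫ F.map (T.rho n X Y).hom ≫ (F.commShiftIso n).hom.app (X ⊗ Y) := by
  have := (whiskerRightIso ((F.commShiftIso n).app X) (F.obj Y)).hom_inv_id_assoc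
    (μ F (X⟦n⟧) Y ≫ F.map (T.rho n X Y).hom ≫ (F.commShiftIso n).hom.app (X ⊗ Y))
  refine Eq.trans ?_ this
  have h : (Functor.Monoidal.μIso F X Y).inv⟦n⟧' ≫ (μ F X Y)⟦n⟧' = 𝟙 _ :=
    ((shiftFunctor D n).mapIso (Functor.Monoidal.μIso F X Y)).inv_hom_id
  simp only [mapRho, Iso.trans_hom, Category.assoc]
  dsimp
  rw [h, Category.comp_id]
  rfl

lemma mapLam_naturality (n : ℤ) {X X' Y Y' : C} (f : X ⟶ X') (g : Y ⟶ Y') :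
    (F.map f ⊗ₘ (F.map g)⟦n⟧') ≫ (T.mapLam F n X' Y').hom =
      (T.mapLam F n X Y).hom ≫ (F.map f ⊗ₘ F.map g)⟦n⟧' := by
  have e1 := (F.commShiftIso n).hom.naturality g
  have e2 := (F.commShiftIso n).hom.naturality (f ⊗ₘ g)
  have e3 : (F.map f ⊗ₘ F.map g)⟦n⟧' ≫ (μ F X' Y')⟦n⟧' =
    (μ F X Y)⟦n⟧' ≫ (F.map (f ⊗ₘ g))⟦n⟧' := by
    rw [← Functor.map_comp, μ_natural, Functor.map_comp]
  dsimp at e1 e2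
  have e4 : (F.obj X ◁ (F.commShiftIso n).hom.app Y) ≫ (F.map f ⊗ₘ (F.map g)⟦n⟧') =
      (F.map f ⊗ₘ F.map (g⟦n⟧')) ≫ (F.obj X' ◁ (F.commShiftIso n).hom.app Y') := by
    rw [← id_tensorHom, ← id_tensorHom]
    dsimp
    rw [tensorHom_comp_tensorHom, tensorHom_comp_tensorHom, e1, Category.id_comp, Category.comp_id]
  have : IsIso (F.obj X ◁ (F.commShiftIso n).hom.app Y) := inferInstance
  rw [← cancel_epi (F.obj X ◁ (F.commShiftIso n).hom.app Y), ← cancel_mono ((μ F X' Y')⟦n⟧'),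
    reassoc_of% e4, Category.assoc, Category.assoc, Category.assoc, Category.assoc, mapLam_comp, e3,
    reassoc_of% (T.mapLam_comp F n X Y), μ_natural_assoc, ← F.map_comp_assoc, T.lam_naturality,
    F.map_comp_assoc, e2]

lemma mapRho_naturality (n : ℤ) {X X' Y Y' : C} (f : X ⟶ X') (g : Y ⟶ Y') :
    ((F.map f)⟦n⟧' ⊗ₘ F.map g) ≫ (T.mapRho F n X' Y').hom =
      (T.mapRho F n X Y).hom ≫ (F.map f ⊗ₘ F.map g)⟦n⟧' := by
  have e1 := (F.commShiftIso n).hom.naturality f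
  have e2 := (F.commShiftIso n).hom.naturality (f ⊗ₘ g)
  have e3 : (F.map f ⊗ₘ F.map g)⟦n⟧' ≫ (μ F X' Y')⟦n⟧' =
    (μ F X Y)⟦n⟧' ≫ (F.map (f ⊗ₘ g))⟦n⟧' := by
    rw [← Functor.map_comp, μ_natural, Functor.map_comp]
  dsimp at e1 e2
  have e4 : ((F.commShiftIso n).hom.app X ▷ F.obj Y) ≫ ((F.map f)⟦n⟧' ⊗ₘ F.map g) =
      (F.map (f⟦n⟧') ⊗ₘ F.map g) ≫ ((F.commShiftIso n).hom.app X' ▷ F.obj Y') := by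
    rw [← tensorHom_id, ← tensorHom_id]
    dsimp
    rw [tensorHom_comp_tensorHom, tensorHom_comp_tensorHom, e1, Category.id_comp, Category.comp_id]
  rw [← cancel_epi ((F.commShiftIso n).hom.app X ▷ F.obj Y), ← cancel_mono ((μ F X' Y')⟦n⟧'),
    reassoc_of% e4, Category.assoc, Category.assoc, Category.assoc, Category.assoc, mapRho_comp, e3,
    reassoc_of% (T.mapRho_comp F n X Y), μ_natural_assoc, ← F.map_comp_assoc, T.rho_naturality,
    F.map_comp_assoc, e2]

/-- The natural isomorphism with components `T.mapLam F n`. -/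
noncomputable def mapLamNatIso (n : ℤ) : F.prod F ⋙ (𝟭 D).prod (shiftFunctor D n) ⋙ tensor D ≅
    F.prod F ⋙ tensor D ⋙ shiftFunctor D n :=
  NatIso.ofComponents (fun x ↦ T.mapLam F n x.1 x.2) (by
    rintro ⟨X, Y⟩ ⟨X', Y'⟩ f
    exact T.mapLam_naturality F n f.1 f.2)

/-- The natural isomorphism with components `T.mapRho F n`. -/
noncomputable def mapRhoNatIso (n : ℤ) : F.prod F ⋙ (shiftFunctor D n).prod (𝟭 D) ⋙ tensor D ≅
    F.prod F ⋙ tensor D ⋙ shiftFunctor D n :=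
  NatIso.ofComponents (fun x ↦ T.mapRho F n x.1 x.2) (by
    rintro ⟨X, Y⟩ ⟨X', Y'⟩ f
    exact T.mapRho_naturality F n f.1 f.2)

variable (W : MorphismProperty C) [W.ContainsIdentities] [F.IsLocalization W]

/-- The extension of `T.mapLam F` to a natural isomorphism. -/
noncomputable def locLam (n : ℤ) :
    (𝟭 D).prod (shiftFunctor D n) ⋙ tensor D ≅ tensor D ⋙ shiftFunctor D n :=
  Localization.liftNatIso (F.prod F) (W.prod W)
    (F.prod F ⋙ (𝟭 D).prod (shiftFunctor D n) ⋙ tensor D)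
    (F.prod F ⋙ tensor D ⋙ shiftFunctor D n) _ _
    (T.mapLamNatIso F n)

/-- The extension of `T.mapRho F` to a natural isomorphism. -/
noncomputable def locRho (n : ℤ) :
    (shiftFunctor D n).prod (𝟭 D) ⋙ tensor D ≅ tensor D ⋙ shiftFunctor D n :=
  Localization.liftNatIso (F.prod F) (W.prod W)
    (F.prod F ⋙ (shiftFunctor D n).prod (𝟭 D) ⋙ tensor D)
    (F.prod F ⋙ tensor D ⋙ shiftFunctor D n) _ _
    (T.mapRhoNatIso F n)

lemma locLam_hom_app (n : ℤ) (X Y : C) :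
    (T.locLam F W n).hom.app (F.obj X, F.obj Y) = (T.mapLam F n X Y).hom := by
  have := Localization.liftNatTrans_app (F.prod F) (W.prod W)
    (F.prod F ⋙ (𝟭 D).prod (shiftFunctor D n) ⋙ tensor D) (F.prod F ⋙ tensor D ⋙ shiftFunctor D n)
    ((𝟭 D).prod (shiftFunctor D n) ⋙ tensor D) (tensor D ⋙ shiftFunctor D n)
    (T.mapLamNatIso F n).hom (X, Y)
  refine this.trans ?_
  change 𝟙 _ ≫ _ ≫ 𝟙 _ = _
  rw [Category.id_comp, Category.comp_id]
  rfl

lemma locRho_hom_app (n : ℤ) (X Y : C) :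
    (T.locRho F W n).hom.app (F.obj X, F.obj Y) = (T.mapRho F n X Y).hom := by
  have := Localization.liftNatTrans_app (F.prod F) (W.prod W)
    (F.prod F ⋙ (shiftFunctor D n).prod (𝟭 D) ⋙ tensor D) (F.prod F ⋙ tensor D ⋙ shiftFunctor D n)
    ((shiftFunctor D n).prod (𝟭 D) ⋙ tensor D) (tensor D ⋙ shiftFunctor D n)
    (T.mapRhoNatIso F n).hom (X, Y)
  refine this.trans ?_
  change 𝟙 _ ≫ _ ≫ 𝟙 _ = _
  rw [Category.id_comp, Category.comp_id]
  rfl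

/-- The shift isomorphisms induced on a monoidal localization. -/
noncomputable def localization : TensorShiftData D where
  lam n X Y := (T.locLam F W n).app (X, Y)
  rho n X Y := (T.locRho F W n).app (X, Y)
  lam_naturality n _ _ _ _ f g := (T.locLam F W n).hom.naturality (Prod.mkHom f g)
  rho_naturality n _ _ _ _ f g := (T.locRho F W n).hom.naturality (Prod.mkHom f g)

lemma localization_compatible : T.Compatible (T.localization F W) F where
  lam n X Y := by
    rw [← mapLam_comp, ← T.locLam_hom_app F W]
    rfl
  rho n X Y := by
    rw [← mapRho_comp, ← T.locRho_hom_app F W]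
    rfl

end

end CategoryTheory.TensorShiftData

namespace CategoryTheory.TensorShift

variable {C D : Type*} [Category C] [Category D] [MonoidalCategory C] [MonoidalCategory D]
  [HasShift C ℤ] [HasShift D ℤ] [Preadditive C] [Preadditive D] (T : TensorShift C)
  (F : C ⥤ D) [F.Monoidal] [F.CommShift ℤ] [F.Additive]
  (W : MorphismProperty C) [W.ContainsIdentities] [F.IsLocalization W]

/-- The shift isomorphisms induced on a monoidal localization. -/
noncomputable def localization : TensorShift D where
  toTensorShiftData := T.toTensorShiftData.localization F W
  lam_unit n X := by
    have := Localization.essSurj F W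
    exact TensorShiftData.lam_unit_of_iso _ n (F.objObjPreimageIso X)
      (((T.localization_compatible F W).lam_unit_iff n _).2 (congr_arg F.map (T.lam_unit n _)))
  rho_unit n X := by
    have := Localization.essSurj F W
    exact TensorShiftData.rho_unit_of_iso _ n (F.objObjPreimageIso X)
      (((T.localization_compatible F W).rho_unit_iff n _).2 (congr_arg F.map (T.rho_unit n _)))
  anticomm m n X Y := by
    have := Localization.essSurj F W
    exact TensorShiftData.anticomm_of_iso _ m n (F.objObjPreimageIso X) (F.objObjPreimageIso Y)
      (((T.localization_compatible F W).anticomm_iff m n _ _).2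
        (congr_arg F.map (T.anticomm m n _ _)))

end CategoryTheory.TensorShift

/-! ### Self-extensions of the unit -/

namespace CategoryTheory

namespace TensorShift

variable {D : Type*} [Category D] [MonoidalCategory D] [Preadditive D] [HasShift D ℤ]

/-- The Eckmann-Hilton argument: both sides are obtained from `f ⊗ g` by moving the shifts out
of the tensor product, in either order. -/
lemma comp_shift_eq (T : TensorShift D) (p q : ℤ) (f : 𝟙_ D ⟶ (𝟙_ D)⟦p⟧)
    (g : 𝟙_ D ⟶ (𝟙_ D)⟦q⟧) :
    f ≫ g⟦p⟧' = (p * q).negOnePow • (g ≫ f⟦q⟧' ≫ (shiftFunctorComm D p q).hom.app (𝟙_ D)) := by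
  have h1 : (f ▷ 𝟙_ D ≫ (𝟙_ D)⟦p⟧ ◁ g) ≫ (T.rho p (𝟙_ D) ((𝟙_ D)⟦q⟧)).hom ≫
      (T.lam q (𝟙_ D) (𝟙_ D)).hom⟦p⟧' ≫ ((λ_ (𝟙_ D)).hom⟦q⟧')⟦p⟧' =
      (λ_ (𝟙_ D)).hom ≫ f ≫ g⟦p⟧' := by
    have e1 := T.rho_naturality p (𝟙 (𝟙_ D)) g
    rw [CategoryTheory.Functor.map_id, id_tensorHom, id_tensorHom] at e1
    rw [Category.assoc, reassoc_of% e1, ← Functor.map_comp, ← Functor.map_comp, T.lam_unit,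
      leftUnitor_naturality, Functor.map_comp, unitors_equal, reassoc_of% (T.rho_unit p (𝟙_ D)),
      rightUnitor_naturality_assoc]
  have h2 : (𝟙_ D ◁ g ≫ f ▷ (𝟙_ D)⟦q⟧) ≫ (T.lam q ((𝟙_ D)⟦p⟧) (𝟙_ D)).hom ≫
      (T.rho p (𝟙_ D) (𝟙_ D)).hom⟦q⟧' ≫ ((λ_ (𝟙_ D)).hom⟦p⟧')⟦q⟧' =
      (λ_ (𝟙_ D)).hom ≫ g ≫ f⟦q⟧' := by
    have e1 := T.lam_naturality q f (𝟙 (𝟙_ D))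
    rw [CategoryTheory.Functor.map_id, tensorHom_id, tensorHom_id] at e1
    rw [Category.assoc, reassoc_of% e1, ← Functor.map_comp, ← Functor.map_comp, unitors_equal,
      T.rho_unit, rightUnitor_naturality, Functor.map_comp, ← unitors_equal,
      reassoc_of% (T.lam_unit q (𝟙_ D)), leftUnitor_naturality_assoc]
  have h3 := (shiftFunctorComm D p q).hom.naturality (λ_ (𝟙_ D)).hom
  dsimp at h3
  have h2' := h2
  simp only [Category.assoc] at h2'
  rw [← cancel_epi (λ_ (𝟙_ D)).hom, ← h1, Category.assoc,
    reassoc_of% (T.anticomm p q (𝟙_ D) (𝟙_ D)), Linear.units_smul_comp, Linear.comp_units_smul,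
    Linear.comp_units_smul, Linear.comp_units_smul]
  simp only [Category.assoc]
  rw [← h3, ← whisker_exchange_assoc, reassoc_of% h2']

/-- The graded commutativity of the endomorphisms of the unit. -/
lemma shiftedHom_comp_comm (T : TensorShift D) {p q n : ℤ} (f : ShiftedHom (𝟙_ D) (𝟙_ D) p)
    (g : ShiftedHom (𝟙_ D) (𝟙_ D) q) (h : q + p = n) (h' : p + q = n) :
    f.comp g h = (p * q).negOnePow • g.comp f h' := by
  have := T.comp_shift_eq p q f g
  rw [ShiftedHom.comp, reassoc_of% this, Linear.units_smul_comp, ShiftedHom.comp, Category.assoc,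
    Category.assoc, shiftFunctorComm_eq D p q n h']
  congr 3
  simp

end TensorShift

/-- The graded commutativity of the shifted endomorphisms of the image of the unit under a full
functor. -/
lemma ShiftedHom.comp_comm_of_tensorShift {D E : Type*} [Category D] [MonoidalCategory D]
    [Preadditive D] [HasShift D ℤ] [Category E] [Preadditive E] [HasShift E ℤ]
    (T : TensorShift D) (F : D ⥤ E) [F.CommShift ℤ] [F.Full] [F.Additive] {X : E}
    (e : F.obj (𝟙_ D) ≅ X) {p q n : ℤ} (f : ShiftedHom X X p) (g : ShiftedHom X X q)
    (h : q + p = n) (h' : p + q = n) :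
    f.comp g h = (p * q).negOnePow • g.comp f h' := by
  let φ {m : ℤ} (a : ShiftedHom X X m) : ShiftedHom (𝟙_ D) (𝟙_ D) m :=
    F.preimage (e.hom ≫ a ≫ e.inv⟦m⟧' ≫ (F.commShiftIso m).inv.app (𝟙_ D))
  have hφ {m : ℤ} (a : ShiftedHom X X m) : (φ a).map F = e.hom ≫ a ≫ e.inv⟦m⟧' := by
    simp [φ, ShiftedHom.map]
  have hcomp {a b c : ℤ} (x : ShiftedHom X X a) (y : ShiftedHom X X b) (hc : b + a = c) :
      x.comp y hc = e.inv ≫ ((φ x).comp (φ y) hc).map F ≫ e.hom⟦c⟧' := by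
    have h1 := (shiftFunctorAdd' E b a c hc).inv.naturality e.inv
    dsimp at h1
    rw [ShiftedHom.map_comp, hφ, hφ, ShiftedHom.comp, ShiftedHom.comp]
    simp only [Functor.map_comp, Category.assoc]
    rw [reassoc_of% h1, ← Functor.map_comp, Iso.inv_hom_id, CategoryTheory.Functor.map_id,
      Category.comp_id, Iso.inv_hom_id_assoc, ← Functor.map_comp_assoc, Iso.inv_hom_id,
      CategoryTheory.Functor.map_id, Category.id_comp]
  rw [hcomp, hcomp, T.shiftedHom_comp_comm (φ f) (φ g) h h', ShiftedHom.map, ShiftedHom.map,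
    Functor.map_units_smul, Linear.units_smul_comp, Linear.units_smul_comp,
    Linear.comp_units_smul]

/-- The graded commutativity of the Yoneda product on the self-extensions of an object that
corresponds to the unit of a monoidal category with shifts, embedded in the derived category. -/
lemma Abelian.Ext.comp_comm_of_tensorShift {B : Type u} [Category.{v} B] [Abelian B] [HasExt.{w} B]
    [HasDerivedCategory B] {D : Type*} [Category D] [MonoidalCategory D]
    [Preadditive D] [HasShift D ℤ]
    (T : TensorShift D) (F : D ⥤ DerivedCategory B) [F.CommShift ℤ] [F.Full] [F.Additive] {X : B}
    (e : F.obj (𝟙_ D) ≅ (DerivedCategory.singleFunctor B 0).obj X) {p q : ℕ}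
    (f : Abelian.Ext X X p) (g : Abelian.Ext X X q) :
    f.comp g rfl = (-1 : ℤ) ^ (p * q) • g.comp f (Nat.add_comm q p) := by
  apply Abelian.Ext.ext
  rw [Abelian.Ext.comp_hom, ShiftedHom.comp_comm_of_tensorShift T F e _ _ _ (by simp),
    ← Abelian.Ext.comp_hom _ _ (Nat.add_comm q p), Units.smul_def,
    ← Abelian.Ext.homAddEquiv_apply, ← Abelian.Ext.homAddEquiv_apply, ← _root_.map_zsmul]
  rw [← Nat.cast_mul, Int.coe_negOnePow_natCast]

end CategoryTheory

/-! ### Bounded derived categories as localizations of complexes of tensor exact objects -/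

section

open CochainComplex

section

variable {B : Type u} [Category.{v} B] [Abelian B]

lemma CochainComplex.subQuasiIso_map_iff {𝓑 : ObjectProperty (CochainComplex B ℤ)}
    {K L K' L' : 𝓑.FullSubcategory} {f : K ⟶ L} {g : K' ⟶ L'} {p : K ⟶ K'} {q : L ⟶ L'}
    (h : f ≫ q = p ≫ g) (hp : subQuasiIso 𝓑 p) (hq : subQuasiIso 𝓑 q) :
    subQuasiIso 𝓑 f ↔ subQuasiIso 𝓑 g := by
  rw [← (subQuasiIso 𝓑).postcomp_iff f q hq, h, (subQuasiIso 𝓑).precomp_iff p g hp]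

variable [HasDerivedCategory.{w} B]

lemma isIso_QMinus_map_iff {K L : Minus B} (f : K ⟶ L) :
    IsIso ((QMinus B).map f) ↔ subQuasiIso (minus B) f := by
  rw [← isIso_iff_of_reflects_iso ((QMinus B).map f) DerivedCategory.TStructure.t.minus.ι]
  exact DerivedCategory.isIso_Q_map_iff_quasiIso _ f.hom

lemma isIso_QPlus_map_iff {K L : CochainComplex.Plus B} (f : K ⟶ L) :
    IsIso ((QPlus B).map f) ↔ subQuasiIso (CochainComplex.plus B) f := by
  rw [← isIso_iff_of_reflects_iso ((QPlus B).map f) DerivedCategory.TStructure.t.plus.ι]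
  exact DerivedCategory.isIso_Q_map_iff_quasiIso _ f.hom

end

variable {B : Type u} [Category.{v} B] [Abelian B] [MonoidalCategory B] [MonoidalPreadditive B]
  [HasGoodCoproducts B] [HasDerivedCategory.{w} B]

namespace FunctorialResolution

variable (Φ : FunctorialResolution (TensorExact (B := B)))

/-- The approximation of bounded above complexes by complexes of tensor exact objects. -/
noncomputable def leftApproximation :
    LeftApproximation (termwiseTensorExact (minus B)) (QMinus B) where
  R := Φ.resolutionFunctor ⋙ (termwiseTensorExact (minus B)).ι
  π K := Φ.resolutionπ.app K
  naturality f := Φ.resolutionπ.naturality f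
  prop K := (Φ.resolutionFunctor.obj K).property
  isIso K := (isIso_QMinus_map_iff _).2 (Φ.subQuasiIso_resolutionπ K)

/-- The truncation `τ≤n`, as a bounded above complex. -/
noncomputable def _root_.CochainComplex.truncMinus (n : ℤ) : CochainComplex B ℤ ⥤ Minus B :=
  ObjectProperty.lift _ ((ComplexShape.embeddingUpIntLE n).truncLEFunctor B) fun K ↦
    ⟨n, inferInstanceAs ((K.truncLE n).IsStrictlyLE n)⟩

lemma essSurj (Φ : FunctorialResolution (TensorExact (B := B))) :
    ((termwiseTensorExact (minus B)).ι ⋙ QMinus B).EssSurj where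
  mem_essImage X := by
    obtain ⟨n, hn⟩ := X.property
    have : X.obj.IsLE n := hn
    obtain ⟨K, hK, ⟨e⟩⟩ := DerivedCategory.exists_iso_Q_obj_of_isLE X.obj n
    let K' : Minus B := ⟨K, n, hK⟩
    have : IsIso ((QMinus B).map (Φ.resolutionπ.app K')) := Φ.leftApproximation.isIso K'
    exact ⟨Φ.resolutionFunctor.obj K', ⟨asIso ((QMinus B).map (Φ.resolutionπ.app K')) ≪≫
      ObjectProperty.isoMk _ e.symm⟩⟩

/-- The natural transformation from the resolution of the truncation `τ≤n`. -/
noncomputable def truncResolutionπ (n : ℤ) :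
    (truncMinus n ⋙ Φ.resolutionFunctor) ⋙ (termwiseTensorExact (minus B)).ι ⋙ (minus B).ι ⟶
      𝟭 (CochainComplex B ℤ) where
  app K := (Φ.resolutionπ.app ((truncMinus n).obj K)).hom ≫ K.ιTruncLE n
  naturality K L f := by
    have h1 := congr_arg (·.hom) (Φ.resolutionπ.naturality ((truncMinus n).map f))
    have h2 := ((ComplexShape.embeddingUpIntLE n).ιTruncLENatTrans B).naturality f
    exact (Category.assoc _ _ _).symm.trans ((h1 =≫ L.ιTruncLE n).trans
      ((Category.assoc _ _ _).trans ((_ ≫= h2).trans (Category.assoc _ _ _).symm)))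

/-- The bounded above derived category is the localization of the category of bounded above
complexes of tensor exact objects. -/
theorem isLocalization (Φ : FunctorialResolution (TensorExact (B := B))) :
    ((termwiseTensorExact (minus B)).ι ⋙ QMinus B).IsLocalization (flatQuasiIso (minus B)) := by
  have := Φ.essSurj
  refine Localization.isLocalization_of_approximations
    (j := (termwiseTensorExact (minus B)).ι ⋙ (minus B).ι) (L := DerivedCategory.Q)
    (W := HomologicalComplex.quasiIso B (ComplexShape.up ℤ))
    (κ := DerivedCategory.TStructure.t.minus.ι) (Iso.refl _)
    (fun n ↦ truncMinus n ⋙ Φ.resolutionFunctor) (fun n ↦ Φ.truncResolutionπ n) ?_ ?_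
  · intro n K L f hf
    have hf' : subQuasiIso (minus B) ((truncMinus n).map f) :=
      (quasiIso_truncLEMap_iff f n).2 fun i _ ↦ (quasiIso_iff f).1 hf i
    exact (subQuasiIso_map_iff (Φ.resolutionπ.naturality ((truncMinus n).map f))
      (Φ.subQuasiIso_resolutionπ _) (Φ.subQuasiIso_resolutionπ _)).2 hf'
  · intro X Y
    obtain ⟨a, ha⟩ := X.obj.property
    obtain ⟨b, hb⟩ := Y.obj.property
    have key (K : Minus B) (hK : K.obj.IsStrictlyLE (max a b)) :
        HomologicalComplex.quasiIso B (ComplexShape.up ℤ)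
          ((Φ.truncResolutionπ (max a b)).app K.obj) :=
      MorphismProperty.comp_mem _ _ _ (Φ.subQuasiIso_resolutionπ ((truncMinus (max a b)).obj K.obj))
        ((K.obj.quasiIso_ιTruncLE_iff (max a b)).2 inferInstance)
    exact ⟨max a b, key X.obj (X.obj.obj.isStrictlyLE_of_le a _ (le_max_left a b)),
      key Y.obj (Y.obj.obj.isStrictlyLE_of_le b _ (le_max_right a b))⟩

end FunctorialResolution

namespace FunctorialCoresolution

variable (Φ : FunctorialCoresolution (TensorExact (B := B)))

/-- The approximation of bounded below complexes by complexes of tensor exact objects. -/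
noncomputable def rightApproximation :
    RightApproximation (termwiseTensorExact (CochainComplex.plus B)) (QPlus B) where
  R := Φ.coresolutionFunctor ⋙ (termwiseTensorExact (CochainComplex.plus B)).ι
  π K := Φ.coresolutionι.app K
  naturality f := Φ.coresolutionι.naturality f
  prop K := (Φ.coresolutionFunctor.obj K).property
  isIso K := (isIso_QPlus_map_iff _).2 (Φ.subQuasiIso_coresolutionι K)

/-- The truncation `τ≥n`, as a bounded below complex. -/
noncomputable def _root_.CochainComplex.truncPlus (n : ℤ) :
    CochainComplex B ℤ ⥤ CochainComplex.Plus B :=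
  ObjectProperty.lift _ ((ComplexShape.embeddingUpIntGE n).truncGEFunctor B) fun K ↦
    ⟨n, inferInstanceAs ((K.truncGE n).IsStrictlyGE n)⟩

lemma essSurj (Φ : FunctorialCoresolution (TensorExact (B := B))) :
    ((termwiseTensorExact (CochainComplex.plus B)).ι ⋙ QPlus B).EssSurj where
  mem_essImage X := by
    obtain ⟨n, hn⟩ := X.property
    have : X.obj.IsGE n := hn
    obtain ⟨K, hK, ⟨e⟩⟩ := DerivedCategory.exists_iso_Q_obj_of_isGE X.obj n
    let K' : CochainComplex.Plus B := ⟨K, n, hK⟩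
    have : IsIso ((QPlus B).map (Φ.coresolutionι.app K')) := Φ.rightApproximation.isIso K'
    exact ⟨Φ.coresolutionFunctor.obj K', ⟨(asIso ((QPlus B).map (Φ.coresolutionι.app K'))).symm ≪≫
      ObjectProperty.isoMk _ e.symm⟩⟩

/-- The natural transformation to the resolution of the truncation `τ≥n`. -/
noncomputable def truncCoresolutionι (n : ℤ) :
    𝟭 (CochainComplex B ℤ) ⟶ (truncPlus n ⋙ Φ.coresolutionFunctor) ⋙
      (termwiseTensorExact (CochainComplex.plus B)).ι ⋙ (CochainComplex.plus B).ι where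
  app K := K.πTruncGE n ≫ (Φ.coresolutionι.app ((truncPlus n).obj K)).hom
  naturality K L f := by
    have h1 := congr_arg (·.hom) (Φ.coresolutionι.naturality ((truncPlus n).map f))
    have h2 := ((ComplexShape.embeddingUpIntGE n).πTruncGENatTrans B).naturality f
    exact (Category.assoc _ _ _).symm.trans ((h2 =≫ _).trans
      ((Category.assoc _ _ _).trans ((_ ≫= h1).trans (Category.assoc _ _ _).symm)))

/-- The bounded below derived category is the localization of the category of bounded below
complexes of tensor exact objects. -/
theorem isLocalization (Φ : FunctorialCoresolution (TensorExact (B := B))) :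
    ((termwiseTensorExact (CochainComplex.plus B)).ι ⋙ QPlus B).IsLocalization
      (flatQuasiIso (CochainComplex.plus B)) := by
  have := Φ.essSurj
  refine Localization.isLocalization_of_coapproximations
    (j := (termwiseTensorExact (CochainComplex.plus B)).ι ⋙ (CochainComplex.plus B).ι)
    (L := DerivedCategory.Q)
    (W := HomologicalComplex.quasiIso B (ComplexShape.up ℤ))
    (κ := DerivedCategory.TStructure.t.plus.ι) (Iso.refl _)
    (fun n ↦ truncPlus n ⋙ Φ.coresolutionFunctor) (fun n ↦ Φ.truncCoresolutionι n) ?_ ?_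
  · intro n K L f hf
    have hf' : subQuasiIso (CochainComplex.plus B) ((truncPlus n).map f) :=
      (quasiIso_truncGEMap_iff f n).2 fun i _ ↦ (quasiIso_iff f).1 hf i
    exact (subQuasiIso_map_iff (Φ.coresolutionι.naturality ((truncPlus n).map f))
      (Φ.subQuasiIso_coresolutionι _) (Φ.subQuasiIso_coresolutionι _)).1 hf'
  · intro X Y
    obtain ⟨a, ha⟩ := X.obj.property
    obtain ⟨b, hb⟩ := Y.obj.property
    have key (K : CochainComplex.Plus B) (hK : K.obj.IsStrictlyGE (min a b)) :
        HomologicalComplex.quasiIso B (ComplexShape.up ℤ)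
          ((Φ.truncCoresolutionι (min a b)).app K.obj) :=
      MorphismProperty.comp_mem _ _ _ ((K.obj.quasiIso_πTruncGE_iff (min a b)).2 inferInstance)
        (Φ.subQuasiIso_coresolutionι ((truncPlus (min a b)).obj K.obj))
    exact ⟨min a b, key X.obj (X.obj.obj.isStrictlyGE_of_ge _ a (min_le_left a b)),
      key Y.obj (Y.obj.obj.isStrictlyGE_of_ge _ b (min_le_right a b))⟩

end FunctorialCoresolution

end

/-! ### Shifts and the comparison with the derived tensor product -/

namespace CategoryTheory

lemma Functor.isIso_map_shift {C D : Type*} [Category C] [Category D] [HasShift C ℤ]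
    [HasShift D ℤ] (Q : C ⥤ D) [Q.CommShift ℤ] (n : ℤ) {X Y : C} (f : X ⟶ Y)
    [IsIso (Q.map f)] : IsIso (Q.map (f⟦n⟧')) :=
  (NatIso.isIso_map_iff (Q.commShiftIso n) f).2 (inferInstanceAs (IsIso ((Q.map f)⟦n⟧')))

namespace MonoidalOn

variable {C D : Type*} [Category C] [Category D] [MonoidalCategory C] [MonoidalCategory D]
  [HasShift C ℤ] [HasShift D ℤ] [Preadditive C] {T : TensorShift C} {P : ObjectProperty C}
  [P.IsMonoidal] [P.IsStableUnderShift ℤ] {Q : C ⥤ D} [Q.CommShift ℤ] [(P.ι ⋙ Q).Monoidal]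
  {T' : TensorShiftData D}

/-- The tensorator is compatible with the shift in the second variable for all objects that satisfy
`P`, also when `P` holds for `y[n]` by another argument than stability under shifts. -/
lemma lam_compatible (h : (T.subData P).Compatible T' (P.ι ⋙ Q)) (n : ℤ) {x y : C} (hx : P x)
    (hy : P y) (hyn : P (y⟦n⟧)) :
    Q.obj x ◁ (Q.commShiftIso n).hom.app y ≫ (T'.lam n (Q.obj x) (Q.obj y)).hom ≫
      ((ofMonoidal P Q inferInstance).μ hx hy).hom⟦n⟧' =
    ((ofMonoidal P Q inferInstance).μ hx hyn).hom ≫ Q.map (T.lam n x y).hom ≫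
      (Q.commShiftIso n).hom.app (x ⊗ y) := by
  let X : P.FullSubcategory := ⟨x, hx⟩
  let Y : P.FullSubcategory := ⟨y, hy⟩
  have h1 := h.lam n X Y
  have h2 := (ofMonoidal P Q inferInstance).natural hx hx (Y⟦n⟧).property hyn (𝟙 x)
    (TensorShift.shiftObjIso P n Y).hom
  have h3 := T.subLam_comp P n X Y
  have h4 (Z : P.FullSubcategory) : ((P.ι ⋙ Q).commShiftIso n).hom.app Z =
    Q.map (TensorShift.shiftObjIso P n Z).hom ≫ (Q.commShiftIso n).hom.app Z.obj :=
    Functor.commShiftIso_comp_hom_app ..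
  rw [h4, h4] at h1
  have h5 : Q.obj x ◁ Q.map (TensorShift.shiftObjIso P n Y).hom ≫
      Q.obj x ◁ (Q.commShiftIso n).hom.app y ≫ (T'.lam n (Q.obj x) (Q.obj y)).hom ≫
      ((ofMonoidal P Q inferInstance).μ hx hy).hom⟦n⟧' =
      ((ofMonoidal P Q inferInstance).μ hx (Y⟦n⟧).property).hom ≫ Q.map (T.subLam P n X Y).hom ≫
        Q.map (TensorShift.shiftObjIso P n (X ⊗ Y)).hom ≫ (Q.commShiftIso n).hom.app (x ⊗ y) := by
    rw [← MonoidalCategory.whiskerLeft_comp_assoc]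
    exact h1
  rw [← Q.map_comp_assoc, h3, Q.map_comp_assoc] at h5
  rw [Q.map_id, id_tensorHom, id_tensorHom] at h2
  rw [← reassoc_of% h2] at h5
  exact (cancel_epi _).1 h5

/-- The tensorator is compatible with the shift in the first variable for all objects that satisfy
`P`, also when `P` holds for `x[n]` by another argument than stability under shifts. -/
lemma rho_compatible (h : (T.subData P).Compatible T' (P.ι ⋙ Q)) (n : ℤ) {x y : C} (hx : P x)
    (hy : P y) (hxn : P (x⟦n⟧)) :
    (Q.commShiftIso n).hom.app x ▷ Q.obj y ≫ (T'.rho n (Q.obj x) (Q.obj y)).hom ≫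
      ((ofMonoidal P Q inferInstance).μ hx hy).hom⟦n⟧' =
    ((ofMonoidal P Q inferInstance).μ hxn hy).hom ≫ Q.map (T.rho n x y).hom ≫
      (Q.commShiftIso n).hom.app (x ⊗ y) := by
  let X : P.FullSubcategory := ⟨x, hx⟩
  let Y : P.FullSubcategory := ⟨y, hy⟩
  have h1 := h.rho n X Y
  have h2 := (ofMonoidal P Q inferInstance).natural (X⟦n⟧).property hxn hy hy
    (TensorShift.shiftObjIso P n X).hom (𝟙 y)
  have h3 := T.subRho_comp P n X Y
  have h4 (Z : P.FullSubcategory) : ((P.ι ⋙ Q).commShiftIso n).hom.app Z =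
    Q.map (TensorShift.shiftObjIso P n Z).hom ≫ (Q.commShiftIso n).hom.app Z.obj :=
    Functor.commShiftIso_comp_hom_app ..
  rw [h4, h4] at h1
  have h5 : Q.map (TensorShift.shiftObjIso P n X).hom ▷ Q.obj y ≫
      (Q.commShiftIso n).hom.app x ▷ Q.obj y ≫ (T'.rho n (Q.obj x) (Q.obj y)).hom ≫
      ((ofMonoidal P Q inferInstance).μ hx hy).hom⟦n⟧' =
      ((ofMonoidal P Q inferInstance).μ (X⟦n⟧).property hy).hom ≫ Q.map (T.subRho P n X Y).hom ≫
        Q.map (TensorShift.shiftObjIso P n (X ⊗ Y)).hom ≫ (Q.commShiftIso n).hom.app (x ⊗ y) := by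
    rw [← comp_whiskerRight_assoc]
    exact h1
  rw [← Q.map_comp_assoc, h3, Q.map_comp_assoc] at h5
  rw [Q.map_id, tensorHom_id, tensorHom_id] at h2
  rw [← reassoc_of% h2] at h5
  exact (cancel_epi _).1 h5

/-- The compatibility of `lμ` with the isomorphisms `X ⊗ Y[n] ≅ (X ⊗ Y)[n]`. -/
lemma lμ_lam (A : LeftApproximation P Q) (h : (T.subData P).Compatible T' (P.ι ⋙ Q)) (n : ℤ)
    (X Y : C) :
    Q.obj X ◁ (Q.commShiftIso n).hom.app Y ≫ (T'.lam n (Q.obj X) (Q.obj Y)).hom ≫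
      ((ofMonoidal P Q inferInstance).lμ A X Y)⟦n⟧' =
    (ofMonoidal P Q inferInstance).lμ A X (Y⟦n⟧) ≫ Q.map (T.lam n X Y).hom ≫
      (Q.commShiftIso n).hom.app (X ⊗ Y) := by
  have hn : P ((A.R.obj Y)⟦n⟧) := P.le_shift n _ (A.prop Y)
  have := Q.isIso_map_shift n (A.π Y)
  have e1 : (Q.map (A.π X) ⊗ₘ Q.map ((A.π Y)⟦n⟧')) ≫ Q.obj X ◁ (Q.commShiftIso n).hom.app Y =
      Q.obj (A.R.obj X) ◁ (Q.commShiftIso n).hom.app (A.R.obj Y) ≫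
        (Q.map (A.π X) ⊗ₘ (Q.map (A.π Y))⟦n⟧') := by
    have e := (Q.commShiftIso n).hom.naturality (A.π Y)
    dsimp at e
    rw [← id_tensorHom, ← id_tensorHom]
    dsimp
    rw [tensorHom_comp_tensorHom, tensorHom_comp_tensorHom, e, Category.id_comp, Category.comp_id]
  have e2 := (Q.commShiftIso n).hom.naturality (A.π X ⊗ₘ A.π Y)
  dsimp at e2
  rw [← cancel_epi (Q.map (A.π X) ⊗ₘ Q.map ((A.π Y)⟦n⟧')), reassoc_of% e1,
    reassoc_of% (T'.lam_naturality n (Q.map (A.π X)) (Q.map (A.π Y))), ← Functor.map_comp,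
    map_tensor_lμ _ A (A.prop X) (A.prop Y), map_tensor_lμ_assoc _ A (A.prop X) hn,
    Functor.map_comp, reassoc_of% (lam_compatible h n (A.prop X) (A.prop Y) hn),
    ← Q.map_comp_assoc, T.lam_naturality, Q.map_comp_assoc, e2]

/-- The compatibility of `lμ` with the isomorphisms `X[n] ⊗ Y ≅ (X ⊗ Y)[n]`. -/
lemma lμ_rho (A : LeftApproximation P Q) (h : (T.subData P).Compatible T' (P.ι ⋙ Q)) (n : ℤ)
    (X Y : C) :
    (Q.commShiftIso n).hom.app X ▷ Q.obj Y ≫ (T'.rho n (Q.obj X) (Q.obj Y)).hom ≫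
      ((ofMonoidal P Q inferInstance).lμ A X Y)⟦n⟧' =
    (ofMonoidal P Q inferInstance).lμ A (X⟦n⟧) Y ≫ Q.map (T.rho n X Y).hom ≫
      (Q.commShiftIso n).hom.app (X ⊗ Y) := by
  have hn : P ((A.R.obj X)⟦n⟧) := P.le_shift n _ (A.prop X)
  have := Q.isIso_map_shift n (A.π X)
  have e1 : (Q.map ((A.π X)⟦n⟧') ⊗ₘ Q.map (A.π Y)) ≫ (Q.commShiftIso n).hom.app X ▷ Q.obj Y =
      (Q.commShiftIso n).hom.app (A.R.obj X) ▷ Q.obj (A.R.obj Y) ≫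
        ((Q.map (A.π X))⟦n⟧' ⊗ₘ Q.map (A.π Y)) := by
    have e := (Q.commShiftIso n).hom.naturality (A.π X)
    dsimp at e
    rw [← tensorHom_id, ← tensorHom_id]
    dsimp
    rw [tensorHom_comp_tensorHom, tensorHom_comp_tensorHom, e, Category.id_comp, Category.comp_id]
  have e2 := (Q.commShiftIso n).hom.naturality (A.π X ⊗ₘ A.π Y)
  dsimp at e2
  rw [← cancel_epi (Q.map ((A.π X)⟦n⟧') ⊗ₘ Q.map (A.π Y)), reassoc_of% e1,
    reassoc_of% (T'.rho_naturality n (Q.map (A.π X)) (Q.map (A.π Y))), ← Functor.map_comp,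
    map_tensor_lμ _ A (A.prop X) (A.prop Y), map_tensor_lμ_assoc _ A hn (A.prop Y),
    Functor.map_comp, reassoc_of% (rho_compatible h n (A.prop X) (A.prop Y) hn),
    ← Q.map_comp_assoc, T.rho_naturality, Q.map_comp_assoc, e2]

/-- The compatibility of `rδ` with the isomorphisms `X ⊗ Y[n] ≅ (X ⊗ Y)[n]`. -/
lemma rδ_lam (A : RightApproximation P Q) (h : (T.subData P).Compatible T' (P.ι ⋙ Q)) (n : ℤ)
    (X Y : C) :
    (ofMonoidal P Q inferInstance).rδ A X (Y⟦n⟧) ≫ Q.obj X ◁ (Q.commShiftIso n).hom.app Y ≫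
      (T'.lam n (Q.obj X) (Q.obj Y)).hom =
    Q.map (T.lam n X Y).hom ≫ (Q.commShiftIso n).hom.app (X ⊗ Y) ≫
      ((ofMonoidal P Q inferInstance).rδ A X Y)⟦n⟧' := by
  have hn : P ((A.R.obj Y)⟦n⟧) := P.le_shift n _ (A.prop Y)
  have e1 : Q.obj X ◁ (Q.commShiftIso n).hom.app Y ≫ (Q.map (A.π X) ⊗ₘ (Q.map (A.π Y))⟦n⟧') =
      (Q.map (A.π X) ⊗ₘ Q.map ((A.π Y)⟦n⟧')) ≫
        Q.obj (A.R.obj X) ◁ (Q.commShiftIso n).hom.app (A.R.obj Y) := by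
    have e := (Q.commShiftIso n).hom.naturality (A.π Y)
    dsimp at e
    rw [← id_tensorHom, ← id_tensorHom]
    dsimp
    rw [tensorHom_comp_tensorHom, tensorHom_comp_tensorHom, e, Category.id_comp, Category.comp_id]
  have e2 := (Q.commShiftIso n).hom.naturality (A.π X ⊗ₘ A.π Y)
  dsimp at e2
  have e3 : ((ofMonoidal P Q inferInstance).μ (A.prop X) hn).inv ≫
      Q.obj (A.R.obj X) ◁ (Q.commShiftIso n).hom.app (A.R.obj Y) ≫
        (T'.lam n (Q.obj (A.R.obj X)) (Q.obj (A.R.obj Y))).hom =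
      Q.map (T.lam n (A.R.obj X) (A.R.obj Y)).hom ≫ (Q.commShiftIso n).hom.app _ ≫
        ((ofMonoidal P Q inferInstance).μ (A.prop X) (A.prop Y)).inv⟦n⟧' := by
    rw [Iso.inv_comp_eq, ← reassoc_of% (lam_compatible h n (A.prop X) (A.prop Y) hn),
      ← Functor.map_comp, Iso.hom_inv_id, CategoryTheory.Functor.map_id, Category.comp_id]
  rw [← cancel_mono ((Q.map (A.π X) ⊗ₘ Q.map (A.π Y))⟦n⟧')]
  simp only [Category.assoc]
  rw [← T'.lam_naturality, reassoc_of% e1, rδ_map_tensor_assoc _ A (A.prop X) hn,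
    ← Functor.map_comp, rδ_map_tensor _ A (A.prop X) (A.prop Y), Functor.map_comp,
    ← reassoc_of% e2, e3, ← Q.map_comp_assoc, ← Q.map_comp_assoc, T.lam_naturality]

/-- The compatibility of `rδ` with the isomorphisms `X[n] ⊗ Y ≅ (X ⊗ Y)[n]`. -/
lemma rδ_rho (A : RightApproximation P Q) (h : (T.subData P).Compatible T' (P.ι ⋙ Q)) (n : ℤ)
    (X Y : C) :
    (ofMonoidal P Q inferInstance).rδ A (X⟦n⟧) Y ≫ (Q.commShiftIso n).hom.app X ▷ Q.obj Y ≫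
      (T'.rho n (Q.obj X) (Q.obj Y)).hom =
    Q.map (T.rho n X Y).hom ≫ (Q.commShiftIso n).hom.app (X ⊗ Y) ≫
      ((ofMonoidal P Q inferInstance).rδ A X Y)⟦n⟧' := by
  have hn : P ((A.R.obj X)⟦n⟧) := P.le_shift n _ (A.prop X)
  have e1 : (Q.commShiftIso n).hom.app X ▷ Q.obj Y ≫ ((Q.map (A.π X))⟦n⟧' ⊗ₘ Q.map (A.π Y)) =
      (Q.map ((A.π X)⟦n⟧') ⊗ₘ Q.map (A.π Y)) ≫
        (Q.commShiftIso n).hom.app (A.R.obj X) ▷ Q.obj (A.R.obj Y) := by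
    have e := (Q.commShiftIso n).hom.naturality (A.π X)
    dsimp at e
    rw [← tensorHom_id, ← tensorHom_id]
    dsimp
    rw [tensorHom_comp_tensorHom, tensorHom_comp_tensorHom, e, Category.id_comp, Category.comp_id]
  have e2 := (Q.commShiftIso n).hom.naturality (A.π X ⊗ₘ A.π Y)
  dsimp at e2
  have e3 : ((ofMonoidal P Q inferInstance).μ hn (A.prop Y)).inv ≫
      (Q.commShiftIso n).hom.app (A.R.obj X) ▷ Q.obj (A.R.obj Y) ≫
        (T'.rho n (Q.obj (A.R.obj X)) (Q.obj (A.R.obj Y))).hom =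
      Q.map (T.rho n (A.R.obj X) (A.R.obj Y)).hom ≫ (Q.commShiftIso n).hom.app _ ≫
        ((ofMonoidal P Q inferInstance).μ (A.prop X) (A.prop Y)).inv⟦n⟧' := by
    rw [Iso.inv_comp_eq, ← reassoc_of% (rho_compatible h n (A.prop X) (A.prop Y) hn),
      ← Functor.map_comp, Iso.hom_inv_id, CategoryTheory.Functor.map_id, Category.comp_id]
  rw [← cancel_mono ((Q.map (A.π X) ⊗ₘ Q.map (A.π Y))⟦n⟧')]
  simp only [Category.assoc]
  rw [← T'.rho_naturality, reassoc_of% e1, rδ_map_tensor_assoc _ A hn (A.prop Y),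
    ← Functor.map_comp, rδ_map_tensor _ A (A.prop X) (A.prop Y), Functor.map_comp,
    ← reassoc_of% e2, e3, ← Q.map_comp_assoc, ← Q.map_comp_assoc, T.rho_naturality]

end MonoidalOn

end CategoryTheory

/-! ### The suspended monoidal structure on bounded derived categories -/

namespace CategoryTheory

section

/-- The structure of a monoidal category on a monoidal localization. -/
@[reducible]
noncomputable def localizedMonoidalCategory {C D : Type*} [Category C] [Category D]
    [MonoidalCategory C] (L : C ⥤ D) (W : MorphismProperty C) [W.IsMonoidal]
    [L.IsLocalization W] : MonoidalCategory D :=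
  inferInstanceAs (MonoidalCategory (LocalizedMonoidal L W (Iso.refl (L.obj (𝟙_ C)))))

/-- The localization functor is monoidal. -/
@[reducible]
noncomputable def localizedMonoidalFunctor {C D : Type*} [Category C] [Category D]
    [MonoidalCategory C] (L : C ⥤ D) (W : MorphismProperty C) [W.IsMonoidal]
    [L.IsLocalization W] :
    letI := localizedMonoidalCategory L W
    L.Monoidal :=
  inferInstanceAs ((Localization.Monoidal.toMonoidalCategory L W
    (Iso.refl (L.obj (𝟙_ C)))).Monoidal)

/-- A functor is additive if it is so on the essential image of an additive functor from
a category with biproducts. -/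
lemma additive_of_essSurj {C D E : Type*} [Category C] [Category D] [Category E] [Preadditive C]
    [Preadditive D] [Preadditive E] (L : C ⥤ D) (F : D ⥤ E) [L.Additive] [L.EssSurj]
    [(L ⋙ F).Additive]
    (hC : ∀ X : C, ∃ b : BinaryBicone X X, b.fst ≫ b.inl + b.snd ≫ b.inr = 𝟙 b.pt) :
    F.Additive where
  map_add {Y Z f g} := by
    let e := L.objObjPreimageIso Z
    obtain ⟨b, hb⟩ := hC (L.objPreimage Z)
    -- `f + g` factors as `(f, g)` followed by the codiagonal, which comes from `C`
    let d : b.pt ⟶ L.objPreimage Z := b.fst + b.snd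
    let h : Y ⟶ L.obj b.pt := f ≫ e.inv ≫ L.map b.inl + g ≫ e.inv ≫ L.map b.inr
    have hL {X X' : C} (φ ψ : X ⟶ X') :
        F.map (L.map (φ + ψ)) = F.map (L.map φ) + F.map (L.map ψ) := (L ⋙ F).map_add
    have h1 : h ≫ L.map d ≫ e.hom = f + g := by
      simp [h, d, Preadditive.add_comp, Preadditive.comp_add, ← Functor.map_comp_assoc,
        Functor.map_add]
    have h2 : h ≫ L.map b.fst ≫ e.hom = f := by
      simp [h, Preadditive.add_comp, ← Functor.map_comp_assoc]
    have h3 : h ≫ L.map b.snd ≫ e.hom = g := by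
      simp [h, Preadditive.add_comp, ← Functor.map_comp_assoc]
    rw [← h1]
    conv_rhs => rw [← h2, ← h3]
    simp only [F.map_comp, d, hL, Preadditive.comp_add, Preadditive.add_comp]

/-- The monoidal structure on a monoidal localization is additive in each variable. -/
lemma monoidalPreadditive_of_localization {C D : Type*} [Category C] [Category D]
    [MonoidalCategory C] [MonoidalCategory D] [Preadditive C] [Preadditive D]
    [MonoidalPreadditive C] (L : C ⥤ D) [L.Monoidal] [L.EssSurj] [L.Additive]
    (hC : ∀ X : C, ∃ b : BinaryBicone X X, b.fst ≫ b.inl + b.snd ≫ b.inr = 𝟙 b.pt) :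
    MonoidalPreadditive D := by
  have hl (X : D) : (tensorLeft X).Additive := by
    have (x : C) : (L ⋙ tensorLeft (L.obj x)).Additive :=
      Functor.additive_of_iso (Functor.Monoidal.commTensorLeft L x).symm
    have h (x : C) : (tensorLeft (L.obj x)).Additive := additive_of_essSurj L _ hC
    have := h (L.objPreimage X)
    exact Functor.additive_of_iso ((curriedTensor D).mapIso (L.objObjPreimageIso X))
  have hr (X : D) : (tensorRight X).Additive := by
    have (x : C) : (L ⋙ tensorRight (L.obj x)).Additive :=
      Functor.additive_of_iso (Functor.Monoidal.commTensorRight L x).symm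
    have h (x : C) : (tensorRight (L.obj x)).Additive := additive_of_essSurj L _ hC
    have := h (L.objPreimage X)
    exact Functor.additive_of_iso ((curriedTensor D).flip.mapIso (L.objObjPreimageIso X))
  exact
    { whiskerLeft_zero := (tensorLeft _).map_zero _ _
      zero_whiskerRight := (tensorRight _).map_zero _ _
      whiskerLeft_add _ _ := (tensorLeft _).map_add
      add_whiskerRight _ _ := (tensorRight _).map_add }

/-- The shift isomorphisms for the shift `[1]` provide a suspended monoidal category. -/
@[reducible]
noncomputable def TensorShift.suspendedMonoidal {D : Type*} [Category D] [Preadditive D]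
    [HasFiniteProducts D] [MonoidalCategory D] [MonoidalPreadditive D] [HasShift D ℤ]
    [(shiftFunctor D (1 : ℤ)).Additive] (T : TensorShift D) :
    SuspendedMonoidal D (shiftFunctor D (1 : ℤ)) where
  lam X Y := T.lam 1 X Y
  rho X Y := T.rho 1 X Y
  lam_naturality f g := T.lam_naturality 1 f g
  rho_naturality f g := T.rho_naturality 1 f g
  lam_unit X := T.lam_unit 1 X
  rho_unit X := T.rho_unit 1 X
  anticomm X Y := by
    rw [T.anticomm, shiftFunctorComm_eq_refl]
    simp

end

end CategoryTheory

section

lemma CochainComplex.isZero_biprod_X {B : Type u} [Category.{v} B] [Abelian B]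
    {K : CochainComplex B ℤ} {n : ℤ} (h : IsZero (K.X n)) :
    IsZero ((K ⊞ K).X n) := by
  rw [IsZero.iff_id_eq_zero]
  have h' := congr_arg (fun φ ↦ φ.f n) (biprod.total (X := K) (Y := K))
  refine Eq.trans h'.symm ?_
  change (biprod.fst : K ⊞ K ⟶ _).f n ≫ _ + (biprod.snd : K ⊞ K ⟶ _).f n ≫ _ = 0
  rw [h.eq_of_tgt ((biprod.fst : K ⊞ K ⟶ _).f n) 0, h.eq_of_tgt ((biprod.snd : K ⊞ K ⟶ _).f n) 0,
    zero_comp, zero_comp, add_zero]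

variable {B : Type u} [Category.{v} B] [Abelian B] [MonoidalCategory B] [MonoidalPreadditive B]

namespace CochainComplex

/-- A binary bicone on two copies of `K` suffices to recover the addition of morphisms in a
localization of the category of complexes of tensor exact objects. -/
lemma termwiseTensorExact_exists_binaryBicone (𝓑 : ObjectProperty (CochainComplex B ℤ))
    (h𝓑 : ∀ K : CochainComplex B ℤ, 𝓑 K → 𝓑 (K ⊞ K))
    (K : (termwiseTensorExact 𝓑).FullSubcategory) :
    ∃ b : BinaryBicone K K, b.fst ≫ b.inl + b.snd ≫ b.inr = 𝟙 b.pt := by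
  let S : (termwiseTensorExact 𝓑).FullSubcategory := ⟨⟨K.obj.obj ⊞ K.obj.obj, h𝓑 _ K.obj.property⟩,
    fun n ↦ by
      have h := congr_arg (fun φ ↦ φ.f n) (biprod.total (X := K.obj.obj) (Y := K.obj.obj))
      refine TensorExact.of_sum_eq_id (Finset.univ (α := Fin 2)) (fun _ ↦ K.obj.obj.X n)
        ![(biprod.fst : K.obj.obj ⊞ K.obj.obj ⟶ _).f n,
          (biprod.snd : K.obj.obj ⊞ K.obj.obj ⟶ _).f n]
        ![(biprod.inl : _ ⟶ K.obj.obj ⊞ K.obj.obj).f n,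
          (biprod.inr : _ ⟶ K.obj.obj ⊞ K.obj.obj).f n]
        ?_ fun _ _ ↦ K.property n
      rw [Fin.sum_univ_two]
      exact h⟩
  let hom₁ (φ : S.obj.obj ⟶ K.obj.obj) : S ⟶ K := ObjectProperty.homMk (ObjectProperty.homMk φ)
  let hom₂ (φ : K.obj.obj ⟶ S.obj.obj) : K ⟶ S := ObjectProperty.homMk (ObjectProperty.homMk φ)
  have ext {X Y : (termwiseTensorExact 𝓑).FullSubcategory} {f g : X ⟶ Y}
      (h : f.hom.hom = g.hom.hom) : f = g := by
    ext : 2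
    exact h
  exact ⟨{ pt := S
           fst := hom₁ biprod.fst
           snd := hom₁ biprod.snd
           inl := hom₂ biprod.inl
           inr := hom₂ biprod.inr
           inl_fst := ext biprod.inl_fst
           inl_snd := ext biprod.inl_snd
           inr_fst := ext biprod.inr_fst
           inr_snd := ext biprod.inr_snd }, ext biprod.total⟩

end CochainComplex

variable [HasGoodCoproducts B]

namespace CochainComplex

lemma ι_whiskerLeft_f (K : CochainComplex B ℤ) {L M : CochainComplex B ℤ} (f : L ⟶ M)
    (i j n : ℤ) (h : i + j = n) :
    ιMapBifunctor K L (curriedTensor B) i j n h ≫ (K ◁ f).f n =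
      K.X i ◁ f.f j ≫ ιMapBifunctor K M (curriedTensor B) i j n h := by
  refine (HomologicalComplex.ι_mapBifunctorMap (𝟙 K) f (curriedTensor B) (ComplexShape.up ℤ)
    i j n h).trans ?_
  refine Eq.trans ?_ (Category.id_comp _)
  exact ((curriedTensor B).flip.obj _).map_id (K.X i) =≫ _

lemma ι_whiskerRight_f {K L : CochainComplex B ℤ} (f : K ⟶ L) (M : CochainComplex B ℤ)
    (i j n : ℤ) (h : i + j = n) :
    ιMapBifunctor K M (curriedTensor B) i j n h ≫ (f ▷ M).f n =
      f.f i ▷ M.X j ≫ ιMapBifunctor L M (curriedTensor B) i j n h := by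
  refine (HomologicalComplex.ι_mapBifunctorMap f (𝟙 M) (curriedTensor B) (ComplexShape.up ℤ)
    i j n h).trans ?_
  exact _ ≫= ((((curriedTensor B).obj _).map_id (M.X j) =≫ _).trans (Category.id_comp _))

lemma tensor_hom_ext {K L M : CochainComplex B ℤ} {f g : K ⊗ L ⟶ M}
    (h : ∀ (i j n : ℤ) (hij : i + j = n), ιMapBifunctor K L (curriedTensor B) i j n hij ≫ f.f n =
      ιMapBifunctor K L (curriedTensor B) i j n hij ≫ g.f n) : f = g :=
  HomologicalComplex.hom_ext _ _ fun n ↦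
    HomologicalComplex.mapBifunctor.hom_ext fun i j hij ↦ h i j n hij

instance : MonoidalPreadditive (CochainComplex B ℤ) where
  whiskerLeft_zero := tensor_hom_ext fun i j n h ↦ by simp [ι_whiskerLeft_f]
  zero_whiskerRight := tensor_hom_ext fun i j n h ↦ by simp [ι_whiskerRight_f]
  whiskerLeft_add f g := tensor_hom_ext fun i j n h ↦ by
    simp [ι_whiskerLeft_f, Preadditive.comp_add, Preadditive.add_comp]
  add_whiskerRight f g := tensor_hom_ext fun i j n h ↦ by
    simp [ι_whiskerRight_f, Preadditive.comp_add, Preadditive.add_comp]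

variable (𝓑 : ObjectProperty (CochainComplex B ℤ))

instance [𝓑.IsStableUnderShift ℤ] : (termwiseTensorExact 𝓑).IsStableUnderShift ℤ where
  isStableUnderShiftBy n := ⟨fun K hK i ↦
    (hK (i + n)).of_iso
      ((HomologicalComplex.eval _ _ i).mapIso (TensorShift.shiftObjIso 𝓑 n K)).symm⟩

end CochainComplex

open CochainComplex

variable [HasDerivedCategory.{w} B]

instance : (QMinus B).Additive where
  map_add {_ _ f g} := DerivedCategory.TStructure.t.minus.hom_ext
    (DerivedCategory.Q.map_add (f := f.hom) (g := g.hom))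

instance : (QPlus B).Additive where
  map_add {_ _ f g} := DerivedCategory.TStructure.t.plus.hom_ext
    (DerivedCategory.Q.map_add (f := f.hom) (g := g.hom))

namespace FunctorialResolution

variable (Φ : FunctorialResolution (TensorExact (B := B)))

/-- The monoidal structure on the bounded above derived category. -/
@[reducible]
noncomputable def monoidalMinus : MonoidalCategory (DerivedCategory.Minus B) :=
  have := Φ.isLocalization
  localizedMonoidalCategory ((termwiseTensorExact (minus B)).ι ⋙ QMinus B)
    (flatQuasiIso (minus B))

/-- The localization functor from complexes of tensor exact objects is monoidal. -/
@[reducible]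
noncomputable def monoidalFunctorMinus :
    letI := Φ.monoidalMinus
    ((termwiseTensorExact (minus B)).ι ⋙ QMinus B).Monoidal :=
  have := Φ.isLocalization
  localizedMonoidalFunctor ((termwiseTensorExact (minus B)).ι ⋙ QMinus B)
    (flatQuasiIso (minus B))

/-- The shift isomorphisms for the bounded above derived category. -/
noncomputable def tensorShiftMinus :
    letI := Φ.monoidalMinus
    TensorShift (DerivedCategory.Minus B) :=
  letI := Φ.monoidalMinus
  letI := Φ.monoidalFunctorMinus
  have := Φ.isLocalization
  (((tensorShift B).fullSubcategory (minus B)).fullSubcategory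
    (termwiseTensorExact (minus B))).localization
      ((termwiseTensorExact (minus B)).ι ⋙ QMinus B) (flatQuasiIso (minus B))

/-- The bounded above derived category is suspended monoidal for the derived tensor product, as
soon as tensor exact objects provide functorial resolutions. -/
noncomputable def leftDerivedSuspendedMonoidal : LeftDerivedSuspendedMonoidal B :=
  letI := Φ.monoidalMinus
  letI := Φ.monoidalFunctorMinus
  have := Φ.isLocalization
  have := Φ.essSurj
  have : MonoidalPreadditive (DerivedCategory.Minus B) :=
    monoidalPreadditive_of_localization ((termwiseTensorExact (minus B)).ι ⋙ QMinus B)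
      (termwiseTensorExact_exists_binaryBicone _ (by
        rintro K ⟨n, hn⟩
        exact ⟨n, (isStrictlyLE_iff _ _).2 fun i hi ↦
          isZero_biprod_X (isZero_of_isStrictlyLE K n i hi)⟩))
  letI M := MonoidalOn.ofMonoidal (termwiseTensorExact (minus B)) (QMinus B) inferInstance
  { monoidal := inferInstance
    preadditive := inferInstance
    suspended := Φ.tensorShiftMinus.suspendedMonoidal
    lax := M.lax Φ.leftApproximation
    isIso_unit := inferInstanceAs (IsIso M.ε.hom)
    isLeftDerived := M.isRightKanExtension_lax Φ.leftApproximation (flatQuasiIso (minus B))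
    lam_compat K L := MonoidalOn.lμ_lam Φ.leftApproximation
      (TensorShiftData.localization_compatible _ _ _) 1 K L
    rho_compat K L := MonoidalOn.lμ_rho Φ.leftApproximation
      (TensorShiftData.localization_compatible _ _ _) 1 K L }

end FunctorialResolution

end

section

variable {B : Type u} [Category.{v} B] [Abelian B] [MonoidalCategory B] [MonoidalPreadditive B]
  [HasGoodCoproducts B]

open CochainComplex

namespace FunctorialCoresolution

section

variable [HasDerivedCategory.{w} B] (Φ : FunctorialCoresolution (TensorExact (B := B)))

/-- The monoidal structure on the bounded below derived category. -/
@[reducible]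
noncomputable def monoidalPlus : MonoidalCategory (DerivedCategory.Plus B) :=
  have := Φ.isLocalization
  localizedMonoidalCategory ((termwiseTensorExact (CochainComplex.plus B)).ι ⋙ QPlus B)
    (flatQuasiIso (CochainComplex.plus B))

/-- The localization functor from complexes of tensor exact objects is monoidal. -/
@[reducible]
noncomputable def monoidalFunctorPlus :
    letI := Φ.monoidalPlus
    ((termwiseTensorExact (CochainComplex.plus B)).ι ⋙ QPlus B).Monoidal :=
  have := Φ.isLocalization
  localizedMonoidalFunctor ((termwiseTensorExact (CochainComplex.plus B)).ι ⋙ QPlus B)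
    (flatQuasiIso (CochainComplex.plus B))

/-- The shift isomorphisms for the bounded below derived category. -/
noncomputable def tensorShiftPlus :
    letI := Φ.monoidalPlus
    TensorShift (DerivedCategory.Plus B) :=
  letI := Φ.monoidalPlus
  letI := Φ.monoidalFunctorPlus
  have := Φ.isLocalization
  (((tensorShift B).fullSubcategory (CochainComplex.plus B)).fullSubcategory
    (termwiseTensorExact (CochainComplex.plus B))).localization
      ((termwiseTensorExact (CochainComplex.plus B)).ι ⋙ QPlus B)
      (flatQuasiIso (CochainComplex.plus B))

/-- The bounded below derived category is suspended monoidal for the derived tensor product, as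
soon as tensor exact objects provide functorial coresolutions. -/
noncomputable def rightDerivedSuspendedMonoidal : RightDerivedSuspendedMonoidal B :=
  letI := Φ.monoidalPlus
  letI := Φ.monoidalFunctorPlus
  have := Φ.isLocalization
  have := Φ.essSurj
  have : MonoidalPreadditive (DerivedCategory.Plus B) :=
    monoidalPreadditive_of_localization
      ((termwiseTensorExact (CochainComplex.plus B)).ι ⋙ QPlus B)
      (termwiseTensorExact_exists_binaryBicone _ (by
        rintro K ⟨n, hn⟩
        exact ⟨n, (isStrictlyGE_iff _ _).2 fun i hi ↦
          isZero_biprod_X (isZero_of_isStrictlyGE K n i hi)⟩))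
  letI M := MonoidalOn.ofMonoidal (termwiseTensorExact (CochainComplex.plus B)) (QPlus B)
    inferInstance
  { monoidal := inferInstance
    preadditive := inferInstance
    suspended := Φ.tensorShiftPlus.suspendedMonoidal
    oplax := M.oplax Φ.rightApproximation
    isIso_unit := inferInstanceAs (IsIso M.ε.inv)
    isRightDerived :=
      M.isLeftKanExtension_oplax Φ.rightApproximation (flatQuasiIso (CochainComplex.plus B))
    lam_compat K L := MonoidalOn.rδ_lam Φ.rightApproximation
      (TensorShiftData.localization_compatible _ _ _) 1 K L
    rho_compat K L := MonoidalOn.rδ_rho Φ.rightApproximation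
      (TensorShiftData.localization_compatible _ _ _) 1 K L }

end

/-- The graded commutativity of the self-extensions of the unit. -/
theorem ext_comp_comm (Φ : FunctorialCoresolution (TensorExact (B := B))) [HasExt.{w} B] {p q : ℕ}
    (f : Abelian.Ext (𝟙_ B) (𝟙_ B) p) (g : Abelian.Ext (𝟙_ B) (𝟙_ B) q) :
    f.comp g rfl = (-1 : ℤ) ^ (p * q) • g.comp f (Nat.add_comm q p) :=
  letI := HasDerivedCategory.standard B
  letI := Φ.monoidalPlus
  Abelian.Ext.comp_comm_of_tensorShift Φ.tensorShiftPlus DerivedCategory.Plus.ι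
    ((DerivedCategory.singleFunctorIsoCompQ B 0).symm.app (𝟙_ B)) f g

end FunctorialCoresolution

/-- The graded commutativity of the self-extensions of the unit. -/
theorem FunctorialResolution.ext_comp_comm (Φ : FunctorialResolution (TensorExact (B := B)))
    [HasExt.{w} B] {p q : ℕ}
    (f : Abelian.Ext (𝟙_ B) (𝟙_ B) p) (g : Abelian.Ext (𝟙_ B) (𝟙_ B) q) :
    f.comp g rfl = (-1 : ℤ) ^ (p * q) • g.comp f (Nat.add_comm q p) :=
  letI := HasDerivedCategory.standard B
  letI := Φ.monoidalMinus
  Abelian.Ext.comp_comm_of_tensorShift Φ.tensorShiftMinus DerivedCategory.Minus.ι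
    ((DerivedCategory.singleFunctorIsoCompQ B 0).symm.app (𝟙_ B)) f g

end

/-! ### Reduction of a functor to a functor that preserves zero -/

namespace CategoryTheory.Abelian

open scoped ZeroObject

variable {B : Type*} [Category B] [Abelian B] (G : B ⥤ B)

/-- The subfunctor of `G` given by the kernels of `G X ⟶ G 0`. -/
noncomputable def reducedFunctor : B ⥤ B where
  obj X := kernel (G.map (0 : X ⟶ 0))
  map {X Y} f := kernel.map _ _ (G.map f) (G.map (𝟙 _)) (by
    rw [← G.map_comp, ← G.map_comp, zero_comp, comp_zero])
  map_id X := by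
    apply equalizer.hom_ext
    simp
  map_comp f g := by
    apply equalizer.hom_ext
    simp

/-- The inclusion of the reduced functor. -/
noncomputable def reducedι : reducedFunctor G ⟶ G where
  app X := kernel.ι (G.map (0 : X ⟶ 0))
  naturality _ _ _ := kernel.lift_ι _ _ _

instance (X : B) : Mono ((reducedι G).app X) :=
  inferInstanceAs (Mono (kernel.ι (G.map (0 : X ⟶ 0))))

lemma reducedι_map_zero (X Y : B) : (reducedι G).app X ≫ G.map (0 : X ⟶ Y) = 0 := by
  have h : (0 : X ⟶ Y) = (0 : X ⟶ 0) ≫ (0 : (0 : B) ⟶ Y) := by simp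
  have h' : (reducedι G).app X ≫ G.map (0 : X ⟶ 0) = 0 :=
    kernel.condition (G.map (0 : X ⟶ 0))
  rw [h, G.map_comp, reassoc_of% h', zero_comp]

instance : (reducedFunctor G).PreservesZeroMorphisms where
  map_zero X Y := by
    rw [← cancel_mono ((reducedι G).app Y), (reducedι G).naturality, reducedι_map_zero, zero_comp]

/-- The projection of `G X` to its summand that vanishes for `X = 0`. -/
noncomputable def toReduced (X : B) : G.obj X ⟶ (reducedFunctor G).obj X :=
  kernel.lift _ (𝟙 _ - G.map 0) (by
    rw [Preadditive.sub_comp, Category.id_comp, ← G.map_comp, zero_comp, sub_self])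

lemma toReduced_ι (X : B) : toReduced G X ≫ (reducedι G).app X = 𝟙 _ - G.map 0 :=
  kernel.lift_ι _ _ _

lemma ι_toReduced (X : B) : (reducedι G).app X ≫ toReduced G X = 𝟙 _ := by
  rw [← cancel_mono ((reducedι G).app X), Category.assoc, toReduced_ι, Preadditive.comp_sub,
    Category.comp_id, reducedι_map_zero, sub_zero, Category.id_comp]

variable {G}

/-- A natural epimorphism `G ⟶ 𝟭 B` remains epimorphic on the reduced functor. -/
noncomputable def reducedLeftResolution (π : G ⟶ 𝟭 B) [∀ X, Epi (π.app X)] :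
    LeftResolution (𝟭 B) where
  F := reducedFunctor G
  π := reducedι G ≫ π
  epi_π_app X := by
    have h : toReduced G X ≫ (reducedι G ≫ π).app X = π.app X := by
      rw [NatTrans.comp_app, ← Category.assoc, toReduced_ι, Preadditive.sub_comp,
        Category.id_comp, π.naturality]
      simp
    have : Epi (toReduced G X ≫ (reducedι G ≫ π).app X) := by
      rw [h]; infer_instance
    exact epi_of_epi (toReduced G X) _

instance (π : G ⟶ 𝟭 B) [∀ X, Epi (π.app X)] :
    (reducedLeftResolution π).F.PreservesZeroMorphisms :=
  inferInstanceAs (reducedFunctor G).PreservesZeroMorphisms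

end CategoryTheory.Abelian

/-- The reduced part is a summand of `G X`. -/
lemma CategoryTheory.TensorExact.reduced {B : Type*} [Category B] [Abelian B] [MonoidalCategory B]
    [MonoidalPreadditive B] (G : B ⥤ B) (X : B) (h : TensorExact (G.obj X)) :
    TensorExact ((Abelian.reducedFunctor G).obj X) :=
  .of_sum_eq_id (Finset.univ (α := Unit)) (fun _ ↦ G.obj X)
    (fun _ ↦ (Abelian.reducedι G).app X) (fun _ ↦ Abelian.toReduced G X)
    (by simp [Abelian.ι_toReduced G X]) (fun _ _ ↦ h)

/-! ### Free bimodules -/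

noncomputable section

namespace BimoduleCat

variable {k A : Type u} [CommRing k] [Ring A] [Algebra k A]

attribute [local instance] kModule

variable (k A) in
/-- The free bimodule with a given basis. -/
abbrev free (I : Type u) : BimoduleCat k A := ModuleCat.of (A ⊗[k] Aᵐᵒᵖ) (I →₀ A ⊗[k] Aᵐᵒᵖ)

section

variable (N : BimoduleCat k A)

/-- The left action as a `k`-linear map. -/
def lactHom : A →ₗ[k] N →ₗ[k] N :=
  ((Algebra.lsmul (A := A ⊗[k] Aᵐᵒᵖ) k k N).comp
    Algebra.TensorProduct.includeLeft).toLinearMap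

/-- The right action as a `k`-linear map. -/
def ractHom : Aᵐᵒᵖ →ₗ[k] N →ₗ[k] N :=
  ((Algebra.lsmul (A := A ⊗[k] Aᵐᵒᵖ) k k N).comp
    Algebra.TensorProduct.includeRight).toLinearMap

variable {N}

lemma smul_ract (r : k) (a : A) (n : N) : ract (r • n) a = r • ract n a :=
  (ractHom N (.op a)).map_smul r n

variable (N)

variable {I : Type u}

/-- Auxiliary definition for `freeTensEquiv`. -/
def freeTensAux (i : I) : A ⊗[k] Aᵐᵒᵖ →ₗ[k] N →ₗ[k] (I →₀ A) ⊗[k] N :=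
  TensorProduct.lift (LinearMap.compl₂
    ((LinearMap.llcomp k N N ((I →₀ A) ⊗[k] N)).comp
      ((TensorProduct.mk k (I →₀ A) N).comp (Finsupp.lsingle i)))
    ((lactHom N).comp (MulOpposite.opLinearEquiv k).symm.toLinearMap))

lemma freeTensAux_tmul (i : I) (a : A) (b : Aᵐᵒᵖ) (n : N) :
    freeTensAux N i (a ⊗ₜ b) n = Finsupp.single i a ⊗ₜ lact b.unop n := rfl

lemma ract_single (i : I) (a : A) (b : Aᵐᵒᵖ) (c : A) :
    ract (M := free k A I) (Finsupp.single i (a ⊗ₜ[k] b)) c =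
      Finsupp.single i (a ⊗ₜ[k] (.op (b.unop * c))) := by
  change (_ : A ⊗[k] Aᵐᵒᵖ) • (Finsupp.single i _ : I →₀ A ⊗[k] Aᵐᵒᵖ) = _
  simp

lemma lact_single (i : I) (a : A) (b : Aᵐᵒᵖ) (c : A) :
    lact (M := free k A I) c (Finsupp.single i (a ⊗ₜ[k] b)) =
      Finsupp.single i ((c * a) ⊗ₜ[k] b) := by
  change (_ : A ⊗[k] Aᵐᵒᵖ) • (Finsupp.single i _ : I →₀ A ⊗[k] Aᵐᵒᵖ) = _
  simp

lemma free_induction {p : free k A I → Prop} (x : free k A I) (h₀ : p 0)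
    (h : ∀ i a b, p (Finsupp.single i (a ⊗ₜ[k] b))) (hadd : ∀ x y, p x → p y → p (x + y)) :
    p x := by
  induction x using Finsupp.induction_linear with
  | zero => exact h₀
  | add f g hf hg => exact hadd _ _ hf hg
  | single i x =>
    induction x with
    | zero => rw [Finsupp.single_zero]; exact h₀
    | tmul a b => exact h i a b
    | add x y hx hy => rw [Finsupp.single_add]; exact hadd _ _ hx hy

/-- The map `F ⊗_A N ⟶ A^(I) ⊗ₖ N` for the free bimodule `F` with basis `I`. -/
def freeTensHom : tens (free k A I) N →+ (I →₀ A) ⊗[k] N :=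
  lift (M := free k A I) (N := N) (Z := (I →₀ A) ⊗[k] N)
    (Finsupp.liftAddHom fun i ↦
      LinearMap.toAddMonoidHom'.comp (freeTensAux N i).toAddMonoidHom)
    (fun x c n ↦ by
      induction x using free_induction with
      | h₀ => simp [ract]
      | h i a b =>
        rw [ract_single]
        simp [freeTensAux_tmul, lact_lact]
      | hadd x y hx hy =>
        rw [ract_add x y c, map_add, map_add, AddMonoidHom.add_apply, AddMonoidHom.add_apply,
          hx, hy])

lemma freeTensHom_tmul (i : I) (a : A) (b : Aᵐᵒᵖ) (n : N) :
    freeTensHom N (tmul (Finsupp.single i (a ⊗ₜ[k] b)) n) =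
      Finsupp.single i a ⊗ₜ lact b.unop n := by
  simp [freeTensHom, freeTensAux_tmul]

/-- The additive map `A^(I) ⟶ (A ⊗ₖ Aᵒᵖ)^(I)` given by `a ↦ a ⊗ 1`. -/
def freeLeft : (I →₀ A) →+ free k A I :=
  Finsupp.mapRange.addMonoidHom
    (Algebra.TensorProduct.includeLeft (R := k) (S := k) (A := A) (B := Aᵐᵒᵖ) : A →+ A ⊗[k] Aᵐᵒᵖ)

/-- The additive map `A^(I) ⟶ (A ⊗ₖ Aᵒᵖ)^(I)` given by `a ↦ 1 ⊗ a`. -/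
def freeRight : (I →₀ A) →+ free k A I :=
  Finsupp.mapRange.addMonoidHom
    (((Algebra.TensorProduct.includeRight (R := k) (A := A) (B := Aᵐᵒᵖ)) : Aᵐᵒᵖ →+ _).comp
      (MulOpposite.opAddEquiv : A ≃+ Aᵐᵒᵖ).toAddMonoidHom)

lemma freeLeft_single (i : I) (a : A) :
    freeLeft (k := k) (Finsupp.single i a) = Finsupp.single i (a ⊗ₜ[k] 1) :=
  Finsupp.mapRange_single (hf := map_zero _)

lemma freeRight_single (i : I) (a : A) :
    freeRight (k := k) (Finsupp.single i a) = Finsupp.single i (1 ⊗ₜ[k] .op a) :=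
  Finsupp.mapRange_single (hf := map_zero _)

lemma freeLeft_smul (r : k) (x : I →₀ A) :
    freeLeft (k := k) (r • x) = ract (freeLeft x) (algebraMap k A r) := by
  induction x using Finsupp.induction_linear with
  | zero => simp [ract]
  | add f g hf hg => rw [smul_add, map_add, map_add, hf, hg, ract_add]
  | single i a =>
    rw [Finsupp.smul_single, freeLeft_single, freeLeft_single]
    refine Eq.trans ?_ (ract_single _ _ _ _).symm
    simp [Algebra.algebraMap_eq_smul_one, TensorProduct.smul_tmul]

lemma freeRight_smul (r : k) (x : I →₀ A) :
    freeRight (k := k) (r • x) = lact (algebraMap k A r) (freeRight x) := by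
  induction x using Finsupp.induction_linear with
  | zero => simp [lact]
  | add f g hf hg => rw [smul_add, map_add, map_add, hf, hg, lact_add]
  | single i a =>
    rw [Finsupp.smul_single, freeRight_single, freeRight_single]
    refine Eq.trans ?_ (lact_single _ _ _ _).symm
    simp [Algebra.algebraMap_eq_smul_one, TensorProduct.smul_tmul]

/-- The inverse of `freeTensHom`. -/
def freeTensInv : (I →₀ A) ⊗[k] N →+ tens (free k A I) N :=
  TensorProduct.liftAddHom ((tmulHom (free k A I) N).comp freeLeft)
    (fun r x n ↦ by
      change tmul (freeLeft (r • x)) n = tmul (freeLeft x) (r • n)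
      rw [freeLeft_smul, ract_tmul, lact_algebraMap])

lemma freeTensInv_tmul (i : I) (a : A) (n : N) :
    freeTensInv N (Finsupp.single i a ⊗ₜ[k] n) = tmul (Finsupp.single i (a ⊗ₜ 1)) n := by
  change tmul (freeLeft _) _ = _
  rw [freeLeft_single]

lemma tmul_single (i : I) (a : A) (b : Aᵐᵒᵖ) (n : N) :
    tmul (M := free k A I) (Finsupp.single i (a ⊗ₜ[k] b)) n =
      tmul (M := free k A I) (Finsupp.single i (a ⊗ₜ[k] 1)) (lact b.unop n) := by
  rw [← ract_tmul, ract_single]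
  simp

/-- For the free bimodule `F` with basis `I`, the group `F ⊗_A N` is `A^(I) ⊗ₖ N`. -/
def freeTensEquiv : tens (free k A I) N ≃+ (I →₀ A) ⊗[k] N :=
  { freeTensHom N with
    invFun := freeTensInv N
    left_inv x := by
      change freeTensInv N (freeTensHom N x) = x
      induction x using tens_induction with
      | h₀ => simp
      | hadd x y hx hy => rw [map_add, map_add, hx, hy]
      | h x n =>
        induction x using free_induction with
        | h₀ => simp [zero_tmul]
        | h i a b => rw [freeTensHom_tmul, freeTensInv_tmul, ← tmul_single]
        | hadd x y hx hy => rw [add_tmul, map_add, map_add, hx, hy]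
    right_inv x := by
      change freeTensHom N (freeTensInv N x) = x
      induction x with
      | zero => simp
      | add x y hx hy => rw [map_add, map_add, hx, hy]
      | tmul x n =>
        induction x using Finsupp.induction_linear with
        | zero => simp
        | add f g hf hg => rw [TensorProduct.add_tmul, map_add, map_add, hf, hg]
        | single i a => rw [freeTensInv_tmul, freeTensHom_tmul, MulOpposite.unop_one, lact_one] }

lemma freeTensEquiv_tensMap {N' : BimoduleCat k A} (f : N ⟶ N') (x : tens (free k A I) N) :
    freeTensEquiv N' (tensMap (𝟙 _) f x) =
      (f.hom.restrictScalars k).lTensor (I →₀ A) (freeTensEquiv N x) := by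
  change freeTensHom _ _ = LinearMap.lTensor _ _ (freeTensHom _ _)
  induction x using tens_induction with
  | h₀ => simp
  | hadd x y hx hy => rw [map_add, map_add, hx, hy, map_add, map_add]
  | h x n =>
    induction x using free_induction with
    | h₀ => simp [zero_tmul]
    | h i a b =>
      rw [tensMap_tmul, freeTensHom_tmul, LinearMap.lTensor_tmul]
      exact (freeTensHom_tmul N' i a b (f n)).trans (by rw [← map_lact]; rfl)
    | hadd x y hx hy => rw [add_tmul, map_add, map_add, hx, hy, map_add, map_add]

/-- Auxiliary definition for `tensFreeEquiv`. -/
def tensFreeAux (i : I) : A ⊗[k] Aᵐᵒᵖ →ₗ[k] N →ₗ[k] N ⊗[k] (I →₀ A) :=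
  TensorProduct.lift (LinearMap.flip (LinearMap.compl₂
    ((LinearMap.llcomp k N N (N ⊗[k] (I →₀ A))).comp
      ((TensorProduct.mk k N (I →₀ A)).flip.comp
        ((Finsupp.lsingle i).comp (MulOpposite.opLinearEquiv k).symm.toLinearMap)))
    ((ractHom N).comp (MulOpposite.opLinearEquiv k).toLinearMap)))

lemma tensFreeAux_tmul (i : I) (a : A) (b : Aᵐᵒᵖ) (n : N) :
    tensFreeAux N i (a ⊗ₜ b) n = ract n a ⊗ₜ Finsupp.single i b.unop := rfl

/-- The map `N ⊗_A F ⟶ N ⊗ₖ A^(I)` for the free bimodule `F` with basis `I`. -/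
def tensFreeHom : tens N (free k A I) →+ N ⊗[k] (I →₀ A) :=
  lift (M := N) (N := free k A I) (Z := N ⊗[k] (I →₀ A))
    (AddMonoidHom.flip (M := free k A I) (N := N) (Finsupp.liftAddHom fun i ↦
      LinearMap.toAddMonoidHom'.comp (tensFreeAux N i).toAddMonoidHom))
    (fun n c x ↦ by
      rw [AddMonoidHom.flip_apply, AddMonoidHom.flip_apply]
      induction x using free_induction with
      | h₀ => simp [lact]
      | h i a b =>
        rw [lact_single]
        simp [tensFreeAux_tmul, ract_ract]
      | hadd x y hx hy =>
        rw [lact_add c x y, map_add, map_add, AddMonoidHom.add_apply, AddMonoidHom.add_apply,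
          hx, hy])

lemma tensFreeHom_tmul (i : I) (a : A) (b : Aᵐᵒᵖ) (n : N) :
    tensFreeHom N (tmul n (Finsupp.single i (a ⊗ₜ[k] b))) =
      ract n a ⊗ₜ Finsupp.single i b.unop := by
  rw [tensFreeHom, lift_tmul, AddMonoidHom.flip_apply]
  simp [tensFreeAux_tmul]

/-- The inverse of `tensFreeHom`. -/
def tensFreeInv : N ⊗[k] (I →₀ A) →+ tens N (free k A I) :=
  TensorProduct.liftAddHom (((tmulHom N (free k A I)).flip.comp freeRight).flip)
    (fun r n x ↦ by
      change tmul (r • n) (freeRight x) = tmul n (freeRight (r • x))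
      rw [freeRight_smul, ← ract_tmul, ract_algebraMap])

lemma tensFreeInv_tmul (i : I) (a : A) (n : N) :
    tensFreeInv N (n ⊗ₜ[k] Finsupp.single i a) = tmul n (Finsupp.single i (1 ⊗ₜ .op a)) := by
  change tmul _ (freeRight _) = _
  rw [freeRight_single]

lemma tmul_single' (i : I) (a : A) (b : Aᵐᵒᵖ) (n : N) :
    tmul (N := free k A I) n (Finsupp.single i (a ⊗ₜ[k] b)) =
      tmul (N := free k A I) (ract n a) (Finsupp.single i (1 ⊗ₜ[k] b)) := by
  rw [ract_tmul, lact_single]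
  simp

/-- For the free bimodule `F` with basis `I`, the group `N ⊗_A F` is `N ⊗ₖ A^(I)`. -/
def tensFreeEquiv : tens N (free k A I) ≃+ N ⊗[k] (I →₀ A) :=
  { tensFreeHom N with
    invFun := tensFreeInv N
    left_inv x := by
      change tensFreeInv N (tensFreeHom N x) = x
      induction x using tens_induction with
      | h₀ => simp
      | hadd x y hx hy => rw [map_add, map_add, hx, hy]
      | h n x =>
        induction x using free_induction with
        | h₀ => simp [tmul_zero]
        | h i a b => rw [tensFreeHom_tmul, tensFreeInv_tmul, MulOpposite.op_unop, ← tmul_single']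
        | hadd x y hx hy => rw [tmul_add, map_add, map_add, hx, hy]
    right_inv x := by
      change tensFreeHom N (tensFreeInv N x) = x
      induction x with
      | zero => simp
      | add x y hx hy => rw [map_add, map_add, hx, hy]
      | tmul n x =>
        induction x using Finsupp.induction_linear with
        | zero => simp
        | add f g hf hg => rw [TensorProduct.tmul_add, map_add, map_add, hf, hg]
        | single i a => rw [tensFreeInv_tmul, tensFreeHom_tmul, MulOpposite.unop_op, ract_one] }

lemma tensFreeEquiv_tensMap {N' : BimoduleCat k A} (f : N ⟶ N') (x : tens N (free k A I)) :
    tensFreeEquiv N' (tensMap f (𝟙 _) x) =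
      (f.hom.restrictScalars k).rTensor (I →₀ A) (tensFreeEquiv N x) := by
  change tensFreeHom _ _ = LinearMap.rTensor _ _ (tensFreeHom _ _)
  induction x using tens_induction with
  | h₀ => simp
  | hadd x y hx hy => rw [map_add, map_add, hx, hy, map_add, map_add]
  | h n x =>
    induction x using free_induction with
    | h₀ => simp [tmul_zero]
    | h i a b =>
      rw [tensMap_tmul, tensFreeHom_tmul, LinearMap.rTensor_tmul]
      exact (tensFreeHom_tmul N' i a b (f n)).trans (by rw [← map_ract]; rfl)
    | hadd x y hx hy => rw [tmul_add, map_add, map_add, hx, hy, map_add, map_add]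

end

lemma exact_of_ladder {X₁ X₂ X₃ Y₁ Y₂ Y₃ : Type*} [AddZeroClass X₁] [AddZeroClass X₂]
    [AddZeroClass X₃] [AddZeroClass Y₁] [AddZeroClass Y₂] [AddZeroClass Y₃] (e₁ : X₁ ≃+ Y₁)
    (e₂ : X₂ ≃+ Y₂) (e₃ : X₃ ≃+ Y₃) {f : X₁ → X₂} {g : X₂ → X₃} {f' : Y₁ → Y₂} {g' : Y₂ → Y₃}
    (hf : ∀ x, e₂ (f x) = f' (e₁ x)) (hg : ∀ x, e₃ (g x) = g' (e₂ x))
    (h : Function.Exact f' g') : Function.Exact f g := by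
  intro y
  rw [← e₃.map_eq_zero_iff, hg, h (e₂ y)]
  constructor
  · rintro ⟨x, hx⟩
    exact ⟨e₁.symm x, e₂.injective (by rw [hf, e₁.apply_symm_apply, hx])⟩
  · rintro ⟨x, rfl⟩
    exact ⟨e₁ x, (hf x).symm⟩

instance [Module.Flat k A] (I : Type u) : Module.Flat k (I →₀ A) := by
  classical exact Module.Flat.of_linearEquiv (finsuppLEquivDirectSum k A I)

lemma tensorExact_free [Module.Flat k A] (I : Type u) :
    TensorExact (free k A I) := by
  intro S hS
  rw [ShortComplex.ShortExact.moduleCat_exact_iff_function_exact] at hS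
  have hS' : Function.Exact (S.f.hom.restrictScalars k) (S.g.hom.restrictScalars k) := hS
  constructor
  · rw [ShortComplex.ShortExact.moduleCat_exact_iff_function_exact]
    exact exact_of_ladder (freeTensEquiv _) (freeTensEquiv _) (freeTensEquiv _)
      (freeTensEquiv_tensMap S.X₁ S.f) (freeTensEquiv_tensMap S.X₂ S.g)
      (Module.Flat.lTensor_exact (I →₀ A) hS')
  · rw [ShortComplex.ShortExact.moduleCat_exact_iff_function_exact]
    exact exact_of_ladder (tensFreeEquiv _) (tensFreeEquiv _) (tensFreeEquiv _)
      (tensFreeEquiv_tensMap S.X₁ S.f) (tensFreeEquiv_tensMap S.X₂ S.g)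
      (Module.Flat.rTensor_exact (I →₀ A) hS')

/-- Over a flat algebra, every bimodule is functorially a quotient of a bimodule whose tensor
product functors are exact: a summand of the free bimodule on its elements. -/
def functorialResolution [Module.Flat k A] :
    FunctorialResolution (TensorExact (B := BimoduleCat k A)) :=
  have : (TensorExact (B := BimoduleCat k A)).IsClosedUnderIsomorphisms := ⟨.of_iso⟩
  Abelian.LeftResolution.functorialResolution
    (Abelian.reducedLeftResolution (ModuleCat.adj (A ⊗[k] Aᵐᵒᵖ)).counit) _
    (fun X ↦ .reduced _ X (tensorExact_free X)) (fun _ h ↦ .of_isZero h)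

end BimoduleCat

/-! ### Cofree bicomodules -/

noncomputable section

namespace Bicomod

open ComonObj Opposite

section

variable {V : Type u} [Category.{v} V] [MonoidalCategory V] {C : V} [ComonObj C]

/-- The cofree bicomodule `C ⊗ M ⊗ C`, where the coactions of `M` are not used. -/
abbrev cofree (M : Bicomod C) : Bicomod C := outer (unit C) (outer M (unit C))

/-- The coactions as a morphism to the cofree bicomodule. -/
def toCofree (M : Bicomod C) : M ⟶ cofree M where
  hom := M.left ≫ C ◁ M.right
  left_comm := by
    have := congr($(M.left_coassoc) ▷ C)
    simp only [comp_whiskerRight] at this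
    simp only [left_right, unit, whiskerLeft_comp, left_right_assoc, Category.assoc]
    rw [← associator_naturality_middle_assoc, reassoc_of% this]
    simp
  right_comm := by
    simp only [left_right, unit, comp_whiskerRight, Category.assoc, right_coassoc_assoc, outer,
      whiskerLeft_comp]
    rw [← associator_inv_naturality_left_assoc, whisker_exchange_assoc]
    simp

variable (C) in
/-- The functor that sends `M` to the cofree bicomodule `C ⊗ M ⊗ C`. -/
def cofreeFunctor : Bicomod C ⥤ Bicomod C where
  obj := cofree
  map f := outerMap (𝟙 _) (outerMap f (𝟙 _))

variable (C) in
/-- The coactions as a natural transformation. -/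
def toCofreeNatTrans : 𝟭 (Bicomod C) ⟶ cofreeFunctor C where
  app := toCofree
  naturality M N f := by
    apply hom_ext
    change f.hom ≫ N.left ≫ C ◁ N.right =
      (M.left ≫ C ◁ M.right) ≫ (𝟙 C ⊗ₘ (f.hom ⊗ₘ 𝟙 C))
    rw [tensorHom_id, id_tensorHom, Category.assoc, ← whiskerLeft_comp, f.right_comm,
      whiskerLeft_comp, f.left_comm_assoc]

instance (M : Bicomod C) : Mono (toCofree M) := by
  have h : IsSplitMono (toCofree M).hom :=
    ⟨⟨{ retraction := C ◁ M.X ◁ ε ≫ C ◁ (ρ_ _).hom ≫ ε ▷ M.X ≫ (λ_ _).hom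
        id := by
          have := congr(C ◁ $(M.right_counit))
          rw [whiskerLeft_comp] at this
          simp only [toCofree, Category.assoc, reassoc_of% this]
          simp }⟩⟩
  exact (forget C).mono_of_mono_map (inferInstanceAs (Mono (toCofree M).hom))

end

variable {V : Type u} [Category.{v} V] [Abelian V] [MonoidalCategory V] [MonoidalPreadditive V]
  {C : V} [ComonObj C] [∀ X : V, PreservesFiniteLimits (tensorLeft X)]
  [∀ X : V, PreservesFiniteLimits (tensorRight X)]

instance : (forget C).Additive where

instance : (forget C).PreservesHomology where
  preservesKernels M N f :=
    preservesLimit_of_preserves_limit_cone (isLimitKer f)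
      ((KernelFork.isLimitMapConeEquiv (KernelFork.ofι (f := f) (kerι f) (hom_ext (by simp)))
        (forget C)).symm (kernelIsKernel f.hom))
  preservesCokernels M N f :=
    preservesColimit_of_preserves_colimit_cocone (isColimitCoker f)
      ((CokernelCofork.isColimitMapCoconeEquiv (CokernelCofork.ofπ (f := f) (cokerπ f)
        (hom_ext (by simp))) (forget C)).symm (cokernelIsCokernel f.hom))

lemma exact_iff_forget (S : ShortComplex (Bicomod C)) : S.Exact ↔ (S.map (forget C)).Exact :=
  (ShortComplex.exact_map_iff_of_faithful S (forget C)).symm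

/-- If `F` is cofree as a right comodule, then `F □ P` is a tensor product. -/
def cotCofreeRight {F : Bicomod C} {X : V} (e : F.X ≅ X ⊗ C)
    (h : F.right ≫ e.hom ▷ C = e.hom ≫ X ◁ Δ ≫ (α_ _ _ _).inv) (P : Bicomod C) :
    (cot F P).X ≅ X ⊗ P.X :=
  have hl := exists_lift F P (X ◁ P.left ≫ (α_ _ _ _).inv ≫ e.inv ▷ P.X) (by
    have h' : e.inv ≫ F.right = X ◁ Δ ≫ (α_ _ _ _).inv ≫ e.inv ▷ C := by
      rw [Iso.inv_comp_eq, ← reassoc_of% h, ← comp_whiskerRight]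
      simp
    have h'' := congr($h' ▷ P.X)
    have h₃ := congr(X ◁ $(P.left_coassoc))
    simp only [comp_whiskerRight, whiskerLeft_comp] at h'' h₃
    simp only [Category.assoc, reassoc_of% h'']
    rw [← whisker_exchange, ← associator_inv_naturality_right_assoc, reassoc_of% h₃]
    simp)
  { hom := cι F P ≫ e.hom ▷ P.X ≫ (α_ _ _ _).hom ≫ X ◁ (ε ▷ P.X ≫ (λ_ _).hom)
    inv := hl.choose
    hom_inv_id := by
      have h₁ := cι_eq_assoc F P (e.hom ▷ (C ⊗ P.X) ≫ (α_ _ _ _).hom ≫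
        X ◁ (ε ▷ (C ⊗ P.X) ≫ (λ_ _).hom) ≫ (α_ _ _ _).inv ≫ e.inv ▷ P.X)
      have h₂ := congr($h ▷ P.X)
      simp only [comp_whiskerRight] at h₂
      rw [← cancel_mono (cι F P)]
      simp only [Category.assoc, hl.choose_spec]
      rw [← associator_naturality_left_assoc, reassoc_of% h₂, whisker_exchange_assoc] at h₁
      have h₃ : Δ ▷ P.X ≫ ε ▷ C ▷ P.X ≫ (α_ (𝟙_ V) C P.X).hom ≫ (λ_ (C ⊗ P.X)).hom = 𝟙 _ := by
        rw [← comp_whiskerRight_assoc]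
        simp
      have h₄ : C ◁ P.left ≫ (α_ C C P.X).inv ≫ ε ▷ C ▷ P.X ≫ (α_ (𝟙_ V) C P.X).hom ≫
          (λ_ (C ⊗ P.X)).hom = ε ▷ P.X ≫ (λ_ P.X).hom ≫ P.left := by
        rw [← leftUnitor_naturality, ← whisker_exchange_assoc]
        simp
      replace h₃ := congr(X ◁ $h₃)
      replace h₄ := congr(X ◁ $h₄)
      simp only [whiskerLeft_comp] at h₃ h₄
      simp at h₁
      rw [reassoc_of% h₃, reassoc_of% h₄] at h₁
      simp only [whiskerLeft_comp, Category.assoc, ← h₁]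
      simp
    inv_hom_id := by
      rw [reassoc_of% hl.choose_spec]
      simp [← comp_whiskerRight_assoc]
      rw [← whiskerLeft_comp, ← whiskerLeft_comp]
      simp }

/-- If `F` is cofree as a left comodule, then `P □ F` is a tensor product. -/
def cotCofreeLeft {F : Bicomod C} {Y : V} (e : F.X ≅ C ⊗ Y)
    (h : F.left ≫ C ◁ e.hom = e.hom ≫ Δ ▷ Y ≫ (α_ _ _ _).hom) (P : Bicomod C) :
    (cot P F).X ≅ P.X ⊗ Y :=
  have hl := exists_lift P F (P.right ▷ Y ≫ (α_ _ _ _).hom ≫ P.X ◁ e.inv) (by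
    have h' : e.inv ≫ F.left = Δ ▷ Y ≫ (α_ _ _ _).hom ≫ C ◁ e.inv := by
      rw [Iso.inv_comp_eq, ← reassoc_of% h, ← whiskerLeft_comp]
      simp
    have h'' := congr(P.X ◁ $h')
    have h₃ := congr($(P.right_coassoc) ▷ Y)
    simp only [comp_whiskerRight, whiskerLeft_comp] at h'' h₃
    simp only [Category.assoc, h'']
    rw [whisker_exchange_assoc, ← associator_naturality_left_assoc, reassoc_of% h₃]
    simp)
  { hom := cι P F ≫ P.X ◁ e.hom ≫ (α_ _ _ _).inv ≫ (P.X ◁ ε ≫ (ρ_ _).hom) ▷ Y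
    inv := hl.choose
    hom_inv_id := by
      have h₁ := cι_eq_assoc P F (P.X ◁ C ◁ e.hom ≫ (α_ _ _ _).inv ≫ (α_ _ _ _).inv ≫
        (((P.X ⊗ C) ◁ ε ≫ (ρ_ _).hom) ▷ Y) ≫ (α_ _ _ _).hom ≫ P.X ◁ e.inv)
      have h₂ := congr(P.X ◁ $h)
      simp only [whiskerLeft_comp] at h₂
      rw [← cancel_mono (cι P F)]
      simp only [Category.assoc, hl.choose_spec]
      have h₃ : Δ ▷ Y ≫ (α_ C C Y).hom ≫ C ◁ ε ▷ Y ≫ C ◁ (λ_ Y).hom = 𝟙 _ := by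
        rw [← associator_naturality_middle_assoc, ← comp_whiskerRight_assoc]
        simp
      replace h₃ := congr(P.X ◁ $h₃)
      simp only [whiskerLeft_comp] at h₃
      simp [reassoc_of% h₂] at h₁
      rw [reassoc_of% h₃, MonoidalCategory.whiskerLeft_id, Category.id_comp,
        whiskerLeft_hom_inv, Category.comp_id] at h₁
      rw [Category.id_comp]
      refine Eq.trans ?_ h₁
      simp only [comp_whiskerRight, whisker_assoc, triangle_assoc_comp_right, Category.assoc,
        Iso.inv_hom_id_assoc, whisker_exchange_assoc]
      simp
    inv_hom_id := by
      rw [reassoc_of% hl.choose_spec]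
      have := congr($(P.right_counit) ▷ Y)
      rw [comp_whiskerRight] at this
      simp only [comp_whiskerRight, whiskerLeft_inv_hom_assoc, Iso.hom_inv_id_assoc]
      rw [reassoc_of% this, ← comp_whiskerRight, Iso.inv_hom_id, id_whiskerRight] }

section

variable [∀ X : V, PreservesFiniteColimits (tensorLeft X)]
  [∀ X : V, PreservesFiniteColimits (tensorRight X)]

lemma tensorExact_of_cofree {F : Bicomod C} {X Y : V} (e : F.X ≅ X ⊗ C)
    (h : F.right ≫ e.hom ▷ C = e.hom ≫ X ◁ Δ ≫ (α_ _ _ _).inv) (e' : F.X ≅ C ⊗ Y)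
    (h' : F.left ≫ C ◁ e'.hom = e'.hom ≫ Δ ▷ Y ≫ (α_ _ _ _).hom) : TensorExact F := by
  intro S hS
  rw [exact_iff_forget] at hS
  constructor
  · rw [exact_iff_forget]
    refine (ShortComplex.exact_iff_of_iso (S.mapNatIso (F := tensorLeft F ⋙ forget C)
      (G := forget C ⋙ tensorLeft X) (NatIso.ofComponents (cotCofreeRight e h) ?_))).2
      (hS.map (tensorLeft X))
    intro P Q f
    have : (cotMap (𝟙 F) f).hom ≫ cι F Q = cι F P ≫ F.X ◁ f.hom := by simp
    change (cotMap (𝟙 F) f).hom ≫ cι F Q ≫ _ = (cι F P ≫ _) ≫ X ◁ f.hom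
    rw [reassoc_of% this, whisker_exchange_assoc]
    simp [← whiskerLeft_comp, whisker_exchange_assoc]
  · rw [exact_iff_forget]
    refine (ShortComplex.exact_iff_of_iso (S.mapNatIso (F := tensorRight F ⋙ forget C)
      (G := forget C ⋙ tensorRight Y) (NatIso.ofComponents (cotCofreeLeft e' h') ?_))).2
      (hS.map (tensorRight Y))
    intro P Q f
    have : (cotMap f (𝟙 F)).hom ≫ cι Q F = cι P F ≫ f.hom ▷ F.X := by simp
    change (cotMap f (𝟙 F)).hom ≫ cι Q F ≫ _ = (cι P F ≫ _) ≫ f.hom ▷ Y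
    rw [reassoc_of% this, ← whisker_exchange_assoc]
    simp [← comp_whiskerRight, ← whisker_exchange_assoc]

lemma tensorExact_cofree (M : Bicomod C) : TensorExact (cofree M) :=
  tensorExact_of_cofree (α_ _ _ _).symm (by simp) (Iso.refl _) (by simp)

variable (C) in
/-- The functorial embedding of each bicomodule into a cofree one. -/
def cofreeLeftResolution : Abelian.LeftResolution (𝟭 (Bicomod C)ᵒᵖ) where
  F := (cofreeFunctor C).op
  π := NatTrans.op (toCofreeNatTrans C)
  epi_π_app X := inferInstanceAs (Epi (toCofree X.unop).op)

instance : (cofreeLeftResolution C).F.PreservesZeroMorphisms where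
  map_zero X Y := by
    refine Quiver.Hom.unop_inj (hom_ext ?_)
    change 𝟙 C ⊗ₘ ((0 : Y.unop.X ⟶ X.unop.X) ⊗ₘ 𝟙 C) = 0
    simp

variable (C) in
/-- Every bicomodule is functorially a subobject of one whose cotensor product functors are
exact. -/
def functorialCoresolution [HasGoodCoproducts V] [HasCoproducts.{0} V]
    [∀ J : Type, HasExactColimitsOfShape (Discrete J) V] :
    FunctorialCoresolution (TensorExact (B := Bicomod C)) :=
  have : (TensorExact (B := Bicomod C)).IsClosedUnderIsomorphisms := ⟨.of_iso⟩
  (cofreeLeftResolution C).functorialCoresolution _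
    (fun X ↦ tensorExact_cofree X.unop) (fun _ h ↦ .of_isZero h)

end

end Bicomod

/-! ### Products of extensions in terms of resolutions -/

noncomputable section

namespace CochainComplex.HomComplex

variable {C : Type*} [Category C] [Preadditive C] {K L M : CochainComplex C ℤ}

lemma Cocycle.equivHomShift_symm_f {p : ℤ} (z : Cocycle K L p) (a b : ℤ) (h : a + p = b) :
    (Cocycle.equivHomShift.symm z).f a =
      z.1.v a b h ≫ (L.shiftFunctorObjXIso p a b h.symm).inv := by
  subst h
  simp [Cocycle.equivHomShift_symm_apply, Cochain.rightShift_v _ _ _ _ a a (add_zero a) _ rfl]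
  rfl

/-- The product of cocycles that are regarded as shifted morphisms is the composition of
cochains. -/
lemma Cocycle.equivHomShift_symm_comp {p q n : ℤ} (x : Cocycle K L p) (y : Cocycle L M q)
    (h : q + p = n) (z : Cocycle K M n) (hz : x.1.comp y.1 (by lia) = z.1) :
    ShiftedHom.comp (Cocycle.equivHomShift.symm x) (Cocycle.equivHomShift.symm y) h =
      Cocycle.equivHomShift.symm z := by
  ext a
  rw [Cocycle.equivHomShift_symm_f z a (a + n) rfl, ← hz,
    Cochain.comp_v _ _ _ a (a + p) (a + n) rfl (by lia), ShiftedHom.comp,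
    HomologicalComplex.comp_f, HomologicalComplex.comp_f, shiftFunctor_map_f',
    Cocycle.equivHomShift_symm_f x a (a + p) rfl,
    Cocycle.equivHomShift_symm_f y (a + p) (a + n) (by lia),
    shiftFunctorAdd'_inv_app_f']
  have key {X₀ X₁ X₂ X₃ : C} (f : X₀ ⟶ X₁) (g : X₁ ⟶ X₂) (e : X₃ ≅ X₂) :
      (f ≫ 𝟙 X₁) ≫ (g ≫ e.inv) ≫ e.hom = (f ≫ g) ≫ 𝟙 X₂ := by simp
  simp only [shiftFunctorObjXIso, HomologicalComplex.XIsoOfEq_rfl, Iso.refl_inv]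
  exact key _ _ (M.XIsoOfEq _)

end CochainComplex.HomComplex

lemma CategoryTheory.ShiftedHom.comp_comp_comp {D : Type*} [Category D] [HasShift D ℤ]
    {X₁ X₂ X₃ X₄ X₅ X₆ X₇ : D} {p q n : ℤ} (h : q + p = n) (f : X₁ ⟶ X₂) (a : ShiftedHom X₂ X₃ p)
    (g : X₃ ⟶ X₄) (g' : X₄ ⟶ X₅) (b : ShiftedHom X₅ X₆ q) (f' : X₆ ⟶ X₇) :
    ShiftedHom.comp (X := X₁) (Y := X₄) (Z := X₇) (f ≫ a ≫ g⟦p⟧') (g' ≫ b ≫ f'⟦q⟧') h =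
      f ≫ ShiftedHom.comp (Z := X₆) a (g ≫ g' ≫ b : X₃ ⟶ X₆⟦q⟧) h ≫ f'⟦n⟧' := by
  have := (shiftFunctorAdd' D q p n h).inv.naturality f'
  dsimp at this
  simp [ShiftedHom.comp, this]

/-- A product of shifted morphisms that are given by roofs with cancelling inner legs. -/
lemma CategoryTheory.ShiftedHom.comp_eq_of_comp_eq_id {D : Type*} [Category D] [HasShift D ℤ]
    {X K S L Y : D} {p q n : ℤ} (h : q + p = n) (A : X ⟶ K) (a : ShiftedHom K K p) (P : K ⟶ S)
    (i : S ⟶ X) (b : ShiftedHom K L q) (B : L ⟶ Y) (hP : P ≫ i ≫ A = 𝟙 K) :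
    ShiftedHom.comp (X := X) (Y := X) (Z := Y) (A ≫ (a ≫ P⟦p⟧') ≫ i⟦p⟧') (A ≫ b ≫ B⟦q⟧') h =
      A ≫ ShiftedHom.comp (Z := L) a b h ≫ B⟦n⟧' := by
  rw [Category.assoc, ← Functor.map_comp, ShiftedHom.comp_comp_comp]
  have : (P ≫ i) ≫ A ≫ b = b := by rw [← Category.assoc, Category.assoc P, hP, Category.id_comp]
  rw [this]

/-- A product of shifted morphisms that are given by coroofs with cancelling inner legs. -/
lemma CategoryTheory.ShiftedHom.comp_eq_of_comp_eq_id' {D : Type*} [Category D] [HasShift D ℤ]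
    {Y S K L X' X : D} {p q n : ℤ} (h : q + p = n) (A : Y ⟶ S) (a : ShiftedHom S K p) (P : K ⟶ X)
    (i : X ⟶ X') (j : X' ⟶ K) (b : ShiftedHom K K q) (B : K ⟶ L) (hP : P ≫ i ≫ j = 𝟙 K) :
    ShiftedHom.comp (X := Y) (Y := X) (Z := L) (A ≫ a ≫ P⟦p⟧') (i ≫ (j ≫ b) ≫ B⟦q⟧') h =
      A ≫ ShiftedHom.comp (X := S) (Z := K) a b h ≫ B⟦n⟧' := by
  have : i ≫ (j ≫ b) ≫ B⟦q⟧' = (i ≫ j) ≫ b ≫ B⟦q⟧' := by simp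
  rw [this, ShiftedHom.comp_comp_comp]
  have : P ≫ (i ≫ j) ≫ b = b := by rw [← Category.assoc, hP, Category.id_comp]
  rw [this]

open CochainComplex HomComplex

namespace CategoryTheory.ProjectiveResolution

variable {C : Type u} [Category.{v} C] [Abelian C] {X Y : C} (R : ProjectiveResolution X)

section

variable {p : ℕ} (F : ∀ i, R.complex.X (p + i) ⟶ R.complex.X i)

/-- Maps `R_{p+i} ⟶ R_i`, with the sign that makes a cocycle of degree `p` out of maps that
commute with the differentials. -/
def liftCochain : Cochain R.cochainComplex R.cochainComplex p :=
  Cochain.mk fun a b h ↦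
    if hb : b ≤ 0 then
      ((p : ℤ) * b).negOnePow • (R.cochainComplexXIso a (p + b.natAbs) (by lia)).hom ≫
        F b.natAbs ≫ (R.cochainComplexXIso b b.natAbs (by lia)).inv
    else 0

lemma liftCochain_v (i : ℕ) (a b : ℤ) (h : a + p = b) (hb : -i = b) :
    (R.liftCochain F).v a b h = ((p : ℤ) * i).negOnePow •
      (R.cochainComplexXIso a (p + i) (by lia)).hom ≫ F i ≫
        (R.cochainComplexXIso b i hb).inv := by
  obtain rfl : b.natAbs = i := by lia
  have hb : b ≤ 0 := by lia
  rw [liftCochain, Cochain.mk_v, dif_pos hb]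
  congr 1
  rw [← Int.negOnePow_neg]
  congr 1
  rw [← mul_neg]
  congr 1
  lia

lemma δ_liftCochain
    (hF : ∀ i, R.complex.d (p + i + 1) (p + i) ≫ F i = F (i + 1) ≫ R.complex.d (i + 1) i) :
    δ p (p + 1) (R.liftCochain F) = 0 := by
  ext a b h
  rw [δ_v _ _ rfl _ a b h (b - 1) (a + 1) rfl rfl, Cochain.zero_v]
  obtain hb | hb := lt_or_ge 0 b
  · exact (CochainComplex.isZero_of_isStrictlyLE R.cochainComplex 0 b hb).eq_of_tgt _ _
  · obtain ⟨i, rfl⟩ := Int.exists_eq_neg_ofNat hb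
    rw [R.liftCochain_v F (i + 1) a _ (by lia) (by lia),
      R.liftCochain_v F i (a + 1) _ (by lia) rfl,
      R.cochainComplex_d (-(i : ℤ) - 1) (-i) (i + 1) i,
      R.cochainComplex_d a (a + 1) (p + i + 1) (p + i)]
    have := hF i
    have hs : ((p : ℤ) * (i + 1 : ℕ)).negOnePow = - (((p : ℤ) + 1).negOnePow *
        ((p : ℤ) * i).negOnePow) := by
      rw [Int.negOnePow_succ, neg_mul, neg_neg, ← Int.negOnePow_add]
      congr 1
      push_cast
      ring
    simp only [Linear.units_smul_comp, Linear.comp_units_smul, Category.assoc,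
      Iso.inv_hom_id_assoc, smul_smul, hs]
    simp only [reassoc_of% this, Units.neg_smul]
    exact neg_add_cancel _

end

variable [HasExt.{w} C]

/-- The cocycle with values in a single complex that corresponds to a morphism. -/
def extCocycle {n : ℕ} (f : R.complex.X n ⟶ Y) (hf : R.complex.d (n + 1) n ≫ f = 0) :
    Cocycle R.cochainComplex ((CochainComplex.singleFunctor C 0).obj Y) n :=
  Cocycle.toSingleMk ((R.cochainComplexXIso (-n) n rfl).hom ≫ f) (by simp)
    (-(n + 1 : ℕ)) (by lia) (by rw [R.cochainComplex_d _ _ (n + 1) n rfl rfl]; simp [hf])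

lemma extMk_hom' [HasDerivedCategory C] {n : ℕ} (f : R.complex.X n ⟶ Y)
    (hf : R.complex.d (n + 1) n ≫ f = 0) :
    (R.extMk f _ rfl hf).hom =
    (ShiftedHom.mk₀ _ rfl ((DerivedCategory.singleFunctorIsoCompQ C 0).hom.app X ≫
      inv (DerivedCategory.Q.map R.π'))).comp
        ((ShiftedHom.map (Cocycle.equivHomShift.symm (R.extCocycle f hf)) _).comp
              (.mk₀ _ rfl ((DerivedCategory.singleFunctorIsoCompQ C 0).inv.app Y))
                (zero_add _)) (add_zero _) :=
  R.extMk_hom f _ rfl hf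

lemma smul_extMk {n m : ℕ} (s : ℤˣ) (f : R.complex.X n ⟶ Y) (hm : n + 1 = m)
    (hf : R.complex.d m n ≫ f = 0) (hf' : R.complex.d m n ≫ (s • f) = 0) :
    R.extMk (s • f) m hm hf' = (s : ℤ) • R.extMk f m hm hf := by
  obtain rfl | rfl := Int.units_eq_one_or s
  · simp
  · rw [Units.val_neg, Units.val_one, neg_smul, one_smul, neg_extMk]
    simp

/-- The product of two extensions, computed by a lift of the first factor. -/
lemma extMk_comp_extMk {p q : ℕ} (f : R.complex.X p ⟶ X)
    (hf : R.complex.d (p + 1) p ≫ f = 0) (g : R.complex.X q ⟶ Y)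
    (hg : R.complex.d (q + 1) q ≫ g = 0) (F : ∀ i, R.complex.X (p + i) ⟶ R.complex.X i)
    (hF₀ : (F 0 ≫ R.π.f 0 : R.complex.X p ⟶ X) = f)
    (hF : ∀ i, R.complex.d (p + i + 1) (p + i) ≫ F i = F (i + 1) ≫ R.complex.d (i + 1) i) :
    (R.extMk f _ rfl hf).comp (R.extMk g _ rfl hg) rfl = (-1 : ℤ) ^ (p * q) •
      R.extMk (F q ≫ g) _ rfl (by rw [← Category.assoc, hF, Category.assoc, hg, comp_zero]) := by
  have hF' : R.complex.d (p + q + 1) (p + q) ≫ F q ≫ g = 0 := by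
    rw [← Category.assoc, hF, Category.assoc, hg, comp_zero]
  have hs : R.complex.d (p + q + 1) (p + q) ≫ (((p : ℤ) * q).negOnePow • (F q ≫ g)) = 0 := by
    rw [Linear.comp_units_smul, hF', smul_zero]
  have h₀ := R.smul_extMk ((p : ℤ) * q).negOnePow (F q ≫ g) rfl hF' hs
  rw [show ((((p : ℤ) * q).negOnePow : ℤˣ) : ℤ) = (-1) ^ (p * q) by
    rw [← Nat.cast_mul, Int.negOnePow_def, zpow_natCast]; simp] at h₀
  rw [← h₀]
  have := HasDerivedCategory.standard C
  let Φ : Cocycle R.cochainComplex R.cochainComplex p :=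
    Cocycle.mk (R.liftCochain F) _ rfl (R.δ_liftCochain F hF)
  have h₁ : R.extCocycle f hf = Φ.postcomp R.π' := by
    ext : 1
    refine (Cochain.toSingleEquiv (p := -p) (by lia)).injective ?_
    have h := Cochain.comp_v (R.liftCochain F) (Cochain.ofHom R.π') (add_zero _) (-p) 0 0
      (by lia) (by lia)
    rw [R.liftCochain_v F 0 (-p) 0 (by lia) rfl, Cochain.ofHom_v, π'_f_zero] at h
    simp only [extCocycle, Cochain.toSingleEquiv, Φ,
      Cocycle.toSingleMk_coe, AddEquiv.coe_mk, Equiv.coe_fn_mk, Cochain.toSingleMk_v,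
      Cocycle.postcomp_coe, Cocycle.mk_coe]
    rw [h]
    have key {X₀ X₁ X₂ X₃ X₄ X₅ : C} (a : X₀ ⟶ X₁) (b : X₁ ⟶ X₂) (e : X₃ ≅ X₂) (c : X₂ ⟶ X₄)
        (c' : X₄ ⟶ X₅) (s : ℤˣ) (hs : s = 1) :
        (a ≫ b ≫ c) ≫ c' = (s • (a ≫ b ≫ e.inv)) ≫ e.hom ≫ c ≫ c' := by
      simp [hs]
    congr 1
    rw [← hF₀]
    exact key _ _ _ _ _ _ (by simp)
  have h₂ : Φ.1.comp (R.extCocycle g hg).1 (by lia) = (R.extCocycle _ hs).1 := by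
    refine (Cochain.toSingleEquiv (p := -(p + q : ℕ)) (by lia)).injective ?_
    have h := Cochain.comp_v (R.liftCochain F) (R.extCocycle g hg).1 (n₁₂ := (p + q : ℕ)) (by lia)
      (-(p + q : ℕ)) (-q) 0 (by lia) (by lia)
    rw [R.liftCochain_v F q (-(p + q : ℕ)) (-q) (by lia) rfl] at h
    simp only [extCocycle, Cochain.toSingleEquiv, Φ,
      Cocycle.toSingleMk_coe, AddEquiv.coe_mk, Equiv.coe_fn_mk, Cochain.toSingleMk_v,
      Cocycle.mk_coe] at h ⊢
    rw [h]
    have key {X₀ X₁ X₂ X₃ X₄ X₅ X₆ : C} (a : X₀ ⟶ X₁) (b : X₁ ⟶ X₂) (e : X₃ ≅ X₂)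
        (c : X₂ ⟶ X₄) (c' : X₄ ⟶ X₅) (c'' : X₅ ⟶ X₆) (s : ℤˣ) :
        ((s • (a ≫ b ≫ e.inv)) ≫ (e.hom ≫ c) ≫ c') ≫ c'' = ((a ≫ (s • (b ≫ c))) ≫ c') ≫ c'' := by
      simp
    exact key _ _ _ _ _ _ _
  ext
  rw [Abelian.Ext.comp_hom, extMk_hom', extMk_hom', extMk_hom', h₁,
    Cocycle.equivHomShift_symm_postcomp, ← Cocycle.equivHomShift_symm_comp _ _ (by lia) _ h₂]
  simp only [ShiftedHom.mk₀_comp, ShiftedHom.comp_mk₀, ShiftedHom.map_comp]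
  have hB : DerivedCategory.Q.map R.π' ≫ (DerivedCategory.singleFunctorIsoCompQ C 0).inv.app X ≫
      (DerivedCategory.singleFunctorIsoCompQ C 0).hom.app X ≫
        inv (DerivedCategory.Q.map R.π') = 𝟙 _ := by
    rw [Iso.inv_hom_id_app_assoc]
    exact IsIso.hom_inv_id _
  have h₃ (x : R.cochainComplex ⟶ R.cochainComplex⟦(p : ℤ)⟧) :
      ShiftedHom.map (Y := (CochainComplex.singleFunctor C 0).obj X) (x ≫ R.π'⟦(p : ℤ)⟧')
        DerivedCategory.Q = ShiftedHom.map (Y := R.cochainComplex) x DerivedCategory.Q ≫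
          (DerivedCategory.Q.map R.π')⟦(p : ℤ)⟧' := by
    rw [← ShiftedHom.comp_mk₀ _ 0 rfl, ShiftedHom.map_comp, ShiftedHom.map_mk₀,
      ShiftedHom.comp_mk₀]
  rw [h₃]
  exact ShiftedHom.comp_eq_of_comp_eq_id _ _ _ _ _ _ _ hB

end CategoryTheory.ProjectiveResolution

namespace CategoryTheory.InjectiveResolution

variable {C : Type u} [Category.{v} C] [Abelian C] {X Y : C} (R : InjectiveResolution X)

section

variable {q : ℕ} (G : ∀ i, R.cocomplex.X i ⟶ R.cocomplex.X (q + i))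

/-- Maps `R^i ⟶ R^{q+i}`, with the sign that makes a cocycle of degree `q` out of maps that
commute with the differentials. -/
def liftCochain : Cochain R.cochainComplex R.cochainComplex q :=
  Cochain.mk fun a b h ↦
    if ha : 0 ≤ a then
      ((q : ℤ) * a).negOnePow • (R.cochainComplexXIso a a.natAbs (by lia)).hom ≫
        G a.natAbs ≫ (R.cochainComplexXIso b (q + a.natAbs) (by lia)).inv
    else 0

lemma liftCochain_v (i : ℕ) (a b : ℤ) (h : a + q = b) (ha : i = a) :
    (R.liftCochain G).v a b h = ((q : ℤ) * i).negOnePow •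
      (R.cochainComplexXIso a i ha).hom ≫ G i ≫
        (R.cochainComplexXIso b (q + i) (by lia)).inv := by
  obtain rfl : a.natAbs = i := by lia
  have ha : 0 ≤ a := by lia
  rw [liftCochain, Cochain.mk_v, dif_pos ha]
  congr 3
  lia

lemma δ_liftCochain
    (hG : ∀ i, R.cocomplex.d i (i + 1) ≫ G (i + 1) = G i ≫ R.cocomplex.d (q + i) (q + i + 1)) :
    δ q (q + 1) (R.liftCochain G) = 0 := by
  ext a b h
  rw [δ_v _ _ rfl _ a b h (b - 1) (a + 1) rfl rfl, Cochain.zero_v]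
  obtain ha | ha := lt_or_ge a 0
  · exact (CochainComplex.isZero_of_isStrictlyGE R.cochainComplex 0 a ha).eq_of_src _ _
  · obtain ⟨i, rfl⟩ := Int.eq_ofNat_of_zero_le ha
    rw [R.liftCochain_v G (i + 1) _ b (by lia) (by lia),
      R.liftCochain_v G i _ (b - 1) (by lia) rfl,
      R.cochainComplex_d (i : ℤ) (i + 1) i (i + 1) rfl rfl,
      R.cochainComplex_d (b - 1) b (q + i) (q + i + 1) (by lia) (by lia)]
    have := hG i
    have hs : ((q : ℤ) * (i + 1 : ℕ)).negOnePow = (q : ℤ).negOnePow *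
        ((q : ℤ) * i).negOnePow := by
      rw [← Int.negOnePow_add]
      congr 1
      push_cast
      ring
    simp only [Linear.units_smul_comp, Linear.comp_units_smul, Category.assoc,
      Iso.inv_hom_id_assoc, smul_smul, hs, Int.negOnePow_succ]
    rw [reassoc_of% this, ← mul_assoc, neg_mul, ← Int.negOnePow_add, ← two_mul,
      Int.negOnePow_two_mul, neg_mul, one_mul, Units.neg_smul]
    exact add_neg_cancel _

end

variable [HasExt.{w} C]

/-- The cocycle on a single complex that corresponds to a morphism. -/
def extCocycle {n : ℕ} (f : Y ⟶ R.cocomplex.X n) (hf : f ≫ R.cocomplex.d n (n + 1) = 0) :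
    Cocycle ((CochainComplex.singleFunctor C 0).obj Y) R.cochainComplex n :=
  Cocycle.fromSingleMk (f ≫ (R.cochainComplexXIso n n rfl).inv) (zero_add _) (n + 1 : ℕ)
    (by lia) (by rw [R.cochainComplex_d _ _ n (n + 1) rfl rfl]; simp [reassoc_of% hf])

lemma extMk_hom' [HasDerivedCategory C] {n : ℕ} (f : Y ⟶ R.cocomplex.X n)
    (hf : f ≫ R.cocomplex.d n (n + 1) = 0) :
    (R.extMk f _ rfl hf).hom =
    (ShiftedHom.mk₀ _ rfl ((DerivedCategory.singleFunctorIsoCompQ C 0).hom.app Y)).comp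
      ((ShiftedHom.map (Cocycle.equivHomShift.symm (R.extCocycle f hf)) _).comp
            (.mk₀ _ rfl (inv (DerivedCategory.Q.map R.ι') ≫
              (DerivedCategory.singleFunctorIsoCompQ C 0).inv.app X))
                (zero_add _)) (add_zero _) :=
  R.extMk_hom f _ rfl hf

lemma smul_extMk {n m : ℕ} (s : ℤˣ) (f : Y ⟶ R.cocomplex.X n) (hm : n + 1 = m)
    (hf : f ≫ R.cocomplex.d n m = 0) (hf' : (s • f) ≫ R.cocomplex.d n m = 0) :
    R.extMk (s • f) m hm hf' = (s : ℤ) • R.extMk f m hm hf := by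
  obtain rfl | rfl := Int.units_eq_one_or s
  · simp
  · rw [Units.val_neg, Units.val_one, neg_smul, one_smul, neg_extMk]
    simp

/-- The product of two extensions, computed by a lift of the second factor. -/
lemma extMk_comp_extMk {p q : ℕ} (f : Y ⟶ R.cocomplex.X p)
    (hf : f ≫ R.cocomplex.d p (p + 1) = 0) (g : X ⟶ R.cocomplex.X q)
    (hg : g ≫ R.cocomplex.d q (q + 1) = 0) (G : ∀ i, R.cocomplex.X i ⟶ R.cocomplex.X (q + i))
    (hG₀ : (R.ι.f 0 ≫ G 0 : X ⟶ R.cocomplex.X q) = g)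
    (hG : ∀ i, R.cocomplex.d i (i + 1) ≫ G (i + 1) = G i ≫ R.cocomplex.d (q + i) (q + i + 1)) :
    (R.extMk f _ rfl hf).comp (R.extMk g _ rfl hg) (Nat.add_comm p q) = (-1 : ℤ) ^ (p * q) •
      R.extMk (f ≫ G p) _ rfl (by rw [Category.assoc, ← hG, reassoc_of% hf, zero_comp]) := by
  have hG' : (f ≫ G p) ≫ R.cocomplex.d (q + p) (q + p + 1) = 0 := by
    rw [Category.assoc, ← hG, reassoc_of% hf, zero_comp]
  have hs : (((q : ℤ) * p).negOnePow • (f ≫ G p)) ≫ R.cocomplex.d (q + p) (q + p + 1) = 0 := by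
    rw [Linear.units_smul_comp, hG', smul_zero]
  have h₀ := R.smul_extMk ((q : ℤ) * p).negOnePow (f ≫ G p) rfl hG' hs
  rw [show ((((q : ℤ) * p).negOnePow : ℤˣ) : ℤ) = (-1) ^ (p * q) by
    rw [← Nat.cast_mul, Int.negOnePow_def, zpow_natCast, mul_comm q]; simp] at h₀
  rw [← h₀]
  have := HasDerivedCategory.standard C
  let Φ : Cocycle R.cochainComplex R.cochainComplex q :=
    Cocycle.mk (R.liftCochain G) _ rfl (R.δ_liftCochain G hG)
  have h₁ : R.extCocycle g hg = Φ.precomp R.ι' := by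
    ext : 1
    refine (Cochain.fromSingleEquiv (q := q) (by lia)).injective ?_
    have h := Cochain.comp_v (Cochain.ofHom R.ι') (R.liftCochain G) (zero_add _) 0 0 q
      (by lia) (by lia)
    rw [R.liftCochain_v G 0 0 q (by lia) rfl, Cochain.ofHom_v, ι'_f_zero] at h
    simp only [extCocycle, Cochain.fromSingleEquiv, Φ,
      Cocycle.fromSingleMk_coe, AddEquiv.coe_mk, Equiv.coe_fn_mk, Cochain.fromSingleMk_v,
      Cocycle.precomp_coe, Cocycle.mk_coe]
    rw [h]
    have key {X₀ X₁ X₂ X₃ X₄ X₅ : C} (a : X₀ ⟶ X₁) (b : X₁ ⟶ X₂) (e : X₃ ≅ X₂) (c : X₂ ⟶ X₄)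
        (c' : X₄ ⟶ X₅) (s : ℤˣ) (hs : s = 1) :
        a ≫ (b ≫ c) ≫ c' = (a ≫ b ≫ e.inv) ≫ (s • (e.hom ≫ c ≫ c')) := by
      simp [hs]
    congr 1
    rw [← hG₀]
    exact key _ _ _ _ _ _ (by simp)
  have h₂ : (R.extCocycle f hf).1.comp Φ.1 (by lia) = (R.extCocycle _ hs).1 := by
    refine (Cochain.fromSingleEquiv (q := (q + p : ℕ)) (by lia)).injective ?_
    have h := Cochain.comp_v (R.extCocycle f hf).1 (R.liftCochain G) (n₁₂ := (q + p : ℕ)) (by lia)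
      0 p (q + p : ℕ) (by lia) (by lia)
    rw [R.liftCochain_v G p p (q + p : ℕ) (by lia) rfl] at h
    simp only [extCocycle, Cochain.fromSingleEquiv, Φ,
      Cocycle.fromSingleMk_coe, AddEquiv.coe_mk, Equiv.coe_fn_mk, Cochain.fromSingleMk_v,
      Cocycle.mk_coe] at h ⊢
    rw [h]
    have key {X₀ X₁ X₂ X₃ X₄ X₅ X₆ : C} (a : X₀ ⟶ X₁) (b : X₁ ⟶ X₂) (c : X₂ ⟶ X₃)
        (e : X₄ ≅ X₃) (c' : X₃ ⟶ X₅) (c'' : X₅ ⟶ X₆) (s : ℤˣ) :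
        a ≫ (b ≫ c ≫ e.inv) ≫ (s • (e.hom ≫ c' ≫ c'')) = a ≫ b ≫ (s • (c ≫ c')) ≫ c'' := by
      simp
    exact key _ _ _ _ _ _ _
  ext
  rw [Abelian.Ext.comp_hom, extMk_hom', extMk_hom', extMk_hom', h₁,
    Cocycle.equivHomShift_symm_precomp, ← Cocycle.equivHomShift_symm_comp _ _ (by lia) _ h₂]
  simp only [ShiftedHom.mk₀_comp, ShiftedHom.comp_mk₀, ShiftedHom.map_comp]
  have hA : (inv (DerivedCategory.Q.map R.ι') ≫
      (DerivedCategory.singleFunctorIsoCompQ C 0).inv.app X) ≫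
        (DerivedCategory.singleFunctorIsoCompQ C 0).hom.app X ≫ DerivedCategory.Q.map R.ι' =
          𝟙 _ := by
    rw [Category.assoc, Iso.inv_hom_id_app_assoc]
    exact IsIso.inv_hom_id _
  have h₃ (x : R.cochainComplex ⟶ R.cochainComplex⟦(q : ℤ)⟧) :
      ShiftedHom.map (X := (CochainComplex.singleFunctor C 0).obj X) (R.ι' ≫ x)
        DerivedCategory.Q = DerivedCategory.Q.map R.ι' ≫
          ShiftedHom.map (X := R.cochainComplex) x DerivedCategory.Q := by
    rw [← ShiftedHom.mk₀_comp 0 rfl, ShiftedHom.map_comp, ShiftedHom.map_mk₀,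
      ShiftedHom.mk₀_comp]
  rw [h₃]
  exact ShiftedHom.comp_eq_of_comp_eq_id' _ _ _ _ _ _ _ _ hA

end CategoryTheory.InjectiveResolution

end

/-! ### Extensions from augmented resolutions -/

noncomputable section

namespace CategoryTheory

open CochainComplex HomComplex

variable {C : Type u} [Category.{v} C] [Abelian C]

/-- A morphism in degree zero is determined by its class. -/
lemma ProjectiveResolution.extMk_zero_eq_zero_iff [HasExt.{w} C] {X Y : C}
    (R : ProjectiveResolution X) (f : R.complex.X 0 ⟶ Y) (hf : R.complex.d 1 0 ≫ f = 0) :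
    R.extMk f 1 rfl hf = 0 ↔ f = 0 := by
  refine ⟨fun h ↦ ?_, ?_⟩
  · rw [← R.extEquivCohomologyClass.apply_eq_iff_eq,
      ProjectiveResolution.extEquivCohomologyClass_extMk,
      ProjectiveResolution.extEquivCohomologyClass_zero, CohomologyClass.mk_eq_zero_iff,
      Cocycle.toSingleMk_mem_coboundaries_iff _ _ _ _ _ 1 (by simp)] at h
    obtain ⟨g, hg⟩ := h
    rw [(CochainComplex.isZero_of_isStrictlyLE R.cochainComplex 0 1).eq_of_src g 0,
      comp_zero] at hg
    exact (cancel_epi (R.cochainComplexXIso (-(0 : ℕ)) 0 rfl).hom).1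
      (hg.symm.trans comp_zero.symm)
  · rintro rfl
    exact R.extMk_zero _ _

/-- A morphism in degree zero is determined by its class. -/
lemma InjectiveResolution.extMk_zero_eq_zero_iff [HasExt.{w} C] {X Y : C}
    (R : InjectiveResolution X) (f : Y ⟶ R.cocomplex.X 0) (hf : f ≫ R.cocomplex.d 0 1 = 0) :
    R.extMk f 1 rfl hf = 0 ↔ f = 0 := by
  refine ⟨fun h ↦ ?_, ?_⟩
  · rw [← R.extEquivCohomologyClass.apply_eq_iff_eq,
      InjectiveResolution.extEquivCohomologyClass_extMk,
      InjectiveResolution.extEquivCohomologyClass_zero, CohomologyClass.mk_eq_zero_iff,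
      Cocycle.fromSingleMk_mem_coboundaries_iff _ _ _ _ _ (-1) (by simp)] at h
    obtain ⟨g, hg⟩ := h
    rw [(CochainComplex.isZero_of_isStrictlyGE R.cochainComplex 0 (-1)).eq_of_tgt g 0,
      zero_comp] at hg
    exact (cancel_mono (R.cochainComplexXIso (0 : ℕ) 0 rfl).inv).1
      (hg.symm.trans zero_comp.symm)
  · rintro rfl
    exact R.extMk_zero _ _

/-- An exact sequence `⋯ ⟶ X 2 ⟶ X 1 ⟶ X 0 ⟶ 0` with `X n` projective for `n > 0`. -/
structure ProjectiveSequence (C : Type u) [Category.{v} C] [Abelian C] where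
  /-- The objects. -/
  X : ℕ → C
  /-- The morphisms. -/
  d n : X (n + 1) ⟶ X n
  d_comp_d n : d (n + 1) ≫ d n = 0
  exact n : (ShortComplex.mk _ _ (d_comp_d n)).Exact
  epi : Epi (d 0)
  projective n : Projective (X (n + 1))

/-- An exact sequence `0 ⟶ X 0 ⟶ X 1 ⟶ X 2 ⟶ ⋯` with `X n` injective for `n > 0`. -/
structure InjectiveSequence (C : Type u) [Category.{v} C] [Abelian C] where
  /-- The objects. -/
  X : ℕ → C
  /-- The morphisms. -/
  d n : X n ⟶ X (n + 1)
  d_comp_d n : d n ≫ d (n + 1) = 0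
  exact n : (ShortComplex.mk _ _ (d_comp_d n)).Exact
  mono : Mono (d 0)
  injective n : Injective (X (n + 1))

namespace ProjectiveSequence

variable (S : ProjectiveSequence C) {Y : C}

/-- The chain complex `⋯ ⟶ X 2 ⟶ X 1`. -/
def complex : ChainComplex C ℕ :=
  ChainComplex.of (fun n ↦ S.X (n + 1)) (fun n ↦ S.d (n + 1)) (fun n ↦ S.d_comp_d (n + 1))

lemma complex_d (n : ℕ) : S.complex.d (n + 1) n = S.d (n + 1) :=
  ChainComplex.of_d (fun n ↦ S.X (n + 1)) (fun n ↦ S.d (n + 1)) n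

/-- The augmentation. -/
def π : S.complex ⟶ (ChainComplex.single₀ C).obj (S.X 0) :=
  (ChainComplex.toSingle₀Equiv _ _).symm ⟨S.d 0, by rw [complex_d]; exact S.d_comp_d 0⟩

lemma π_f_zero : S.π.f 0 = S.d 0 := by
  simp only [π]
  exact ChainComplex.toSingle₀Equiv_symm_apply_f_zero _ _

lemma exactAt (n : ℕ) : S.complex.ExactAt (n + 1) := by
  rw [HomologicalComplex.exactAt_iff' _ (n + 1 + 1) (n + 1) n (by simp) (by simp)]
  refine ShortComplex.exact_of_iso ?_ (S.exact (n + 1))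
  exact ShortComplex.isoMk (Iso.refl _) (Iso.refl _) (Iso.refl _)
    (by
      change 𝟙 _ ≫ S.complex.d (n + 2) (n + 1) = S.d (n + 2) ≫ 𝟙 _
      rw [complex_d]
      exact (Category.id_comp _).trans (Category.comp_id _).symm)
    (by
      change 𝟙 _ ≫ S.complex.d (n + 1) n = S.d (n + 1) ≫ 𝟙 _
      rw [complex_d]
      exact (Category.id_comp _).trans (Category.comp_id _).symm)

instance quasiIso : QuasiIso S.π where
  quasiIsoAt n := by
    cases n with
    | zero =>
      rw [ChainComplex.quasiIsoAt₀_iff, ShortComplex.quasiIso_iff_of_zeros' _ rfl rfl rfl]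
      refine (ShortComplex.exact_and_epi_g_iff_of_iso ?_).2 ⟨S.exact 0, S.epi⟩
      exact ShortComplex.isoMk (Iso.refl _) (Iso.refl _) (Iso.refl _)
        (by
          change 𝟙 _ ≫ S.d 1 = S.complex.d 1 0 ≫ 𝟙 _
          rw [complex_d]
          exact (Category.id_comp _).trans (Category.comp_id _).symm)
        (by
          change 𝟙 _ ≫ S.d 0 = S.π.f 0 ≫ 𝟙 _
          rw [π_f_zero]
          exact (Category.id_comp _).trans (Category.comp_id _).symm)
    | succ n =>
      rw [quasiIsoAt_iff_exactAt' _ _ (ChainComplex.exactAt_succ_single_obj _ _)]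
      exact S.exactAt n

/-- The projective resolution of `X 0`. -/
def resolution : ProjectiveResolution (S.X 0) where
  complex := S.complex
  projective n := S.projective n
  π := S.π

variable [HasExt.{w} C]

/-- The extension that is given by a cocycle. -/
def ext {n : ℕ} (f : S.X (n + 1) ⟶ Y) (hf : S.d (n + 1) ≫ f = 0) : Abelian.Ext (S.X 0) Y n :=
  S.resolution.extMk (n := n) f (n + 1) rfl (by
    change S.complex.d _ _ ≫ _ = 0
    rw [complex_d]
    exact hf)

lemma ext_add {n : ℕ} (f g : S.X (n + 1) ⟶ Y) (hf : S.d (n + 1) ≫ f = 0)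
    (hg : S.d (n + 1) ≫ g = 0) :
    S.ext (f + g) (by rw [Preadditive.comp_add, hf, hg, add_zero]) = S.ext f hf + S.ext g hg :=
  (S.resolution.add_extMk _ _ _ _ _ _).symm

lemma ext_surjective {n : ℕ} (α : Abelian.Ext (S.X 0) Y n) :
    ∃ (f : S.X (n + 1) ⟶ Y) (hf : S.d (n + 1) ≫ f = 0), S.ext f hf = α := by
  obtain ⟨f, hf, h⟩ := S.resolution.extMk_surjective α _ rfl
  exact ⟨f, by rwa [← complex_d], h⟩

lemma ext_succ_eq_zero_iff {n : ℕ} (f : S.X (n + 2) ⟶ Y) (hf : S.d (n + 2) ≫ f = 0) :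
    S.ext f hf = 0 ↔ ∃ g, S.d (n + 1) ≫ g = f := by
  rw [← complex_d]
  exact S.resolution.extMk_eq_zero_iff f _ rfl _ n rfl

lemma ext_zero_eq_zero_iff (f : S.X 1 ⟶ Y) (hf : S.d 1 ≫ f = 0) :
    S.ext (n := 0) f hf = 0 ↔ f = 0 :=
  S.resolution.extMk_zero_eq_zero_iff _ _

lemma ext_comp_ext {p q : ℕ} (f : S.X (p + 1) ⟶ S.X 0) (hf : S.d (p + 1) ≫ f = 0)
    (g : S.X (q + 1) ⟶ Y) (hg : S.d (q + 1) ≫ g = 0) (F : ∀ i, S.X (p + i + 1) ⟶ S.X (i + 1))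
    (hF₀ : F 0 ≫ S.d 0 = f) (hF : ∀ i, S.d (p + i + 1) ≫ F i = F (i + 1) ≫ S.d (i + 1)) :
    (S.ext f hf).comp (S.ext g hg) rfl = (-1 : ℤ) ^ (p * q) •
      S.ext (n := p + q) (F q ≫ g) (by
        rw [← Category.assoc, hF, Category.assoc, hg, comp_zero]) :=
  S.resolution.extMk_comp_extMk f _ g _ F
    ((congrArg (F 0 ≫ ·) S.π_f_zero).trans hF₀)
    (fun i ↦ ((congrArg (· ≫ F i) (S.complex_d (p + i))).trans (hF i)).trans
      (congrArg (F (i + 1) ≫ ·) (S.complex_d i)).symm)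

end ProjectiveSequence

namespace InjectiveSequence

variable (S : InjectiveSequence C) {Y : C}

/-- The cochain complex `X 1 ⟶ X 2 ⟶ ⋯`. -/
def complex : CochainComplex C ℕ :=
  CochainComplex.of (fun n ↦ S.X (n + 1)) (fun n ↦ S.d (n + 1)) (fun n ↦ S.d_comp_d (n + 1))

lemma complex_d (n : ℕ) : S.complex.d n (n + 1) = S.d (n + 1) :=
  CochainComplex.of_d (fun n ↦ S.X (n + 1)) (fun n ↦ S.d (n + 1)) n

/-- The coaugmentation. -/
def ι : (CochainComplex.single₀ C).obj (S.X 0) ⟶ S.complex :=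
  (CochainComplex.fromSingle₀Equiv _ _).symm ⟨S.d 0, by rw [complex_d]; exact S.d_comp_d 0⟩

lemma ι_f_zero : S.ι.f 0 = S.d 0 := by
  simp only [ι]
  exact CochainComplex.fromSingle₀Equiv_symm_apply_f_zero _ _

lemma exactAt (n : ℕ) : S.complex.ExactAt (n + 1) := by
  rw [HomologicalComplex.exactAt_iff' _ n (n + 1) (n + 1 + 1) (by simp) (by simp)]
  refine ShortComplex.exact_of_iso ?_ (S.exact (n + 1))
  exact ShortComplex.isoMk (Iso.refl _) (Iso.refl _) (Iso.refl _)
    (by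
      change 𝟙 _ ≫ S.complex.d n (n + 1) = S.d (n + 1) ≫ 𝟙 _
      rw [complex_d]
      exact (Category.id_comp _).trans (Category.comp_id _).symm)
    (by
      change 𝟙 _ ≫ S.complex.d (n + 1) (n + 2) = S.d (n + 2) ≫ 𝟙 _
      rw [complex_d]
      exact (Category.id_comp _).trans (Category.comp_id _).symm)

instance quasiIso : QuasiIso S.ι where
  quasiIsoAt n := by
    cases n with
    | zero =>
      rw [CochainComplex.quasiIsoAt₀_iff, ShortComplex.quasiIso_iff_of_zeros _ rfl rfl rfl]
      refine (ShortComplex.exact_and_mono_f_iff_of_iso ?_).2 ⟨S.exact 0, S.mono⟩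
      exact ShortComplex.isoMk (Iso.refl _) (Iso.refl _) (Iso.refl _)
        (by
          change 𝟙 _ ≫ S.d 0 = S.ι.f 0 ≫ 𝟙 _
          rw [ι_f_zero]
          exact (Category.id_comp _).trans (Category.comp_id _).symm)
        (by
          change 𝟙 _ ≫ S.d 1 = S.complex.d 0 1 ≫ 𝟙 _
          rw [complex_d]
          exact (Category.id_comp _).trans (Category.comp_id _).symm)
    | succ n =>
      rw [quasiIsoAt_iff_exactAt _ _ (CochainComplex.exactAt_succ_single_obj _ _)]
      exact S.exactAt n

/-- The injective resolution of `X 0`. -/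
def resolution : InjectiveResolution (S.X 0) where
  cocomplex := S.complex
  injective n := S.injective n
  ι := S.ι

variable [HasExt.{w} C]

/-- The extension that is given by a cocycle. -/
def ext {n : ℕ} (f : Y ⟶ S.X (n + 1)) (hf : f ≫ S.d (n + 1) = 0) : Abelian.Ext Y (S.X 0) n :=
  S.resolution.extMk (n := n) f (n + 1) rfl (by
    change _ ≫ S.complex.d _ _ = 0
    rw [complex_d]
    exact hf)

lemma ext_add {n : ℕ} (f g : Y ⟶ S.X (n + 1)) (hf : f ≫ S.d (n + 1) = 0)
    (hg : g ≫ S.d (n + 1) = 0) :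
    S.ext (f + g) (by rw [Preadditive.add_comp, hf, hg, add_zero]) = S.ext f hf + S.ext g hg :=
  (S.resolution.add_extMk _ _ _ _ _ _).symm

lemma ext_surjective {n : ℕ} (α : Abelian.Ext Y (S.X 0) n) :
    ∃ (f : Y ⟶ S.X (n + 1)) (hf : f ≫ S.d (n + 1) = 0), S.ext f hf = α := by
  obtain ⟨f, hf, h⟩ := S.resolution.extMk_surjective α _ rfl
  exact ⟨f, by rwa [← complex_d], h⟩

lemma ext_succ_eq_zero_iff {n : ℕ} (f : Y ⟶ S.X (n + 2)) (hf : f ≫ S.d (n + 2) = 0) :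
    S.ext f hf = 0 ↔ ∃ g, g ≫ S.d (n + 1) = f := by
  rw [← complex_d]
  exact S.resolution.extMk_eq_zero_iff f _ rfl _ n rfl

lemma ext_zero_eq_zero_iff (f : Y ⟶ S.X 1) (hf : f ≫ S.d 1 = 0) :
    S.ext (n := 0) f hf = 0 ↔ f = 0 :=
  S.resolution.extMk_zero_eq_zero_iff _ _

lemma ext_comp_ext {p q : ℕ} (f : Y ⟶ S.X (p + 1)) (hf : f ≫ S.d (p + 1) = 0)
    (g : S.X 0 ⟶ S.X (q + 1)) (hg : g ≫ S.d (q + 1) = 0) (G : ∀ i, S.X (i + 1) ⟶ S.X (q + i + 1))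
    (hG₀ : S.d 0 ≫ G 0 = g) (hG : ∀ i, S.d (i + 1) ≫ G (i + 1) = G i ≫ S.d (q + i + 1)) :
    (S.ext f hf).comp (S.ext g hg) (Nat.add_comm p q) = (-1 : ℤ) ^ (p * q) •
      S.ext (n := q + p) (f ≫ G p) (by
        rw [Category.assoc, ← hG, ← Category.assoc, hf, zero_comp]) :=
  S.resolution.extMk_comp_extMk f _ g _ G
    ((congrArg (· ≫ G 0) S.ι_f_zero).trans hG₀)
    (fun i ↦ ((congrArg (· ≫ G (i + 1)) (S.complex_d i)).trans (hG i)).trans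
      (congrArg (G i ≫ ·) (S.complex_d (q + i))).symm)

end InjectiveSequence

end CategoryTheory

end

/-! ### The bar resolution -/

noncomputable section

namespace BimoduleCat

variable {k A : Type u} [CommRing k] [Ring A] [Algebra k A]

section

attribute [local instance] kModule

variable {M N P : BimoduleCat k A}

/-- Additive maps between bimodules that are linear for the right actions. -/
abbrev RightHom (M N : BimoduleCat k A) : Type u :=
  {φ : M →+ N // ∀ x a, φ (ract x a) = ract (φ x) a}

lemma RightHom.map_smul (φ : RightHom M N) (r : k) (x : M) : φ.1 (r • x) = r • φ.1 x := by
  rw [← ract_algebraMap (A := A), φ.2, ract_algebraMap]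

/-- A right linear map as a `k`-linear map. -/
def RightHom.toLinearMap (φ : RightHom M N) : M →ₗ[k] N where
  toFun := φ.1
  map_add' := map_add φ.1
  map_smul' := φ.map_smul

/-- The composition of right linear maps. -/
abbrev RightHom.comp (ψ : RightHom N P) (φ : RightHom M N) : RightHom M P :=
  ⟨ψ.1.comp φ.1, fun x a ↦ (congrArg ψ.1 (φ.2 x a)).trans (ψ.2 _ _)⟩

/-- A morphism of bimodules is right linear. -/
abbrev RightHom.ofHom (f : M ⟶ N) : RightHom M N := ⟨f.hom.toAddMonoidHom, map_ract f⟩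

variable (M) in
/-- The bimodule `A ⊗ₖ M`. -/
def leftFree : BimoduleCat k A := ModuleCat.of (A ⊗[k] Aᵐᵒᵖ) (Outer (unit k A) M)

/-- The element `a ⊗ x` of `A ⊗ₖ M`. -/
def leftMk (a : A) (x : M) : leftFree M := Outer.tmul (toUnit (k := k) a) x

lemma leftMk_add (a : A) (x y : M) : leftMk a (x + y) = leftMk a x + leftMk a y :=
  TensorProduct.tmul_add _ _ _

lemma add_leftMk (a b : A) (x : M) : leftMk (a + b) x = leftMk a x + leftMk b x :=
  TensorProduct.add_tmul _ _ _

lemma lact_leftMk (a b : A) (x : M) : lact b (leftMk a x) = leftMk (b * a) x := by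
  refine (Outer.smul_tmul b 1 _ x).trans ?_
  rw [lact_toUnit, MulOpposite.unop_one, ract_one]
  rfl

lemma ract_leftMk (a b : A) (x : M) : ract (leftMk a x) b = leftMk a (ract x b) := by
  refine (Outer.smul_tmul 1 (.op b) _ x).trans ?_
  rw [lact_one]
  rfl

lemma leftMk_smul (r : k) (a : A) (x : M) : leftMk a (r • x) = r • leftMk a x := by
  rw [← ract_algebraMap (A := A), ← ract_leftMk, ract_algebraMap]

lemma smul_leftMk (r : k) (a : A) (x : M) : leftMk (r • a) x = r • leftMk a x := by
  rw [← lact_algebraMap (A := A), lact_leftMk, Algebra.smul_def]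

lemma leftFree_induction {p : leftFree M → Prop} (x : leftFree M) (h₀ : p 0)
    (h : ∀ a x, p (leftMk a x)) (hadd : ∀ x y, p x → p y → p (x + y)) : p x := by
  induction x using TensorProduct.induction_on with
  | zero => exact h₀
  | tmul m n => exact h m n
  | add x y hx hy => exact hadd _ _ hx hy

/-- The map `x ↦ 1 ⊗ x`. -/
def oneMk (M : BimoduleCat k A) : RightHom M (leftFree M) :=
  ⟨AddMonoidHom.mk' (leftMk 1) (leftMk_add 1), fun x a ↦ (ract_leftMk 1 a x).symm⟩

lemma leftMk_eq (a : A) (x : M) : leftMk a x = lact a ((oneMk M).1 x) :=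
  (congrArg (leftMk · x) (mul_one a).symm).trans (lact_leftMk 1 a x).symm

lemma lact_sub (a : A) (x y : M) : lact a (x - y) = lact a x - lact a y := smul_sub _ _ _

lemma smul_unit (r : k) (a : unit k A) : r • a = toUnit (r • ofUnit a) := by
  rw [← lact_algebraMap (A := A), Algebra.smul_def]
  exact lact_toUnit _ _

/-- The bilinear map `(a, x) ↦ a ⊗ x`. -/
def leftMkₗ (M : BimoduleCat k A) : A →ₗ[k] M →ₗ[k] leftFree M :=
  LinearMap.mk₂ k leftMk add_leftMk smul_leftMk leftMk_add leftMk_smul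

/-- Linear maps out of `A ⊗ₖ M`. -/
def leftLift {Z : Type*} [AddCommGroup Z] [Module k Z] (g : A →ₗ[k] M →ₗ[k] Z) :
    leftFree M →ₗ[k] Z :=
  let φ : leftFree M →+ Z := TensorProduct.liftAddHom
    (LinearMap.toAddMonoidHom'.comp (g.toAddMonoidHom.comp (AddMonoidHom.id A)) :
      unit k A →+ M →+ Z)
    (fun r a x ↦ by
      rw [smul_unit]
      change g (r • ofUnit a) x = g (ofUnit a) (r • x)
      rw [map_smul, map_smul, LinearMap.smul_apply])
  { toFun := φ
    map_add' := φ.map_add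
    map_smul' := fun r y ↦ by
      induction y using leftFree_induction with
      | h₀ => rw [smul_zero]; exact φ.map_zero.trans ((smul_zero r).symm.trans
          (congrArg (r • ·) φ.map_zero.symm))
      | h a x =>
        rw [← leftMk_smul]
        exact (g a).map_smul r x
      | hadd x y hx hy =>
        rw [smul_add]
        exact (φ.map_add _ _).trans ((congrArg₂ _ hx hy).trans
          ((smul_add _ _ _).symm.trans (congrArg (r • ·) (φ.map_add x y).symm))) }

/-- The morphism of bimodules `A ⊗ₖ M ⟶ N` that extends a right linear map. -/
def leftDesc (φ : RightHom M N) : leftFree M ⟶ N :=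
  homMk (leftLift (LinearMap.compl₂ (lactHom N) φ.toLinearMap)).toAddMonoidHom
    (fun a y ↦ by
      induction y using leftFree_induction with
      | h₀ => simp [lact]
      | h b x =>
        rw [lact_leftMk]
        exact (lact_lact a b (φ.1 x)).symm
      | hadd x y hx hy => rw [lact_add, map_add, hx, hy, map_add, lact_add])
    (fun y a ↦ by
      induction y using leftFree_induction with
      | h₀ => simp [ract]
      | h b x =>
        rw [ract_leftMk]
        exact (congrArg (lact b) (φ.2 x a)).trans (lact_ract b a _)
      | hadd x y hx hy => rw [ract_add, map_add, hx, hy, map_add, ract_add])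

lemma leftDesc_leftMk (φ : RightHom M N) (a : A) (x : M) :
    leftDesc φ (leftMk a x) = lact a (φ.1 x) := rfl

lemma leftDesc_oneMk (φ : RightHom M N) (x : M) : leftDesc φ ((oneMk M).1 x) = φ.1 x :=
  lact_one _ _

lemma leftFree_hom_ext {f g : leftFree M ⟶ N}
    (h : ∀ x, f ((oneMk M).1 x) = g ((oneMk M).1 x)) : f = g := by
  ext y
  induction y using leftFree_induction with
  | h₀ => simp
  | h a x => rw [leftMk_eq, map_lact, map_lact, h]
  | hadd x y hx hy => rw [map_add, hx, hy, map_add]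

variable (k A) in
/-- The bimodule `A^{⊗ (n + 1)}`. -/
def bar : ℕ → BimoduleCat k A
  | 0 => unit k A
  | n + 1 => leftFree (bar n)

variable (k A) in
/-- The map `x ↦ 1 ⊗ x`, which is a contracting homotopy of the bar resolution. -/
def barOne (n : ℕ) : RightHom (bar k A n) (bar k A (n + 1)) := oneMk (bar k A n)

lemma bar_hom_ext {n : ℕ} {f g : bar k A (n + 1) ⟶ N}
    (h : ∀ x, f ((barOne k A n).1 x) = g ((barOne k A n).1 x)) : f = g :=
  leftFree_hom_ext h

/-- The morphism of bimodules `A^{⊗ (n + 2)} ⟶ N` that extends a right linear map on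
`A^{⊗ (n + 1)}`. -/
def barDesc {n : ℕ} (φ : RightHom (bar k A n) N) : bar k A (n + 1) ⟶ N := leftDesc φ

lemma barDesc_barOne {n : ℕ} (φ : RightHom (bar k A n) N) (x : bar k A n) :
    barDesc φ ((barOne k A n).1 x) = φ.1 x :=
  leftDesc_oneMk φ x

/-- The element `a ⊗ x` of `A^{⊗ (n + 2)}`. -/
def barMk {n : ℕ} (a : A) (x : bar k A n) : bar k A (n + 1) := leftMk a x

lemma bar_induction {n : ℕ} {p : bar k A (n + 1) → Prop} (x : bar k A (n + 1)) (h₀ : p 0)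
    (h : ∀ a x, p (barMk a x)) (hadd : ∀ x y, p x → p y → p (x + y)) : p x :=
  leftFree_induction x h₀ h hadd

/-- Linear maps out of `A^{⊗ (n + 2)}`. -/
def barLift {n : ℕ} (g : A →ₗ[k] bar k A n →ₗ[k] N) : bar k A (n + 1) →ₗ[k] N := leftLift g

lemma ract_barMk {n : ℕ} (a b : A) (x : bar k A n) : ract (barMk a x) b = barMk a (ract x b) :=
  ract_leftMk a b x

lemma lact_barMk {n : ℕ} (a b : A) (x : bar k A n) : lact b (barMk a x) = barMk (b * a) x :=
  lact_leftMk a b x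

/-- Left multiplication `x ↦ a ⊗ x`. -/
def barMkHom {n : ℕ} (a : A) : RightHom (bar k A n) (bar k A (n + 1)) :=
  ⟨AddMonoidHom.mk' (barMk a) (leftMk_add a), fun x b ↦ (ract_barMk a b x).symm⟩

/-- An element of `A`, as an element of the bottom term of the bar resolution. -/
def barUnit (a : A) : bar k A 0 := toUnit a

lemma lact_barUnit (a b : A) : lact a (barUnit (k := k) b) = barUnit (a * b) := lact_toUnit a b

lemma ract_barUnit (a b : A) : ract (barUnit (k := k) b) a = barUnit (b * a) := ract_toUnit a b

lemma barMk_eq {n : ℕ} (a : A) (x : bar k A n) : barMk a x = lact a ((barOne k A n).1 x) :=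
  leftMk_eq a x

lemma barDesc_barMk {n : ℕ} (φ : RightHom (bar k A n) N) (a : A) (x : bar k A n) :
    barDesc φ (barMk a x) = lact a (φ.1 x) :=
  leftDesc_leftMk φ a x

variable (k A) in
/-- The differential `A^{⊗ (n + 2)} ⟶ A^{⊗ (n + 1)}` of the bar resolution, which is determined by
`d (1 ⊗ x) = x - 1 ⊗ d x`. -/
def barD : ∀ n, bar k A (n + 1) ⟶ bar k A n
  | 0 => barDesc (n := 0) ⟨AddMonoidHom.id _, fun _ _ ↦ rfl⟩
  | n + 1 => barDesc
      ⟨AddMonoidHom.id _ - ((barOne k A n).comp (RightHom.ofHom (barD n))).1, fun x a ↦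
        (congrArg (ract x a - ·) (((barOne k A n).comp (RightHom.ofHom (barD n))).2 x a)).trans
          (smul_sub (_ : A ⊗[k] Aᵐᵒᵖ) _ _).symm⟩

lemma barD_zero_barOne (x : bar k A 0) : barD k A 0 ((barOne k A 0).1 x) = x :=
  barDesc_barOne _ x

lemma barD_succ_barOne (n : ℕ) (x : bar k A (n + 1)) :
    barD k A (n + 1) ((barOne k A (n + 1)).1 x) = x - (barOne k A n).1 (barD k A n x) :=
  barDesc_barOne _ x

lemma barD_comp_barD : ∀ n, barD k A (n + 1) ≫ barD k A n = 0
  | 0 => bar_hom_ext fun x ↦ by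
    change barD k A 0 (barD k A 1 ((barOne k A 1).1 x)) = 0
    rw [barD_succ_barOne, map_sub, barD_zero_barOne, sub_self]
  | n + 1 => bar_hom_ext fun x ↦ by
    change barD k A (n + 1) (barD k A (n + 2) ((barOne k A (n + 2)).1 x)) = 0
    have h : barD k A n (barD k A (n + 1) x) = 0 :=
      DFunLike.congr_fun (congrArg ModuleCat.Hom.hom (barD_comp_barD n)) x
    rw [barD_succ_barOne, map_sub, barD_succ_barOne, h, map_zero, sub_zero, sub_self]

/-- The map `x ↦ 1 ⊗ x` is a contracting homotopy. -/
lemma bar_exact (n : ℕ) : (ShortComplex.mk _ _ (barD_comp_barD (k := k) (A := A) n)).Exact := by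
  rw [ShortComplex.moduleCat_exact_iff]
  intro x hx
  refine ⟨(barOne k A (n + 1)).1 x, (barD_succ_barOne n x).trans ?_⟩
  rw [show barD k A n x = 0 from hx, map_zero, sub_zero]

/-! ### Multilinear maps and the bar resolution -/

variable (k A) in
/-- The multilinear map `(a₁, …, aₙ) ↦ a₁ ⊗ ⋯ ⊗ aₙ ⊗ 1`. -/
def pureTensor : ∀ n, MultilinearMap k (fun _ : Fin n ↦ A) (bar k A n)
  | 0 => MultilinearMap.constOfIsEmpty k _ (barUnit 1)
  | n + 1 => LinearMap.uncurryLeft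
      { toFun a := (leftMkₗ (bar k A n) a).compMultilinearMap (pureTensor n)
        map_add' a b := by
          ext x
          exact add_leftMk a b _
        map_smul' r a := by
          ext x
          exact smul_leftMk r a _ }

lemma pureTensor_zero (a : Fin 0 → A) : pureTensor k A 0 a = barUnit 1 := rfl

lemma pureTensor_succ {n : ℕ} (a : Fin (n + 1) → A) :
    pureTensor k A (n + 1) a = barMk (a 0) (pureTensor k A n (Fin.tail a)) := rfl

/-- The right linear map on `A^{⊗ (n + 1)}` that is determined by a multilinear map. -/
def evₗ (N : BimoduleCat k A) : ∀ n, MultilinearMap k (fun _ : Fin n ↦ A) N →ₗ[k] bar k A n →ₗ[k] N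
  | 0 => LinearMap.mk₂ k (fun f (b : unit k A) ↦ ract (f ![]) (ofUnit b))
      (fun f g b ↦ ract_add _ _ _) (fun r f b ↦ smul_ract r _ _) (fun f b c ↦ ract_add' _ _ _)
      (fun r f b ↦ (congrArg (ract (f ![])) (smul_unit r b)).trans
        ((ractHom N).map_smul₂ r (.op (ofUnit b)) (f ![])))
  | n + 1 =>
    { toFun f := barLift ((evₗ N n).comp f.curryLeft)
      map_add' f g := LinearMap.ext fun y ↦ by
        induction y using bar_induction with
        | h₀ => rw [map_zero, map_zero]
        | h a x =>
          change evₗ N n ((f + g).curryLeft a) x =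
            evₗ N n (f.curryLeft a) x + evₗ N n (g.curryLeft a) x
          rw [← LinearMap.add_apply, ← map_add]
          rfl
        | hadd x y hx hy => rw [map_add, map_add, hx, hy]
      map_smul' r f := LinearMap.ext fun y ↦ by
        induction y using bar_induction with
        | h₀ => rw [map_zero, map_zero]
        | h a x =>
          change evₗ N n ((r • f).curryLeft a) x = r • evₗ N n (f.curryLeft a) x
          rw [← LinearMap.smul_apply, ← map_smul]
          rfl
        | hadd x y hx hy => rw [map_add, map_add, hx, hy] }

lemma evₗ_zero (f : MultilinearMap k (fun _ : Fin 0 ↦ A) N) (b : A) :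
    evₗ N 0 f (barUnit b) = ract (f ![]) b := rfl

lemma evₗ_succ {n : ℕ} (f : MultilinearMap k (fun _ : Fin (n + 1) ↦ A) N) (a : A)
    (x : bar k A n) : evₗ N (n + 1) f (barMk a x) = evₗ N n (f.curryLeft a) x := rfl

lemma evₗ_ract : ∀ (n : ℕ) (f : MultilinearMap k (fun _ : Fin n ↦ A) N) (x : bar k A n) (a : A),
    evₗ N n f (ract x a) = ract (evₗ N n f x) a
  | 0, f, b, a => by
    change ract (f ![]) (ofUnit (ract (toUnit (ofUnit b)) a)) = ract (ract (f ![]) (ofUnit b)) a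
    rw [ract_ract, ract_toUnit]
    rfl
  | n + 1, f, y, b => by
    induction y using bar_induction with
    | h₀ => simp [ract]
    | h a x => exact (congrArg (evₗ N (n + 1) f) (ract_barMk a b x)).trans (evₗ_ract n _ x b)
    | hadd x y hx hy => rw [ract_add, map_add, hx, hy, map_add, ract_add]

/-- The right linear map on `A^{⊗ (n + 1)}` that is determined by a multilinear map. -/
def ev {n : ℕ} (f : MultilinearMap k (fun _ : Fin n ↦ A) N) : RightHom (bar k A n) N :=
  ⟨(evₗ N n f).toAddMonoidHom, evₗ_ract n f⟩

lemma ev_pureTensor : ∀ {n : ℕ} (f : MultilinearMap k (fun _ : Fin n ↦ A) N) (a : Fin n → A),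
    (ev f).1 (pureTensor k A n a) = f a
  | 0, f, a => (ract_one N (f ![])).trans (congrArg f (Subsingleton.elim _ _))
  | n + 1, f, a => (ev_pureTensor (f.curryLeft (a 0)) (Fin.tail a)).trans (by
    rw [MultilinearMap.curryLeft_apply, Fin.cons_self_tail])

lemma rightHom_ext : ∀ {n : ℕ} {φ ψ : RightHom (bar k A n) N}
    (_ : ∀ a, φ.1 (pureTensor k A n a) = ψ.1 (pureTensor k A n a)) (x : bar k A n), φ.1 x = ψ.1 x
  | 0, φ, ψ, h, x => by
    have hx : x = ract (pureTensor k A 0 ![]) (ofUnit x) := by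
      rw [pureTensor_zero, ract_barUnit, one_mul]
      rfl
    rw [hx, φ.2, ψ.2, h]
  | n + 1, φ, ψ, h, y => by
    induction y using bar_induction with
    | h₀ => rw [map_zero, map_zero]
    | h a x =>
      refine rightHom_ext (n := n) (φ := φ.comp (barMkHom a)) (ψ := ψ.comp (barMkHom a))
        (fun b ↦ ?_) x
      have h' := h (Fin.cons a b)
      rwa [pureTensor_succ, Fin.cons_zero, Fin.tail_cons] at h'
    | hadd x y hx hy => rw [map_add, map_add, hx, hy]

lemma bar_hom_ext' {n : ℕ} {f g : bar k A (n + 1) ⟶ N}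
    (h : ∀ a, f ((barOne k A n).1 (pureTensor k A n a)) =
      g ((barOne k A n).1 (pureTensor k A n a))) : f = g :=
  bar_hom_ext fun x ↦ rightHom_ext (φ := (RightHom.ofHom f).comp (barOne k A n))
    (ψ := (RightHom.ofHom g).comp (barOne k A n)) h x

lemma contractNth_zero {n : ℕ} (a : Fin (n + 2) → A) :
    Fin.contractNth 0 (· * ·) a = Fin.cons (a 0 * Fin.tail a 0) (Fin.tail (Fin.tail a)) := by
  ext i
  cases i using Fin.cases with
  | zero => simp [Fin.contractNth, Fin.tail]
  | succ i => simp [Fin.contractNth, Fin.tail]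

lemma contractNth_succ {n : ℕ} (j : Fin (n + 1)) (a : Fin (n + 2) → A) :
    Fin.contractNth j.succ (· * ·) a = Fin.cons (a 0) (Fin.contractNth j (· * ·) (Fin.tail a)) := by
  ext i
  cases i using Fin.cases with
  | zero => simp [Fin.contractNth]
  | succ i => simp [Fin.contractNth, Fin.tail]

/-- The bar differential, evaluated on a tensor. -/
lemma barD_pureTensor : ∀ (n : ℕ) (a : Fin (n + 1) → A),
    barD k A n (pureTensor k A (n + 1) a) =
      ∑ j : Fin n, (-1 : ℤ) ^ j.val • pureTensor k A n (Fin.contractNth j.castSucc (· * ·) a) +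
        (-1 : ℤ) ^ n • ract (pureTensor k A n (fun i ↦ a i.castSucc)) (a (Fin.last n))
  | 0, a => by
    rw [pureTensor_succ, barMk_eq, map_lact, barD_zero_barOne, pureTensor_zero, pureTensor_zero,
      lact_barUnit, ract_barUnit]
    simp
  | n + 1, a => by
    rw [pureTensor_succ, barMk_eq, map_lact, barD_succ_barOne, barD_pureTensor n]
    have h₀ : pureTensor k A (n + 1) (Fin.contractNth 0 (· * ·) a) =
        lact (a 0) (pureTensor k A (n + 1) (Fin.tail a)) := by
      rw [contractNth_zero, pureTensor_succ, pureTensor_succ, lact_barMk, Fin.cons_zero,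
        Fin.tail_cons]
    have h₁ (j : Fin (n + 1)) :
        pureTensor k A (n + 1) (Fin.contractNth j.succ (· * ·) a) =
          (barMkHom (a 0)).1 (pureTensor k A n (Fin.contractNth j (· * ·) (Fin.tail a))) := by
      rw [contractNth_succ, pureTensor_succ, Fin.cons_zero, Fin.tail_cons]
      rfl
    have h₂ (x : bar k A n) : lact (a 0) ((barOne k A n).1 x) = (barMkHom (a 0)).1 x :=
      (barMk_eq (a 0) x).symm
    have h₃ : pureTensor k A (n + 1) (fun i ↦ a i.castSucc) =
        (barMkHom (a 0)).1 (pureTensor k A n (fun i ↦ Fin.tail a i.castSucc)) := rfl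
    rw [lact_sub, h₂, Fin.sum_univ_succ, Fin.castSucc_zero, h₀, h₃]
    simp only [Fin.castSucc_succ, h₁, map_add, map_sum, map_zsmul,
      (barMkHom (a 0)).2, Fin.val_zero, Fin.val_succ, pow_succ, pow_zero, one_smul, mul_neg,
      mul_one, neg_smul, Finset.sum_neg_distrib]
    rw [show Fin.last (n + 1) = (Fin.last n).succ from rfl]
    simp only [Fin.tail]
    abel

/-- Multilinear maps out of a projective module lift through surjections. -/
lemma exists_comp_multilinearMap_eq [Module.Projective k A] {M N : Type*} [AddCommGroup M]
    [Module k M] [AddCommGroup N] [Module k N] (g : M →ₗ[k] N) (hg : Function.Surjective g) :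
    ∀ (n : ℕ) (f : MultilinearMap k (fun _ : Fin n ↦ A) N),
      ∃ f' : MultilinearMap k (fun _ : Fin n ↦ A) M, g.compMultilinearMap f' = f
  | 0, f => by
    obtain ⟨m, hm⟩ := hg (f ![])
    refine ⟨MultilinearMap.constOfIsEmpty k _ m, ?_⟩
    ext a
    rw [Subsingleton.elim a ![]]
    exact hm
  | n + 1, f => by
    let φ : MultilinearMap k (fun _ : Fin n ↦ A) M →ₗ[k] MultilinearMap k (fun _ : Fin n ↦ A) N :=
      { toFun := g.compMultilinearMap
        map_add' f f' := by
          ext a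
          exact map_add g _ _
        map_smul' r f := by
          ext a
          exact map_smul g _ _ }
    obtain ⟨h, hh⟩ := Module.projective_lifting_property φ f.curryLeft
      (exists_comp_multilinearMap_eq g hg n)
    refine ⟨LinearMap.uncurryLeft h, ?_⟩
    ext a
    refine (DFunLike.congr_fun (DFunLike.congr_fun hh (a 0)) (Fin.tail a)).trans ?_
    rw [MultilinearMap.curryLeft_apply, Fin.cons_self_tail]

/-- The morphism `A^{⊗ (n + 2)} ⟶ N` that is determined by a multilinear map. -/
def ofMultilinear {n : ℕ} (f : MultilinearMap k (fun _ : Fin n ↦ A) N) : bar k A (n + 1) ⟶ N :=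
  barDesc (ev f)

lemma ofMultilinear_pureTensor {n : ℕ} (f : MultilinearMap k (fun _ : Fin n ↦ A) N)
    (a : Fin n → A) : ofMultilinear f ((barOne k A n).1 (pureTensor k A n a)) = f a :=
  (barDesc_barOne _ _).trans (ev_pureTensor f a)

/-- The multilinear map that determines a morphism out of the bar resolution. -/
def toMultilinear {n : ℕ} (f : bar k A (n + 1) ⟶ N) : MultilinearMap k (fun _ : Fin n ↦ A) N :=
  ((RightHom.ofHom f).comp (barOne k A n)).toLinearMap.compMultilinearMap (pureTensor k A n)

/-- Morphisms out of `A^{⊗ (n + 2)}` are multilinear maps, and these lift through surjections. -/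
instance projective_bar [Module.Projective k A] (n : ℕ) : Projective (bar k A (n + 1)) where
  factors {E X} f e he := by
    obtain ⟨f', hf'⟩ := exists_comp_multilinearMap_eq (RightHom.ofHom e).toLinearMap
      ((ModuleCat.epi_iff_surjective e).1 he) n (toMultilinear f)
    refine ⟨ofMultilinear f', bar_hom_ext' fun a ↦ ?_⟩
    change e (ofMultilinear f' _) = _
    rw [ofMultilinear_pureTensor]
    exact DFunLike.congr_fun hf' a

variable (k A) in
/-- The bar resolution. -/
def barSequence [Module.Projective k A] : ProjectiveSequence (BimoduleCat k A) where
  X := bar k A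
  d := barD k A
  d_comp_d := barD_comp_barD
  exact := bar_exact
  epi := (ModuleCat.epi_iff_surjective _).2 fun x ↦ ⟨_, barD_zero_barOne x⟩
  projective n := projective_bar n

/-- The composition with the bar differential is the Hochschild differential. -/
lemma barD_ofMultilinear {n : ℕ} (f : MultilinearMap k (fun _ : Fin n ↦ A) N)
    (a : Fin (n + 1) → A) :
    ofMultilinear f (barD k A (n + 1) ((barOne k A (n + 1)).1 (pureTensor k A (n + 1) a))) =
      lact (a 0) (f (Fin.tail a)) +
        ∑ j : Fin n, (-1 : ℤ) ^ (j.val + 1) • f (Fin.contractNth j.castSucc (· * ·) a) +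
        (-1 : ℤ) ^ (n + 1) • ract (f (fun i ↦ a i.castSucc)) (a (Fin.last n)) := by
  have h : ofMultilinear f (pureTensor k A (n + 1) a) = lact (a 0) (f (Fin.tail a)) := by
    rw [pureTensor_succ]
    exact (barDesc_barMk _ _ _).trans (congrArg _ (ev_pureTensor f _))
  have h' (x : bar k A n) : ofMultilinear f ((barOne k A n).1 x) = (ev f).1 x := barDesc_barOne _ x
  rw [barD_succ_barOne, barD_pureTensor, map_sub, h, h', map_add, map_sum, map_zsmul, (ev f).2,
    ev_pureTensor]
  simp only [map_zsmul, ev_pureTensor, pow_succ, mul_neg, mul_one, neg_smul,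
    Finset.sum_neg_distrib]
  abel

end

end BimoduleCat

end

/-! ### Hochschild cohomology as extensions of bimodules -/

noncomputable section

/-- A surjective homomorphism on `Z` whose kernel is `B` identifies the subquotient `Z / B` with
its target. -/
def Subquotient.addEquivOfSurjective {R V G : Type*} [CommRing R] [AddCommGroup V] [Module R V]
    [AddCommGroup G] {Z B : Submodule R V} (E : Z →+ G) (hE : Function.Surjective E)
    (hB : ∀ z, E z = 0 ↔ z.1 ∈ B) : Subquotient Z B ≃+ G :=
  (QuotientAddGroup.quotientAddEquivOfEq (by
    ext z
    exact (hB z).symm)).trans (QuotientAddGroup.quotientKerEquivOfSurjective E hE)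

namespace BimoduleCat

variable {k A : Type u} [CommRing k] [Ring A] [Algebra k A]

section

attribute [local instance] kModule

variable (k A) in
/-- The identification of `A` with the bottom term of the bar resolution. -/
def barUnitₗ : A →ₗ[k] bar k A 0 where
  toFun := barUnit
  map_add' _ _ := rfl
  map_smul' r a := (congrArg barUnit (Algebra.smul_def r a)).trans
    ((lact_barUnit _ _).symm.trans (lact_algebraMap r _))

lemma barUnit_injective : Function.Injective (barUnit (k := k) (A := A)) := fun _ _ h ↦ h

/-- The morphism `A^{⊗ (n + 2)} ⟶ A` that is determined by a Hochschild cochain. -/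
def cochainHom {n : ℕ} (f : Hochschild.cochains k A n) : bar k A (n + 1) ⟶ bar k A 0 :=
  ofMultilinear ((barUnitₗ k A).compMultilinearMap f.2.choose)

lemma multilinear_apply {n : ℕ} (f : Hochschild.cochains k A n) (a : Fin n → A) :
    (barUnitₗ k A).compMultilinearMap f.2.choose a = barUnit (k := k) (A := A) (f.1 a) :=
  congrArg (barUnit (k := k) (A := A)) (congrFun f.2.choose_spec a)

lemma cochainHom_pureTensor {n : ℕ} (f : Hochschild.cochains k A n) (a : Fin n → A) :
    cochainHom f ((barOne k A n).1 (pureTensor k A n a)) = barUnit (f.1 a) :=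
  (ofMultilinear_pureTensor _ a).trans (multilinear_apply f a)

lemma barD_cochainHom {n : ℕ} (f : Hochschild.cochains k A n) (a : Fin (n + 1) → A) :
    (barD k A (n + 1) ≫ cochainHom f) ((barOne k A (n + 1)).1 (pureTensor k A (n + 1) a)) =
      barUnit (Hochschild.d k A n f.1 a) := by
  refine (barD_ofMultilinear _ a).trans ?_
  simp only [multilinear_apply, lact_barUnit, ract_barUnit]
  change _ = barUnitₗ k A _
  simp only [map_add, map_sum, map_zsmul]
  rfl

lemma cochainHom_add {n : ℕ} (f g : Hochschild.cochains k A n) :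
    cochainHom (f + g) = cochainHom f + cochainHom g :=
  bar_hom_ext' fun a ↦ by
    refine (cochainHom_pureTensor _ a).trans ?_
    change _ = cochainHom f _ + cochainHom g _
    rw [cochainHom_pureTensor, cochainHom_pureTensor]
    rfl

lemma cochainHom_eq_iff {n : ℕ} (f : Hochschild.cochains k A n) (h : bar k A (n + 1) ⟶ bar k A 0) :
    cochainHom f = h ↔
      ∀ a, h ((barOne k A n).1 (pureTensor k A n a)) = barUnit (f.1 a) := by
  refine ⟨?_, fun H ↦ bar_hom_ext' fun a ↦ (cochainHom_pureTensor f a).trans (H a).symm⟩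
  rintro rfl a
  exact cochainHom_pureTensor f a

lemma cochainHom_surjective {n : ℕ} (h : bar k A (n + 1) ⟶ bar k A 0) :
    ∃ f : Hochschild.cochains k A n, cochainHom f = h := by
  let e : bar k A 0 →ₗ[k] A :=
    { toFun := ofUnit
      map_add' := fun _ _ ↦ rfl
      map_smul' := smul_unit }
  exact ⟨⟨_, e.compMultilinearMap (toMultilinear h), rfl⟩, (cochainHom_eq_iff _ _).2 fun a ↦ rfl⟩

lemma barD_comp_cochainHom_iff {n : ℕ} (f : Hochschild.cochains k A n)
    (g : Hochschild.cochains k A (n + 1)) :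
    barD k A (n + 1) ≫ cochainHom f = cochainHom g ↔ Hochschild.d k A n f.1 = g.1 := by
  rw [eq_comm, cochainHom_eq_iff]
  refine ⟨fun h ↦ funext fun a ↦ barUnit_injective ((barD_cochainHom f a).symm.trans (h a)), ?_⟩
  intro h a
  rw [barD_cochainHom, h]

lemma cochainHom_zero {n : ℕ} : cochainHom (0 : Hochschild.cochains k A n) = 0 :=
  (cochainHom_eq_iff _ _).2 fun _ ↦ rfl

lemma cochainHom_injective {n : ℕ} {f g : Hochschild.cochains k A n}
    (h : cochainHom f = cochainHom g) : f = g :=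
  Subtype.ext (funext fun a ↦ barUnit_injective
    (((cochainHom_eq_iff f _).1 h a).symm.trans (cochainHom_pureTensor g a)))

lemma barD_comp_cochainHom_eq_zero_iff {n : ℕ} (f : Hochschild.cochains k A n) :
    barD k A (n + 1) ≫ cochainHom f = 0 ↔ Hochschild.d k A n f.1 = 0 := by
  rw [← cochainHom_zero, barD_comp_cochainHom_iff]
  rfl

/-- A cocycle as a cochain. -/
def cocycleCochain {n : ℕ} : Hochschild.cocycles k A n →ₗ[k] Hochschild.cochains k A n :=
  Submodule.inclusion inf_le_left

lemma barD_cocycle {n : ℕ} (f : Hochschild.cocycles k A n) :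
    barD k A (n + 1) ≫ cochainHom (cocycleCochain f) = 0 :=
  (barD_comp_cochainHom_eq_zero_iff _).2 (Submodule.mem_inf.1 f.2).2

variable [Module.Projective k A] [HasExt.{w} (BimoduleCat k A)]

/-- The extension that is represented by a morphism out of the bar resolution. -/
def barExt {n : ℕ} (f : bar k A (n + 1) ⟶ bar k A 0) (hf : barD k A (n + 1) ≫ f = 0) :
    Abelian.Ext (𝟙_ (BimoduleCat k A)) (𝟙_ (BimoduleCat k A)) n :=
  (barSequence k A).ext f hf

lemma barExt_add {n : ℕ} (f g h : bar k A (n + 1) ⟶ bar k A 0) (hf : barD k A (n + 1) ≫ f = 0)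
    (hg : barD k A (n + 1) ≫ g = 0) (hh : barD k A (n + 1) ≫ h = 0) (hfg : h = f + g) :
    barExt.{w} h hh = barExt f hf + barExt g hg := by
  subst hfg
  exact (barSequence k A).ext_add f g hf hg

lemma barExt_congr {n : ℕ} {f g : bar k A (n + 1) ⟶ bar k A 0} (h : f = g)
    (hf : barD k A (n + 1) ≫ f = 0) (hg : barD k A (n + 1) ≫ g = 0) :
    barExt.{w} f hf = barExt g hg := by
  subst h
  rfl

/-- The extension that is represented by a Hochschild cocycle. -/
def hochschildExt (n : ℕ) : Hochschild.cocycles k A n →+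
    Abelian.Ext (𝟙_ (BimoduleCat k A)) (𝟙_ (BimoduleCat k A)) n :=
  AddMonoidHom.mk' (fun f ↦ barExt (cochainHom (cocycleCochain f)) (barD_cocycle f))
    (fun f g ↦ barExt_add _ _ _ _ _ _
      ((congrArg cochainHom (cocycleCochain.map_add f g)).trans (cochainHom_add _ _)))

lemma hochschildExt_surjective (n : ℕ) :
    Function.Surjective (hochschildExt.{w} (k := k) (A := A) n) := fun α ↦ by
  obtain ⟨h, hh, rfl⟩ := (barSequence k A).ext_surjective α
  obtain ⟨f, rfl⟩ := cochainHom_surjective h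
  exact ⟨⟨f.1, Submodule.mem_inf.2 ⟨f.2, (barD_comp_cochainHom_eq_zero_iff f).1 hh⟩⟩, rfl⟩

lemma hochschildExt_eq_zero_iff : ∀ {n : ℕ} (f : Hochschild.cocycles k A n),
    hochschildExt.{w} n f = 0 ↔ f.1 ∈ Hochschild.coboundaries k A n
  | 0, f => by
    refine ((barSequence k A).ext_zero_eq_zero_iff _ (barD_cocycle f)).trans
      ⟨fun h ↦ ?_, fun h ↦ ?_⟩
    · exact congrArg Subtype.val (cochainHom_injective (h.trans cochainHom_zero.symm))
    · refine Eq.trans ?_ cochainHom_zero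
      congr 1
      exact Subtype.ext h
  | n + 1, f => by
    refine ((barSequence k A).ext_succ_eq_zero_iff _ (barD_cocycle f)).trans
      ⟨fun ⟨g, hg⟩ ↦ ?_, fun ⟨g, hg, h⟩ ↦ ?_⟩
    · obtain ⟨g, rfl⟩ := cochainHom_surjective g
      exact ⟨g.1, g.2, (barD_comp_cochainHom_iff g _).1 hg⟩
    · exact ⟨cochainHom ⟨g, hg⟩, (barD_comp_cochainHom_iff ⟨g, hg⟩ _).2 h⟩

variable (k A) in
/-- Hochschild cohomology is the Yoneda algebra of self-extensions. -/
def hochschildEquiv (n : ℕ) : Hochschild.cohomology k A n ≃+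
    Abelian.Ext (𝟙_ (BimoduleCat k A)) (𝟙_ (BimoduleCat k A)) n :=
  Subquotient.addEquivOfSurjective (hochschildExt.{w} n) (hochschildExt_surjective n)
    hochschildExt_eq_zero_iff

end

/-! ### Cup products and the Yoneda product -/

section

variable {p : ℕ}

/-- The maps `A^{⊗ (p + i + 1)} ⟶ A^{⊗ (i + 1)}` that apply a right linear map to the last
factors. -/
def barShift (φ : RightHom (bar k A p) (bar k A 0)) : ∀ i, RightHom (bar k A (p + i)) (bar k A i)
  | 0 => φ
  | i + 1 => RightHom.ofHom (barDesc (n := p + i) ((barOne k A i).comp (barShift φ i)))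

/-- The morphism of bimodules that underlies `barShift`. -/
def barShiftHom (φ : RightHom (bar k A p) (bar k A 0)) (i : ℕ) :
    bar k A (p + i + 1) ⟶ bar k A (i + 1) :=
  barDesc ((barOne k A i).comp (barShift φ i))

lemma barShiftHom_barOne (φ : RightHom (bar k A p) (bar k A 0)) (i : ℕ) (x : bar k A (p + i)) :
    barShiftHom φ i ((barOne k A (p + i)).1 x) = (barOne k A i).1 ((barShift φ i).1 x) :=
  barDesc_barOne _ x

lemma barShiftHom_barMk (φ : RightHom (bar k A p) (bar k A 0)) (i : ℕ) (a : A)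
    (x : bar k A (p + i)) :
    barShiftHom φ i (barMk a x) = barMk a ((barShift φ i).1 x) := by
  rw [barMk_eq, map_lact, barShiftHom_barOne, ← barMk_eq]

/-- If `φ` is a cocycle, then the maps `barShift` commute with the differentials. -/
lemma barShift_barD (φ : RightHom (bar k A p) (bar k A 0))
    (hφ : barD k A (p + 1) ≫ barDesc φ = 0) : ∀ (i : ℕ) (x : bar k A (p + i + 1)),
      (barShift φ i).1 (barD k A (p + i) x) = barD k A i (barShiftHom φ i x)
  | 0, x => by
    have h : barDesc φ (barD k A (p + 1) ((barOne k A (p + 1)).1 x)) = 0 :=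
      DFunLike.congr_fun (congrArg ModuleCat.Hom.hom hφ) _
    rw [barD_succ_barOne, map_sub, barDesc_barOne, sub_eq_zero] at h
    refine h.symm.trans ?_
    have h' : barDesc φ = barShiftHom φ 0 ≫ barD k A 0 := bar_hom_ext fun y ↦ by
      change _ = barD k A 0 (barShiftHom φ 0 ((barOne k A p).1 y))
      rw [barDesc_barOne]
      exact ((congrArg _ (barShiftHom_barOne φ 0 y)).trans (barD_zero_barOne _)).symm
    rw [h']
    rfl
  | i + 1, x => by
    change (barD k A (p + (i + 1)) ≫ barShiftHom φ i) x =
      (barShiftHom φ (i + 1) ≫ barD k A (i + 1)) x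
    congr 2
    refine bar_hom_ext fun y ↦ ?_
    change barShiftHom φ i (barD k A (p + i + 1) ((barOne k A (p + i + 1)).1 y)) =
      barD k A (i + 1) (barShiftHom φ (i + 1) ((barOne k A (p + (i + 1))).1 y))
    rw [barD_succ_barOne, map_sub, barShiftHom_barOne φ i, barShift_barD φ hφ i,
      barShiftHom_barOne φ (i + 1), barD_succ_barOne]
    rfl

attribute [local instance] kModule

/-- The value of `g` on the tensor that is obtained by applying `f` to the last factors. -/
lemma ev_barShift {N : BimoduleCat k A} (φ : RightHom (bar k A p) (bar k A 0))
    (f : (Fin p → A) → A) (hf : ∀ a, φ.1 (pureTensor k A p a) = barUnit (f a)) :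
    ∀ {q : ℕ} (g : MultilinearMap k (fun _ : Fin q ↦ A) N) (a : Fin (p + q) → A),
      (ev g).1 ((barShift φ q).1 (pureTensor k A (p + q) a)) =
        ract (g fun j ↦ a ((j.castAdd p).cast (Nat.add_comm q p)))
          (f fun i ↦ a ((i.natAdd q).cast (Nat.add_comm q p)))
  | 0, g, a => by
    refine (congrArg (ev g).1 (hf a)).trans ((evₗ_zero g _).trans ?_)
    congr 2
    · exact Subsingleton.elim _ _
    · funext i
      congr 1
      ext
      simp
  | q + 1, g, a => by
    have h : (barShift φ (q + 1)).1 (pureTensor k A (p + (q + 1)) a) =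
        barMk (a 0) ((barShift φ q).1 (pureTensor k A (p + q) (Fin.tail a))) :=
      barShiftHom_barMk φ q (a 0) (pureTensor k A (p + q) (Fin.tail a))
    rw [h]
    refine (evₗ_succ g _ _).trans
      ((ev_barShift φ f hf (g.curryLeft (a 0)) (Fin.tail a)).trans ?_)
    rw [MultilinearMap.curryLeft_apply]
    congr 2
    · funext j
      cases j using Fin.cases with
      | zero => rfl
      | succ j =>
        rw [Fin.cons_succ, Fin.tail]
        congr 1
    · funext i
      rw [Fin.tail]
      congr 1
      ext
      simp
      lia

/-- The underlying multilinear map of a cochain, with values in the bimodule `A`. -/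
def cochainEv {n : ℕ} (f : Hochschild.cochains k A n) : RightHom (bar k A n) (bar k A 0) :=
  ev ((barUnitₗ k A).compMultilinearMap f.2.choose)

lemma cochainEv_pureTensor {n : ℕ} (f : Hochschild.cochains k A n) (a : Fin n → A) :
    (cochainEv f).1 (pureTensor k A n a) = barUnit (f.1 a) :=
  (ev_pureTensor _ a).trans (multilinear_apply f a)

/-- Lifting `f` along the bar resolution and composing with `g` gives the cup product of `g`
and `f`, in this order. -/
lemma barShiftHom_comp_cochainHom {q : ℕ} (f : Hochschild.cochains k A p)
    (g : Hochschild.cochains k A q) (e : Hochschild.cochains k A (p + q))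
    (he : cochainHom e = barShiftHom (cochainEv f) q ≫ cochainHom g) :
    e.1 = Hochschild.reindex (Nat.add_comm q p) (Hochschild.cup g.1 f.1) := by
  funext a
  refine barUnit_injective (((cochainHom_eq_iff e _).1 he a).symm.trans ?_)
  change cochainHom g (barShiftHom (cochainEv f) q _) = _
  rw [barShiftHom_barOne]
  refine (barDesc_barOne _ _).trans ((ev_barShift _ f.1 (cochainEv_pureTensor f) _ a).trans ?_)
  rw [multilinear_apply, ract_barUnit]
  rfl

lemma barShiftHom_barD (f : Hochschild.cocycles k A p) (i : ℕ) :
    barD k A (p + i + 1) ≫ barShiftHom (cochainEv (cocycleCochain f)) i =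
      barShiftHom (cochainEv (cocycleCochain f)) (i + 1) ≫ barD k A (i + 1) := by
  ext x
  exact barShift_barD _ (barD_cocycle f) (i + 1) x

lemma exists_cochainHom_eq {q : ℕ} (f : Hochschild.cocycles k A p)
    (g : Hochschild.cocycles k A q) : ∃ e : Hochschild.cocycles k A (p + q),
      cochainHom (cocycleCochain e) =
        barShiftHom (cochainEv (cocycleCochain f)) q ≫ cochainHom (cocycleCochain g) := by
  obtain ⟨e, he⟩ := cochainHom_surjective (barShiftHom (cochainEv (cocycleCochain f)) q ≫
    cochainHom (cocycleCochain g))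
  refine ⟨⟨e.1, Submodule.mem_inf.2 ⟨e.2, (barD_comp_cochainHom_eq_zero_iff e).1 ?_⟩⟩, he⟩
  rw [he, ← Category.assoc, barShiftHom_barD f q, Category.assoc, barD_cocycle, comp_zero]

variable [Module.Projective k A] [HasExt.{w} (BimoduleCat k A)]

lemma hochschildExt_comp_of_eq {q : ℕ} (f : Hochschild.cocycles k A p)
    (g : Hochschild.cocycles k A q) (e : Hochschild.cocycles k A (p + q))
    (he : cochainHom (cocycleCochain e) =
      barShiftHom (cochainEv (cocycleCochain f)) q ≫ cochainHom (cocycleCochain g)) :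
    (hochschildExt.{w} p f).comp (hochschildExt.{w} q g) rfl =
      (-1 : ℤ) ^ (p * q) • hochschildExt.{w} (p + q) e := by
  refine ((barSequence k A).ext_comp_ext _ (barD_cocycle f) _ (barD_cocycle g)
    (barShiftHom (cochainEv (cocycleCochain f))) (bar_hom_ext fun x ↦ ?_)
    (barShiftHom_barD f)).trans (congrArg ((-1 : ℤ) ^ (p * q) • ·) ?_)
  · change barD k A 0 (barShiftHom _ 0 ((barOne k A p).1 x)) = barDesc _ _
    exact ((congrArg _ (barShiftHom_barOne _ 0 x)).trans (barD_zero_barOne _)).trans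
      (barDesc_barOne (cochainEv (cocycleCochain f)) x).symm
  · exact barExt_congr he.symm _ (barD_cocycle e)

lemma hochschildExt_comp {q n : ℕ} (h : p + q = n) (h' : q + p = n)
    (f : Hochschild.cocycles k A p) (g : Hochschild.cocycles k A q) :
    ∃ hc : Hochschild.reindex h' (Hochschild.cup g.1 f.1) ∈ Hochschild.cocycles k A n,
      (hochschildExt.{w} p f).comp (hochschildExt.{w} q g) h =
        (-1 : ℤ) ^ (p * q) • hochschildExt.{w} n ⟨_, hc⟩ := by
  subst h
  obtain ⟨e, he⟩ := exists_cochainHom_eq f g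
  have he' : Hochschild.reindex h' (Hochschild.cup g.1 f.1) = e.1 :=
    (barShiftHom_comp_cochainHom _ _ _ he).symm
  rw [he']
  exact ⟨e.2, hochschildExt_comp_of_eq f g e he⟩

/-- The cup product of cocycles represents the Yoneda product. The bar resolution gives the product
in the opposite order and with a sign, and this is compensated by graded commutativity. -/
lemma hochschildExt_cup {q : ℕ} (f : Hochschild.cocycles k A p) (g : Hochschild.cocycles k A q) :
    ∃ hc : Hochschild.cup f.1 g.1 ∈ Hochschild.cocycles k A (p + q),
      hochschildExt (p + q) ⟨_, hc⟩ =
        (hochschildExt.{w} p f).comp (hochschildExt.{w} q g) rfl := by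
  obtain ⟨hc, h⟩ := hochschildExt_comp.{w} (Nat.add_comm q p) rfl g f
  refine ⟨hc, ?_⟩
  rw [(functorialResolution (k := k) (A := A)).ext_comp_comm, h, smul_smul, mul_comm q p,
    ← mul_pow, neg_one_mul, neg_neg, one_pow, one_smul]
  rfl

/-- The cup product of Hochschild cocycles is graded commutative up to coboundaries. -/
lemma cup_sub_mem_coboundaries {q : ℕ} (f : Hochschild.cocycles k A p)
    (g : Hochschild.cocycles k A q) :
    Hochschild.cup f.1 g.1 - (-1 : ℤ) ^ (p * q) •
      Hochschild.reindex (Nat.add_comm q p) (Hochschild.cup g.1 f.1) ∈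
        Hochschild.coboundaries k A (p + q) := by
  obtain ⟨hc, h⟩ := hochschildExt_cup.{w} f g
  obtain ⟨hc', h'⟩ := hochschildExt_comp.{w} rfl (Nat.add_comm q p) f g
  let e : Hochschild.cocycles k A (p + q) := ⟨_, hc⟩
  let e' : Hochschild.cocycles k A (p + q) := ⟨_, hc'⟩
  refine (hochschildExt_eq_zero_iff.{w} (e - (-1 : ℤ) ^ (p * q) • e')).1 ?_
  rw [map_sub, map_zsmul, h, h', sub_self]

end

end BimoduleCat

end

/-! ### The cobar resolution -/

noncomputable section

namespace Bicomod

open ComonObj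

section

variable {V : Type u} [Category.{v} V] [MonoidalCategory V] {C : V} [ComonObj C]
  {M N P : Bicomod C}

/-- Morphisms between bicomodules that are colinear for the right coactions. -/
abbrev RightHom (M N : Bicomod C) : Type v :=
  {φ : M.X ⟶ N.X // M.right ≫ φ ▷ C = φ ≫ N.right}

/-- A morphism of bicomodules is right colinear. -/
abbrev RightHom.ofHom (f : M ⟶ N) : RightHom M N := ⟨f.hom, f.right_comm⟩

/-- The composition of right colinear morphisms. -/
abbrev RightHom.comp (φ : RightHom M N) (ψ : RightHom N P) : RightHom M P :=
  ⟨φ.1 ≫ ψ.1, by rw [comp_whiskerRight, reassoc_of% φ.2, ψ.2, Category.assoc]⟩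

/-- The bicomodule `C ⊗ M` that is cofree as a left comodule. -/
def leftCofree (M : Bicomod C) : Bicomod C := outer (unit C) M

/-- The functoriality of `C ⊗ M` for right colinear morphisms. -/
def leftMap (φ : RightHom M N) : leftCofree M ⟶ leftCofree N where
  hom := C ◁ φ.1
  left_comm := by
    change (Δ ▷ M.X ≫ (α_ _ _ _).hom) ≫ C ◁ C ◁ φ.1 = C ◁ φ.1 ≫ Δ ▷ N.X ≫ (α_ _ _ _).hom
    rw [whisker_exchange_assoc]
    simp
  right_comm := by
    change (C ◁ M.right ≫ (α_ _ _ _).inv) ≫ (C ◁ φ.1) ▷ C = C ◁ φ.1 ≫ C ◁ N.right ≫ (α_ _ _ _).inv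
    rw [← whiskerLeft_comp_assoc, ← φ.2]
    simp

/-- The left coaction is a morphism of bicomodules. -/
def coact (M : Bicomod C) : M ⟶ leftCofree M where
  hom := M.left
  left_comm := M.left_coassoc
  right_comm := by
    change M.right ≫ M.left ▷ C = M.left ≫ C ◁ M.right ≫ (α_ _ _ _).inv
    simp

/-- The counit is a right colinear morphism. -/
def leftCounit (M : Bicomod C) : RightHom (leftCofree M) M :=
  ⟨ε ▷ M.X ≫ (λ_ M.X).hom, by
    change (C ◁ M.right ≫ (α_ _ _ _).inv) ≫ (ε ▷ M.X ≫ (λ_ M.X).hom) ▷ C =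
      (ε ▷ M.X ≫ (λ_ M.X).hom) ≫ M.right
    rw [comp_whiskerRight, Category.assoc, ← associator_inv_naturality_left_assoc,
      whisker_exchange_assoc]
    simp⟩

lemma leftMap_leftCounit (φ : RightHom M N) :
    (leftMap φ).hom ≫ (leftCounit N).1 = (leftCounit M).1 ≫ φ.1 := by
  change C ◁ φ.1 ≫ ε ▷ N.X ≫ (λ_ N.X).hom = (ε ▷ M.X ≫ (λ_ M.X).hom) ≫ φ.1
  rw [whisker_exchange_assoc]
  simp

lemma coact_leftCounit (M : Bicomod C) : (coact M).hom ≫ (leftCounit M).1 = 𝟙 M.X := by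
  change M.left ≫ ε ▷ M.X ≫ (λ_ M.X).hom = _
  simp

/-- The morphism of bicomodules to `C ⊗ N` that corresponds to a right colinear morphism. -/
def leftLift (φ : RightHom M N) : M ⟶ leftCofree N := coact M ≫ leftMap φ

lemma leftLift_leftCounit (φ : RightHom M N) :
    (leftLift φ).hom ≫ (leftCounit N).1 = φ.1 := by
  change ((coact M).hom ≫ (leftMap φ).hom) ≫ _ = _
  rw [Category.assoc, leftMap_leftCounit, reassoc_of% coact_leftCounit]

lemma leftLift_eq (f : M ⟶ leftCofree N) :
    leftLift ((RightHom.ofHom f).comp (leftCounit N)) = f := by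
  apply hom_ext
  change M.left ≫ C ◁ (f.hom ≫ ε ▷ N.X ≫ (λ_ N.X).hom) = f.hom
  rw [whiskerLeft_comp, reassoc_of% f.left_comm]
  have h : (Δ ▷ N.X ≫ (α_ C C N.X).hom) ≫ C ◁ (ε ▷ N.X ≫ (λ_ N.X).hom) = 𝟙 (C ⊗ N.X) := by
    rw [whiskerLeft_comp, Category.assoc, ← associator_naturality_middle_assoc,
      ← comp_whiskerRight_assoc]
    simp
  exact (congrArg (f.hom ≫ ·) h).trans (Category.comp_id _)

lemma leftCofree_hom_ext {f g : M ⟶ leftCofree N}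
    (h : f.hom ≫ (leftCounit N).1 = g.hom ≫ (leftCounit N).1) : f = g := by
  rw [← leftLift_eq f, ← leftLift_eq g]
  congr 1
  exact Subtype.ext h

variable (C) in
/-- The bicomodule `C^{⊗ (n + 1)}`. -/
def cobar : ℕ → Bicomod C
  | 0 => unit C
  | n + 1 => leftCofree (cobar n)

variable (C) in
/-- The map `C^{⊗ (n + 2)} ⟶ C^{⊗ (n + 1)}` that applies the counit to the first factor.  It is a
contracting homotopy of the cobar resolution. -/
def cobarCounit (n : ℕ) : RightHom (cobar C (n + 1)) (cobar C n) := leftCounit (cobar C n)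

lemma cobar_hom_ext {n : ℕ} {f g : M ⟶ cobar C (n + 1)}
    (h : f.hom ≫ (cobarCounit C n).1 = g.hom ≫ (cobarCounit C n).1) : f = g :=
  leftCofree_hom_ext h

section

variable {q : ℕ} (φ : RightHom (cobar C 0) (cobar C q))

/-- The maps `C^{⊗ (i + 1)} ⟶ C^{⊗ (q + i + 1)}` that apply a right colinear morphism to the last
factor. -/
def cobarShift : ∀ i, RightHom (cobar C i) (cobar C (q + i))
  | 0 => φ
  | i + 1 => RightHom.ofHom (leftMap (cobarShift i))

/-- The morphism of bicomodules that underlies `cobarShift`. -/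
def cobarShiftHom (i : ℕ) : cobar C (i + 1) ⟶ cobar C (q + i + 1) := leftMap (cobarShift φ i)

lemma cobarShiftHom_counit (i : ℕ) :
    (cobarShiftHom φ i).hom ≫ (cobarCounit C (q + i)).1 =
      (cobarCounit C i).1 ≫ (cobarShift φ i).1 :=
  leftMap_leftCounit _

end

variable (C) in
/-- The object `C^{⊗ n}`. -/
def tensorPow : ℕ → V
  | 0 => 𝟙_ V
  | n + 1 => C ⊗ tensorPow n

variable (C) in
/-- The map `C^{⊗ (n + 1)} ⟶ C^{⊗ n}` that applies the counit to the last factor. -/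
def lastCounit : ∀ n, (cobar C n).X ⟶ tensorPow C n
  | 0 => ε[C]
  | n + 1 => C ◁ lastCounit n

variable (C) in
/-- The identification of `C^{⊗ n} ⊗ C` and `C^{⊗ (n + 1)}`. -/
def powTensor : ∀ n, tensorPow C n ⊗ C ⟶ (cobar C n).X
  | 0 => (λ_ C).hom
  | n + 1 => (α_ C (tensorPow C n) C).hom ≫ C ◁ powTensor n

lemma powTensor_right : ∀ n, powTensor C n ≫ (cobar C n).right =
    tensorPow C n ◁ Δ ≫ (α_ _ _ _).inv ≫ powTensor C n ▷ C
  | 0 => by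
    change (λ_ C).hom ≫ Δ = 𝟙_ V ◁ Δ ≫ (α_ _ _ _).inv ≫ (λ_ C).hom ▷ C
    simp
  | n + 1 => by
    change ((α_ C (tensorPow C n) C).hom ≫ C ◁ powTensor C n) ≫ C ◁ (cobar C n).right ≫
      (α_ _ _ _).inv = (C ⊗ tensorPow C n) ◁ Δ ≫ (α_ _ _ _).inv ≫
        ((α_ C (tensorPow C n) C).hom ≫ C ◁ powTensor C n) ▷ C
    rw [Category.assoc, ← whiskerLeft_comp_assoc, powTensor_right n]
    simp

lemma powTensor_lastCounit : ∀ n, powTensor C n ≫ lastCounit C n =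
    tensorPow C n ◁ ε ≫ (ρ_ _).hom
  | 0 => by
    change (λ_ C).hom ≫ ε = 𝟙_ V ◁ ε ≫ (ρ_ (𝟙_ V)).hom
    rw [← unitors_equal]
    simp
  | n + 1 => by
    change ((α_ C (tensorPow C n) C).hom ≫ C ◁ powTensor C n) ≫ C ◁ lastCounit C n =
      (C ⊗ tensorPow C n) ◁ ε ≫ (ρ_ (C ⊗ tensorPow C n)).hom
    rw [Category.assoc, ← whiskerLeft_comp, powTensor_lastCounit n]
    simp

lemma right_powTensor : ∀ n, (cobar C n).right ≫ lastCounit C n ▷ C ≫ powTensor C n = 𝟙 _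
  | 0 => by
    change Δ ≫ ε ▷ C ≫ (λ_ C).hom = 𝟙 C
    simp
  | n + 1 => by
    change (C ◁ (cobar C n).right ≫ (α_ _ _ _).inv) ≫ (C ◁ lastCounit C n) ▷ C ≫
      (α_ C (tensorPow C n) C).hom ≫ C ◁ powTensor C n = 𝟙 (C ⊗ (cobar C n).X)
    have := congr(C ◁ $(right_powTensor n))
    rw [whiskerLeft_comp, whiskerLeft_comp, MonoidalCategory.whiskerLeft_id] at this
    simpa using this

/-- A right colinear morphism to `C^{⊗ (n + 1)}` is determined by its composition with the counit of
the last factor. -/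
lemma rightHom_ext {n : ℕ} {φ ψ : RightHom M (cobar C n)}
    (h : φ.1 ≫ lastCounit C n = ψ.1 ≫ lastCounit C n) : φ = ψ := by
  have (φ : RightHom M (cobar C n)) :
      φ.1 = M.right ≫ (φ.1 ≫ lastCounit C n) ▷ C ≫ powTensor C n := by
    rw [comp_whiskerRight, Category.assoc, reassoc_of% φ.2, right_powTensor, Category.comp_id]
  apply Subtype.ext
  rw [this φ, this ψ, h]

/-- The right colinear morphism that corresponds to a morphism to `C^{⊗ n}`. -/
def rightLift {n : ℕ} (f : M.X ⟶ tensorPow C n) : RightHom M (cobar C n) :=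
  ⟨M.right ≫ f ▷ C ≫ powTensor C n, by
    simp only [comp_whiskerRight, Category.assoc, powTensor_right]
    rw [← whisker_exchange_assoc, M.right_coassoc_assoc]
    simp⟩

lemma rightLift_lastCounit {n : ℕ} (f : M.X ⟶ tensorPow C n) :
    (rightLift f).1 ≫ lastCounit C n = f := by
  change (M.right ≫ f ▷ C ≫ powTensor C n) ≫ lastCounit C n = f
  simp only [Category.assoc, powTensor_lastCounit]
  rw [← whisker_exchange_assoc, M.right_counit_assoc]
  simp

/-- The corestriction of a morphism to the cobar resolution. -/
def toPow {n : ℕ} (f : M ⟶ cobar C (n + 1)) : M.X ⟶ tensorPow C n :=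
  f.hom ≫ (cobarCounit C n).1 ≫ lastCounit C n

lemma toPow_injective {n : ℕ} {f g : M ⟶ cobar C (n + 1)} (h : toPow f = toPow g) : f = g := by
  refine cobar_hom_ext (congrArg Subtype.val (rightHom_ext (φ := (RightHom.ofHom f).comp
    (cobarCounit C n)) (ψ := (RightHom.ofHom g).comp (cobarCounit C n)) ?_))
  simpa [toPow] using h

lemma exists_toPow_eq {n : ℕ} (h : M.X ⟶ tensorPow C n) :
    ∃ f : M ⟶ cobar C (n + 1), toPow f = h :=
  ⟨leftLift (rightLift h), by
    refine ((Category.assoc _ _ _).symm.trans (congrArg (· ≫ lastCounit C n) ?_)).trans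
      (rightLift_lastCounit h)
    exact leftLift_leftCounit (rightLift h)⟩

instance injective_cobar [∀ X : V, Injective X] [(forget C).PreservesMonomorphisms] (n : ℕ) :
    Injective (cobar C (n + 1)) where
  factors {X Y} g f hf := by
    have : Mono f.hom := inferInstanceAs (Mono ((forget C).map f))
    obtain ⟨h, hh⟩ := exists_toPow_eq (Injective.factorThru (toPow g) f.hom)
    refine ⟨h, toPow_injective ?_⟩
    change (f.hom ≫ h.hom) ≫ _ = _
    rw [Category.assoc]
    exact (congrArg (f.hom ≫ ·) hh).trans (Injective.comp_factorThru _ _)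

end

variable {V : Type u} [Category.{v} V] [Abelian V] [MonoidalCategory V] [MonoidalPreadditive V]
  {C : V} [ComonObj C]

lemma coact_sub_leftMap_leftCounit {N : Bicomod C} (d : N ⟶ leftCofree N) :
    (coact (leftCofree N) - leftMap (RightHom.ofHom d)).hom ≫ (leftCounit (leftCofree N)).1 =
      𝟙 _ - (leftCounit N).1 ≫ d.hom := by
  rw [sub_hom, Preadditive.sub_comp, coact_leftCounit, leftMap_leftCounit]

variable (C) in
/-- The differential of the cobar resolution. -/
def cobarD : ∀ n, cobar C n ⟶ cobar C (n + 1)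
  | 0 => coact _
  | n + 1 => coact _ - leftMap (RightHom.ofHom (cobarD n))

lemma cobarD_zero_counit : (cobarD C 0).hom ≫ (cobarCounit C 0).1 = 𝟙 _ :=
  coact_leftCounit _

lemma cobarD_succ_counit (n : ℕ) : (cobarD C (n + 1)).hom ≫ (cobarCounit C (n + 1)).1 =
    𝟙 _ - (cobarCounit C n).1 ≫ (cobarD C n).hom :=
  coact_sub_leftMap_leftCounit (cobarD C n)

lemma cobarD_comp_cobarD : ∀ n, cobarD C n ≫ cobarD C (n + 1) = 0
  | 0 => cobar_hom_ext (by
    change ((cobarD C 0).hom ≫ (cobarD C 1).hom) ≫ _ = 0 ≫ _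
    rw [Category.assoc, cobarD_succ_counit, Preadditive.comp_sub, reassoc_of% cobarD_zero_counit,
      Category.comp_id, sub_self, zero_comp])
  | n + 1 => cobar_hom_ext (by
    have h : (cobarD C n).hom ≫ (cobarD C (n + 1)).hom = 0 :=
      congrArg Hom.hom (cobarD_comp_cobarD n)
    change ((cobarD C (n + 1)).hom ≫ (cobarD C (n + 2)).hom) ≫ _ = 0 ≫ _
    rw [Category.assoc, cobarD_succ_counit, Preadditive.comp_sub,
      ← Category.assoc _ (cobarCounit C (n + 1)).1, cobarD_succ_counit, Preadditive.sub_comp,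
      Category.assoc _ (cobarD C n).hom, h]
    simp)

lemma eq_comp_cobarD {n : ℕ} {A : V} (x : A ⟶ (cobar C (n + 1)).X)
    (hx : x ≫ (cobarD C (n + 1)).hom = 0) :
    x = (x ≫ (cobarCounit C n).1) ≫ (cobarD C n).hom := by
  have h := congrArg (x ≫ ·) (cobarD_succ_counit (C := C) n)
  rw [← Category.assoc, hx, zero_comp, Preadditive.comp_sub, Category.comp_id, eq_comm,
    sub_eq_zero] at h
  rw [Category.assoc]
  exact h

section

variable {q : ℕ} (φ : RightHom (cobar C 0) (cobar C q))

/-- If `φ` is a cocycle, then the maps `cobarShift` commute with the differentials. -/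
lemma cobarD_cobarShift (hφ : leftLift φ ≫ cobarD C (q + 1) = 0) : ∀ i,
    (cobarD C i).hom ≫ (cobarShiftHom φ i).hom = (cobarShift φ i).1 ≫ (cobarD C (q + i)).hom
  | 0 => by
    have h : (leftLift φ).hom ≫ (cobarD C (q + 1)).hom = 0 := congrArg Hom.hom hφ
    exact (eq_comp_cobarD (leftLift φ).hom h).trans
      (congrArg (· ≫ (cobarD C q).hom) (leftLift_leftCounit φ))
  | i + 1 => by
    suffices h : cobarD C (i + 1) ≫ cobarShiftHom φ (i + 1) =
        cobarShiftHom φ i ≫ cobarD C (q + i + 1) from congrArg Hom.hom h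
    refine cobar_hom_ext ?_
    change ((cobarD C (i + 1)).hom ≫ (cobarShiftHom φ (i + 1)).hom) ≫
      (cobarCounit C (q + (i + 1))).1 = ((cobarShiftHom φ i).hom ≫ (cobarD C (q + i + 1)).hom) ≫ _
    rw [Category.assoc, Category.assoc, cobarShiftHom_counit]
    have h₁ := cobarD_succ_counit (C := C) (q + i)
    refine Eq.trans ?_ (congrArg ((cobarShiftHom φ i).hom ≫ ·) h₁).symm
    rw [← Category.assoc, cobarD_succ_counit, Preadditive.sub_comp, Preadditive.comp_sub,
      ← Category.assoc _ (cobarCounit C (q + i)).1, cobarShiftHom_counit, Category.assoc,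
      Category.assoc, ← cobarD_cobarShift hφ i, Category.id_comp, Category.comp_id]
    rfl

end

variable [∀ X : V, PreservesFiniteLimits (tensorLeft X)]
  [∀ X : V, PreservesFiniteLimits (tensorRight X)]

lemma cobar_exact (n : ℕ) : (ShortComplex.mk _ _ (cobarD_comp_cobarD (C := C) n)).Exact := by
  rw [exact_iff_forget, ShortComplex.exact_iff_exact_up_to_refinements]
  intro A x hx
  refine ⟨A, 𝟙 A, inferInstance, x ≫ (cobarCounit C n).1, ?_⟩
  change 𝟙 A ≫ x = (x ≫ (cobarCounit C n).1) ≫ (cobarD C n).hom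
  exact (Category.id_comp x).trans (eq_comp_cobarD x hx)

instance mono_cobarD : Mono (cobarD C 0) :=
  (forget C).mono_of_mono_map
    (SplitMono.mk (cobarCounit C 0).1 cobarD_zero_counit).mono

variable (C) in
/-- The cobar resolution. -/
def cobarSequence [∀ X : V, Injective X] : InjectiveSequence (Bicomod C) where
  X := cobar C
  d := cobarD C
  d_comp_d := cobarD_comp_cobarD
  exact := cobar_exact
  mono := inferInstance
  injective n := injective_cobar n

end Bicomod

end

/-! ### The tensor powers of a coalgebra inside the tensor algebra -/

noncomputable section

namespace TensorAlgebra

section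

variable (k C : Type u) [CommRing k] [AddCommGroup C] [Module k C]

/-- The multiplication `C ⊗ T(C) ⟶ T(C)`. -/
def ιMul : C ⊗[k] TensorAlgebra k C →ₗ[k] TensorAlgebra k C :=
  LinearMap.mul' k (TensorAlgebra k C) ∘ₗ (ι k).rTensor (TensorAlgebra k C)

lemma ιMul_tmul (c : C) (x : TensorAlgebra k C) : ιMul k C (c ⊗ₜ x) = ι k c * x := rfl

/-- The map `k × (C ⊗ T(C)) ⟶ T(C)`, which is an isomorphism. -/
def scalarAdd : k × (C ⊗[k] TensorAlgebra k C) →ₗ[k] TensorAlgebra k C :=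
  (Algebra.linearMap k (TensorAlgebra k C)).coprod (ιMul k C)

/-- The representation of `T(C)` on `k × (C ⊗ T(C))` that corresponds to left multiplication. -/
def scalarAddRep : TensorAlgebra k C →ₐ[k] Module.End k (k × (C ⊗[k] TensorAlgebra k C)) :=
  TensorAlgebra.lift k
    { toFun c := LinearMap.inr k k _ ∘ₗ TensorProduct.mk k C (TensorAlgebra k C) c ∘ₗ scalarAdd k C
      map_add' c c' := by
        ext x <;> simp
      map_smul' r c := by
        ext x <;> simp }

lemma scalarAdd_scalarAddRep (x : TensorAlgebra k C) (z : k × (C ⊗[k] TensorAlgebra k C)) :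
    scalarAdd k C (scalarAddRep k C x z) = x * scalarAdd k C z := by
  induction x using TensorAlgebra.induction generalizing z with
  | algebraMap r => simp [Algebra.smul_def]
  | ι c => simp [scalarAddRep, scalarAdd, ιMul_tmul]
  | mul x y hx hy => simp [hx, hy, mul_assoc]
  | add x y hx hy => simp [hx, hy, add_mul]

/-- The map `C ⊗ T(C) ⟶ T(C)` is injective, since the tensor algebra is free. -/
lemma ιMul_injective : Function.Injective (ιMul k C) := by
  have h : (LinearMap.snd k k _ ∘ₗ (scalarAddRep k C).toLinearMap.flip (1, 0)) ∘ₗ ιMul k C =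
      LinearMap.id := by
    ext c x
    have h : scalarAdd k C (scalarAddRep k C x (1, 0)) = x := by
      rw [scalarAdd_scalarAddRep]
      simp [scalarAdd]
    have h' (z : k × (C ⊗[k] TensorAlgebra k C)) :
        scalarAddRep k C (ι k c) z = (0, c ⊗ₜ scalarAdd k C z) := by
      simp [scalarAddRep]
    simp [ιMul_tmul, h, h']
  exact Function.LeftInverse.injective (g := LinearMap.snd k k _ ∘ₗ
    (scalarAddRep k C).toLinearMap.flip (1, 0)) fun z ↦ DFunLike.congr_fun h z

end

section

variable {k C X : Type*} [CommRing k] [AddCommGroup C] [Module k C] [AddCommGroup X] [Module k X]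
  (t : X →ₗ[k] TensorAlgebra k C) (t' : C ⊗[k] X →ₗ[k] TensorAlgebra k C)

lemma mul_map_assoc_symm (ht' : ∀ c x, t' (c ⊗ₜ x) = ι k c * t x)
    (g : C →ₗ[k] TensorAlgebra k C) (c : C) (z : X ⊗[k] C) :
    LinearMap.mul' k _ (TensorProduct.map t' g ((TensorProduct.assoc k C X C).symm (c ⊗ₜ[k] z))) =
      ι k c * LinearMap.mul' k _ (TensorProduct.map t g z) := by
  induction z using TensorProduct.induction_on with
  | zero => simp
  | tmul x y => simp [ht', mul_assoc]
  | add x y hx hy => simp only [map_add, TensorProduct.tmul_add, mul_add, hx, hy]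

lemma apply_assoc (ht' : ∀ c x, t' (c ⊗ₜ x) = ι k c * t x)
    (t'' : C ⊗[k] (C ⊗[k] X) →ₗ[k] TensorAlgebra k C) (ht'' : ∀ c x, t'' (c ⊗ₜ x) = ι k c * t' x)
    (x : X) (z : C ⊗[k] C) : t'' (TensorProduct.assoc k C C X (z ⊗ₜ[k] x)) =
      LinearMap.mul' k _ (TensorProduct.map (ι k) (ι k) z) * t x := by
  induction z using TensorProduct.induction_on with
  | zero => simp
  | tmul a b => simp [ht', ht'', mul_assoc]
  | add a b ha hb => simp only [map_add, TensorProduct.add_tmul, add_mul, ha, hb]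

end

section

variable {k C : Type*} [CommRing k] [AddCommGroup C] [Module k C] [Coalgebra k C]
  (t : C →ₗ[k] TensorAlgebra k C)

lemma mul_map_comul (ht : ∀ c, t c = algebraMap k _ (Coalgebra.counit c))
    (g : C →ₗ[k] TensorAlgebra k C) (c : C) :
    LinearMap.mul' k _ (TensorProduct.map t g (Coalgebra.comul c)) = g c := by
  have h (z : C ⊗[k] C) : LinearMap.mul' k _ (TensorProduct.map t g z) =
      g (TensorProduct.lid k C ((Coalgebra.counit (R := k)).rTensor C z)) := by
    induction z using TensorProduct.induction_on with
    | zero => simp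
    | tmul x y => simp [ht, Algebra.smul_def]
    | add x y hx hy => simp only [map_add, hx, hy]
  rw [h, Coalgebra.rTensor_counit_comul]
  simp

lemma apply_comul (ht : ∀ c, t c = algebraMap k _ (Coalgebra.counit c))
    (t' : C ⊗[k] C →ₗ[k] TensorAlgebra k C)
    (ht' : ∀ c x, t' (c ⊗ₜ x) = ι k c * t x) (c : C) : t' (Coalgebra.comul c) = ι k c := by
  have h (z : C ⊗[k] C) :
      t' z = ι k (TensorProduct.rid k C ((Coalgebra.counit (R := k)).lTensor C z)) := by
    induction z using TensorProduct.induction_on with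
    | zero => simp
    | tmul x y => simp [ht', ht, Algebra.smul_def, Algebra.commutes]
    | add x y hx hy => simp only [map_add, hx, hy]
  rw [h, Coalgebra.lTensor_counit_comul]
  simp

end

end TensorAlgebra

namespace BicomoduleCat

open TensorAlgebra

variable {k C : Type u} [Field k] [AddCommGroup C] [Module k C]

variable (k C) in
/-- The embedding of the tensor power `C^{⊗ n}` in the tensor algebra. -/
def powToAlgebra : ∀ n, (Bicomod.tensorPow (ModuleCat.of k C) n : ModuleCat.{u} k) →ₗ[k]
    TensorAlgebra k C
  | 0 => Algebra.linearMap k (TensorAlgebra k C)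
  | n + 1 => ιMul k C ∘ₗ (powToAlgebra n).lTensor C

lemma powToAlgebra_injective : ∀ n, Function.Injective (powToAlgebra k C n)
  | 0 => (TensorAlgebra.algebraMap_leftInverse (R := k) C).injective
  | n + 1 => (ιMul_injective k C).comp
    (Module.Flat.lTensor_preserves_injective_linearMap _ (powToAlgebra_injective n))

lemma range_powToAlgebra : ∀ n, LinearMap.range (powToAlgebra k C n) =
    LinearMap.range (ι k (M := C)) ^ n
  | 0 => by
    rw [pow_zero, Submodule.one_eq_range]
    rfl
  | n + 1 => by
    rw [pow_succ', ← range_powToAlgebra n]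
    apply le_antisymm
    · rintro _ ⟨z, rfl⟩
      induction z using TensorProduct.induction_on with
      | zero => exact (map_zero (powToAlgebra k C (n + 1))).symm ▸ zero_mem _
      | tmul c x => exact Submodule.mul_mem_mul ⟨c, rfl⟩ ⟨x, rfl⟩
      | add x y hx hy => exact (map_add (powToAlgebra k C (n + 1)) x y).symm ▸ add_mem hx hy
    · rw [Submodule.mul_le]
      rintro _ ⟨c, rfl⟩ _ ⟨x, rfl⟩
      exact ⟨c ⊗ₜ x, rfl⟩

lemma shift_step {X Y : Type u} [AddCommGroup X] [Module k X] [AddCommGroup Y] [Module k Y]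
    {t : Y →ₗ[k] TensorAlgebra k C} {t' : C ⊗[k] Y →ₗ[k] TensorAlgebra k C}
    {r : X →ₗ[k] TensorAlgebra k C} {r' : C ⊗[k] X →ₗ[k] TensorAlgebra k C} {s : X →ₗ[k] Y}
    (ht' : ∀ c y, t' (c ⊗ₜ y) = ι k c * t y) (hr' : ∀ c x, r' (c ⊗ₜ x) = ι k c * r x)
    (h : ∀ x, t (s x) = r x) (z : C ⊗[k] X) : t' (s.lTensor C z) = r' z := by
  induction z using TensorProduct.induction_on with
  | zero => simp
  | tmul c x => simp [ht', hr', h]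
  | add x y hx hy => simp only [map_add, hx, hy]

variable [Coalgebra k C]

variable (k C) in
/-- The bicomodule `C^{⊗ (n + 1)}`. -/
abbrev cobar (n : ℕ) : BicomoduleCat k C := Bicomod.cobar (ModuleCat.of k C) n

variable (k C) in
/-- The map from `C^{⊗ (n + 1)}` to the tensor algebra that applies the counit to the last
factor. -/
def cobarToAlgebra (n : ℕ) : ((cobar k C n).X : ModuleCat.{u} k) →ₗ[k] TensorAlgebra k C :=
  powToAlgebra k C n ∘ₗ (Bicomod.lastCounit (ModuleCat.of k C) n).hom

lemma cobarToAlgebra_zero (c : C) :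
    cobarToAlgebra k C 0 c = algebraMap k _ (Coalgebra.counit c) := rfl

lemma cobarToAlgebra_succ (n : ℕ) (c : C) (x : (cobar k C n).X) :
    cobarToAlgebra k C (n + 1) (c ⊗ₜ[k] x) = ι k c * cobarToAlgebra k C n x := rfl

variable (k C) in
/-- The cup product `x ↦ ∑ t(x₁) g(x₂)` of the map `t` to the tensor algebra and a map `g` on
`C`. -/
def cobarCup (n : ℕ) (g : C →ₗ[k] TensorAlgebra k C) :
    ((cobar k C n).X : ModuleCat.{u} k) →ₗ[k] TensorAlgebra k C :=
  LinearMap.mul' k _ ∘ₗ TensorProduct.map (cobarToAlgebra k C n) g ∘ₗ (cobar k C n).right.hom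

lemma cobarCup_zero (g : C →ₗ[k] TensorAlgebra k C) (c : C) : cobarCup k C 0 g c = g c :=
  mul_map_comul (k := k) (C := C) (cobarToAlgebra k C 0) cobarToAlgebra_zero g c

lemma cobarCup_succ (n : ℕ) (g : C →ₗ[k] TensorAlgebra k C) (c : C) (x : (cobar k C n).X) :
    cobarCup k C (n + 1) g (c ⊗ₜ[k] x) = ι k c * cobarCup k C n g x :=
  mul_map_assoc_symm (cobarToAlgebra k C n) (cobarToAlgebra k C (n + 1)) (cobarToAlgebra_succ n)
    g c ((cobar k C n).right.hom x)

lemma der_step {X : Type u} [AddCommGroup X] [Module k X] {t : X →ₗ[k] TensorAlgebra k C}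
    {t' : C ⊗[k] X →ₗ[k] TensorAlgebra k C} {t'' : C ⊗[k] (C ⊗[k] X) →ₗ[k] TensorAlgebra k C}
    {r : X →ₗ[k] TensorAlgebra k C} {r' : C ⊗[k] X →ₗ[k] TensorAlgebra k C}
    {d : X →ₗ[k] C ⊗[k] X} {d' : C ⊗[k] X →ₗ[k] C ⊗[k] (C ⊗[k] X)} {n : ℕ}
    (ht' : ∀ c x, t' (c ⊗ₜ x) = ι k c * t x) (ht'' : ∀ c x, t'' (c ⊗ₜ x) = ι k c * t' x)
    (hr' : ∀ c x, r' (c ⊗ₜ x) = ι k c * r x)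
    (hd' : ∀ c x, d' (c ⊗ₜ x) =
      TensorProduct.assoc k C C X (Coalgebra.comul c ⊗ₜ[k] x) - c ⊗ₜ d x)
    (h : ∀ x, t' (d x) = Cartier.der k C (t x) + (-1 : ℤ) ^ n • r x) (y : C ⊗[k] X) :
    t'' (d' y) = Cartier.der k C (t' y) + (-1 : ℤ) ^ (n + 1) • r' y := by
  induction y using TensorProduct.induction_on with
  | zero => simp
  | tmul c x =>
    rw [hd', map_sub, apply_assoc t t' ht' t'' ht'', ht'', h, ht', hr', Cartier.der_ι_mul]
    have : LinearMap.mul' k _ (TensorProduct.map (ι k) (ι k) (Coalgebra.comul c)) =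
      Cartier.comul k C c := rfl
    rw [this, mul_add, pow_succ, mul_smul_comm]
    simp only [mul_neg, mul_one, neg_smul]
    abel
  | add x y hx hy =>
    simp only [map_add, hx, hy, smul_add]
    abel

/-- The differential of the cobar resolution corresponds to the derivation of the tensor algebra. -/
lemma cobarToAlgebra_cobarD : ∀ (n : ℕ) (x : (cobar k C n).X),
    cobarToAlgebra k C (n + 1) ((Bicomod.cobarD (ModuleCat.of k C) n).hom.hom x) =
      Cartier.der k C (cobarToAlgebra k C n x) + (-1 : ℤ) ^ n • cobarCup k C n (ι k) x
  | 0, c => by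
    refine (apply_comul (k := k) (C := C) (cobarToAlgebra k C 0) cobarToAlgebra_zero
      (cobarToAlgebra k C 1) (cobarToAlgebra_succ 0) c).trans ?_
    have h (a : k) : Cartier.der k C (algebraMap k _ a) = 0 := by
      rw [Algebra.algebraMap_eq_smul_one, map_smul, Cartier.der_one, smul_zero]
    have h' : Cartier.der k C (cobarToAlgebra k C 0 c) = 0 := h _
    rw [h', pow_zero, one_smul, zero_add]
    exact (cobarCup_zero (k := k) (C := C) (ι k) c).symm
  | n + 1, y => der_step (cobarToAlgebra_succ n) (cobarToAlgebra_succ (n + 1))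
      (cobarCup_succ n (ι k)) (d := (Bicomod.cobarD (ModuleCat.of k C) n).hom.hom)
      (d' := (Bicomod.cobarD (ModuleCat.of k C) (n + 1)).hom.hom) (fun _ _ ↦ rfl)
      (cobarToAlgebra_cobarD n) y

/-- Under the embedding in the tensor algebra, the lift of `φ` to the cobar resolution becomes the
cup product with `φ`. -/
lemma cobarToAlgebra_cobarShift {q : ℕ} (φ : Bicomod.RightHom (cobar k C 0) (cobar k C q)) :
    ∀ (p : ℕ) (x : (cobar k C p).X),
      cobarToAlgebra k C (q + p) ((Bicomod.cobarShift φ p).1.hom x) =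
        cobarCup k C p (cobarToAlgebra k C q ∘ₗ φ.1.hom) x
  | 0, c => (cobarCup_zero (k := k) (C := C) (cobarToAlgebra k C q ∘ₗ φ.1.hom) c).symm
  | p + 1, y => shift_step (s := (Bicomod.cobarShift φ p).1.hom) (cobarToAlgebra_succ (q + p))
      (cobarCup_succ p (cobarToAlgebra k C q ∘ₗ φ.1.hom)) (cobarToAlgebra_cobarShift φ p) y

end BicomoduleCat

end

/-! ### Cartier cohomology as extensions of bicomodules -/

noncomputable section

instance ModuleCat.injective_of_field {k : Type u} [Field k] (X : ModuleCat.{u} k) :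
    Injective X := by
  have : Module.Injective k X := Module.injective_of_isSemisimpleRing k X
  exact Module.injective_object_of_injective_module k X

namespace BicomoduleCat

open TensorAlgebra

variable {k C : Type u} [Field k] [AddCommGroup C] [Module k C]

lemma mul_map_map {X : Type u} [AddCommGroup X] [Module k X] (t : X →ₗ[k] TensorAlgebra k C)
    (g : C →ₗ[k] TensorAlgebra k C) (φ : C →ₗ[k] X) (z : C ⊗[k] C) :
    LinearMap.mul' k _ (TensorProduct.map t g (φ.rTensor C z)) =
      LinearMap.mul' k _ (TensorProduct.map (t ∘ₗ φ) g z) := by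
  induction z using TensorProduct.induction_on with
  | zero => simp
  | tmul x y => simp
  | add x y hx hy => simp only [map_add, hx, hy]

lemma apply_lTensor {X : Type u} [AddCommGroup X] [Module k X] {t : X →ₗ[k] TensorAlgebra k C}
    {t' : C ⊗[k] X →ₗ[k] TensorAlgebra k C} (ht' : ∀ c x, t' (c ⊗ₜ x) = ι k c * t x)
    (φ : C →ₗ[k] X) (z : C ⊗[k] C) : t' (φ.lTensor C z) =
      LinearMap.mul' k _ (TensorProduct.map (ι k) (t ∘ₗ φ) z) := by
  induction z using TensorProduct.induction_on with
  | zero => simp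
  | tmul x y => simp [ht']
  | add x y hx hy => simp only [map_add, hx, hy]

variable [Coalgebra k C]

/-- The linear map that underlies a right colinear map `C ⟶ C^{⊗ (n + 1)}`. -/
abbrev rightHomLin {n : ℕ} (φ : Bicomod.RightHom (cobar k C 0) (cobar k C n)) :
    C →ₗ[k] (cobar k C n).X := φ.1.hom

/-- The map from `C` to the tensor algebra that corresponds to a right colinear map
`C ⟶ C^{⊗ (n + 1)}`. -/
def rightHomCochain {n : ℕ} (φ : Bicomod.RightHom (cobar k C 0) (cobar k C n)) :
    C →ₗ[k] TensorAlgebra k C :=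
  cobarToAlgebra k C n ∘ₗ rightHomLin φ

lemma cobarCup_rightHom {n : ℕ} (φ : Bicomod.RightHom (cobar k C 0) (cobar k C n))
    (g : C →ₗ[k] TensorAlgebra k C) (c : C) :
    cobarCup k C n g (rightHomLin φ c) = Cartier.cup (rightHomCochain φ) g c := by
  have h : (cobar k C n).right.hom (rightHomLin φ c) =
      LinearMap.rTensor C (rightHomLin φ) (Coalgebra.comul (R := k) c) :=
    (DFunLike.congr_fun (congrArg ModuleCat.Hom.hom φ.2) c).symm
  exact (congrArg (LinearMap.mul' k _ ∘ₗ TensorProduct.map (cobarToAlgebra k C n) g) h).trans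
    (mul_map_map (cobarToAlgebra k C n) g (rightHomLin φ) _)

/-- The morphism to the cobar resolution that is determined by a right colinear map. -/
abbrev cobarLift {n : ℕ} (φ : Bicomod.RightHom (cobar k C 0) (cobar k C n)) :
    cobar k C 0 ⟶ cobar k C (n + 1) := Bicomod.leftLift φ

lemma cobarToAlgebra_cobarLift {n : ℕ} (φ : Bicomod.RightHom (cobar k C 0) (cobar k C n)) (c : C) :
    cobarToAlgebra k C (n + 1) ((cobarLift φ).hom.hom c) =
      Cartier.cup (ι k) (rightHomCochain φ) c :=
  apply_lTensor (cobarToAlgebra_succ n) (rightHomLin φ) (Coalgebra.comul (R := k) c)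

/-- The right colinear map that underlies a morphism to the cobar resolution. -/
abbrev cobarCorestrict {n : ℕ} (g : cobar k C 0 ⟶ cobar k C (n + 1)) :
    Bicomod.RightHom (cobar k C 0) (cobar k C n) :=
  (Bicomod.RightHom.ofHom g).comp (Bicomod.cobarCounit _ n)

/-- The cochain that corresponds to a morphism to the cobar resolution. -/
def cobarCochain {n : ℕ} (g : cobar k C 0 ⟶ cobar k C (n + 1)) : C →ₗ[k] TensorAlgebra k C :=
  rightHomCochain (cobarCorestrict g)

lemma cobarCochain_mem {n : ℕ} (g : cobar k C 0 ⟶ cobar k C (n + 1)) :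
    cobarCochain g ∈ Cartier.cochains k C n := fun c ↦ by
  rw [← range_powToAlgebra]
  exact ⟨_, rfl⟩

lemma cobarCochain_injective {n : ℕ} {g h : cobar k C 0 ⟶ cobar k C (n + 1)}
    (H : cobarCochain g = cobarCochain h) : g = h := by
  refine Bicomod.toPow_injective (ModuleCat.hom_ext (LinearMap.ext fun c ↦ ?_))
  exact powToAlgebra_injective n (DFunLike.congr_fun H c)

lemma exists_cobarCochain_eq {n : ℕ} {f : C →ₗ[k] TensorAlgebra k C}
    (hf : f ∈ Cartier.cochains k C n) :
    ∃ g : cobar k C 0 ⟶ cobar k C (n + 1), cobarCochain g = f := by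
  let e := LinearEquiv.ofInjective _ (powToAlgebra_injective (k := k) (C := C) n)
  have hf' (c : C) : f c ∈ LinearMap.range (powToAlgebra k C n) := by
    rw [range_powToAlgebra]
    exact hf c
  obtain ⟨g, hg⟩ := Bicomod.exists_toPow_eq (M := cobar k C 0)
    (ModuleCat.ofHom (e.symm.toLinearMap ∘ₗ f.codRestrict _ hf'))
  refine ⟨g, LinearMap.ext fun c ↦ ?_⟩
  refine (congrArg (fun h ↦ powToAlgebra k C n (ModuleCat.Hom.hom h c)) hg).trans ?_
  exact congrArg Subtype.val (e.apply_symm_apply ⟨f c, hf' c⟩)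

lemma cobarCochain_add {n : ℕ} (g h : cobar k C 0 ⟶ cobar k C (n + 1)) :
    cobarCochain (g + h) = cobarCochain g + cobarCochain h :=
  LinearMap.ext fun c ↦ map_add (cobarToAlgebra k C n ∘ₗ
    (Bicomod.cobarCounit (ModuleCat.of k C) n).1.hom) (g.hom.hom c) (h.hom.hom c)

/-- The differential of the cobar resolution corresponds to the coboundary of the Cartier
complex. -/
lemma cobarCochain_comp_cobarD {n : ℕ} (g : cobar k C 0 ⟶ cobar k C (n + 1)) :
    cobarCochain (g ≫ Bicomod.cobarD _ (n + 1)) = Cartier.d k C n (cobarCochain g) := by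
  refine LinearMap.ext fun c ↦ ?_
  have h : (g ≫ Bicomod.cobarD _ (n + 1)).hom ≫ (Bicomod.cobarCounit _ (n + 1)).1 =
      (cobarLift (cobarCorestrict g)).hom -
        (cobarCorestrict g).1 ≫ (Bicomod.cobarD _ n).hom := by
    refine (Category.assoc _ _ _).trans ((congrArg (g.hom ≫ ·)
      (Bicomod.cobarD_succ_counit n)).trans ?_)
    rw [Preadditive.comp_sub, Category.comp_id, ← Category.assoc]
    exact congrArg (· - _) (congrArg Bicomod.Hom.hom (Bicomod.leftLift_eq g)).symm
  refine (congrArg (fun h : (cobar k C 0).X ⟶ (cobar k C (n + 1)).X ↦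
    cobarToAlgebra k C (n + 1) (h.hom (c : (cobar k C 0).X))) h).trans ?_
  refine (map_sub (cobarToAlgebra k C (n + 1)) _ _).trans ?_
  refine (congrArg₂ (· - ·) (cobarToAlgebra_cobarLift (cobarCorestrict g) c)
    ((cobarToAlgebra_cobarD n _).trans (congrArg (fun z ↦ _ + (-1 : ℤ) ^ n • z)
      (cobarCup_rightHom (cobarCorestrict g) (ι k) c)))).trans ?_
  change Cartier.cup (ι k) (cobarCochain g) c - (Cartier.der k C (cobarCochain g c) + (-1 : ℤ) ^ n •
    Cartier.cup (cobarCochain g) (ι k) c) = Cartier.cup (ι k) (cobarCochain g) c -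
      Cartier.der k C (cobarCochain g c) + (-1 : ℤ) ^ (n + 1) • Cartier.cup (cobarCochain g) (ι k) c
  rw [pow_succ, mul_neg_one, neg_smul]
  abel

lemma cobarCochain_comp_cobarShiftHom {p q : ℕ} (f : cobar k C 0 ⟶ cobar k C (p + 1))
    (g : cobar k C 0 ⟶ cobar k C (q + 1)) :
    cobarCochain (f ≫ Bicomod.cobarShiftHom (cobarCorestrict g) p) =
      Cartier.cup (cobarCochain f) (cobarCochain g) := by
  refine LinearMap.ext fun c ↦ ?_
  have h : (f ≫ Bicomod.cobarShiftHom (cobarCorestrict g) p).hom ≫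
      (Bicomod.cobarCounit _ (q + p)).1 =
        (cobarCorestrict f).1 ≫ (Bicomod.cobarShift (cobarCorestrict g) p).1 :=
    ((Category.assoc _ _ _).trans (congrArg (f.hom ≫ ·)
      (Bicomod.cobarShiftHom_counit (cobarCorestrict g) p))).trans (Category.assoc _ _ _).symm
  refine (congrArg (fun h : (cobar k C 0).X ⟶ (cobar k C (q + p)).X ↦
    cobarToAlgebra k C (q + p) (h.hom (c : (cobar k C 0).X))) h).trans ?_
  exact (cobarToAlgebra_cobarShift (cobarCorestrict g) p _).trans
    (cobarCup_rightHom (cobarCorestrict f) (cobarCochain g) c)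

lemma cobarCochain_mem_cocycles_iff {n : ℕ} (g : cobar k C 0 ⟶ cobar k C (n + 1)) :
    cobarCochain g ∈ Cartier.cocycles k C n ↔ g ≫ Bicomod.cobarD _ (n + 1) = 0 := by
  have h₀ : cobarCochain (0 : cobar k C 0 ⟶ cobar k C (n + 2)) = 0 := by
    simpa using cobarCochain_add (0 : cobar k C 0 ⟶ cobar k C (n + 2)) 0
  refine ⟨fun h ↦ cobarCochain_injective ?_, fun h ↦ Submodule.mem_inf.2
    ⟨cobarCochain_mem g, LinearMap.mem_ker.2 ?_⟩⟩
  · rw [cobarCochain_comp_cobarD, h₀]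
    exact h.2
  · rw [← cobarCochain_comp_cobarD, h, h₀]

/-- The morphism to the cobar resolution that corresponds to a cochain. -/
def cochainHom {n : ℕ} (f : Cartier.cochains k C n) : cobar k C 0 ⟶ cobar k C (n + 1) :=
  (exists_cobarCochain_eq f.2).choose

lemma cobarCochain_cochainHom {n : ℕ} (f : Cartier.cochains k C n) :
    cobarCochain (cochainHom f) = f.1 :=
  (exists_cobarCochain_eq f.2).choose_spec

end BicomoduleCat

end

/-! ### Cup products of Cartier cocycles and the Yoneda product -/

noncomputable section

lemma CategoryTheory.Abelian.Ext.zsmul_comp_zsmul {C : Type u} [Category.{v} C] [Abelian C]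
    [HasExt.{w} C] {X Y Z : C} {a b c : ℕ} (r s : ℤ) (α : Ext X Y a) (β : Ext Y Z b)
    (h : a + b = c) : (r • α).comp (s • β) h = (r * s) • α.comp β h := by
  change bilinearComp X Y Z a b c h (r • α) (s • β) = (r * s) • bilinearComp X Y Z a b c h α β
  rw [map_zsmul, map_zsmul, AddMonoidHom.zsmul_apply, smul_smul, mul_comm]

namespace BicomoduleCat

variable {k C : Type u} [Field k] [AddCommGroup C] [Module k C] [Coalgebra k C]

lemma cochainHom_cobarCochain {n : ℕ} (f : Cartier.cochains k C n)
    (g : cobar k C 0 ⟶ cobar k C (n + 1)) (h : cobarCochain g = f.1) : cochainHom f = g :=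
  cobarCochain_injective ((cobarCochain_cochainHom f).trans h.symm)

/-- The cochain that underlies a cocycle. -/
abbrev cocycleCochain {n : ℕ} (f : Cartier.cocycles k C n) : Cartier.cochains k C n :=
  ⟨f.1, (Submodule.mem_inf.1 f.2).1⟩

lemma cochainHom_cobarD {n : ℕ} (f : Cartier.cocycles k C n) :
    cochainHom (cocycleCochain f) ≫ Bicomod.cobarD _ (n + 1) = 0 := by
  rw [← cobarCochain_mem_cocycles_iff, cobarCochain_cochainHom]
  exact f.2

lemma cobarShiftHom_cobarD {q : ℕ} (g : Cartier.cocycles k C q) (i : ℕ) :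
    Bicomod.cobarD _ (i + 1) ≫
      Bicomod.cobarShiftHom (cobarCorestrict (cochainHom (cocycleCochain g))) (i + 1) =
        Bicomod.cobarShiftHom (cobarCorestrict (cochainHom (cocycleCochain g))) i ≫
          Bicomod.cobarD _ (q + i + 1) :=
  Bicomod.hom_ext (Bicomod.cobarD_cobarShift (cobarCorestrict (cochainHom (cocycleCochain g)))
    ((congrArg (· ≫ Bicomod.cobarD _ (q + 1)) (Bicomod.leftLift_eq _)).trans
      (cochainHom_cobarD g)) (i + 1))

variable [HasExt.{w} (BicomoduleCat k C)]

/-- The extension that is represented by a cocycle in the cobar resolution. -/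
def cobarExt {n : ℕ} (f : cobar k C 0 ⟶ cobar k C (n + 1)) (hf : f ≫ Bicomod.cobarD _ (n + 1) = 0) :
    Abelian.Ext (𝟙_ (BicomoduleCat k C)) (𝟙_ (BicomoduleCat k C)) n :=
  (Bicomod.cobarSequence (ModuleCat.of k C)).ext f hf

lemma cobarExt_add {n : ℕ} (f g h : cobar k C 0 ⟶ cobar k C (n + 1))
    (hf : f ≫ Bicomod.cobarD _ (n + 1) = 0) (hg : g ≫ Bicomod.cobarD _ (n + 1) = 0)
    (hh : h ≫ Bicomod.cobarD _ (n + 1) = 0) (hfg : h = f + g) :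
    cobarExt.{w} h hh = cobarExt f hf + cobarExt g hg := by
  subst hfg
  exact (Bicomod.cobarSequence (ModuleCat.of k C)).ext_add f g hf hg

lemma cobarExt_congr {n : ℕ} {f g : cobar k C 0 ⟶ cobar k C (n + 1)} (h : f = g)
    (hf : f ≫ Bicomod.cobarD _ (n + 1) = 0) (hg : g ≫ Bicomod.cobarD _ (n + 1) = 0) :
    cobarExt.{w} f hf = cobarExt g hg := by
  subst h
  rfl

/-- The extension that is represented by a Cartier cocycle, without the sign that makes it
multiplicative. -/
def cocycleExt (n : ℕ) : Cartier.cocycles k C n →+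
    Abelian.Ext (𝟙_ (BicomoduleCat k C)) (𝟙_ (BicomoduleCat k C)) n :=
  AddMonoidHom.mk' (fun f ↦ cobarExt (cochainHom (cocycleCochain f)) (cochainHom_cobarD f))
    (fun _ _ ↦ cobarExt_add _ _ _ _ _ _ (cochainHom_cobarCochain _ _
      ((cobarCochain_add _ _).trans (congrArg₂ (· + ·) (cobarCochain_cochainHom _)
        (cobarCochain_cochainHom _)))))

lemma cocycleExt_surjective (n : ℕ) :
    Function.Surjective (cocycleExt.{w} (k := k) (C := C) n) := fun α ↦ by
  obtain ⟨h, hh, rfl⟩ := (Bicomod.cobarSequence (ModuleCat.of k C)).ext_surjective α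
  let f : Cartier.cocycles k C n := ⟨cobarCochain h, (cobarCochain_mem_cocycles_iff h).2 hh⟩
  exact ⟨f, cobarExt_congr (cochainHom_cobarCochain (cocycleCochain f) h rfl)
    (cochainHom_cobarD f) hh⟩

lemma cocycleExt_eq_zero_iff : ∀ {n : ℕ} (f : Cartier.cocycles k C n),
    cocycleExt.{w} n f = 0 ↔ f.1 ∈ Cartier.coboundaries k C n
  | 0, f => by
    have h₀ : cobarCochain (0 : cobar k C 0 ⟶ cobar k C 1) = 0 := by
      simpa using cobarCochain_add (0 : cobar k C 0 ⟶ cobar k C 1) 0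
    refine ((Bicomod.cobarSequence (ModuleCat.of k C)).ext_zero_eq_zero_iff _
      (cochainHom_cobarD f)).trans ⟨fun h ↦ ?_, fun h ↦ ?_⟩
    · exact ((cobarCochain_cochainHom (cocycleCochain f)).symm.trans
        (congrArg cobarCochain h)).trans h₀
    · exact cochainHom_cobarCochain _ _ (h₀.trans h.symm)
  | n + 1, f => by
    refine ((Bicomod.cobarSequence (ModuleCat.of k C)).ext_succ_eq_zero_iff _
      (cochainHom_cobarD f)).trans ⟨fun ⟨g, hg⟩ ↦ ?_, fun ⟨g, hg, h⟩ ↦ ?_⟩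
    · exact ⟨cobarCochain g, cobarCochain_mem g, (cobarCochain_comp_cobarD g).symm.trans
        ((congrArg cobarCochain hg).trans (cobarCochain_cochainHom (cocycleCochain f)))⟩
    · refine ⟨cochainHom ⟨g, hg⟩, (cochainHom_cobarCochain (cocycleCochain f) _ ?_).symm⟩
      exact (cobarCochain_comp_cobarD _).trans
        ((congrArg (Cartier.d k C n) (cobarCochain_cochainHom _)).trans h)

/-- The product of two extensions is computed by lifting the second cocycle along the cobar
resolution. -/
lemma cocycleExt_comp {p q n : ℕ} (hn : p + q = n) (f : Cartier.cocycles k C p)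
    (g : Cartier.cocycles k C q) : ∃ hc : Cartier.cup f.1 g.1 ∈ Cartier.cocycles k C n,
      (cocycleExt.{w} p f).comp (cocycleExt.{w} q g) hn =
        (-1 : ℤ) ^ (p * q) • cocycleExt.{w} n ⟨_, hc⟩ := by
  obtain rfl : q + p = n := by rw [← hn, Nat.add_comm]
  let f' := cochainHom (cocycleCochain f)
  let g' := cochainHom (cocycleCochain g)
  let h := f' ≫ Bicomod.cobarShiftHom (cobarCorestrict g') p
  have hh : h ≫ Bicomod.cobarD _ (q + p + 1) = 0 := by
    have hf : f' ≫ Bicomod.cobarD _ (p + 1) = 0 := cochainHom_cobarD f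
    change (f' ≫ Bicomod.cobarShiftHom (cobarCorestrict g') p) ≫ _ = 0
    rw [Category.assoc, ← cobarShiftHom_cobarD g p, reassoc_of% hf, zero_comp]
  have hc : cobarCochain h = Cartier.cup f.1 g.1 :=
    (cobarCochain_comp_cobarShiftHom f' g').trans (congrArg₂ Cartier.cup
      (cobarCochain_cochainHom _) (cobarCochain_cochainHom _))
  let e : Cartier.cocycles k C (q + p) :=
    ⟨Cartier.cup f.1 g.1, hc ▸ (cobarCochain_mem_cocycles_iff h).2 hh⟩
  refine ⟨e.2, ?_⟩
  refine ((Bicomod.cobarSequence (ModuleCat.of k C)).ext_comp_ext _ (cochainHom_cobarD f) _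
    (cochainHom_cobarD g) (Bicomod.cobarShiftHom (cobarCorestrict g')) (Bicomod.leftLift_eq g')
    (cobarShiftHom_cobarD g)).trans (congrArg ((-1 : ℤ) ^ (p * q) • ·) ?_)
  exact cobarExt_congr (cochainHom_cobarCochain (cocycleCochain e) h hc).symm hh
    (cochainHom_cobarD e)

/-- The cup product of Cartier cocycles is graded commutative up to coboundaries. -/
lemma cup_sub_mem_coboundaries {p q : ℕ} (f : Cartier.cocycles k C p) (g : Cartier.cocycles k C q) :
    Cartier.cup f.1 g.1 - (-1 : ℤ) ^ (p * q) • Cartier.cup g.1 f.1 ∈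
      Cartier.coboundaries k C (p + q) := by
  obtain ⟨hc, h⟩ := cocycleExt_comp.{w} rfl f g
  obtain ⟨hc', h'⟩ := cocycleExt_comp.{w} (Nat.add_comm q p) g f
  let e : Cartier.cocycles k C (p + q) := ⟨_, hc⟩
  let e' : Cartier.cocycles k C (p + q) := ⟨_, hc'⟩
  refine (cocycleExt_eq_zero_iff.{w} (e - (-1 : ℤ) ^ (p * q) • e')).1 ?_
  have H := (Bicomod.functorialCoresolution (ModuleCat.of k C)).ext_comp_comm
    (cocycleExt.{w} p f) (cocycleExt.{w} q g)
  have h₁ : ((-1 : ℤ) ^ (p * q)) * (-1) ^ (p * q) = 1 := by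
    rw [← mul_pow, neg_one_mul, neg_neg, one_pow]
  replace H := (h.symm.trans H).trans (congrArg ((-1 : ℤ) ^ (p * q) • ·) h')
  replace H := congrArg ((-1 : ℤ) ^ (p * q) • ·) H
  simp only [smul_smul, mul_comm q p, h₁, one_smul] at H
  exact ((map_sub (cocycleExt (p + q)) e _).trans (congrArg (_ - ·)
    (map_zsmul (cocycleExt (p + q)) _ e'))).trans (sub_eq_zero.2 H)

/-- The sign `(-1)^{n (n - 1) / 2}`. -/
def cartierSign (n : ℕ) : ℤ := (-1) ^ n.choose 2

lemma cartierSign_mul_self (n : ℕ) : cartierSign n * cartierSign n = 1 := by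
  rw [cartierSign, ← mul_pow, neg_one_mul, neg_neg, one_pow]

lemma cartierSign_add (p q : ℕ) :
    cartierSign (p + q) = cartierSign p * cartierSign q * (-1) ^ (p * q) := by
  rw [cartierSign, cartierSign, cartierSign, ← pow_add, ← pow_add]
  congr 1
  induction q with
  | zero => simp
  | succ q ih =>
    rw [← Nat.add_assoc, Nat.choose_succ_succ' _ 1, Nat.choose_succ_succ' q 1, ih]
    simp only [Nat.choose_one_right]
    ring

/-- The extension that is represented by a Cartier cocycle. The cobar resolution gives the
cup product only up to the sign `(-1)^{pq}`, which the sign in this definition removes. -/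
def cartierExt (n : ℕ) : Cartier.cocycles k C n →+
    Abelian.Ext (𝟙_ (BicomoduleCat k C)) (𝟙_ (BicomoduleCat k C)) n :=
  cartierSign n • cocycleExt.{w} n

lemma cartierExt_surjective (n : ℕ) :
    Function.Surjective (cartierExt.{w} (k := k) (C := C) n) := fun α ↦ by
  obtain ⟨f, rfl⟩ := cocycleExt_surjective n α
  refine ⟨cartierSign n • f, (congrArg (cartierSign n • ·)
    (map_zsmul (cocycleExt n) (cartierSign n) f)).trans ?_⟩
  rw [smul_smul, cartierSign_mul_self, one_smul]

lemma cartierExt_eq_zero_iff {n : ℕ} (f : Cartier.cocycles k C n) :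
    cartierExt.{w} n f = 0 ↔ f.1 ∈ Cartier.coboundaries k C n := by
  rw [← cocycleExt_eq_zero_iff.{w}]
  refine ⟨fun h ↦ ?_, fun h ↦ (congrArg (cartierSign n • ·) h).trans (smul_zero _)⟩
  have := congrArg (cartierSign n • ·) h
  change cartierSign n • (cartierSign n • cocycleExt.{w} n f) = cartierSign n • 0 at this
  rwa [smul_smul, cartierSign_mul_self, one_smul, smul_zero] at this

variable (k C) in
/-- Cartier cohomology is the Yoneda algebra of self-extensions. -/
def cartierEquiv (n : ℕ) : Cartier.cohomology k C n ≃+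
    Abelian.Ext (𝟙_ (BicomoduleCat k C)) (𝟙_ (BicomoduleCat k C)) n :=
  Subquotient.addEquivOfSurjective (cartierExt.{w} n) (cartierExt_surjective n)
    cartierExt_eq_zero_iff

/-- The cup product of cocycles represents the Yoneda product. -/
lemma cartierExt_cup {p q : ℕ} (f : Cartier.cocycles k C p) (g : Cartier.cocycles k C q) :
    ∃ hc : Cartier.cup f.1 g.1 ∈ Cartier.cocycles k C (p + q),
      cartierExt (p + q) ⟨_, hc⟩ = (cartierExt.{w} p f).comp (cartierExt.{w} q g) rfl := by
  obtain ⟨hc, h⟩ := cocycleExt_comp.{w} rfl f g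
  refine ⟨hc, ?_⟩
  change cartierSign (p + q) • cocycleExt.{w} (p + q) ⟨_, hc⟩ =
    (cartierSign p • cocycleExt.{w} p f).comp (cartierSign q • cocycleExt.{w} q g) rfl
  refine (Eq.trans ?_ (Abelian.Ext.zsmul_comp_zsmul _ _ _ _ _).symm)
  rw [h, smul_smul, cartierSign_add]

end BicomoduleCat

end

/-! ### Graded commutativity of Hochschild and Cartier cohomology -/

theorem mainTheorem3 :
    (∀ (k A : Type u) [CommRing k] [Ring A] [Algebra k A] [Module.Flat k A],
      (∀ [HasDerivedCategory.{w} (BimoduleCat k A)],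
        Nonempty (LeftDerivedSuspendedMonoidal (BimoduleCat k A))) ∧
      ∀ [HasExt.{w} (BimoduleCat k A)],
        (∀ (p q : ℕ) (f : Abelian.Ext (𝟙_ (BimoduleCat k A)) (𝟙_ (BimoduleCat k A)) p)
            (g : Abelian.Ext (𝟙_ (BimoduleCat k A)) (𝟙_ (BimoduleCat k A)) q),
          f.comp g rfl = (-1 : ℤ) ^ (p * q) • g.comp f (Nat.add_comm q p)) ∧
        (Module.Projective k A →
          (∃ Φ : ∀ n : ℕ, Hochschild.cohomology k A n ≃+
              Abelian.Ext (𝟙_ (BimoduleCat k A)) (𝟙_ (BimoduleCat k A)) n,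
            ∀ (p q : ℕ) (f : (Fin p → A) → A) (hf : f ∈ Hochschild.cocycles k A p)
              (g : (Fin q → A) → A) (hg : g ∈ Hochschild.cocycles k A q),
              ∃ hfg : Hochschild.cup f g ∈ Hochschild.cocycles k A (p + q),
                Φ (p + q) (Subquotient.mk _ (Hochschild.cup f g) hfg) =
                  (Φ p (Subquotient.mk _ f hf)).comp (Φ q (Subquotient.mk _ g hg)) rfl) ∧
          ∀ (p q : ℕ), ∀ f ∈ Hochschild.cocycles k A p, ∀ g ∈ Hochschild.cocycles k A q,
            Hochschild.cup f g - (-1 : ℤ) ^ (p * q) •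
              Hochschild.reindex (Nat.add_comm q p) (Hochschild.cup g f) ∈
                Hochschild.coboundaries k A (p + q))) ∧
    (∀ (k C : Type u) [Field k] [AddCommGroup C] [Module k C] [Coalgebra k C],
      (∀ [HasDerivedCategory.{w} (BicomoduleCat k C)],
        Nonempty (RightDerivedSuspendedMonoidal (BicomoduleCat k C))) ∧
      ∀ [HasExt.{w} (BicomoduleCat k C)],
        (∀ (p q : ℕ) (f : Abelian.Ext (𝟙_ (BicomoduleCat k C)) (𝟙_ (BicomoduleCat k C)) p)
            (g : Abelian.Ext (𝟙_ (BicomoduleCat k C)) (𝟙_ (BicomoduleCat k C)) q),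
          f.comp g rfl = (-1 : ℤ) ^ (p * q) • g.comp f (Nat.add_comm q p)) ∧
        (∃ Φ : ∀ n : ℕ, Cartier.cohomology k C n ≃+
            Abelian.Ext (𝟙_ (BicomoduleCat k C)) (𝟙_ (BicomoduleCat k C)) n,
          ∀ (p q : ℕ) (f : C →ₗ[k] TensorAlgebra k C) (hf : f ∈ Cartier.cocycles k C p)
            (g : C →ₗ[k] TensorAlgebra k C) (hg : g ∈ Cartier.cocycles k C q),
            ∃ hfg : Cartier.cup f g ∈ Cartier.cocycles k C (p + q),
              Φ (p + q) (Subquotient.mk _ (Cartier.cup f g) hfg) =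
                (Φ p (Subquotient.mk _ f hf)).comp (Φ q (Subquotient.mk _ g hg)) rfl) ∧
        ∀ (p q : ℕ), ∀ f ∈ Cartier.cocycles k C p, ∀ g ∈ Cartier.cocycles k C q,
          Cartier.cup f g - (-1 : ℤ) ^ (p * q) • Cartier.cup g f ∈
            Cartier.coboundaries k C (p + q)) := by
  refine ⟨fun k A _ _ _ _ ↦ ⟨fun {_} ↦ ?_, fun {_} ↦ ⟨?_, fun _ ↦ ⟨?_, ?_⟩⟩⟩,
    fun k C _ _ _ _ ↦ ⟨fun {_} ↦ ?_, fun {_} ↦ ⟨?_, ?_, ?_⟩⟩⟩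
  · exact ⟨BimoduleCat.functorialResolution.leftDerivedSuspendedMonoidal⟩
  · exact fun p q f g ↦ BimoduleCat.functorialResolution.ext_comp_comm f g
  · exact ⟨BimoduleCat.hochschildEquiv k A, fun p q f hf g hg ↦
      BimoduleCat.hochschildExt_cup ⟨f, hf⟩ ⟨g, hg⟩⟩
  · exact fun p q f hf g hg ↦ BimoduleCat.cup_sub_mem_coboundaries.{w} ⟨f, hf⟩ ⟨g, hg⟩
  · exact ⟨(Bicomod.functorialCoresolution (ModuleCat.of k C)).rightDerivedSuspendedMonoidal⟩
  · exact fun p q f g ↦ (Bicomod.functorialCoresolution (ModuleCat.of k C)).ext_comp_comm f g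
  · exact ⟨BicomoduleCat.cartierEquiv k C, fun p q f hf g hg ↦
      BicomoduleCat.cartierExt_cup ⟨f, hf⟩ ⟨g, hg⟩⟩
  · exact fun p q f hf g hg ↦ BicomoduleCat.cup_sub_mem_coboundaries.{w} ⟨f, hf⟩ ⟨g, hg⟩
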